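/- Let $p\colon V\to M$ be an oriented real vector bundle of rank $n$ over a smooth manifold $M$ (Hausdorff, $\sigma$-compact, finite-dimensional, without boundary), with a smooth fibre metric $\langle-,-\rangle$ and a compatible smooth connection $\nabla$ with curvature $F$, and let $\mathbf x\in\Gamma(V,p^*V)$ be the tautological section. For a smooth manifold $X$ let $\mathcal L^{0|1}(X)$ be the stack whose objects over a supermanifold $S$ (with complex valued functions, i.e. a $cs$-manifold) are the maps $\phi\colon S\times\mathbb R^{0|1}\to X$ and whose morphisms over $S$ are the $S$-families of conformal isometries $\theta\mapsto\eta+\mu\theta$ of $\mathbb R^{0|1}$ compatible with the maps to $X$ ($\eta$ odd; $\mu$ even and invertible with real body). A section of $\omega^{k/2}$ over $\mathcal L^{0|1}(X)$ assigns to every object over $S$ a function on $S$, compatibly with base change, such that an isometry $(\eta,\mu)$ acts by $\mu^k$. Writing $\phi^*f=\phi_0(f)+\theta\phi_1(f)$, a closed form $\sum f\,dg_1\wedge\dots\wedge dg_k\in\Omega^k_{\rm cl}(X;\mathbb C)$ is identified with the section $\phi\mapsto\sum\phi_0(f)\phi_1(g_1)\cdots\phi_1(g_k)$ of $\omega^{k/2}$.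 Let $\mathcal F^{0|1}(V)\to\mathcal L^{0|1}(V)$ be the bundle with fibre $\Gamma(S\times\mathbb R^{0|1},\phi^*p^*\Pi V)$ at $\phi\colon S\times\mathbb R^{0|1}\to V$, and put $$\mathcal S_{\rm MQ}(\Psi)=\int_{\mathbb R^{0|1}}\Big(\tfrac12\langle\Psi,\nabla_D\Psi\rangle-i\langle\Psi,\phi^*\mathbf x\rangle\Big)d\theta,\qquad D=\partial_\theta .$$ In component fields $\psi_1=\Psi|_{\theta=0}$ (odd) and $\psi_0=(\nabla_D\Psi)|_{\theta=0}$ (even), taken in an oriented orthonormal frame, let $d\Psi=d\psi_1\,d\psi_0$ be Lebesgue measure in $\psi_0\in\mathbb R^n$ times the Berezin integral in $\psi_1$ (the iterated left derivative with $\psi_1^1\cdots\psi_1^n b\mapsto b$ for $b$ independent of $\psi_1$). Then the following hold. 1. The finite-dimensional Berezin integral $$\mathrm{Th}(V)=\frac1{(2\pi)^{n}}\int_{\mathcal F^{0|1}(V)/\mathcal L^{0|1}(V)}e^{-\mathcal S_{\rm MQ}(\Psi)}\,d\Psi$$ converges and is a well-defined section of $\omega^{n/2}$ over $\mathcal L^{0|1}(V)$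 (independent of the frame). 2. It is identified with a smooth closed $n$-form on $V$ that is rapidly decreasing, with all derivatives, in the fibre directions, locally uniformly over $M$, namely with the Mathai–Quillen form $$\frac1{(2\pi)^{n/2}}\int\exp\Big(-\tfrac12|\mathbf x|^2-i\langle\psi,\nabla\mathbf x\rangle+\tfrac12\langle\psi,F\psi\rangle\Big)d\psi ,$$ where $\psi$ is odd with values in $V$, $\langle\psi,F\psi\rangle=\sum_{a,b}\psi_aF_{ab}\psi_b$ with $F_{ab}=\langle e_a,Fe_b\rangle$, and $F(X,Y)=[\nabla_X,\nabla_Y]-\nabla_{[X,Y]}$. 3. With $\varepsilon(n)=1$ for $n$ even and $\varepsilon(n)=i$ for $n$ odd, the form $\varepsilon(n)\,\mathrm{Th}(V)$ is a Thom form: it is closed, rapidly decreasing in the fibre directions, and has integral $1$ over every oriented fibre of $V$. -/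

import Mathlib

open scoped Manifold ContDiff
open Bundle MeasureTheory

noncomputable section

namespace MathaiQuillen

/-! ### Grassmann algebras -/

/-- The complex Grassmann algebra on odd generators indexed by `κ`. -/
abbrev Gr (κ : Type) : Type := ExteriorAlgebra ℂ (κ →₀ ℂ)

section Grassmann

variable {κ κ' : Type}

/-- The odd generator with index `i`. -/
def gen (i : κ) : Gr κ := ExteriorAlgebra.ι ℂ (Finsupp.single i 1)

/-- The body: all odd generators are set to `0`. -/
def body : Gr κ →ₐ[ℂ] ℂ := ExteriorAlgebra.algebraMapInv

/-- The parity involution: every odd generator changes sign. -/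
def parity : Gr κ →ₐ[ℂ] Gr κ := ExteriorAlgebra.map (-LinearMap.id)

def IsEven (x : Gr κ) : Prop := parity x = x

def IsOdd (x : Gr κ) : Prop := parity x = -x

/-- The left derivative with respect to the odd generator `i`; it is the odd derivation with
`∂_i (gen i) = 1` and `∂_i (gen j) = 0` for `j ≠ i`. -/
def der (i : κ) : Gr κ →ₗ[ℂ] Gr κ :=
  CliffordAlgebra.contractLeft (Q := (0 : QuadraticForm ℂ (κ →₀ ℂ))) (Finsupp.lapply i)

/-- The homomorphism that renames the generators. -/
def rename (j : κ → κ') : Gr κ →ₐ[ℂ] Gr κ' := ExteriorAlgebra.map (Finsupp.lmapDomain ℂ ℂ j)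

/-- The homomorphism that sets to `0` the generators outside the range of the injection `j`. -/
def keep (j : κ → κ') (hj : Function.Injective j) : Gr κ' →ₐ[ℂ] Gr κ :=
  ExteriorAlgebra.map (Finsupp.lcomapDomain j hj)

/-- The Berezin integral over the generators in the list `l`: the iterated left derivative, so
that for a list `[i₁, …, iₙ]` without repetitions and `b` free of these generators
`gen i₁ ⋯ gen iₙ * b` is sent to `b`. -/
def berezin (l : List κ) : Gr κ →ₗ[ℂ] Gr κ :=
  l.foldl (fun T i => der i ∘ₗ T) LinearMap.id

/-- The exponential: body and nilpotent part are exponentiated separately. -/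
def grExp (x : Gr κ) : Gr κ :=
  Complex.exp (body x) • IsNilpotent.exp (x - algebraMap ℂ (Gr κ) (body x))

/-- `v` is the integral over `ℝⁿ` of the Grassmann algebra valued function `g`: every coordinate
is integrable and has the integral that `v` prescribes. -/
def IsGrIntegral {n : ℕ} (g : EuclideanSpace ℝ (Fin n) → Gr κ) (v : Gr κ) : Prop :=
  ∀ l : Module.Dual ℂ (Gr κ), Integrable (fun t => l (g t)) ∧ ∫ t, l (g t) = l v

end Grassmann

/-! The odd line `ℝ^{0|1}` has the coordinate `θ`.  Functions on `S × ℝ^{0|1}`, where `S` has odd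
coordinates indexed by `ι`, take values in `Gr (Option ι)`, and `θ` is the generator `none`. -/

section OddLine

variable {ι : Type}

/-- Restriction to `θ = 0`. -/
def atZero : Gr (Option ι) →ₐ[ℂ] Gr ι := keep some (Option.some_injective ι)

/-- The vector field `D = ∂_θ`. -/
def D : Gr (Option ι) →ₗ[ℂ] Gr (Option ι) := der none

/-- The Berezin integral over `ℝ^{0|1}`. -/
def intTheta : Gr (Option ι) →ₗ[ℂ] Gr ι := atZero.toLinearMap ∘ₗ D

end OddLine

/-! ### Superdomains -/

/-- A superdomain `U × ℝ^{0|q}` with `U` open in `ℝᵖ`. -/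
structure SuperDomain where
  p : ℕ
  q : ℕ
  U : TopologicalSpace.Opens (EuclideanSpace ℝ (Fin p))

/-- Smoothness of a Grassmann algebra valued function on an open subset of `ℝᵖ`. -/
def SmoothGr {p : ℕ} {U : TopologicalSpace.Opens (EuclideanSpace ℝ (Fin p))} {κ : Type}
    (f : U → Gr κ) : Prop :=
  ∀ l : Module.Dual ℂ (Gr κ),
    ContMDiff 𝓘(ℝ, EuclideanSpace ℝ (Fin p)) 𝓘(ℝ, ℂ) ∞ (fun y => l (f y))

theorem finite_gr (q : ℕ) : Module.Finite ℂ (Gr (Fin q)) :=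
  Module.Finite.of_basis (Finsupp.basisSingleOne (R := ℂ) (ι := Fin q)).ExteriorAlgebra

theorem contMDiff_dual_mul {A E : Type} [Ring A] [Algebra ℂ A] [Module.Finite ℂ A]
    [NormedAddCommGroup E] [NormedSpace ℝ E] {U : TopologicalSpace.Opens E} {f g : U → A}
    (hf : ∀ l : Module.Dual ℂ A, ContMDiff 𝓘(ℝ, E) 𝓘(ℝ, ℂ) ∞ (fun y => l (f y)))
    (hg : ∀ l : Module.Dual ℂ A, ContMDiff 𝓘(ℝ, E) 𝓘(ℝ, ℂ) ∞ (fun y => l (g y)))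
    (l : Module.Dual ℂ A) : ContMDiff 𝓘(ℝ, E) 𝓘(ℝ, ℂ) ∞ (fun y => l (f y * g y)) := by
  let b := Module.finBasis ℂ A
  have key : (fun y => l (f y * g y)) = fun y => ∑ i, ∑ j,
      (b.coord i (f y) * b.coord j (g y)) * l (b i * b j) := by
    funext y
    have h1 : f y = ∑ i, b.coord i (f y) • b i := (b.sum_repr (f y)).symm
    have h2 : g y = ∑ i, b.coord i (g y) • b i := (b.sum_repr (g y)).symm
    conv_lhs => rw [h1, h2]
    simp only [Finset.sum_mul, Finset.mul_sum, map_sum, smul_mul_assoc, mul_smul_comm, map_smul,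
      smul_eq_mul]
    refine Finset.sum_comm.trans ?_
    refine Finset.sum_congr rfl fun i _ => Finset.sum_congr rfl fun j _ => ?_
    ring
  rw [key]
  refine contMDiff_finsetSum fun i _ => contMDiff_finsetSum fun j _ => ?_
  have h3 : ContDiff ℝ ∞ fun z : ℂ × ℂ => z.1 * z.2 * l (b i * b j) :=
    (contDiff_fst.mul contDiff_snd).mul contDiff_const
  exact h3.contMDiff.comp ((hf (b.coord i)).prodMk_space (hg (b.coord j)))

theorem SmoothGr.mul {p q : ℕ} {U : TopologicalSpace.Opens (EuclideanSpace ℝ (Fin p))}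
    {f g : U → Gr (Fin q)} (hf : SmoothGr f) (hg : SmoothGr g) : SmoothGr (f * g) := by
  have := finite_gr q
  exact fun l => contMDiff_dual_mul hf hg l

/-- The superalgebra `C^∞(S) = C^∞(U; ℂ) ⊗ Λ(ℂ^q)` of functions on a superdomain. -/
def SuperDomain.O (S : SuperDomain) : Subalgebra ℂ (S.U → Gr (Fin S.q)) where
  carrier := {f | SmoothGr f}
  mul_mem' hf hg := SmoothGr.mul hf hg
  add_mem' {f g} hf hg := by
    intro l
    have h := (hf l).add (hg l)
    convert h using 1
    funext y
    exact map_add l (f y) (g y)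
  algebraMap_mem' c := by
    intro l
    exact contMDiff_const (c := l (algebraMap ℂ (Gr (Fin S.q)) c))

/-- A map of superdomains `S' → S`: a parity preserving homomorphism `C^∞(S) → C^∞(S')`. -/
structure SuperMap (S' S : SuperDomain) where
  pull : S.O →ₐ[ℂ] S'.O
  even : ∀ f : S.O, (∀ y, IsEven (f.1 y)) → ∀ y, IsEven ((pull f).1 y)
  odd : ∀ f : S.O, (∀ y, IsOdd (f.1 y)) → ∀ y, IsOdd ((pull f).1 y)

/-! ### The stack `L^{0|1}(X)` and the line bundles `ω^{k/2}` -/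

section Stack

variable {EX : Type*} [NormedAddCommGroup EX] [NormedSpace ℝ EX]
  {HX : Type*} [TopologicalSpace HX] (I : ModelWithCorners ℝ EX HX)
  (X : Type*) [TopologicalSpace X] [ChartedSpace HX X]

/-- An object of `L^{0|1}(X)` over `S`: a map of ringed spaces `φ : S × ℝ^{0|1} → X`, given by the
underlying map `red` and by the homomorphism `pull` from `C^∞(X)` to the even functions on
`S × ℝ^{0|1}`. -/
structure SPoint (S : SuperDomain) where
  red : S.U → X
  pull : C^∞⟮I, X; 𝓘(ℝ, ℝ), ℝ⟯ →ₐ[ℝ] (S.U → Gr (Option (Fin S.q)))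
  continuous_red : Continuous red
  smooth : ∀ f, SmoothGr (pull f)
  even : ∀ f y, IsEven (pull f y)
  body_eq : ∀ f y, body (pull f y) = (f (red y) : ℂ)

variable {I X} {S : SuperDomain}

/-- The component `φ₀(f)` of `φ^* f = φ₀(f) + θ φ₁(f)`. -/
def SPoint.comp₀ (φ : SPoint I X S) (f : C^∞⟮I, X; 𝓘(ℝ, ℝ), ℝ⟯) : S.O :=
  ⟨fun y => atZero (φ.pull f y), (fun l => φ.smooth f (l ∘ₗ atZero.toLinearMap) :
    SmoothGr fun y => atZero (φ.pull f y))⟩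

/-- The component `φ₁(f)` of `φ^* f = φ₀(f) + θ φ₁(f)`. -/
def SPoint.comp₁ (φ : SPoint I X S) (f : C^∞⟮I, X; 𝓘(ℝ, ℝ), ℝ⟯) : S.O :=
  ⟨fun y => intTheta (φ.pull f y), (fun l => φ.smooth f (l ∘ₗ intTheta) :
    SmoothGr fun y => intTheta (φ.pull f y))⟩

/-- `φ'` is the base change of `φ` along `h : S' → S`. -/
def IsBaseChange {S' : SuperDomain} (h : SuperMap S' S) (φ : SPoint I X S)
    (φ' : SPoint I X S') : Prop :=
  ∀ f, φ'.comp₀ f = h.pull (φ.comp₀ f) ∧ φ'.comp₁ f = h.pull (φ.comp₁ f)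

/-- An `S`-point of the group `E^{0|1} ⋊ ℝ^×` of conformal isometries `θ ↦ η + μ θ` of
`ℝ^{0|1}`: `η` is odd, `μ` is even, and the body of `μ` is real and nowhere zero. -/
structure ConfIsometry (S : SuperDomain) where
  η : S.O
  μ : S.O
  η_odd : ∀ y, IsOdd (η.1 y)
  μ_even : ∀ y, IsEven (μ.1 y)
  μ_real : ∀ y, ∃ r : ℝ, r ≠ 0 ∧ body (μ.1 y) = (r : ℂ)

/-- `φ' = φ ∘ g`, that is, `g` is an isomorphism from `φ'` to `φ`. -/
def IsPrecomp (g : ConfIsometry S) (φ φ' : SPoint I X S) : Prop :=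
  ∀ f, φ'.comp₀ f = φ.comp₀ f + g.η * φ.comp₁ f ∧ φ'.comp₁ f = g.μ * φ.comp₁ f

variable (I X) in
/-- A section of `ω^{k/2}` over `L^{0|1}(X)`: a function on `S` for every object over `S`,
compatible with base change, on which isometries act through the `k`-th power of the dilation
character.  (Superdomains suffice, since they cover all supermanifolds.) -/
structure LSection (k : ℕ) where
  val : ∀ {S : SuperDomain}, SPoint I X S → S.O
  natural : ∀ {S S' : SuperDomain} (h : SuperMap S' S) (φ : SPoint I X S) (φ' : SPoint I X S'),
    IsBaseChange h φ φ' → val φ' = h.pull (val φ)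
  equivariant : ∀ {S : SuperDomain} (g : ConfIsometry S) (φ φ' : SPoint I X S),
    IsPrecomp g φ φ' → val φ' = g.μ ^ k * val φ

/-- Restriction of smooth functions to an open subset. -/
def restrict (O : TopologicalSpace.Opens X) :
    C^∞⟮I, X; 𝓘(ℝ, ℝ), ℝ⟯ →ₐ[ℝ] C^∞⟮I, O; 𝓘(ℝ, ℝ), ℝ⟯ where
  toFun f := f.comp ⟨Subtype.val, contMDiff_subtype_val⟩
  map_one' := rfl
  map_mul' _ _ := rfl
  map_zero' := rfl
  map_add' _ _ := rfl
  commutes' _ := rfl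

/-- A map to an open subset of `X`, viewed as a map to `X`. -/
def SPoint.toAmbient {O : TopologicalSpace.Opens X} (φ : SPoint I O S) : SPoint I X S where
  red y := (φ.red y).1
  pull := φ.pull.comp (restrict O)
  continuous_red := continuous_subtype_val.comp φ.continuous_red
  smooth f := φ.smooth (restrict O f)
  even f := φ.even (restrict O f)
  body_eq f := φ.body_eq (restrict O f)

end Stack

/-! ### Differential forms and their evaluation on points of `L^{0|1}(X)` -/

section Forms

variable {EX : Type*} [NormedAddCommGroup EX] [NormedSpace ℝ EX]
  {HX : Type*} [TopologicalSpace HX] (I : ModelWithCorners ℝ EX HX)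
  (X : Type*) [TopologicalSpace X] [ChartedSpace HX X]

/-- Complex valued differential forms of degree `k` (not necessarily smooth). -/
abbrev DiffForm (k : ℕ) : Type _ := ∀ x : X, TangentSpace I x [⋀^Fin k]→L[ℝ] ℂ

variable {I X}

/-- The form `α` in the preferred chart at `x`. -/
def DiffForm.inChart {k : ℕ} (α : DiffForm I X k) (x : X) (y : EX) : EX [⋀^Fin k]→L[ℝ] ℂ :=
  (α ((extChartAt I x).symm y)).compContinuousLinearMap
    (mfderiv 𝓘(ℝ, EX) I (extChartAt I x).symm y : EX →L[ℝ] _)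

/-- Smoothness of a form on a manifold without boundary. -/
def DiffForm.IsSmooth {k : ℕ} (α : DiffForm I X k) : Prop :=
  ∀ x : X, ContDiffOn ℝ ∞ (α.inChart x) (extChartAt I x).target

/-- Closedness of a smooth form on a manifold without boundary. -/
def DiffForm.IsClosed {k : ℕ} (α : DiffForm I X k) : Prop :=
  ∀ x : X, ∀ y ∈ (extChartAt I x).target, extDeriv (α.inChart x) y = 0

variable (I) in
/-- A finite formal sum `∑ⱼ cⱼ fⱼ dgⱼ₁ ∧ ⋯ ∧ dgⱼₖ` on an open subset `O` of `X`. -/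
structure FormSum (O : TopologicalSpace.Opens X) (k : ℕ) where
  N : ℕ
  c : Fin N → ℂ
  f : Fin N → C^∞⟮I, O; 𝓘(ℝ, ℝ), ℝ⟯
  g : Fin N → Fin k → C^∞⟮I, O; 𝓘(ℝ, ℝ), ℝ⟯

/-- The value of a formal sum on tangent vectors. -/
def FormSum.eval {O : TopologicalSpace.Opens X} {k : ℕ} (P : FormSum I O k) (x : O)
    (u : Fin k → TangentSpace I x) : ℂ :=
  ∑ j, P.c j * (P.f j x : ℂ) *
    ((Matrix.of fun a b : Fin k => (mfderiv I 𝓘(ℝ, ℝ) (P.g j a) x (u b) : ℝ)).det : ℂ)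

/-- For `φ : T × ℝ^{0|1} → O` and a form `β = ∑ⱼ cⱼ fⱼ dgⱼ₁ ∧ ⋯ ∧ dgⱼₖ`, the function
`∑ⱼ cⱼ φ^*(fⱼ) D(φ^* gⱼ₁) ⋯ D(φ^* gⱼₖ)`; for `k = 1` it is `(φ^* β)(D)`. -/
def FormSum.contract {O : TopologicalSpace.Opens X} {k : ℕ} (P : FormSum I O k) {T ι : Type}
    (pull : C^∞⟮I, O; 𝓘(ℝ, ℝ), ℝ⟯ → T → Gr (Option ι)) (y : T) : Gr (Option ι) :=
  ∑ j, P.c j • (pull (P.f j) y * (List.ofFn fun a => D (pull (P.g j a) y)).prod)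

/-- The section `σ` of `ω^{k/2}` is the one identified with the form `α`, under the isomorphism
`Γ(L^{0|1}(X); ω^{k/2}) ≅ Ω^k_cl(X)` for which `f` is the function `φ ↦ φ₀(f)` and `df` the
function `φ ↦ φ₁(f)`. -/
def IsSectionOfForm {k : ℕ} (σ : LSection I X k) (α : DiffForm I X k) : Prop :=
  ∀ (O : TopologicalSpace.Opens X) (P : FormSum I O k),
    (∀ (x : O) (u : Fin k → TangentSpace I x),
      α x.1 (fun b => mfderiv I I (Subtype.val : O → X) x (u b)) = P.eval x u) →
    ∀ (S : SuperDomain) (φ : SPoint I O S) (y : S.U),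
      (σ.val φ.toAmbient).1 y = atZero (P.contract (fun f => φ.pull f) y)

end Forms

/-! ### The vector bundle, its frames, and the Mathai–Quillen form -/

section Bundle

variable {EB : Type*} [NormedAddCommGroup EB] [NormedSpace ℝ EB]
  {M : Type*} [TopologicalSpace M] [ChartedSpace EB M]
  {F : Type*} [NormedAddCommGroup F] [NormedSpace ℝ F]
  {V : M → Type*} [TopologicalSpace (TotalSpace F V)]
  [∀ m, NormedAddCommGroup (V m)] [∀ m, InnerProductSpace ℝ (V m)]
  [FiberBundle F V] [VectorBundle ℝ F V]
  {n : ℕ}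

/-- The orientations `o m` of the fibres depend continuously on `m`: near every point they are
given by a smooth local frame. -/
def IsBundleOrientation (EB F : Type*) [NormedAddCommGroup EB] [NormedSpace ℝ EB]
    {M : Type*} [TopologicalSpace M] [ChartedSpace EB M]
    [NormedAddCommGroup F] [NormedSpace ℝ F]
    {V : M → Type*} [TopologicalSpace (TotalSpace F V)]
    [∀ m, NormedAddCommGroup (V m)] [∀ m, InnerProductSpace ℝ (V m)]
    [FiberBundle F V] [VectorBundle ℝ F V] {n : ℕ}
    (o : ∀ m, Orientation ℝ (V m) (Fin n)) : Prop :=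
  ∀ m₀ : M, ∃ (W : TopologicalSpace.Opens M) (e : Fin n → ∀ m, V m)
    (he : IsLocalFrameOn 𝓘(ℝ, EB) F ∞ e (W : Set M)),
    m₀ ∈ W ∧ ∀ (m : M) (hm : m ∈ (W : Set M)), (he.toBasisAt hm).orientation = o m

/-- A smooth oriented orthonormal frame of `V` over an open subset `W` of `M`. -/
structure OrthoFrame (EB F : Type*) [NormedAddCommGroup EB] [NormedSpace ℝ EB]
    {M : Type*} [TopologicalSpace M] [ChartedSpace EB M]
    [NormedAddCommGroup F] [NormedSpace ℝ F]
    {V : M → Type*} [TopologicalSpace (TotalSpace F V)]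
    [∀ m, NormedAddCommGroup (V m)] [∀ m, InnerProductSpace ℝ (V m)]
    [FiberBundle F V] [VectorBundle ℝ F V] {n : ℕ}
    (o : ∀ m, Orientation ℝ (V m) (Fin n)) where
  W : TopologicalSpace.Opens M
  e : Fin n → ∀ m, V m
  isFrame : IsLocalFrameOn 𝓘(ℝ, EB) F ∞ e (W : Set M)
  orthonormal : ∀ m ∈ W, Orthonormal ℝ (fun a => e a m)
  oriented : ∀ (m : M) (hm : m ∈ (W : Set M)), (isFrame.toBasisAt hm).orientation = o m

variable {o : ∀ m, Orientation ℝ (V m) (Fin n)}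

/-- The open subset `V|_W` of the total space. -/
def OrthoFrame.over (fr : OrthoFrame EB F o) : TopologicalSpace.Opens (TotalSpace F V) :=
  ⟨TotalSpace.proj ⁻¹' (fr.W : Set M),
    fr.W.isOpen.preimage (FiberBundle.continuous_proj F V)⟩

/-- The `a`-th coordinate of the tautological section `𝐱` of `p^* V`. -/
def OrthoFrame.coord (fr : OrthoFrame EB F o) (a : Fin n) (v : TotalSpace F V) : ℝ :=
  inner ℝ (fr.e a v.proj) v.snd

variable (EB) in
/-- The differential of the bundle projection. -/
def dproj (v : TotalSpace F V) :
    TangentSpace (𝓘(ℝ, EB).prod 𝓘(ℝ, F)) v →L[ℝ] TangentSpace 𝓘(ℝ, EB) v.proj :=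
  mfderiv (𝓘(ℝ, EB).prod 𝓘(ℝ, F)) 𝓘(ℝ, EB) (TotalSpace.proj : TotalSpace F V → M) v

/-- The value at `u ∈ T_vV` of the pulled back connection form `p^* Aᵃ_b`, where
`∇ e_b = ∑ₐ Aᵃ_b e_a`. -/
def OrthoFrame.connForm (fr : OrthoFrame EB F o) (cov : CovariantDerivative 𝓘(ℝ, EB) F V)
    (a b : Fin n) (v : TotalSpace F V) (u : TangentSpace (𝓘(ℝ, EB).prod 𝓘(ℝ, F)) v) : ℝ :=
  inner ℝ (fr.e a v.proj) (cov (fr.e b) v.proj (dproj EB v u))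

/-- The value at `u ∈ T_vV` of the `a`-th component of `∇𝐱 ∈ Ω¹(V; p^* V)`. -/
def OrthoFrame.nablaX (fr : OrthoFrame EB F o) (cov : CovariantDerivative 𝓘(ℝ, EB) F V)
    (a : Fin n) (v : TotalSpace F V) (u : TangentSpace (𝓘(ℝ, EB).prod 𝓘(ℝ, F)) v) : ℝ :=
  (show ℝ from mfderiv (𝓘(ℝ, EB).prod 𝓘(ℝ, F)) 𝓘(ℝ, ℝ) (fr.coord a) v u)
    + ∑ b, fr.coord b v * fr.connForm cov a b v u

/-- The curvature `F(u, w) s = ∇_u ∇_w s - ∇_w ∇_u s - ∇_[u, w] s` at `m`, computed with smooth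
extensions of `u`, `w` and `s`. -/
def curvature (cov : CovariantDerivative 𝓘(ℝ, EB) F V) (m : M)
    (u w : TangentSpace 𝓘(ℝ, EB) m) [IsManifold 𝓘(ℝ, EB) 1 M] (s : V m) : V m :=
  let U : ∀ m', TangentSpace 𝓘(ℝ, EB) m' := FiberBundle.extend EB u
  let W : ∀ m', TangentSpace 𝓘(ℝ, EB) m' := FiberBundle.extend EB w
  let s' : ∀ m', V m' := FiberBundle.extend F s
  cov (fun m' => cov s' m' (W m')) m u - cov (fun m' => cov s' m' (U m')) m w
    - cov s' m (VectorField.mlieBracket 𝓘(ℝ, EB) U W m)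

/-- The value at tangent vectors `u₁, …, uₙ ∈ T_vV` of the form
`(2π)^{-n/2} ∫ exp(-½ |𝐱|² - i ⟨ψ, ∇𝐱⟩ + ½ ⟨ψ, F ψ⟩) dψ`.  In the Grassmann algebra the
generators `inr a` are the odd variables `ψ_a`, and a form is represented by its pullback
along `∑ⱼ ηⱼ uⱼ`, where `ηⱼ` are the generators `inl j`; the value of an `n`-form on
`(u₁, …, uₙ)` is then the coefficient of `η₁ ⋯ ηₙ`. -/
def OrthoFrame.mqValue [IsManifold 𝓘(ℝ, EB) 1 M] (fr : OrthoFrame EB F o)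
    (cov : CovariantDerivative 𝓘(ℝ, EB) F V) (v : TotalSpace F V)
    (u : Fin n → TangentSpace (𝓘(ℝ, EB).prod 𝓘(ℝ, F)) v) : ℂ :=
  let η : Fin n → Gr (Fin n ⊕ Fin n) := fun j => gen (Sum.inl j)
  let ψ : Fin n → Gr (Fin n ⊕ Fin n) := fun a => gen (Sum.inr a)
  let dx : Fin n → Gr (Fin n ⊕ Fin n) := fun a => ∑ j, (fr.nablaX cov a v (u j) : ℂ) • η j
  let Fab : Fin n → Fin n → Gr (Fin n ⊕ Fin n) := fun a b =>
    ∑ j, ∑ k, if j < k then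
      ((inner ℝ (fr.e a v.proj)
        (curvature cov v.proj (dproj EB v (u j)) (dproj EB v (u k)) (fr.e b v.proj)) : ℝ) : ℂ)
          • (η j * η k) else 0
  (((2 * Real.pi) ^ (-(n : ℝ) / 2) : ℝ) : ℂ) *
    body (berezin ((List.finRange n).map Sum.inl) (berezin ((List.finRange n).map Sum.inr)
      (grExp (algebraMap ℂ _ (-(1 / 2 : ℂ) * ((‖v.snd‖ ^ 2 : ℝ) : ℂ))
        - Complex.I • ∑ a, ψ a * dx a
        + (1 / 2 : ℂ) • ∑ a, ∑ b, ψ a * Fab a b * ψ b))))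

/-! ### The action functional and the integral over the fibres of `F^{0|1}(V)` -/

/-- Smooth functions on the part of the total space over the domain of a frame. -/
abbrev OrthoFrame.Fun (fr : OrthoFrame EB F o) : Type _ :=
  C^∞⟮𝓘(ℝ, EB).prod 𝓘(ℝ, F), fr.over; 𝓘(ℝ, ℝ), ℝ⟯

/-- The coordinates of `𝐱` as smooth functions on `V|_W`, and an expression of the forms
`p^* Aᵃ_b` on `V|_W` through functions and their differentials. -/
structure LocalData (fr : OrthoFrame EB F o) (cov : CovariantDerivative 𝓘(ℝ, EB) F V) where
  x : Fin n → fr.Fun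
  x_eq : ∀ a (v : fr.over), x a v = fr.coord a v.1
  A : Fin n → Fin n → FormSum (𝓘(ℝ, EB).prod 𝓘(ℝ, F)) fr.over 1
  A_eq : ∀ a b (v : fr.over) (u : Fin 1 → TangentSpace (𝓘(ℝ, EB).prod 𝓘(ℝ, F)) v),
    (A a b).eval v u = (fr.connForm cov a b v.1
      (mfderiv (𝓘(ℝ, EB).prod 𝓘(ℝ, F)) (𝓘(ℝ, EB).prod 𝓘(ℝ, F))
        (Subtype.val : fr.over → TotalSpace F V) v (u 0)) : ℂ)

variable {fr : OrthoFrame EB F o} {cov : CovariantDerivative 𝓘(ℝ, EB) F V}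

/-- For `φ : T × ℝ^{0|1} → V|_W` and a section `Ψ = ∑ₐ Ψᵃ e_a` of `φ^* p^* ΠV`, the `a`-th
coordinate of `∇_D Ψ`, namely `D Ψᵃ + ∑_b (φ^* Aᵃ_b)(D) Ψᵇ`. -/
def LocalData.nablaD (L : LocalData fr cov) {T ι : Type} (pull : fr.Fun → T → Gr (Option ι))
    (Ψ : Fin n → T → Gr (Option ι)) (a : Fin n) (y : T) : Gr (Option ι) :=
  D (Ψ a y) + ∑ b, (L.A a b).contract pull y * Ψ b y

/-- The functional `S_MQ(Ψ) = ∫ (½ ⟨Ψ, ∇_D Ψ⟩ - i ⟨Ψ, φ^* 𝐱⟩) dθ`. -/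
def LocalData.action (L : LocalData fr cov) {T ι : Type} (pull : fr.Fun → T → Gr (Option ι))
    (Ψ : Fin n → T → Gr (Option ι)) (y : T) : Gr ι :=
  intTheta ((1 / 2 : ℂ) • ∑ a, Ψ a y * L.nablaD pull Ψ a y
    - Complex.I • ∑ a, Ψ a y * pull (L.x a) y)

/-- The total space of `F^{0|1}(V)` over an object `φ` over `S` is `S × ℝ^{n|n}`, with even
fibre coordinates `ψ₀ = t ∈ ℝⁿ` and odd fibre coordinates `ψ₁`, the generators `inr a`.  This is
the pullback of `φ` to the total space. -/
def pullTotal {S : SuperDomain} (pull : fr.Fun → S.U → Gr (Option (Fin S.q)))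
    (f : fr.Fun) (z : S.U × EuclideanSpace ℝ (Fin n)) : Gr (Option (Fin S.q ⊕ Fin n)) :=
  rename (Option.map Sum.inl) (pull f z.1)

/-- The universal section over the total space of `F^{0|1}(V)`, with component fields
`ψ₁ = Ψ|_{θ=0}` and `ψ₀ = (∇_D Ψ)|_{θ=0}`; so `Ψᵃ = ψ₁ᵃ + θ (ψ₀ᵃ - ∑_b (φ^* Aᵃ_b)(D) ψ₁ᵇ)`. -/
def LocalData.universal (L : LocalData fr cov) {S : SuperDomain}
    (pull : fr.Fun → S.U → Gr (Option (Fin S.q))) (a : Fin n)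
    (z : S.U × EuclideanSpace ℝ (Fin n)) : Gr (Option (Fin S.q ⊕ Fin n)) :=
  gen (some (Sum.inr a)) + gen none * (algebraMap ℂ _ ((z.2 a : ℝ) : ℂ)
    - ∑ b, (L.A a b).contract (pullTotal pull) z * gen (some (Sum.inr b)))

/-- The function `w` on `S` is the Berezin integral of `exp(-S_MQ)` over the fibres of
`F^{0|1}(V)` at `φ : S × ℝ^{0|1} → V|_W`, that is `∫ exp(-S_MQ(ψ₁, ψ₀)) dψ₁ dψ₀`. -/
def LocalData.IsFibreIntegral (L : LocalData fr cov) {S : SuperDomain}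
    (φ : SPoint (𝓘(ℝ, EB).prod 𝓘(ℝ, F)) fr.over S) (w : S.U → Gr (Fin S.q)) : Prop :=
  ∀ y : S.U, IsGrIntegral (fun t : EuclideanSpace ℝ (Fin n) =>
    keep Sum.inl Sum.inl_injective (berezin ((List.finRange n).map Sum.inr)
      (grExp (-(L.action (pullTotal fun f => φ.pull f) (L.universal fun f => φ.pull f) (y, t))))))
    (w y)

/-! ### Thom forms -/

/-- The form is rapidly decreasing in the fibre directions: in the charts of the total space
given by a chart of `M` and a local trivialization, all derivatives of its coefficients decrease
faster than every power of the fibre coordinate, uniformly over compact subsets of the base. -/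
def IsRapidlyDecreasing {k : ℕ}
    (α : DiffForm (𝓘(ℝ, EB).prod 𝓘(ℝ, F)) (TotalSpace F V) k) : Prop :=
  ∀ (v : TotalSpace F V) (K : Set EB), IsCompact K →
    K ×ˢ Set.univ ⊆ (extChartAt (𝓘(ℝ, EB).prod 𝓘(ℝ, F)) v).target →
    ∀ N j : ℕ, ∃ C : ℝ, ∀ b ∈ K, ∀ x : F,
      ‖x‖ ^ N * ‖iteratedFDeriv ℝ j (α.inChart v) (b, x)‖ ≤ C

/-- The map `ℝⁿ → V` onto the fibre over `m` given by a frame. -/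
def OrthoFrame.fibre (fr : OrthoFrame EB F o) (m : M) (t : EuclideanSpace ℝ (Fin n)) :
    TotalSpace F V :=
  ⟨m, ∑ a, t a • fr.e a m⟩

/-- A Thom form of the oriented bundle `V` of rank `n`: a smooth closed `n`-form on the total
space that is rapidly decreasing in the fibre directions and has integral `1` over every
oriented fibre. -/
structure IsThomForm (o : ∀ m, Orientation ℝ (V m) (Fin n))
    (α : DiffForm (𝓘(ℝ, EB).prod 𝓘(ℝ, F)) (TotalSpace F V) n) : Prop where
  smooth : α.IsSmooth
  closed : α.IsClosed
  rapid : IsRapidlyDecreasing α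
  integral_one : ∀ (fr : OrthoFrame EB F o), ∀ m ∈ fr.W,
    Integrable (fun t : EuclideanSpace ℝ (Fin n) => α (fr.fibre m t) fun a =>
      mfderiv 𝓘(ℝ, EuclideanSpace ℝ (Fin n)) (𝓘(ℝ, EB).prod 𝓘(ℝ, F)) (fr.fibre m) t
        (EuclideanSpace.single a (1 : ℝ))) ∧
    ∫ t : EuclideanSpace ℝ (Fin n), (α (fr.fibre m t) fun a =>
      mfderiv 𝓘(ℝ, EuclideanSpace ℝ (Fin n)) (𝓘(ℝ, EB).prod 𝓘(ℝ, F)) (fr.fibre m) t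
        (EuclideanSpace.single a (1 : ℝ))) = 1

/-- The constant `1` for even and `i` for odd rank. -/
def epsilon (n : ℕ) : ℂ := if Even n then 1 else Complex.I

end Bundle

end MathaiQuillen

end

open MathaiQuillen

noncomputable section

namespace MathaiQuillen

/-! ### Grassmann algebra -/

section GrassmannAlgebra

variable {κ κ' : Type}

/-! The theorem comes from one Gaussian integral with Grassmann algebra values. In an orthonormal
frame the connection matrix `A` is antisymmetric. With the component fields `ψ₁ = ψ` and `ψ₀ = t`
the cross terms of the action therefore cancel, and `-S = -½|t|² + i⟨t, 𝐱⟩ - i⟨ψ, ∇𝐱⟩ + ½⟨ψ, Fψ⟩`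
remains (`neg_action_eq_mqExponent`). The integral over `t` is the Fourier transform of the
Gaussian, evaluated by Taylor expansion at even elements with a nilpotent part
(`isGrIntegral_gauss`). It equals `√(2π)ⁿ exp(-½|𝐱|²)`, and the prefactor `(2π)⁻ⁿ` turns the
constant into the Mathai–Quillen normalisation `(2π)^{-n/2}`.

Local expressions can be compared because a homomorphism from smooth functions to a finitely
generated Grassmann algebra that lies over a point sees only a finite jet there, and hence obeys the
chain rule in coordinates (`LiesOver.chain_rule`). Consequently the contraction of `∑ c f dg₁ ⋯ dgₖ`
with such a homomorphism depends only on the differential form near the point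
(`FormalForm.contract_eq_zero`). Together with invariance of the `ψ`-integral under rotations of
determinant one (`mqExp_rotate`) this gives independence of the frame, lets the local sections glue,
and identifies the glued section with the form. Frames and connection coefficients are first cut off
to globally defined objects (`LocalModel`), so that homomorphisms out of global functions can be
applied to them.

Closedness is `der_mqExp`: the odd vector field `∂ + ∑ (i x_c - (Aψ)_c) ∂/∂ψ_c` annihilates the
exponent by the structure equation and the Bianchi identity, hence annihilates the exponential.
After integration over `ψ` the terms with `∂/∂ψ_c` vanish. Closedness also gives the weight `n/2`:
the isometry `θ ↦ η + μθ` changes the function of an `n`-form `ω` into `μⁿ(ω + η dω)`.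

On a fibre the connection and the curvature do not contribute and `∇𝐱` becomes `dt`, so the form is
a normalised Gaussian times a fourth root of unity, which `epsilon` compensates. Rapid decrease
holds because the form is the exponential of a negative definite quadratic function times a form
whose coefficients are polynomial along the fibres (`rapidBdd_exp_smul`). -/

@[elab_as_elim]
theorem gr_induction {P : Gr κ → Prop} (one : P 1) (smul : ∀ (c : ℂ) x, P x → P (c • x))
    (add : ∀ x y, P x → P y → P (x + y)) (gen_mul : ∀ i x, P x → P (gen i * x)) (x : Gr κ) :
    P x := by
  refine CliffordAlgebra.left_induction (Q := (0 : QuadraticForm ℂ (κ →₀ ℂ))) ?_ add ?_ x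
  · intro r
    rw [Algebra.algebraMap_eq_smul_one]
    exact smul r 1 one
  · intro x m hx
    induction m using Finsupp.induction_linear with
    | zero => simpa using smul 0 x hx
    | add f g hf hg => rw [map_add, add_mul]; exact add _ _ hf hg
    | single i c =>
      have : Finsupp.single i c = c • Finsupp.single i (1 : ℂ) := by simp
      rw [this, map_smul, smul_mul_assoc]
      exact smul _ _ (gen_mul i x hx)

@[simp] theorem parity_gen (i : κ) : parity (gen i) = -gen i := by
  simp [parity, gen]

@[simp] theorem body_gen (i : κ) : body (gen i) = 0 := by
  simp [body, gen, ExteriorAlgebra.algebraMapInv]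

theorem gen_mul_gen_self (i : κ) : gen i * gen i = 0 := ExteriorAlgebra.ι_sq_zero _

theorem gen_mul_gen (i j : κ) : gen i * gen j = -(gen j * gen i) :=
  eq_neg_of_add_eq_zero_left (ExteriorAlgebra.ι_add_mul_swap _ _)

theorem mul_gen (x : Gr κ) (i : κ) : x * gen i = gen i * parity x := by
  induction x using gr_induction with
  | one => simp
  | smul c x h => simp [h]
  | add x y hx hy => simp [hx, hy, add_mul, mul_add]
  | gen_mul j x h =>
    rw [mul_assoc, h, ← mul_assoc, gen_mul_gen, map_mul, parity_gen]
    simp [mul_assoc]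

theorem parity_body (x : Gr κ) : body (parity x) = body x := by
  induction x using gr_induction with
  | one => simp
  | smul c x h => simp [h]
  | add x y hx hy => simp [hx, hy]
  | gen_mul j x h => simp

theorem IsOdd.mul_eq {x : Gr κ} (hx : IsOdd x) (y : Gr κ) : y * x = x * parity y := by
  have hx : parity x = -x := hx
  induction y using gr_induction with
  | one => simp
  | smul c x h => simp [h]
  | add x y hx hy => simp [hx, hy, add_mul, mul_add]
  | gen_mul j z h =>
    have h2 : gen j * x = -(x * gen j) := by rw [mul_gen, hx]; simp
    rw [mul_assoc, h, ← mul_assoc, h2, map_mul, parity_gen]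
    simp [mul_assoc]

theorem IsEven.commute {x : Gr κ} (hx : IsEven x) (y : Gr κ) : x * y = y * x := by
  have hx : parity x = x := hx
  induction y using gr_induction with
  | one => simp
  | smul c x h => simp [h]
  | add x y hx hy => simp [hx, hy, add_mul, mul_add]
  | gen_mul j z h => rw [← mul_assoc, mul_gen, hx, mul_assoc, h, mul_assoc]

theorem IsOdd.mul_odd {x y : Gr κ} (hx : IsOdd x) (hy : IsOdd y) : x * y = -(y * x) := by
  rw [hy.mul_eq, show parity x = -x from hx]; simp

theorem IsOdd.mul_self {x : Gr κ} (hx : IsOdd x) : x * x = 0 := by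
  have h := hx.mul_odd hx
  have h2 : (2 : ℂ) • (x * x) = 0 := by rw [two_smul]; nth_rw 1 [h]; simp
  simpa using h2

theorem IsEven.mul {x y : Gr κ} (hx : IsEven x) (hy : IsEven y) : IsEven (x * y) := by
  unfold IsEven at *; simp [hx, hy]
theorem IsOdd.mul {x y : Gr κ} (hx : IsOdd x) (hy : IsOdd y) : IsEven (x * y) := by
  unfold IsEven IsOdd at *; simp [hx, hy]
theorem IsEven.mul_odd {x y : Gr κ} (hx : IsEven x) (hy : IsOdd y) : IsOdd (x * y) := by
  unfold IsEven IsOdd at *; simp [hx, hy]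
theorem IsOdd.mul_even {x y : Gr κ} (hx : IsOdd x) (hy : IsEven y) : IsOdd (x * y) := by
  unfold IsEven IsOdd at *; simp [hx, hy]
theorem IsEven.add {x y : Gr κ} (hx : IsEven x) (hy : IsEven y) : IsEven (x + y) := by
  unfold IsEven at *; simp [hx, hy]
theorem IsOdd.add {x y : Gr κ} (hx : IsOdd x) (hy : IsOdd y) : IsOdd (x + y) := by
  unfold IsOdd at *; simp [hx, hy]; abel
theorem IsEven.smul {x : Gr κ} (c : ℂ) (hx : IsEven x) : IsEven (c • x) := by
  unfold IsEven at *; simp [hx]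
theorem IsOdd.smul {x : Gr κ} (c : ℂ) (hx : IsOdd x) : IsOdd (c • x) := by
  unfold IsOdd at *; simp [hx]
theorem IsEven.neg {x : Gr κ} (hx : IsEven x) : IsEven (-x) := by
  unfold IsEven at *; simp [hx]
theorem IsEven.sub {x y : Gr κ} (hx : IsEven x) (hy : IsEven y) : IsEven (x - y) := by
  rw [sub_eq_add_neg]; exact hx.add hy.neg
theorem IsEven.sum {ι : Type*} {s : Finset ι} {f : ι → Gr κ} (h : ∀ i ∈ s, IsEven (f i)) :
    IsEven (∑ i ∈ s, f i) := by
  unfold IsEven at *; rw [map_sum]; exact Finset.sum_congr rfl h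
theorem IsOdd.sum {ι : Type*} {s : Finset ι} {f : ι → Gr κ} (h : ∀ i ∈ s, IsOdd (f i)) :
    IsOdd (∑ i ∈ s, f i) := by
  unfold IsOdd at *; rw [map_sum, ← Finset.sum_neg_distrib]; exact Finset.sum_congr rfl h
theorem isEven_algebraMap (c : ℂ) : IsEven (algebraMap ℂ (Gr κ) c) := by simp [IsEven]
theorem isOdd_gen (i : κ) : IsOdd (gen i) := parity_gen i
theorem IsEven.pow {x : Gr κ} (hx : IsEven x) (k : ℕ) : IsEven (x ^ k) := by
  unfold IsEven at *; simp [hx]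

theorem IsOdd.body_eq {x : Gr κ} (hx : IsOdd x) : body x = 0 := by
  have h := parity_body x
  rw [show parity x = -x from hx, map_neg] at h
  exact self_eq_neg.mp h.symm

/-! #### Left derivatives -/

@[simp] theorem der_algebraMap (i : κ) (c : ℂ) : der i (algebraMap ℂ (Gr κ) c) = 0 :=
  CliffordAlgebra.contractLeft_algebraMap _ _ _

@[simp] theorem der_one (i : κ) : der i (1 : Gr κ) = 0 := CliffordAlgebra.contractLeft_one _ _

theorem der_gen_mul (i j : κ) (x : Gr κ) :
    der i (gen j * x) = (Finsupp.single j (1 : ℂ) i) • x - gen j * der i x :=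
  CliffordAlgebra.contractLeft_ι_mul (Q := (0 : QuadraticForm ℂ (κ →₀ ℂ)))
    (Finsupp.lapply i) (Finsupp.single j (1 : ℂ)) x

theorem der_gen_self (i : κ) : der i (gen i) = 1 := by
  simpa using der_gen_mul i i 1

theorem der_gen_of_ne {i j : κ} (h : j ≠ i) : der i (gen j) = 0 := by
  have := der_gen_mul i j 1
  rw [Finsupp.single_eq_of_ne h.symm] at this
  simpa using this

theorem der_mul (i : κ) (x y : Gr κ) : der i (x * y) = der i x * y + parity x * der i y := by
  induction x using gr_induction with
  | one => simp
  | smul c x h => simp [h]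
  | add x x' hx hx' => simp only [map_add, add_mul, hx, hx']; abel
  | gen_mul j x h =>
    rw [mul_assoc, der_gen_mul, h, der_gen_mul]
    simp [sub_mul, mul_add, mul_assoc]
    abel

theorem parity_der (i : κ) (x : Gr κ) : parity (der i x) = -der i (parity x) := by
  induction x using gr_induction with
  | one => simp
  | smul c x h => simp [h]
  | add x x' hx hx' => simp only [map_add, hx, hx']; abel
  | gen_mul j x h =>
    simp only [der_gen_mul, map_sub, map_smul, map_mul, parity_gen, h, neg_mul, map_neg]
    simp

theorem IsEven.der {x : Gr κ} (hx : IsEven x) (i : κ) : IsOdd (der i x) := by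
  unfold IsEven IsOdd at *; rw [parity_der, hx]
theorem IsOdd.der {x : Gr κ} (hx : IsOdd x) (i : κ) : IsEven (MathaiQuillen.der i x) := by
  unfold IsEven IsOdd at *; rw [parity_der, hx]; simp

theorem IsEven.der_mul {x : Gr κ} (hx : IsEven x) (i : κ) (y : Gr κ) :
    MathaiQuillen.der i (x * y) = MathaiQuillen.der i x * y + x * MathaiQuillen.der i y := by
  rw [MathaiQuillen.der_mul, show parity x = x from hx]

theorem IsOdd.der_mul {x : Gr κ} (hx : IsOdd x) (i : κ) (y : Gr κ) :
    MathaiQuillen.der i (x * y) = MathaiQuillen.der i x * y - x * MathaiQuillen.der i y := by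
  rw [MathaiQuillen.der_mul, show parity x = -x from hx]; noncomm_ring

theorem der_der (i : κ) (x : Gr κ) : der i (der i x) = 0 :=
  CliffordAlgebra.contractLeft_contractLeft _ _

theorem der_comm (i j : κ) (x : Gr κ) : der i (der j x) = -der j (der i x) :=
  CliffordAlgebra.contractLeft_comm _ _ _

/-! #### Renaming and forgetting generators -/

@[simp] theorem rename_gen (j : κ → κ') (i : κ) : rename j (gen i) = gen (j i) := by
  simp [rename, gen]

theorem keep_gen (j : κ → κ') (hj : Function.Injective j) (i : κ) :
    keep j hj (gen (j i)) = gen i := by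
  simp only [keep, gen, ExteriorAlgebra.map_apply_ι]
  congr 1
  ext k
  simp [Finsupp.lcomapDomain]

theorem keep_gen_of_notMem (j : κ → κ') (hj : Function.Injective j) {i : κ'}
    (hi : i ∉ Set.range j) : keep j hj (gen i) = 0 := by
  simp only [keep, gen, ExteriorAlgebra.map_apply_ι]
  rw [ExteriorAlgebra.ι_eq_zero_iff]
  ext k
  have : i ≠ j k := fun h => hi ⟨k, h.symm⟩
  simp [Finsupp.lcomapDomain, Finsupp.comapDomain_apply, this]

@[simp] theorem parity_rename (j : κ → κ') (x : Gr κ) : parity (rename j x) = rename j (parity x) := by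
  induction x using gr_induction with
  | one => simp
  | smul c x h => simp [h]
  | add x x' hx hx' => simp [hx, hx']
  | gen_mul j x h => simp [h]

theorem parity_keep (j : κ → κ') (hj : Function.Injective j) (x : Gr κ') :
    parity (keep j hj x) = keep j hj (parity x) := by
  induction x using gr_induction with
  | one => simp
  | smul c x h => simp [h]
  | add x x' hx hx' => simp [hx, hx']
  | gen_mul i x h =>
    by_cases hi : i ∈ Set.range j
    · obtain ⟨k, rfl⟩ := hi
      simp [h, keep_gen]
    · simp [keep_gen_of_notMem j hj hi]

theorem IsEven.rename {x : Gr κ} (hx : IsEven x) (j : κ → κ') : IsEven (rename j x) := by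
  unfold IsEven at *; simp [hx]
theorem IsOdd.rename {x : Gr κ} (hx : IsOdd x) (j : κ → κ') : IsOdd (MathaiQuillen.rename j x) := by
  unfold IsOdd at *; simp [hx]
theorem IsEven.keep {x : Gr κ'} (hx : IsEven x) (j : κ → κ') (hj : Function.Injective j) :
    IsEven (keep j hj x) := by
  unfold IsEven at *; rw [parity_keep, hx]
theorem IsOdd.keep {x : Gr κ'} (hx : IsOdd x) (j : κ → κ') (hj : Function.Injective j) :
    IsOdd (MathaiQuillen.keep j hj x) := by
  unfold IsOdd at *; rw [parity_keep, hx, map_neg]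

@[simp] theorem body_rename (j : κ → κ') (x : Gr κ) : body (rename j x) = body x := by
  induction x using gr_induction with
  | one => simp
  | smul c x h => simp [h]
  | add x x' hx hx' => simp [hx, hx']
  | gen_mul j x h => simp

@[simp] theorem body_keep (j : κ → κ') (hj : Function.Injective j) (x : Gr κ') :
    body (keep j hj x) = body x := by
  induction x using gr_induction with
  | one => simp
  | smul c x h => simp [h]
  | add x x' hx hx' => simp [hx, hx']
  | gen_mul i x h =>
    by_cases hi : i ∈ Set.range j
    · obtain ⟨k, rfl⟩ := hi
      simp [keep_gen]
    · simp [keep_gen_of_notMem j hj hi]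

@[simp] theorem keep_rename (j : κ → κ') (hj : Function.Injective j) (x : Gr κ) :
    keep j hj (rename j x) = x := by
  induction x using gr_induction with
  | one => simp
  | smul c x h => simp [h]
  | add x x' hx hx' => simp [hx, hx']
  | gen_mul i x h => simp [h, keep_gen]

theorem der_rename (j : κ → κ') (hj : Function.Injective j) (i : κ) (x : Gr κ) :
    der (j i) (rename j x) = rename j (der i x) := by
  induction x using gr_induction with
  | one => simp
  | smul c x h => simp [h]
  | add x x' hx hx' => simp [hx, hx']
  | gen_mul k x h => simp [h, der_gen_mul, Finsupp.single_apply_left hj]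

theorem der_rename_of_notMem (j : κ → κ') {i : κ'} (hi : i ∉ Set.range j) (x : Gr κ) :
    der i (rename j x) = 0 := by
  induction x using gr_induction with
  | one => simp
  | smul c x h => simp [h]
  | add x x' hx hx' => simp [hx, hx']
  | gen_mul k x h =>
    have : i ≠ j k := fun h => hi ⟨k, h.symm⟩
    simp [h, der_gen_mul, this]

theorem der_keep (j : κ → κ') (hj : Function.Injective j) (i : κ) (x : Gr κ') :
    der i (keep j hj x) = keep j hj (der (j i) x) := by
  induction x using gr_induction with
  | one => simp
  | smul c x h => simp [h]
  | add x x' hx hx' => simp [hx, hx']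
  | gen_mul k x h =>
    by_cases hk : k ∈ Set.range j
    · obtain ⟨k, rfl⟩ := hk
      simp [h, der_gen_mul, keep_gen, Finsupp.single_apply_left hj]
    · have : j i ≠ k := fun h => hk ⟨i, h⟩
      simp [keep_gen_of_notMem j hj hk, der_gen_mul, this]

/-! #### The filtration by the number of odd generators -/

/-- The span of the products of at least `k` generators. -/
def filt (κ : Type) (k : ℕ) : Submodule ℂ (Gr κ) :=
  Submodule.span ℂ {x | ∃ l : List κ, k ≤ l.length ∧ x = (l.map gen).prod}

theorem filt_zero : filt κ 0 = ⊤ := by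
  rw [eq_top_iff]
  rintro x -
  induction x using gr_induction with
  | one => exact Submodule.subset_span ⟨[], by simp, by simp⟩
  | smul c x h => exact Submodule.smul_mem _ _ h
  | add x y hx hy => exact Submodule.add_mem _ hx hy
  | gen_mul i x h =>
    refine Submodule.span_induction (p := fun x _ => gen i * x ∈ filt κ 0) ?_ ?_ ?_ ?_ h
    · rintro _ ⟨l, -, rfl⟩
      exact Submodule.subset_span ⟨i :: l, by simp, by simp⟩
    · simp
    · intro x y _ _ hx hy
      rw [mul_add]; exact Submodule.add_mem _ hx hy
    · intro c x _ hx
      rw [mul_smul_comm]; exact Submodule.smul_mem _ _ hx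

theorem filt_mul_le (j k : ℕ) : filt κ j * filt κ k ≤ filt κ (j + k) := by
  unfold filt
  rw [Submodule.span_mul_span]
  apply Submodule.span_mono
  rintro _ ⟨_, ⟨l, hl, rfl⟩, _, ⟨l', hl', rfl⟩, rfl⟩
  exact ⟨l ++ l', by simp; omega, by simp⟩

theorem filt_mul {j k : ℕ} {x y : Gr κ} (hx : x ∈ filt κ j) (hy : y ∈ filt κ k) :
    x * y ∈ filt κ (j + k) := filt_mul_le j k (Submodule.mul_mem_mul hx hy)

theorem prod_gen_eq_zero {l : List κ} (hl : ¬ l.Nodup) : (l.map (gen (κ := κ))).prod = 0 := by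
  induction l with
  | nil => simp at hl
  | cons a l ih =>
    rw [List.nodup_cons, not_and_or, not_not] at hl
    rcases hl with h | h
    · obtain ⟨s, t, rfl⟩ := List.append_of_mem h
      simp only [List.map_append, List.map_cons, List.prod_append, List.prod_cons]
      rw [← mul_assoc _ (gen a), mul_gen, mul_assoc, ← mul_assoc (gen a), gen_mul_gen_self, zero_mul]
    · simp [ih h]

/-- A product of more than `Nat.card κ` generators repeats one and so vanishes. An element that lies
in `filt κ N` for all `N` is therefore zero, which is how order-by-order arguments terminate. -/
theorem filt_eq_bot [Finite κ] {k : ℕ} (h : Nat.card κ < k) : filt κ k = ⊥ := by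
  have := Fintype.ofFinite κ
  rw [eq_bot_iff]
  apply Submodule.span_le.2
  rintro _ ⟨l, hl, rfl⟩
  refine prod_gen_eq_zero fun hn => ?_
  have := hn.length_le_card
  rw [Nat.card_eq_fintype_card] at h
  omega

theorem sub_body_mem_filt (x : Gr κ) : x - algebraMap ℂ _ (body x) ∈ filt κ 1 := by
  have hx : x ∈ filt κ 0 := by simp [filt_zero]
  refine Submodule.span_induction (p := fun x _ => x - algebraMap ℂ _ (body x) ∈ filt κ 1)
    ?_ ?_ ?_ ?_ hx
  · rintro _ ⟨l, -, rfl⟩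
    cases l with
    | nil => simp
    | cons a l =>
      simp only [List.map_cons, List.prod_cons, map_mul, body_gen, zero_mul, map_zero, sub_zero]
      exact Submodule.subset_span ⟨a :: l, by simp, by simp⟩
  · simp
  · intro x y _ _ hx hy
    rw [map_add, map_add, add_sub_add_comm]; exact Submodule.add_mem _ hx hy
  · intro c x _ hx
    have : c • x - algebraMap ℂ (Gr κ) (body (c • x)) = c • (x - algebraMap ℂ _ (body x)) := by
      rw [map_smul, smul_sub, smul_eq_mul, map_mul, Algebra.smul_def, Algebra.smul_def]
    rw [this]; exact Submodule.smul_mem _ _ hx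

theorem mem_filt_one {x : Gr κ} (hx : body x = 0) : x ∈ filt κ 1 := by
  simpa [hx] using sub_body_mem_filt x

theorem pow_mem_filt {x : Gr κ} (hx : x ∈ filt κ 1) (k : ℕ) : x ^ k ∈ filt κ k := by
  induction k with
  | zero => simp [filt_zero]
  | succ k ih => rw [pow_succ]; exact filt_mul ih hx

theorem pow_eq_zero_of_body [Finite κ] {x : Gr κ} (hx : body x = 0) {k : ℕ} (hk : Nat.card κ < k) :
    x ^ k = 0 := by
  have := pow_mem_filt (mem_filt_one hx) k
  rwa [filt_eq_bot hk, Submodule.mem_bot] at this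

theorem isNilpotent_of_body [Finite κ] {x : Gr κ} (hx : body x = 0) : IsNilpotent x :=
  ⟨_, pow_eq_zero_of_body hx (Nat.lt_succ_self _)⟩

/-! #### The exponential -/

theorem body_sub_body (x : Gr κ) : body (x - algebraMap ℂ _ (body x)) = 0 := by
  rw [map_sub, AlgHom.commutes]; simp

theorem grExp_of_body [Finite κ] {x : Gr κ} (hx : body x = 0) : grExp x = IsNilpotent.exp x := by
  simp [grExp, hx]

theorem grExp_add [Finite κ] {x y : Gr κ} (h : Commute x y) :
    grExp (x + y) = grExp x * grExp y := by
  unfold grExp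
  have : x + y - algebraMap ℂ (Gr κ) (body (x + y))
      = (x - algebraMap ℂ _ (body x)) + (y - algebraMap ℂ _ (body y)) := by
    rw [map_add, map_add]; abel
  rw [this, IsNilpotent.exp_add_of_commute _ (isNilpotent_of_body (body_sub_body x))
    (isNilpotent_of_body (body_sub_body y)), map_add, Complex.exp_add, smul_mul_smul_comm]
  exact ((h.sub_right (Algebra.commutes _ _).symm).sub_left
    ((Commute.sub_right (Algebra.commutes _ _) (Algebra.commutes _ _))))

theorem grExp_algebraMap (c : ℂ) : grExp (algebraMap ℂ (Gr κ) c) = algebraMap ℂ _ (Complex.exp c) := by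
  unfold grExp
  have : body (algebraMap ℂ (Gr κ) c) = c := by rw [AlgHom.commutes]; rfl
  rw [this]; simp [Algebra.algebraMap_eq_smul_one]

/-- The condition on bodies is needed because `grExp` treats the body analytically and only the
nilpotent part algebraically. -/
theorem map_grExp [Finite κ] (f : Gr κ →ₐ[ℂ] Gr κ') (hf : ∀ x, body (f x) = body x) (x : Gr κ) :
    f (grExp x) = grExp (f x) := by
  unfold grExp
  rw [map_smul, IsNilpotent.map_exp (isNilpotent_of_body (body_sub_body x)) f, hf, map_sub,
    AlgHom.commutes]

theorem nilpotent_exp_eq [Finite κ] {x : Gr κ} (hx : body x = 0) {N : ℕ} (hN : Nat.card κ < N) :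
    IsNilpotent.exp x = ∑ k ∈ Finset.range N, ((k.factorial : ℂ)⁻¹) • x ^ k := by
  rw [IsNilpotent.exp_eq_sum (pow_eq_zero_of_body hx hN)]
  refine Finset.sum_congr rfl fun k _ => ?_
  rw [← Rat.cast_smul_eq_qsmul ℂ]; simp

/-- A linear map that satisfies the Leibniz rule on powers of `x` differentiates `grExp x`. -/
theorem leibniz_grExp [Finite κ] (Q : Gr κ →ₗ[ℂ] Gr κ) {x : Gr κ}
    (hx : ∀ y, x * y = y * x) (hQ1 : Q 1 = 0) (hQ : ∀ y, Q (x * y) = Q x * y + x * Q y) :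
    Q (grExp x) = Q x * grExp x := by
  set z := x - algebraMap ℂ _ (body x) with hz
  have hz0 : body z = 0 := body_sub_body x
  have hzc : ∀ y, z * y = y * z := fun y => by
    rw [hz, sub_mul, mul_sub, hx, Algebra.commutes]
  have hQz : ∀ y, Q (z * y) = Q z * y + z * Q y := fun y => by
    rw [hz, sub_mul, map_sub, hQ, ← Algebra.smul_def, map_smul, map_sub,
      Algebra.algebraMap_eq_smul_one, map_smul, hQ1, smul_zero, sub_zero, sub_mul, smul_one_mul]
    abel
  have hpow : ∀ k : ℕ, Q (z ^ (k + 1)) = ((k + 1 : ℕ) : ℂ) • (Q z * z ^ k) := by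
    intro k
    induction k with
    | zero => simp
    | succ k ih =>
      rw [pow_succ', hQz, ih, mul_smul_comm, hzc (Q z * z ^ k), mul_assoc, ← pow_succ]
      push_cast
      module
  have hN : Nat.card κ < Nat.card κ + 1 := Nat.lt_succ_self _
  have hQz' : Q z = Q x := by
    rw [hz, map_sub, Algebra.algebraMap_eq_smul_one, map_smul, hQ1]; simp
  unfold grExp
  rw [map_smul, ← hz, ← hQz', mul_smul_comm]
  congr 1
  -- The left series is cut one term later than the right one, so that after its constant term is
  -- split off the two sums match index by index.
  conv_rhs => rw [nilpotent_exp_eq hz0 hN]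
  rw [nilpotent_exp_eq hz0 (hN.trans (Nat.lt_succ_self _)), Finset.sum_range_succ', map_add,
    map_sum]
  simp only [pow_zero, map_smul, hQ1, smul_zero, add_zero, Finset.mul_sum]
  refine Finset.sum_congr rfl fun k _ => ?_
  rw [hpow, smul_smul, mul_smul_comm]
  congr 1
  rw [Nat.factorial_succ]
  have := Nat.factorial_ne_zero k
  push_cast
  field_simp

theorem IsEven.grExp [Finite κ] {x : Gr κ} (hx : IsEven x) : IsEven (MathaiQuillen.grExp x) := by
  unfold IsEven at *
  rw [map_grExp _ parity_body, hx]

end GrassmannAlgebra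

/-! ### Berezin integrals -/

section Berezin

variable {κ κ' : Type} {n : ℕ}

@[simp] theorem berezin_nil (x : Gr κ) : berezin [] x = x := rfl

theorem berezin_append (l l' : List κ) (x : Gr κ) :
    berezin (l ++ l') x = berezin l' (berezin l x) := by
  have key : ∀ (l : List κ) (T : Gr κ →ₗ[ℂ] Gr κ),
      l.foldl (fun T i => der i ∘ₗ T) T = berezin l ∘ₗ T := by
    intro l
    induction l with
    | nil => intro T; rfl
    | cons i l ih =>
      intro T
      simp only [berezin, List.foldl_cons]
      rw [ih, ih]; rfl
  unfold berezin
  rw [List.foldl_append, key]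
  rfl

theorem berezin_cons (i : κ) (l : List κ) (x : Gr κ) :
    berezin (i :: l) x = berezin l (der i x) := berezin_append [i] l x

theorem berezin_concat (l : List κ) (i : κ) (x : Gr κ) :
    berezin (l ++ [i]) x = der i (berezin l x) := berezin_append l [i] x

theorem berezin_mul_free {l : List κ} {b : Gr κ} (hb : ∀ i ∈ l, der i b = 0) (x : Gr κ) :
    berezin l (x * b) = berezin l x * b := by
  induction l generalizing x with
  | nil => rfl
  | cons i l ih =>
    rw [berezin_cons, der_mul, hb i (by simp), mul_zero, add_zero,
      ih (fun j hj => hb j (List.mem_cons_of_mem _ hj)), berezin_cons]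

theorem berezin_free_mul {l : List κ} {b : Gr κ} (hb : ∀ i ∈ l, der i b = 0) (x : Gr κ) :
    berezin l (b * x) = (parity^[l.length] b) * berezin l x := by
  induction l generalizing x b with
  | nil => rfl
  | cons i l ih =>
    rw [berezin_cons, der_mul, hb i (by simp), zero_mul, zero_add, ih, berezin_cons]
    · rfl
    · intro j hj
      have := parity_der j b
      rw [hb j (List.mem_cons_of_mem _ hj), map_zero] at this
      exact neg_eq_zero.mp this.symm

theorem der_berezin (l : List κ) (j : κ) (x : Gr κ) :
    der j (berezin l x) = (-1 : ℂ) ^ l.length • berezin l (der j x) := by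
  induction l generalizing x with
  | nil => simp
  | cons i l ih =>
    rw [berezin_cons, ih, der_comm, berezin_cons, map_neg, List.length_cons, pow_succ]
    simp

/-- Derivatives in different directions anticommute and each one squares to zero, so total
derivatives integrate to zero. -/
theorem berezin_der_of_mem {l : List κ} {i : κ} (hi : i ∈ l) (x : Gr κ) :
    berezin l (der i x) = 0 := by
  induction l generalizing x with
  | nil => simp at hi
  | cons j l ih =>
    rw [berezin_cons]
    rcases List.mem_cons.1 hi with rfl | h
    · rw [der_der, map_zero]
    · rw [der_comm, map_neg, ih h, neg_zero]

/-- Integration by parts: the total derivative `der i (gen j * x)` integrates to zero, and its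
Leibniz expansion consists of the two sides. -/
theorem berezin_gen_mul_der {l : List κ} {i : κ} (hi : i ∈ l) (j : κ) (x : Gr κ) :
    berezin l (gen j * der i x) = Finsupp.single j (1 : ℂ) i • berezin l x := by
  have h := congrArg (berezin l) (der_gen_mul i j x)
  rw [berezin_der_of_mem hi, map_sub, map_smul] at h
  exact (sub_eq_zero.mp h.symm).symm

theorem berezin_prod_gen {l : List κ} (hl : l.Nodup) : berezin l (l.map gen).prod = 1 := by
  induction l with
  | nil => simp
  | cons i l ih =>
    rw [List.nodup_cons] at hl
    have : der i (l.map gen).prod = 0 := by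
      have h : ∀ l : List κ, i ∉ l → der i (l.map (gen (κ := κ))).prod = 0 := by
        intro l hl
        induction l with
        | nil => simp
        | cons j l ih =>
          rw [List.mem_cons, not_or] at hl
          rw [List.map_cons, List.prod_cons, der_mul, ih hl.2, der_gen_of_ne (Ne.symm hl.1)]
          simp
      exact h l hl.1
    rw [List.map_cons, List.prod_cons, berezin_cons, der_mul, this, der_gen_self]
    simp [ih hl.2]

theorem berezin_keep (j : κ → κ') (hj : Function.Injective j) (l : List κ) (x : Gr κ') :
    berezin l (keep j hj x) = keep j hj (berezin (l.map j) x) := by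
  induction l generalizing x with
  | nil => rfl
  | cons i l ih => rw [List.map_cons, berezin_cons, der_keep j hj, ih, berezin_cons]

/-! #### Determinants -/

/-- Scalar alternating forms of top degree are multiples of the determinant; values in `N` are
reduced to scalars by testing against linear functionals. -/
theorem alternatingMap_apply_matrix {N : Type*} [AddCommGroup N] [Module ℂ N]
    (f : (Fin n → ℂ) [⋀^Fin n]→ₗ[ℂ] N) (g : Matrix (Fin n) (Fin n) ℂ) :
    f (fun i => g i) = g.det • f (fun i => Pi.single i 1) := by
  rw [← sub_eq_zero, ← Module.forall_dual_apply_eq_zero_iff ℂ]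
  intro l
  have h := (l.compAlternatingMap f).eq_smul_basis_det (Pi.basisFun ℂ (Fin n))
  have h2 := congrArg (fun F => F (fun i => g i)) h
  simp only [LinearMap.compAlternatingMap_apply, AlternatingMap.smul_apply,
    Pi.basisFun_det_apply, smul_eq_mul] at h2
  have h3 : (fun i => (Pi.basisFun ℂ (Fin n)) i) = fun i => Pi.single i 1 := by
    funext i; simp
  rw [map_sub, map_smul, h2, smul_eq_mul, mul_comm]
  simp only [h3, sub_eq_zero]
  rfl

/-- Products of odd generators are alternating in the rows of `g`. This is the source of the
determinant in the value of `dg₁ ∧ ⋯ ∧ dgₖ` on tangent vectors. -/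
theorem prod_linearCombination_gen (j : Fin n → κ) (g : Matrix (Fin n) (Fin n) ℂ) :
    (List.ofFn fun a => ∑ b, g a b • gen (j b)).prod
      = g.det • (List.ofFn fun a => (gen (j a) : Gr κ)).prod := by
  let L : (Fin n → ℂ) →ₗ[ℂ] (κ →₀ ℂ) :=
    ∑ b, (LinearMap.proj b : (Fin n → ℂ) →ₗ[ℂ] ℂ).smulRight (Finsupp.single (j b) (1 : ℂ))
  have hL : ∀ v, ExteriorAlgebra.ι ℂ (L v) = ∑ b, v b • gen (j b) := by
    intro v
    simp only [L, LinearMap.sum_apply, LinearMap.smulRight_apply, LinearMap.proj_apply, map_sum,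
      map_smul]
    rfl
  have h := alternatingMap_apply_matrix ((ExteriorAlgebra.ιMulti ℂ n).compLinearMap L) g
  simp only [AlternatingMap.compLinearMap_apply, ExteriorAlgebra.ιMulti_apply, hL] at h
  rw [h]
  congr 3
  funext a
  rw [Finset.sum_eq_single a] <;> simp +contextual [eq_comm]

/-! #### Integration over the generators `ψ` -/

/-- The Berezin integral over the generators `inr a`. -/
def fibreInt : Gr (κ ⊕ Fin n) →ₗ[ℂ] Gr κ :=
  (keep Sum.inl Sum.inl_injective).toLinearMap ∘ₗ berezin ((List.finRange n).map Sum.inr)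

theorem fibreInt_apply (x : Gr (κ ⊕ Fin n)) : fibreInt x =
    keep Sum.inl Sum.inl_injective (berezin ((List.finRange n).map Sum.inr) x) := rfl

theorem der_inr_rename_inl (a : Fin n) (x : Gr κ) : der (Sum.inr a) (rename Sum.inl x) = 0 :=
  der_rename_of_notMem _ (by simp) x

theorem fibreInt_mul_rename (y : Gr (κ ⊕ Fin n)) (b : Gr κ) :
    fibreInt (y * rename Sum.inl b) = fibreInt y * b := by
  rw [fibreInt_apply, berezin_mul_free, map_mul, keep_rename, fibreInt_apply]
  intro i hi
  obtain ⟨a, -, rfl⟩ := List.mem_map.1 hi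
  exact der_inr_rename_inl a b

/-- The sign comes from moving one odd derivative past the `n` derivatives in the directions `ψ`. -/
theorem der_fibreInt (i : κ) (y : Gr (κ ⊕ Fin n)) :
    der i (fibreInt y) = (-1 : ℂ) ^ n • fibreInt (der (Sum.inl i) y) := by
  rw [fibreInt_apply, der_keep, der_berezin, map_smul, fibreInt_apply]
  simp

theorem fibreInt_even_mul {b : Gr κ} (hb : IsEven b) (y : Gr (κ ⊕ Fin n)) :
    fibreInt (rename Sum.inl b * y) = b * fibreInt y := by
  rw [(hb.rename _).commute, fibreInt_mul_rename, hb.commute]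

theorem fibreInt_der (a : Fin n) (y : Gr (κ ⊕ Fin n)) : fibreInt (der (Sum.inr a) y) = 0 := by
  rw [fibreInt_apply, berezin_der_of_mem (by simp), map_zero]

theorem fibreInt_gen_mul_der (a b : Fin n) (y : Gr (κ ⊕ Fin n)) :
    fibreInt (gen (Sum.inr b) * der (Sum.inr a) y) = (if a = b then (1 : ℂ) else 0) • fibreInt y := by
  rw [fibreInt_apply, berezin_gen_mul_der (by simp), map_smul, fibreInt_apply]
  classical
  congr 1
  simp [Finsupp.single_apply, eq_comm]

theorem fibreInt_odd_mul {b : Gr κ} (hb : IsOdd b) (y : Gr (κ ⊕ Fin n)) :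
    fibreInt (rename Sum.inl b * y) = (-1 : ℂ) ^ n • (b * fibreInt y) := by
  rw [fibreInt_apply, berezin_free_mul]
  · have : ∀ k, parity^[k] (rename (κ' := κ ⊕ Fin n) Sum.inl b)
        = (-1 : ℂ) ^ k • rename Sum.inl b := by
      intro k
      induction k with
      | zero => simp
      | succ k ih =>
        rw [Function.iterate_succ_apply', ih, map_smul, parity_rename, show parity b = -b from hb,
          pow_succ]
        simp
    rw [this, smul_mul_assoc, map_smul, map_mul, keep_rename, fibreInt_apply]
    simp
  · intro i hi
    obtain ⟨a, -, rfl⟩ := List.mem_map.1 hi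
    exact der_inr_rename_inl a b

/-- The linear substitution `ψ_a ↦ ∑ g_ab ψ_b`. -/
def rot (g : Matrix (Fin n) (Fin n) ℂ) : Gr (κ ⊕ Fin n) →ₐ[ℂ] Gr (κ ⊕ Fin n) :=
  ExteriorAlgebra.map (Finsupp.linearCombination ℂ (Sum.elim
    (fun i => Finsupp.single (Sum.inl i) (1 : ℂ))
    (fun a => ∑ b, g a b • Finsupp.single (Sum.inr b) (1 : ℂ))))

theorem rot_inl (g : Matrix (Fin n) (Fin n) ℂ) (i : κ) :
    rot g (gen (Sum.inl i)) = gen (Sum.inl i) := by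
  simp [rot, gen]

theorem rot_inr (g : Matrix (Fin n) (Fin n) ℂ) (a : Fin n) :
    rot g (gen (Sum.inr a) : Gr (κ ⊕ Fin n)) = ∑ b, g a b • gen (Sum.inr b) := by
  simp only [rot, gen, ExteriorAlgebra.map_apply_ι, Finsupp.linearCombination_single, Sum.elim_inr,
    one_smul, map_sum, map_smul]

theorem rot_rename (g : Matrix (Fin n) (Fin n) ℂ) (x : Gr κ) :
    rot g (rename Sum.inl x) = rename Sum.inl x := by
  induction x using gr_induction with
  | one => simp
  | smul c x h => simp [h]
  | add x x' hx hx' => simp [hx, hx']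
  | gen_mul i x h => simp [h, rot_inl]

theorem parity_rot (g : Matrix (Fin n) (Fin n) ℂ) (x : Gr (κ ⊕ Fin n)) :
    parity (rot g x) = rot g (parity x) := by
  induction x using gr_induction with
  | one => simp
  | smul c x h => simp [h]
  | add x x' hx hx' => simp [hx, hx']
  | gen_mul i x h => rcases i with i | a <;> simp [h, rot_inl, rot_inr]

theorem body_rot (g : Matrix (Fin n) (Fin n) ℂ) (x : Gr (κ ⊕ Fin n)) :
    body (rot g x) = body x := by
  induction x using gr_induction with
  | one => simp
  | smul c x h => simp [h]
  | add x x' hx hx' => simp [hx, hx']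
  | gen_mul i x h => rcases i with i | a <;> simp [h, rot_inl, rot_inr]

theorem keep_rot (g : Matrix (Fin n) (Fin n) ℂ) (x : Gr (κ ⊕ Fin n)) :
    keep Sum.inl Sum.inl_injective (rot g x) = keep Sum.inl Sum.inl_injective x := by
  induction x using gr_induction with
  | one => simp
  | smul c x h => simp [h]
  | add x x' hx hx' => simp [hx, hx']
  | gen_mul i x h =>
    rcases i with i | a
    · simp [h, rot_inl]
    · have : ∀ b : Fin n, keep Sum.inl Sum.inl_injective (gen (Sum.inr b) : Gr (κ ⊕ Fin n)) = 0 :=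
        fun b => keep_gen_of_notMem _ _ (by simp)
      simp [rot_inr, this]

/-- Chain rule: `g c a` is the derivative of the image of `ψ_c` in the direction of `ψ_a`. -/
theorem der_rot (g : Matrix (Fin n) (Fin n) ℂ) (a : Fin n) (x : Gr (κ ⊕ Fin n)) :
    der (Sum.inr a) (rot g x) = ∑ c, g c a • rot g (der (Sum.inr c) x) := by
  induction x using gr_induction with
  | one => simp
  | smul c x h => simp [h, Finset.smul_sum, smul_comm c]
  | add x x' hx hx' => simp [hx, hx', Finset.sum_add_distrib]
  | gen_mul i x h =>
    rw [map_mul, der_mul, h, parity_rot]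
    rcases i with i | b
    · rw [rot_inl]
      simp only [der_gen_mul, map_sub, map_mul, rot_inl, parity_gen]
      rw [der_gen_of_ne (by simp)]
      simp [Finset.mul_sum, rot_inl]
    · have h1 : der (Sum.inr a) (rot g (gen (Sum.inr b) : Gr (κ ⊕ Fin n))) = g b a • 1 := by
        rw [rot_inr, map_sum, Finset.sum_eq_single a]
        · rw [map_smul, der_gen_self]
        · intro c _ hc
          rw [map_smul, der_gen_of_ne (by simpa using hc), smul_zero]
        · simp
      rw [h1]
      simp only [der_gen_mul, map_sub, map_mul, map_smul, parity_gen, map_neg, smul_sub,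
        Finset.sum_sub_distrib]
      classical
      have hs : ∑ c, g c a • (Finsupp.single (Sum.inr b) (1 : ℂ) (Sum.inr c : κ ⊕ Fin n)) • rot g x
          = g b a • rot g x := by
        rw [Finset.sum_eq_single b
          (by intro c _ hc; rw [Finsupp.single_eq_of_ne (by simpa using hc)]; simp) (by simp)]
        simp
      rw [hs]
      simp [Finset.mul_sum, sub_eq_add_neg]

/-- The iterated derivative in the directions of `v`, the last one being applied first. -/
def derAlt : (Fin n → ℂ) [⋀^Fin n]→ₗ[ℂ] Module.End ℂ (Gr (κ ⊕ Fin n)) :=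
  let L : (Fin n → ℂ) →ₗ[ℂ] Module.End ℂ (Gr (κ ⊕ Fin n)) :=
    ∑ b, (LinearMap.proj b : (Fin n → ℂ) →ₗ[ℂ] ℂ).smulRight (der (Sum.inr b))
  (ExteriorAlgebra.lift ℂ ⟨L, by
    intro v
    have hL : ∀ x, L v x = ∑ b, v b • der (Sum.inr b) x := fun x => by
      simp [L, LinearMap.sum_apply]
    refine LinearMap.ext fun x => ?_
    change L v (L v x) = 0
    have h : L v (L v x) = -L v (L v x) := by
      simp only [hL, map_sum, map_smul, Finset.smul_sum]
      conv_lhs => rw [Finset.sum_comm]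
      rw [← Finset.sum_neg_distrib]
      refine Finset.sum_congr rfl fun a _ => ?_
      rw [← Finset.sum_neg_distrib]
      refine Finset.sum_congr rfl fun b _ => ?_
      rw [der_comm, smul_neg, smul_neg, smul_comm]
    have h2 : (2 : ℂ) • L v (L v x) = 0 := by rw [two_smul]; nth_rw 1 [h]; simp
    simpa using h2⟩).toLinearMap.compAlternatingMap (ExteriorAlgebra.ιMulti ℂ n)

theorem derAlt_apply (v : Fin n → Fin n → ℂ) : derAlt (κ := κ) v =
    (List.ofFn fun i => ∑ b, v i b • (der (Sum.inr b) : Module.End ℂ (Gr (κ ⊕ Fin n)))).prod := by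
  simp only [derAlt, LinearMap.compAlternatingMap_apply, ExteriorAlgebra.ιMulti_apply,
    AlgHom.toLinearMap_apply, map_list_prod, List.map_ofFn]
  congr 2
  funext i
  simp [LinearMap.sum_apply]

/-- Berezin change of variables. Pushing the derivatives through `rot g` replaces the coordinate
directions by the columns of `g`, and an iterated odd derivative is alternating in its directions
(`derAlt`). Hence the determinant comes out, and not its inverse as for Lebesgue measure. -/
theorem fibreInt_rot (g : Matrix (Fin n) (Fin n) ℂ) (x : Gr (κ ⊕ Fin n)) :
    fibreInt (rot g x) = g.det • fibreInt x := by
  have hber : ∀ l : List (Fin n), ∀ x : Gr (κ ⊕ Fin n), berezin (l.map Sum.inr) x =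
      ((l.reverse.map fun b => (der (Sum.inr b) : Module.End ℂ (Gr (κ ⊕ Fin n)))).prod) x := by
    intro l
    induction l with
    | nil => intro x; rfl
    | cons i l ih =>
      intro x
      rw [List.map_cons, berezin_cons, ih]
      simp [Module.End.mul_apply]
  have hrot : ∀ l : List (Fin n), ∀ x : Gr (κ ⊕ Fin n), berezin (l.map Sum.inr) (rot g x) =
      rot g (((l.reverse.map fun a => ∑ b, g b a •
        (der (Sum.inr b) : Module.End ℂ (Gr (κ ⊕ Fin n)))).prod) x) := by
    intro l
    induction l with
    | nil => intro x; rfl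
    | cons i l ih =>
      intro x
      rw [List.map_cons, berezin_cons, der_rot]
      have : ∑ c, g c i • rot g (der (Sum.inr c) x) = rot g (∑ c, g c i • der (Sum.inr c) x) := by
        simp [map_sum]
      rw [this, ih]
      simp [Module.End.mul_apply, LinearMap.sum_apply]
  have hrev : ∀ f : Fin n → Module.End ℂ (Gr (κ ⊕ Fin n)),
      (List.finRange n).reverse.map f = List.ofFn fun i : Fin n => f i.rev := by
    intro f
    rw [List.finRange_reverse, List.map_map, List.ofFn_eq_map]
    rfl
  rw [fibreInt_apply, hrot, keep_rot, fibreInt_apply, hber, hrev, hrev]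
  -- The first generator of the list is differentiated first, so as a product of endomorphisms the
  -- list is reversed. The reversal of rows is applied to `g` and to `1` alike, and its sign cancels
  -- between the two.
  have h1 := alternatingMap_apply_matrix (derAlt (κ := κ) (n := n))
    ((g.transpose).submatrix Fin.revPerm id)
  have h2 := alternatingMap_apply_matrix (derAlt (κ := κ) (n := n))
    ((1 : Matrix (Fin n) (Fin n) ℂ).submatrix Fin.revPerm id)
  rw [Matrix.det_permute, derAlt_apply] at h1 h2
  rw [Matrix.det_transpose] at h1
  have e1 : (List.ofFn fun i : Fin n => ∑ b, ((g.transpose).submatrix Fin.revPerm id) i b •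
      (der (Sum.inr b) : Module.End ℂ (Gr (κ ⊕ Fin n)))) = List.ofFn fun i : Fin n => ∑ b, g b i.rev •
        (der (Sum.inr b) : Module.End ℂ (Gr (κ ⊕ Fin n))) := rfl
  have e2 : (List.ofFn fun i : Fin n => ∑ b, ((1 : Matrix (Fin n) (Fin n) ℂ).submatrix Fin.revPerm id) i b •
      (der (Sum.inr b) : Module.End ℂ (Gr (κ ⊕ Fin n)))) = List.ofFn fun i : Fin n =>
        (der (Sum.inr i.rev) : Module.End ℂ (Gr (κ ⊕ Fin n))) := by
    congr 1
    funext i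
    rw [Finset.sum_eq_single i.rev] <;> simp +contextual [Matrix.one_apply, eq_comm]
  rw [e1] at h1
  rw [e2, Matrix.det_one, mul_one] at h2
  rw [h1, h2, mul_comm, mul_smul, LinearMap.smul_apply, map_smul]

end Berezin

/-! ### The algebraic Mathai–Quillen element -/

section MQ

open Matrix

variable {κ κ' : Type} {n : ℕ}

/-- The exponent `s - i ⟨ψ, dx⟩ + ½ ⟨ψ, F ψ⟩`. -/
def mqExponent (s : Gr κ) (dx : Fin n → Gr κ) (F : Fin n → Fin n → Gr κ) : Gr (κ ⊕ Fin n) :=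
  rename Sum.inl s - Complex.I • ∑ a, gen (Sum.inr a) * rename Sum.inl (dx a)
    + (1 / 2 : ℂ) • ∑ a, ∑ b, gen (Sum.inr a) * rename Sum.inl (F a b) * gen (Sum.inr b)

/-- The integral `∫ exp(s - i ⟨ψ, dx⟩ + ½ ⟨ψ, F ψ⟩) dψ`. -/
def mqExp (s : Gr κ) (dx : Fin n → Gr κ) (F : Fin n → Fin n → Gr κ) : Gr κ :=
  fibreInt (grExp (mqExponent s dx F))

theorem isEven_mqExponent {s : Gr κ} {dx : Fin n → Gr κ} {F : Fin n → Fin n → Gr κ}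
    (hs : IsEven s) (hdx : ∀ a, IsOdd (dx a)) (hF : ∀ a b, IsEven (F a b)) :
    IsEven (mqExponent s dx F) := by
  refine ((hs.rename _).sub (IsEven.smul _ (IsEven.sum fun a _ => ?_))).add
    (IsEven.smul _ (IsEven.sum fun a _ => IsEven.sum fun b _ => ?_))
  · exact (isOdd_gen _).mul ((hdx a).rename _)
  · exact ((isOdd_gen _).mul_even ((hF a b).rename _)).mul (isOdd_gen _)

theorem body_mqExponent (s : Gr κ) (dx : Fin n → Gr κ) (F : Fin n → Fin n → Gr κ) :
    body (mqExponent s dx F) = body s := by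
  simp [mqExponent]

theorem mqExponent_eq_add (s : Gr κ) (dx : Fin n → Gr κ) (F : Fin n → Fin n → Gr κ) :
    mqExponent s dx F = rename Sum.inl s + mqExponent 0 dx F := by
  simp only [mqExponent, map_zero, zero_sub]; abel

/-- An even `s` free of `ψ` is central and leaves the integral as a factor. In the action the fibre
coordinates `t` occur in `s` only, so this separates the integral over `t` from the one over `ψ`. -/
theorem mqExp_eq_mul [Finite κ] {s : Gr κ} (hs : IsEven s) (dx : Fin n → Gr κ)
    (F : Fin n → Fin n → Gr κ) : mqExp s dx F = grExp s * mqExp 0 dx F := by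
  unfold mqExp
  rw [mqExponent_eq_add, grExp_add ((hs.rename _).commute _),
    ← map_grExp (rename Sum.inl) (body_rename _), fibreInt_even_mul hs.grExp]

/-- Integration over `ψ` commutes with setting other odd variables to zero. It is applied to
`atZero`, where the forgotten variable is `θ`. -/
theorem mqExp_keep [Finite κ'] (j : κ → κ') (hj : Function.Injective j) (s : Gr κ')
    (dx : Fin n → Gr κ') (F : Fin n → Fin n → Gr κ') :
    mqExp (keep j hj s) (fun a => keep j hj (dx a)) (fun a b => keep j hj (F a b))
      = keep j hj (mqExp s dx F) := by
  have hJ : Function.Injective (Sum.map j id : κ ⊕ Fin n → κ' ⊕ Fin n) :=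
    Sum.map_injective.2 ⟨hj, Function.injective_id⟩
  have hr : ∀ y : Gr κ', keep (Sum.map j id) hJ (rename (Sum.inl : κ' → κ' ⊕ Fin n) y)
      = rename Sum.inl (keep j hj y) := by
    intro y
    induction y using gr_induction with
    | one => simp
    | smul c x h => simp [h]
    | add x x' hx hx' => simp [hx, hx']
    | gen_mul i x h =>
      by_cases hi : i ∈ Set.range j
      · obtain ⟨k, rfl⟩ := hi
        have : keep (Sum.map j id) hJ (gen (Sum.inl (j k)) : Gr (κ' ⊕ Fin n)) = gen (Sum.inl k) :=
          keep_gen (Sum.map j id) hJ (Sum.inl k)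
        simp [h, keep_gen, this]
      · have : keep (Sum.map j id) hJ (gen (Sum.inl i) : Gr (κ' ⊕ Fin n)) = 0 :=
          keep_gen_of_notMem _ _ (by simpa using hi)
        simp [keep_gen_of_notMem j hj hi, this]
  have hp : ∀ a : Fin n, keep (Sum.map j id) hJ (gen (Sum.inr a) : Gr (κ' ⊕ Fin n))
      = gen (Sum.inr a) := fun a => keep_gen (Sum.map j id) hJ (Sum.inr a)
  have h1 : mqExponent (keep j hj s) (fun a => keep j hj (dx a)) (fun a b => keep j hj (F a b))
      = keep (Sum.map j id) hJ (mqExponent s dx F) := by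
    simp [mqExponent, hr, hp]
  have h2 : ∀ y : Gr (κ' ⊕ Fin n), keep Sum.inl Sum.inl_injective (keep (Sum.map j id) hJ y)
      = keep j hj (keep Sum.inl Sum.inl_injective y) := by
    intro y
    induction y using gr_induction with
    | one => simp
    | smul c x h => simp [h]
    | add x x' hx hx' => simp [hx, hx']
    | gen_mul i x h =>
      rcases i with i | i
      · have := hr (gen i)
        rw [rename_gen] at this
        simp [h, this, keep_gen]
      · have e1 : keep Sum.inl Sum.inl_injective (gen (Sum.inr i) : Gr (κ ⊕ Fin n)) = 0 :=
          keep_gen_of_notMem _ _ (by simp)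
        have e2 : keep Sum.inl Sum.inl_injective (gen (Sum.inr i) : Gr (κ' ⊕ Fin n)) = 0 :=
          keep_gen_of_notMem _ _ (by simp)
        simp [e1, e2, hp]
  unfold mqExp
  rw [h1, ← map_grExp _ (body_keep _ _), fibreInt_apply, fibreInt_apply, ← h2, berezin_keep,
    List.map_map]
  rfl

/-- Invariance under rotations of the frame. -/
theorem mqExp_rotate [Finite κ] (g : Matrix (Fin n) (Fin n) ℂ) (s : Gr κ) (dx : Fin n → Gr κ)
    (F : Fin n → Fin n → Gr κ) :
    mqExp s (fun b => ∑ a, g a b • dx a) (fun b d => ∑ a, ∑ c, (g a b * g c d) • F a c)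
      = g.det • mqExp s dx F := by
  have : mqExponent s (fun b => ∑ a, g a b • dx a) (fun b d => ∑ a, ∑ c, (g a b * g c d) • F a c)
      = rot g (mqExponent s dx F) := by
    simp only [mqExponent, map_add, map_sub, map_smul, map_sum, map_mul, rot_rename, rot_inr]
    congr 2
    · congr 1
      simp only [Finset.mul_sum, Finset.sum_mul]
      rw [Finset.sum_comm]
      simp
    · have e1 : ∀ b d : Fin n, gen (Sum.inr b) * (∑ a, ∑ c, (g a b * g c d) • rename Sum.inl (F a c))
          * gen (Sum.inr d) = ∑ a, ∑ c, (g a b * g c d) •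
            (gen (Sum.inr b) * rename Sum.inl (F a c) * gen (Sum.inr d)) := by
        intro b d
        simp only [Finset.mul_sum, Finset.sum_mul, mul_smul_comm, smul_mul_assoc]
      have e2 : ∀ a c : Fin n, (∑ b, g a b • gen (Sum.inr b)) * rename Sum.inl (F a c)
          * (∑ d, g c d • gen (Sum.inr d)) = ∑ b, ∑ d, (g a b * g c d) •
            (gen (Sum.inr b) * rename Sum.inl (F a c) * gen (Sum.inr d)) := by
        intro a c
        simp only [Finset.mul_sum, Finset.sum_mul, mul_smul_comm, smul_mul_assoc, Finset.smul_sum]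
        rw [Finset.sum_comm]
        refine Finset.sum_congr rfl fun b _ => Finset.sum_congr rfl fun d _ => ?_
        rw [smul_smul, mul_comm]
      simp only [e1, e2]
      rw [show (∑ b, ∑ d, ∑ a, ∑ c, (g a b * g c d) •
          (gen (Sum.inr b) * rename Sum.inl (F a c) * gen (Sum.inr d) : Gr (κ ⊕ Fin n)))
          = ∑ b, ∑ a, ∑ d, ∑ c, (g a b * g c d) •
          (gen (Sum.inr b) * rename Sum.inl (F a c) * gen (Sum.inr d) : Gr (κ ⊕ Fin n)) from
          Finset.sum_congr rfl fun b _ => Finset.sum_comm, Finset.sum_comm]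
      refine Finset.sum_congr rfl fun a _ => ?_
      rw [show (∑ b, ∑ d, ∑ c, (g a b * g c d) •
          (gen (Sum.inr b) * rename Sum.inl (F a c) * gen (Sum.inr d) : Gr (κ ⊕ Fin n)))
          = ∑ b, ∑ c, ∑ d, (g a b * g c d) •
          (gen (Sum.inr b) * rename Sum.inl (F a c) * gen (Sum.inr d) : Gr (κ ⊕ Fin n)) from
          Finset.sum_congr rfl fun b _ => Finset.sum_comm, Finset.sum_comm]
  unfold mqExp
  rw [this, ← map_grExp _ (body_rot g), fibreInt_rot]

/-! #### Closedness -/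

variable {ψ X dX : Fin n → Gr κ} {A dA : Matrix (Fin n) (Fin n) (Gr κ)}

theorem IsOdd.mul_odd_mul {x y z : Gr κ} (hx : IsOdd x) (hy : IsOdd y) (hz : IsOdd z) :
    x * (y * z) = -(z * (y * x)) := by
  rw [← (hy.mul hz).commute x, mul_assoc, ← (hz.mul hx).commute y, mul_assoc, hx.mul_odd hy,
    mul_neg]

/-- Antisymmetry of `A` and the anticommutation of its entries with `ψ` each cost a sign, and the
two signs cancel. -/
theorem mulVec_dotProduct_odd (hψ : ∀ a, IsOdd (ψ a)) (hA : ∀ a b, IsOdd (A a b))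
    (hA' : ∀ a b, A a b = -A b a) (v : Fin n → Gr κ) :
    (A *ᵥ ψ) ⬝ᵥ v = ψ ⬝ᵥ (A *ᵥ v) := by
  simp only [dotProduct, mulVec, Finset.sum_mul, Finset.mul_sum]
  rw [Finset.sum_comm]
  refine Finset.sum_congr rfl fun a _ => Finset.sum_congr rfl fun b _ => ?_
  rw [(hA b a).mul_odd (hψ a), ← mul_assoc, hA' a b]
  simp

theorem dotProduct_mulVec_antisymm {B : Matrix (Fin n) (Fin n) (Gr κ)} (hX : ∀ a, IsEven (X a))
    (hB' : ∀ a b, B a b = -B b a) (v : Fin n → Gr κ) (hv : ∀ a b c, v a * B b c = B b c * v a) 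
    (hXv : ∀ a b, X a * v b = v b * X a) :
    X ⬝ᵥ (B *ᵥ v) = -(v ⬝ᵥ (B *ᵥ X)) := by
  simp only [dotProduct, mulVec, Finset.mul_sum]
  rw [Finset.sum_comm, ← Finset.sum_neg_distrib]
  refine Finset.sum_congr rfl fun a _ => ?_
  rw [← Finset.sum_neg_distrib]
  refine Finset.sum_congr rfl fun b _ => ?_
  rw [← mul_assoc (v a), hv, mul_assoc, ← hXv, ← mul_assoc (B a b), ← (hX b).commute, mul_assoc,
    hB' b a, neg_mul, mul_neg]

/-- Write `F = dA + A * A` and sort by degree in `ψ`. In degree zero `X · dX` cancels and `X · AX`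
vanishes by antisymmetry. In degree one the terms cancel by `FX = dA X + A(AX)` and the antisymmetry
of `F`. In degree two this is the Bianchi identity `dA * A - A * dA = F * A - A * F`, combined with
`ψ · FAψ = -ψ · AFψ`. -/
theorem mq_bianchi (hψ : ∀ a, IsOdd (ψ a)) (hX : ∀ a, IsEven (X a))
    (hA : ∀ a b, IsOdd (A a b)) (hA' : ∀ a b, A a b = -A b a)
    (hdA : ∀ a b, IsEven (dA a b)) (hdA' : ∀ a b, dA a b = -dA b a) :
    -(X ⬝ᵥ dX) + Complex.I • (ψ ⬝ᵥ (dA *ᵥ X - A *ᵥ dX))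
      - (1 / 2 : ℂ) • (ψ ⬝ᵥ ((dA * A - A * dA) *ᵥ ψ))
      + (Complex.I • X - A *ᵥ ψ) ⬝ᵥ (-(Complex.I • (dX + A *ᵥ X)) + (dA + A * A) *ᵥ ψ) = 0 := by
  have hF' : ∀ a b, (dA + A * A) a b = -(dA + A * A) b a := by
    intro a b
    simp only [Matrix.add_apply, mul_apply, neg_add, ← Finset.sum_neg_distrib]
    rw [← hdA' a b]
    congr 1
    refine Finset.sum_congr rfl fun c _ => ?_
    rw [hA' a c, hA' c b, neg_mul_neg, (hA c a).mul_odd (hA b c)]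
  have hF : ∀ a b, IsEven ((dA + A * A) a b) := by
    intro a b
    simp only [Matrix.add_apply, mul_apply]
    exact (hdA a b).add (IsEven.sum fun c _ => (hA a c).mul (hA c b))
  set F := dA + A * A with hFdef
  have h1 : X ⬝ᵥ (A *ᵥ X) = 0 := by
    have h := dotProduct_mulVec_antisymm hX hA' X (fun a b c => (hX a).commute _)
      (fun a b => (hX a).commute _)
    have h2 : (2 : ℂ) • (X ⬝ᵥ (A *ᵥ X)) = 0 := by rw [two_smul]; nth_rw 1 [h]; simp
    simpa using h2
  have h2 : X ⬝ᵥ (F *ᵥ ψ) = -(ψ ⬝ᵥ (F *ᵥ X)) :=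
    dotProduct_mulVec_antisymm hX hF' ψ (fun a b c => ((hF b c).commute _).symm)
      (fun a b => (hX a).commute _)
  have h3 := mulVec_dotProduct_odd hψ hA hA'
  have hd : dA * A - A * dA = F * A - A * F := by
    rw [hFdef]; noncomm_ring
  have h4 : ψ ⬝ᵥ ((F * A) *ᵥ ψ) = -(ψ ⬝ᵥ ((A * F) *ᵥ ψ)) := by
    simp only [dotProduct, mulVec, Finset.mul_sum, mul_apply, Finset.sum_mul]
    rw [Finset.sum_comm, ← Finset.sum_neg_distrib]
    refine Finset.sum_congr rfl fun a _ => ?_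
    rw [← Finset.sum_neg_distrib]
    refine Finset.sum_congr rfl fun b _ => ?_
    rw [← Finset.sum_neg_distrib]
    refine Finset.sum_congr rfl fun c _ => ?_
    have e : F b c * A c a = A a c * F c b := by
      rw [hA' c a, hF' b c, neg_mul_neg, (hF c b).commute]
    rw [e, (hψ b).mul_odd_mul ((hA a c).mul_even (hF c b)) (hψ a)]
  have h5 : F *ᵥ X = dA *ᵥ X + A *ᵥ (A *ᵥ X) := by
    rw [hFdef, add_mulVec, mulVec_mulVec]
  rw [hd]
  simp only [sub_dotProduct, dotProduct_add, dotProduct_neg, smul_dotProduct, dotProduct_smul,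
    h3, dotProduct_sub, sub_mulVec, h1, h2, h4, h5,
    mulVec_mulVec]
  simp only [smul_add, smul_sub, smul_neg, smul_smul, Complex.I_mul_I, smul_zero]
  module

/-- This is closedness of the Mathai–Quillen form. The derivative `∂_o` is completed by derivatives
in the directions `ψ` to an odd vector field `Q` that annihilates the exponent (`mq_bianchi`) and
hence the exponential. The added terms integrate to zero over `ψ`, so `∂_o` of the integral
vanishes. -/
theorem der_mqExp [Finite κ] (o : κ) (x : Fin n → Gr κ) (A : Fin n → Fin n → Gr κ)
    (hx : ∀ a, IsEven (x a)) (hA : ∀ a b, IsOdd (A a b)) (hA' : ∀ a b, A a b = -A b a) :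
    der o (mqExp (-(1 / 2 : ℂ) • ∑ a, x a * x a) (fun a => der o (x a) + ∑ b, A a b * x b)
      (fun a b => der o (A a b) + ∑ c, A a c * A c b)) = 0 := by
  set E := mqExponent (-(1 / 2 : ℂ) • ∑ a, x a * x a) (fun a => der o (x a) + ∑ b, A a b * x b)
      (fun a b => der o (A a b) + ∑ c, A a c * A c b) with hE
  have hEe : IsEven E := isEven_mqExponent (IsEven.smul _ (IsEven.sum fun a _ => (hx a).mul (hx a)))
    (fun a => ((hx a).der o).add (IsOdd.sum fun b _ => (hA a b).mul_even (hx b)))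
    (fun a b => ((hA a b).der o).add (IsEven.sum fun c _ => (hA a c).mul (hA c b)))
  let ψ : Fin n → Gr (κ ⊕ Fin n) := fun a => gen (Sum.inr a)
  let X : Fin n → Gr (κ ⊕ Fin n) := fun a => rename Sum.inl (x a)
  let dX : Fin n → Gr (κ ⊕ Fin n) := fun a => rename Sum.inl (der o (x a))
  let B : Matrix (Fin n) (Fin n) (Gr (κ ⊕ Fin n)) := fun a b => rename Sum.inl (A a b)
  let dB : Matrix (Fin n) (Fin n) (Gr (κ ⊕ Fin n)) := fun a b => rename Sum.inl (der o (A a b))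
  have hψ : ∀ a, IsOdd (ψ a) := fun a => isOdd_gen _
  have hX : ∀ a, IsEven (X a) := fun a => (hx a).rename _
  have hdX : ∀ a, IsOdd (dX a) := fun a => ((hx a).der o).rename _
  have hB : ∀ a b, IsOdd (B a b) := fun a b => (hA a b).rename _
  have hdB : ∀ a b, IsEven (dB a b) := fun a b => ((hA a b).der o).rename _
  have hB' : ∀ a b, B a b = -B b a := fun a b => by
    change rename _ _ = -rename _ _; rw [hA' a b, map_neg]
  have hdB' : ∀ a b, dB a b = -dB b a := fun a b => by
    change rename _ _ = -rename _ _; rw [hA' a b, map_neg, map_neg]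
  have dψ : ∀ a, der (Sum.inl o) (ψ a) = 0 := fun a => der_gen_of_ne (by simp)
  have ddX : ∀ a, der (Sum.inl o) (X a) = dX a := fun a => der_rename _ Sum.inl_injective o _
  have ddX2 : ∀ a, der (Sum.inl o) (dX a) = 0 := fun a => by
    change der (Sum.inl o) (rename _ _) = 0
    rw [der_rename _ Sum.inl_injective o, der_der, map_zero]
  have ddB : ∀ a b, der (Sum.inl o) (B a b) = dB a b :=
    fun a b => der_rename _ Sum.inl_injective o _
  have ddB2 : ∀ a b, der (Sum.inl o) (dB a b) = 0 := fun a b => by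
    change der (Sum.inl o) (rename _ _) = 0
    rw [der_rename _ Sum.inl_injective o, der_der, map_zero]
  have hEq : E = -(1 / 2 : ℂ) • ∑ a, X a * X a
      - Complex.I • ∑ a, ψ a * (dX a + (B *ᵥ X) a)
      + (1 / 2 : ℂ) • ∑ a, ∑ b, ψ a * (dB + B * B) a b * ψ b := by
    rw [hE, mqExponent]
    simp only [map_smul, map_sum, map_mul, map_add, mulVec, dotProduct, Matrix.add_apply,
      Matrix.mul_apply]
    rfl
  -- The summand `-Bψ` makes the derivative covariant in `ψ`; the summand `iX`, paired with `-i∇X`,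
  -- cancels the derivative of `-½|X|²`.
  set W : Fin n → Gr (κ ⊕ Fin n) := Complex.I • X - B *ᵥ ψ with hW
  have hWe : ∀ c, IsEven (W c) := fun c =>
    show IsEven (Complex.I • X c - ∑ b, B c b * ψ b) from
      ((hX c).smul _).sub (IsEven.sum fun b _ => (hB c b).mul (hψ b))
  let Q : Gr (κ ⊕ Fin n) →ₗ[ℂ] Gr (κ ⊕ Fin n) := der (Sum.inl o)
    + ∑ c, (LinearMap.mulLeft ℂ (W c)) ∘ₗ der (Sum.inr c)
  have hQ : ∀ y, Q y = der (Sum.inl o) y + ∑ c, W c * der (Sum.inr c) y := fun y => by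
    simp [Q, LinearMap.sum_apply]
  have hF' : ∀ a b, (dB + B * B) a b = -(dB + B * B) b a := by
    intro a b
    simp only [Matrix.add_apply, mul_apply, neg_add, ← Finset.sum_neg_distrib]
    rw [← hdB' a b]
    congr 1
    refine Finset.sum_congr rfl fun c _ => ?_
    rw [hB' a c, hB' c b, neg_mul_neg, (hB c a).mul_odd (hB b c)]
  have hF : ∀ a b, IsEven ((dB + B * B) a b) := by
    intro a b
    simp only [Matrix.add_apply, mul_apply]
    exact (hdB a b).add (IsEven.sum fun c _ => (hB a c).mul (hB c b))
  have dE : der (Sum.inl o) E = -(X ⬝ᵥ dX) + Complex.I • (ψ ⬝ᵥ (dB *ᵥ X - B *ᵥ dX))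
      - (1 / 2 : ℂ) • (ψ ⬝ᵥ ((dB * B - B * dB) *ᵥ ψ)) := by
    have e1 : der (Sum.inl o) (∑ a, X a * X a) = (2 : ℂ) • (X ⬝ᵥ dX) := by
      rw [map_sum, dotProduct, Finset.smul_sum]
      refine Finset.sum_congr rfl fun a _ => ?_
      rw [(hX a).der_mul, ddX, ← (hX a).commute, two_smul]
    have e2 : der (Sum.inl o) (∑ a, ψ a * (dX a + (B *ᵥ X) a)) = -(ψ ⬝ᵥ (dB *ᵥ X - B *ᵥ dX)) := by
      rw [map_sum, dotProduct, ← Finset.sum_neg_distrib]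
      refine Finset.sum_congr rfl fun a _ => ?_
      rw [(hψ a).der_mul, dψ, zero_mul, zero_sub, map_add, ddX2, zero_add, mulVec, dotProduct,
        map_sum, Pi.sub_apply, mulVec, mulVec, dotProduct, dotProduct, ← Finset.sum_sub_distrib]
      congr 2
      refine Finset.sum_congr rfl fun b _ => ?_
      rw [(hB a b).der_mul, ddX, ddB]
    have e3 : der (Sum.inl o) (∑ a, ∑ b, ψ a * (dB + B * B) a b * ψ b)
        = -(ψ ⬝ᵥ ((dB * B - B * dB) *ᵥ ψ)) := by
      simp only [map_sum, dotProduct, mulVec, ← Finset.sum_neg_distrib, Finset.mul_sum]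
      refine Finset.sum_congr rfl fun a _ => Finset.sum_congr rfl fun b _ => ?_
      rw [mul_assoc, (hψ a).der_mul, dψ, zero_mul, zero_sub, (hF a b).der_mul, dψ, mul_zero, add_zero]
      congr 3
      simp only [Matrix.add_apply, Matrix.sub_apply, mul_apply, map_add, ddB2, zero_add, map_sum,
        ← Finset.sum_sub_distrib]
      refine Finset.sum_congr rfl fun c _ => ?_
      rw [(hB a c).der_mul, ddB, ddB]
    rw [hEq, map_add, map_sub, map_smul, map_smul, map_smul, e1, e2, e3]
    module
  have pE : ∀ c, der (Sum.inr c) E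
      = (-(Complex.I • (dX + B *ᵥ X)) + (dB + B * B) *ᵥ ψ) c := by
    intro c
    have free : ∀ y : Gr κ, der (Sum.inr c) (rename (Sum.inl : κ → κ ⊕ Fin n) y) = 0 :=
      der_inr_rename_inl c
    have pψ : ∀ a, der (Sum.inr c) (ψ a) = if a = c then 1 else 0 := by
      intro a
      split_ifs with h
      · rw [h]; exact der_gen_self _
      · exact der_gen_of_ne (by simpa using h)
    have pX : ∀ a, der (Sum.inr c) (X a) = 0 := fun a => free _
    have pdX : ∀ a, der (Sum.inr c) (dX a) = 0 := fun a => free _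
    have pB : ∀ a b, der (Sum.inr c) (B a b) = 0 := fun a b => free _
    have pdB : ∀ a b, der (Sum.inr c) (dB a b) = 0 := fun a b => free _
    have pF : ∀ a b, der (Sum.inr c) ((dB + B * B) a b) = 0 := by
      intro a b
      simp [Matrix.add_apply, mul_apply, map_sum, der_mul, pB, pdB]
    have pBX : ∀ a, der (Sum.inr c) ((B *ᵥ X) a) = 0 := by
      intro a
      simp [mulVec, dotProduct, map_sum, der_mul, pB, pX]
    have e1 : der (Sum.inr c) (∑ a, X a * X a) = 0 := by
      simp [map_sum, der_mul, pX]
    have e2 : der (Sum.inr c) (∑ a, ψ a * (dX a + (B *ᵥ X) a)) = dX c + (B *ᵥ X) c := by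
      simp [map_sum, der_mul, pψ, pdX, pBX]
    have e3 : der (Sum.inr c) (∑ a, ∑ b, ψ a * (dB + B * B) a b * ψ b)
        = (2 : ℂ) • ((dB + B * B) *ᵥ ψ) c := by
      have : ∀ a b, der (Sum.inr c) (ψ a * (dB + B * B) a b * ψ b)
          = (if a = c then (dB + B * B) c b * ψ b else 0)
            + (if b = c then (dB + B * B) c a * ψ a else 0) := by
        intro a b
        rw [mul_assoc, (hψ a).der_mul, (hF a b).der_mul, pF, pψ, pψ]
        split_ifs with h1 h2 h2 <;> try subst h1
        · subst h2; simp only [one_mul, zero_mul, zero_add, mul_one]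
          have hz : (dB + B * B) b b = 0 := by
            have h2 : (2 : ℂ) • (dB + B * B) b b = 0 := by rw [two_smul]; nth_rw 1 [hF' b b]; simp
            exact (smul_eq_zero.mp h2).resolve_left two_ne_zero
          rw [hz]; simp
        · simp
        · subst h2
          simp only [zero_mul, mul_one, zero_add, zero_sub]
          rw [← (hF a b).commute, hF' a b, neg_mul, neg_neg]
        · simp
      simp only [map_sum, this, Finset.sum_add_distrib, mulVec, dotProduct, two_smul]
      congr 1
      · rw [Finset.sum_comm]; simp
      · simp
    rw [hEq, map_add, map_sub, map_smul, map_smul, map_smul, e1, e2, e3]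
    simp only [Pi.add_apply, Pi.neg_apply, Pi.smul_apply]
    module
  have hQE : Q E = 0 := by
    rw [hQ, dE]
    simp only [pE]
    exact mq_bianchi hψ hX hB hB' hdB hdB'
  have hQexp : Q (grExp E) = 0 := by
    -- `Q` is odd, but `E` is even, so multiplication by `E` obeys the Leibniz rule without a sign.
    rw [leibniz_grExp Q hEe.commute, hQE, zero_mul]
    · rw [hQ]; simp
    · intro y
      simp only [hQ, hEe.der_mul, mul_add, Finset.mul_sum, Finset.sum_add_distrib, add_mul,
        Finset.sum_mul]
      have : ∀ c, W c * (E * der (Sum.inr c) y) = E * (W c * der (Sum.inr c) y) := fun c => by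
        rw [← mul_assoc, ← mul_assoc, hEe.commute]
      simp only [this, mul_assoc]
      abel
  have h0 : fibreInt (der (Sum.inl o) (grExp E)) = 0 := by
    have h := congrArg fibreInt hQexp
    rw [hQ, map_add, map_sum, map_zero] at h
    -- The coefficient `X c` is free of `ψ` and leaves a total derivative. For `(Bψ)_c`, integration
    -- by parts leaves only the diagonal entry `A c c`, which is zero by antisymmetry.
    have hW0 : ∑ c, fibreInt (W c * der (Sum.inr c) (grExp E)) = 0 := by
      have : ∀ c, fibreInt (W c * der (Sum.inr c) (grExp E)) = 0 := by
        intro c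
        rw [hW, Pi.sub_apply, sub_mul, map_sub, Pi.smul_apply, smul_mul_assoc, map_smul]
        have e1 : fibreInt (X c * der (Sum.inr c) (grExp E)) = 0 := by
          rw [fibreInt_even_mul (hx c), fibreInt_der, mul_zero]
        have e2 : fibreInt ((B *ᵥ ψ) c * der (Sum.inr c) (grExp E)) = 0 := by
          have hcc : A c c = 0 := by
            have h2 : (2 : ℂ) • A c c = 0 := by rw [two_smul]; nth_rw 1 [hA' c c]; simp
            simpa using h2
          simp only [mulVec, dotProduct, Finset.sum_mul, map_sum, mul_assoc]
          refine Finset.sum_eq_zero fun b _ => ?_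
          rw [fibreInt_odd_mul (hA c b), fibreInt_gen_mul_der]
          split_ifs with hcb
          · subst hcb; rw [hcc]; simp
          · simp
        rw [e1, e2]; simp
      exact Finset.sum_eq_zero fun c _ => this c
    rwa [hW0, add_zero] at h
  unfold mqExp
  rw [der_fibreInt, ← hE, h0, smul_zero]

/-! #### The top coefficient for vanishing curvature -/

/-- The scalar `∏_{k < n} (-1)^k (-i)`. -/
def topSign (n : ℕ) : ℂ := ∏ k ∈ Finset.range n, ((-1) ^ k * -Complex.I)

/-- The factors with indices `n` and `n + 1` multiply to `(-1)^(2n+1) (-i)² = 1`. So `topSign` has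
period two, like `epsilon`, and ranks zero and one decide. -/
theorem epsilon_mul_topSign (n : ℕ) : epsilon n * topSign n = 1 := by
  have h2 : ∀ n, epsilon (n + 2) * topSign (n + 2) = epsilon n * topSign n := by
    intro n
    have : epsilon (n + 2) = epsilon n := by simp [epsilon, Nat.even_add]
    rw [this, topSign, topSign, Finset.prod_range_succ, Finset.prod_range_succ, pow_succ]
    rcases neg_one_pow_eq_or ℂ n with h | h <;> rw [h] <;> ring_nf <;> simp
  induction n using Nat.twoStepInduction with
  | zero => simp [epsilon, topSign]
  | one => simp [epsilon, topSign]
  | more n h _ => rw [h2, h]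

/-- Each derivative `∂/∂ψ_c` of the exponential brings down `-i η_c` after passing the odd factors
already extracted; these signs accumulate to `topSign n`. What is left of the exponential becomes
`1` when `ψ` is set to zero. -/
theorem mqExp_zero_curvature [Finite κ] (η : Fin n → Gr κ) (hη : ∀ a, IsOdd (η a)) :
    mqExp 0 η 0 = topSign n • (List.ofFn η).prod := by
  set E := mqExponent 0 η (0 : Fin n → Fin n → Gr κ) with hE
  have hEe : IsEven E := isEven_mqExponent (by simp [IsEven]) hη (by simp [IsEven])
  have hEq : E = -(Complex.I • ∑ a, gen (Sum.inr a) * rename Sum.inl (η a)) := by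
    rw [hE, mqExponent]; simp
  have pE : ∀ c : Fin n, der (Sum.inr c) E = -Complex.I • rename Sum.inl (η c) := by
    intro c
    rw [hEq, map_neg, map_smul, map_sum, Finset.sum_eq_single c]
    · rw [der_mul, der_gen_self, der_inr_rename_inl]; simp
    · intro a _ ha
      rw [der_mul, der_gen_of_ne (by simpa using ha), der_inr_rename_inl]; simp
    · simp
  -- The induction appends generators at the end, because the last one in the list is differentiated
  -- last.
  have key : ∀ l : List (Fin n), berezin (l.map Sum.inr) (grExp E) =
      (topSign l.length • rename Sum.inl (l.map η).prod) * grExp E := by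
    intro l
    induction l using List.reverseRecOn with
    | nil => simp [topSign]
    | append_singleton l c ih =>
      rw [List.map_append, List.map_singleton, berezin_concat, ih, smul_mul_assoc, map_smul, der_mul,
        der_inr_rename_inl, zero_mul, zero_add, leibniz_grExp _ hEe.commute (der_one _)
        (hEe.der_mul _), pE, parity_rename]
      have hp : parity (l.map η).prod = (-1 : ℂ) ^ l.length • (l.map η).prod := by
        clear ih
        induction l with
        | nil => simp
        | cons a l ih =>
          rw [List.map_cons, List.prod_cons, map_mul, ih, show parity (η a) = -η a from hη a,
            List.length_cons, pow_succ]
          simp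
      have ts : topSign (l.length + 1) = topSign l.length * ((-1) ^ l.length * -Complex.I) :=
        Finset.prod_range_succ _ _
      rw [hp, List.length_append, List.length_singleton, ts, List.map_append, List.prod_append,
        map_mul]
      simp [smul_smul, mul_assoc, mul_comm Complex.I]
  have hk : keep Sum.inl Sum.inl_injective (grExp E) = 1 := by
    rw [map_grExp _ (body_keep _ _)]
    have : keep Sum.inl Sum.inl_injective E = 0 := by
      rw [hEq, map_neg, map_smul, map_sum, Finset.sum_eq_zero]
      · simp
      · intro a _
        rw [map_mul, keep_gen_of_notMem _ _ (by simp), zero_mul]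
    rw [this]
    simpa using grExp_algebraMap (κ := κ) 0
  unfold mqExp
  rw [← hE, fibreInt_apply, key, map_mul, hk, mul_one, map_smul, keep_rename, List.length_finRange,
    List.ofFn_eq_map]

end MQ

/-! ### Formal differential forms over a commutative algebra -/

section FormalForms

/-- A point of the odd tangent bundle of the spectrum of `R`, with values in a finitely generated
Grassmann algebra. -/
structure GrPoint (R : Type*) [CommRing R] [Algebra ℝ R] where
  κ : Type
  finite : Finite κ
  hom : R →ₐ[ℝ] Gr (Option κ)
  even : ∀ f, IsEven (hom f)

attribute [instance] GrPoint.finite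

variable {R : Type*} [CommRing R] [Algebra ℝ R] {n : ℕ}

/-- The functions `p ↦ ∑ c f(p) D(g₁(p)) ⋯ D(g_k(p))` on the points. -/
def formSpan (R : Type*) [CommRing R] [Algebra ℝ R] (k : ℕ) :
    Submodule ℂ (∀ p : GrPoint R, Gr (Option p.κ)) :=
  Submodule.span ℂ {Φ | ∃ (f : R) (l : List R), l.length = k ∧
    Φ = fun p => p.hom f * (l.map fun g => D (p.hom g)).prod}

theorem isOdd_D_hom (p : GrPoint R) (g : R) : IsOdd (D (p.hom g)) := (p.even g).der none

theorem hom_mem_formSpan (f : R) : (fun p : GrPoint R => p.hom f) ∈ formSpan R 0 :=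
  Submodule.subset_span ⟨f, [], rfl, by funext p; simp⟩

theorem D_hom_mem_formSpan (f : R) : (fun p : GrPoint R => D (p.hom f)) ∈ formSpan R 1 :=
  Submodule.subset_span ⟨1, [f], rfl, by funext p; simp⟩

theorem mul_mem_formSpan {j k : ℕ} {Φ Φ' : ∀ p : GrPoint R, Gr (Option p.κ)}
    (h : Φ ∈ formSpan R j) (h' : Φ' ∈ formSpan R k) : Φ * Φ' ∈ formSpan R (j + k) := by
  have : formSpan R j * formSpan R k ≤ formSpan R (j + k) := by
    unfold formSpan
    rw [Submodule.span_mul_span]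
    apply Submodule.span_mono
    rintro _ ⟨_, ⟨f, l, hl, rfl⟩, _, ⟨f', l', hl', rfl⟩, rfl⟩
    refine ⟨f * f', l ++ l', by simp [hl, hl'], ?_⟩
    funext p
    simp only [Pi.mul_apply, map_mul, List.map_append, List.prod_append]
    rw [mul_assoc, mul_assoc, ← mul_assoc _ (p.hom f'), ← (p.even f').commute, mul_assoc]
  exact this (Submodule.mul_mem_mul h h')

theorem D_prod_D (p : GrPoint R) (l : List R) :
    D ((l.map fun g => D (p.hom g)).prod) = 0 := by
  induction l with
  | nil => exact der_one _
  | cons a l ih =>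
    rw [List.map_cons, List.prod_cons]
    refine (der_mul none _ _).trans ?_
    rw [show der none (D (p.hom a)) = 0 from der_der _ _,
      show der none ((l.map fun g => D (p.hom g)).prod) = 0 from ih]
    simp

/-- Since `D` squares to zero, only the leading function is differentiated, and it becomes one more
differential. -/
theorem D_mem_formSpan {k : ℕ} {Φ : ∀ p : GrPoint R, Gr (Option p.κ)} (h : Φ ∈ formSpan R k) :
    (fun p => D (Φ p)) ∈ formSpan R (k + 1) := by
  refine Submodule.span_induction (p := fun Φ _ => (fun p => D (Φ p)) ∈ formSpan R (k + 1))
    ?_ ?_ ?_ ?_ h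
  · rintro _ ⟨f, l, hl, rfl⟩
    refine Submodule.subset_span ⟨1, f :: l, by simp [hl], ?_⟩
    funext p
    rw [map_one, one_mul, List.map_cons, List.prod_cons]
    refine (der_mul none _ _).trans ?_
    rw [show der none ((l.map fun g => D (p.hom g)).prod) = 0 from D_prod_D p l]
    simp [D]
  · convert Submodule.zero_mem (formSpan R (k + 1)) using 1
    funext p
    exact map_zero D
  · intro x y _ _ hx hy
    convert Submodule.add_mem _ hx hy using 1
    funext p
    exact map_add D _ _
  · intro c x _ hx
    convert Submodule.smul_mem _ c hx using 1
    funext p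
    exact map_smul D _ _

theorem parity_of_mem_formSpan {k : ℕ} {Φ : ∀ p : GrPoint R, Gr (Option p.κ)}
    (h : Φ ∈ formSpan R k) (p : GrPoint R) : parity (Φ p) = (-1 : ℂ) ^ k • Φ p := by
  refine Submodule.span_induction (p := fun Φ _ => parity (Φ p) = (-1 : ℂ) ^ k • Φ p)
    ?_ ?_ ?_ ?_ h
  · rintro _ ⟨f, l, rfl, rfl⟩
    have : parity ((l.map fun g => D (p.hom g)).prod)
        = (-1 : ℂ) ^ l.length • (l.map fun g => D (p.hom g)).prod := by
      clear h
      induction l with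
      | nil => simp
      | cons a l ih =>
        rw [List.map_cons, List.prod_cons, map_mul, ih,
          show parity (D (p.hom a)) = -D (p.hom a) from isOdd_D_hom p a, List.length_cons, pow_succ]
        simp
    change parity (p.hom f * _) = _ • (p.hom f * _)
    rw [map_mul, this, show parity (p.hom f) = p.hom f from p.even f, mul_smul_comm]
  · simp
  · intro x y _ _ hx hy
    simp [hx, hy]
  · intro c x _ hx
    simp [hx, smul_comm c]

theorem exists_sum_of_mem_formSpan {k : ℕ} {Φ : ∀ p : GrPoint R, Gr (Option p.κ)}
    (h : Φ ∈ formSpan R k) : ∃ (N : ℕ) (c : Fin N → ℂ) (f : Fin N → R) (g : Fin N → Fin k → R),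
      ∀ p : GrPoint R, Φ p =
        ∑ j, c j • (p.hom (f j) * (List.ofFn fun a => D (p.hom (g j a))).prod) := by
  obtain ⟨N, c, v, rfl⟩ := Submodule.mem_span_set'.1 h
  choose f l hl hv using fun j => (v j).2
  refine ⟨N, c, f, fun j a => (l j).get (a.cast (hl j).symm), fun p => ?_⟩
  rw [Finset.sum_apply]
  refine Finset.sum_congr rfl fun j _ => ?_
  rw [Pi.smul_apply, hv]
  change c j • (p.hom (f j) * _) = _
  congr 3
  apply List.ext_getElem
  · simp [hl]
  · intro i h1 h2
    simp

/-! #### Integration over `ψ` -/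

/-- The span of the functions `ψ_l * Φ` with `Φ` a form of degree the length of `l`, at least `i`. -/
def psiSpan (R : Type*) [CommRing R] [Algebra ℝ R] (n i : ℕ) :
    Submodule ℂ (∀ p : GrPoint R, Gr (Option p.κ ⊕ Fin n)) :=
  Submodule.span ℂ {Ψ | ∃ (l : List (Fin n)) (Φ : ∀ p : GrPoint R, Gr (Option p.κ)),
    i ≤ l.length ∧ Φ ∈ formSpan R l.length ∧
      Ψ = fun p => ((l.map Sum.inr).map gen).prod * rename Sum.inl (Φ p)}

theorem mul_prod_gen {κ : Type} (x : Gr κ) (l : List κ) :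
    x * (l.map gen).prod = (l.map gen).prod * (parity^[l.length] x) := by
  induction l generalizing x with
  | nil => simp
  | cons i l ih =>
    rw [List.map_cons, List.prod_cons, ← mul_assoc, mul_gen, mul_assoc, ih, mul_assoc]
    rfl

/-- Moving a form past generators `ψ` costs a sign that depends on the two degrees alone. It is the
same at all points, so the product stays in the span. -/
theorem mul_mem_psiSpan {i j : ℕ} {Ψ Ψ' : ∀ p : GrPoint R, Gr (Option p.κ ⊕ Fin n)}
    (h : Ψ ∈ psiSpan R n i) (h' : Ψ' ∈ psiSpan R n j) : Ψ * Ψ' ∈ psiSpan R n (i + j) := by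
  have : psiSpan R n i * psiSpan R n j ≤ psiSpan R n (i + j) := by
    conv_lhs => unfold psiSpan
    rw [Submodule.span_mul_span, Submodule.span_le]
    rintro _ ⟨_, ⟨l, Φ, hl, hΦ, rfl⟩, _, ⟨l', Φ', hl', hΦ', rfl⟩, rfl⟩
    have hp : ∀ p : GrPoint R, parity^[l'.length] (rename (Sum.inl : _ → _ ⊕ Fin n) (Φ p))
        = ((-1 : ℂ) ^ l.length) ^ l'.length • rename Sum.inl (Φ p) := by
      intro p
      generalize l'.length = m
      induction m with
      | zero => simp
      | succ m ih =>
        rw [Function.iterate_succ_apply', ih, map_smul, parity_rename, parity_of_mem_formSpan hΦ,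
          map_smul, smul_smul, pow_succ]
    have e : (fun p : GrPoint R => ((l.map Sum.inr).map gen).prod * rename Sum.inl (Φ p)) *
        (fun p : GrPoint R => ((l'.map Sum.inr).map gen).prod * rename Sum.inl (Φ' p))
        = ((-1 : ℂ) ^ l.length) ^ l'.length • fun p : GrPoint R =>
          (((l ++ l').map Sum.inr).map (gen (κ := Option p.κ ⊕ Fin n))).prod
            * rename Sum.inl ((Φ * Φ') p) := by
      funext p
      simp only [Pi.mul_apply, Pi.smul_apply, List.map_append, List.prod_append, map_mul]
      rw [mul_assoc, ← mul_assoc (rename Sum.inl (Φ p)), mul_prod_gen, List.length_map, hp]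
      simp [mul_assoc]
    change _ * _ ∈ _
    rw [e]
    refine Submodule.smul_mem _ _ (Submodule.subset_span ⟨l ++ l', Φ * Φ', ?_, ?_, rfl⟩)
    · simp; omega
    · rw [List.length_append]; exact mul_mem_formSpan hΦ hΦ'
  exact this (Submodule.mul_mem_mul h h')

theorem psiSpan_antitone {i j : ℕ} (h : i ≤ j) : psiSpan R n j ≤ psiSpan R n i := by
  apply Submodule.span_mono
  rintro _ ⟨l, Φ, hl, hΦ, rfl⟩
  exact ⟨l, Φ, h.trans hl, hΦ, rfl⟩

theorem psiSpan_eq_bot {i : ℕ} (h : n < i) : psiSpan R n i = ⊥ := by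
  rw [eq_bot_iff]
  apply Submodule.span_le.2
  rintro _ ⟨l, Φ, hl, hΦ, rfl⟩
  have : ¬ (l : List (Fin n)).Nodup := fun hn => by
    have := hn.length_le_card
    rw [Fintype.card_fin] at this; omega
  rw [SetLike.mem_coe, Submodule.mem_bot]
  funext p
  rw [prod_gen_eq_zero (fun hn => this (hn.of_map _)), zero_mul]
  rfl

theorem berezin_eq_zero_of_der {κ : Type} {l : List κ} {i : κ} (hi : i ∈ l) {x : Gr κ}
    (hx : der i x = 0) : berezin l x = 0 := by
  induction l generalizing x with
  | nil => simp at hi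
  | cons j l ih =>
    rw [berezin_cons]
    rcases List.mem_cons.1 hi with rfl | h
    · rw [hx, map_zero]
    · exact ih h (by rw [der_comm, hx, map_zero, neg_zero])

theorem der_prod_gen_of_notMem {κ : Type} {l : List κ} {i : κ} (hi : i ∉ l) :
    der i (l.map (gen (κ := κ))).prod = 0 := by
  induction l with
  | nil => simp
  | cons j l ih =>
    rw [List.mem_cons, not_or] at hi
    rw [List.map_cons, List.prod_cons, der_mul, ih hi.2, der_gen_of_ne (Ne.symm hi.1)]
    simp

theorem exists_prod_gen_perm {κ : Type} {l l' : List κ} (h : l.Perm l') :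
    ∃ c : ℂ, (l.map (gen (κ := κ))).prod = c • (l'.map gen).prod := by
  induction h with
  | nil => exact ⟨1, by simp⟩
  | cons a _ ih =>
    obtain ⟨c, hc⟩ := ih
    exact ⟨c, by simp [hc]⟩
  | swap a b l =>
    refine ⟨-1, ?_⟩
    simp only [List.map_cons, List.prod_cons, ← mul_assoc]
    rw [gen_mul_gen]; simp
  | trans _ _ ih ih' =>
    obtain ⟨c, hc⟩ := ih
    obtain ⟨c', hc'⟩ := ih'
    exact ⟨c * c', by rw [hc, hc', smul_smul]⟩

/-- The scalar is quantified before `κ`: it has to be the same at all points if integration over `ψ`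
is to map formal forms to formal forms. -/
theorem exists_berezin_prod_gen (l : List (Fin n)) : ∃ c : ℂ, (l.length ≠ n → c = 0) ∧
    ∀ κ : Type, fibreInt (((l.map Sum.inr).map gen).prod : Gr (κ ⊕ Fin n)) = c • 1 := by
  by_cases hl : l.Nodup
  · by_cases hn : l.length = n
    · have hp : l.Perm (List.finRange n) := by
        refine (List.perm_ext_iff_of_nodup hl (List.nodup_finRange n)).2 fun a => ?_
        have : l.toFinset = Finset.univ := by
          rw [← Finset.card_eq_iff_eq_univ, List.toFinset_card_of_nodup hl, hn, Fintype.card_fin]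
        simp only [List.mem_finRange, iff_true]
        rw [← List.mem_toFinset, this]; exact Finset.mem_univ a
      -- The scalar is found in the algebra on the generators `ψ` alone and then transported to
      -- every `κ` by renaming.
      obtain ⟨c, hc⟩ := exists_prod_gen_perm (hp.map (Sum.inr : Fin n → Empty ⊕ Fin n))
      refine ⟨c, fun h => absurd hn h, fun κ => ?_⟩
      have hc' := congrArg (rename (Sum.map Empty.elim id : Empty ⊕ Fin n → κ ⊕ Fin n)) hc
      have hmap : ∀ l : List (Fin n), rename (Sum.map Empty.elim id : Empty ⊕ Fin n → κ ⊕ Fin n)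
          ((l.map Sum.inr).map gen).prod = ((l.map Sum.inr).map gen).prod := by
        intro l
        rw [map_list_prod]
        simp [Function.comp_def]
      rw [map_smul, hmap, hmap] at hc'
      rw [hc', map_smul, fibreInt_apply, berezin_prod_gen, map_one]
      exact (List.nodup_finRange n).map Sum.inr_injective
    · refine ⟨0, fun _ => rfl, fun κ => ?_⟩
      have : ∃ a, a ∉ l := by
        by_contra! h
        apply hn
        have h2 : l.toFinset = Finset.univ := by ext a; simp [h a]
        rw [← List.toFinset_card_of_nodup hl, h2, Finset.card_univ, Fintype.card_fin]
      obtain ⟨a, ha⟩ := this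
      rw [fibreInt_apply, berezin_eq_zero_of_der (i := Sum.inr a) (by simp), map_zero, zero_smul]
      exact der_prod_gen_of_notMem (by simpa using ha)
  · refine ⟨0, fun _ => rfl, fun κ => ?_⟩
    rw [prod_gen_eq_zero (fun hn => hl (hn.of_map _)), map_zero, zero_smul]

theorem fibreInt_mem_formSpan {Ψ : ∀ p : GrPoint R, Gr (Option p.κ ⊕ Fin n)}
    (h : Ψ ∈ psiSpan R n 0) : (fun p => fibreInt (Ψ p)) ∈ formSpan R n := by
  refine Submodule.span_induction (p := fun Ψ _ => (fun p => fibreInt (Ψ p)) ∈ formSpan R n)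
    ?_ ?_ ?_ ?_ h
  · rintro _ ⟨l, Φ, -, hΦ, rfl⟩
    obtain ⟨c, hc, hl⟩ := exists_berezin_prod_gen l
    have : (fun p : GrPoint R => fibreInt (((l.map Sum.inr).map gen).prod * rename Sum.inl (Φ p)))
        = c • Φ := by
      funext p
      rw [fibreInt_mul_rename, hl]; simp
    rw [this]
    by_cases hn : l.length = n
    · rw [← hn]; exact Submodule.smul_mem _ _ hΦ
    · rw [hc hn, zero_smul]; exact Submodule.zero_mem _
  · convert Submodule.zero_mem (formSpan R n) using 1
    funext p
    exact map_zero fibreInt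
  · intro x y _ _ hx hy
    convert Submodule.add_mem _ hx hy using 1
    funext p
    exact map_add fibreInt _ _
  · intro c x _ hx
    convert Submodule.smul_mem _ c hx using 1
    funext p
    exact map_smul fibreInt _ _

/-- In every term of the exponent the degree in `ψ` equals the degree as a form, which is what
`psiSpan` records. The Berezin integral extracts degree `n` in `ψ`, hence a form of degree `n`. -/
theorem mqExp_mem_formSpan {B : Fin n → ∀ p : GrPoint R, Gr (Option p.κ)}
    {C : Fin n → Fin n → ∀ p : GrPoint R, Gr (Option p.κ)} (hB : ∀ a, B a ∈ formSpan R 1)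
    (hC : ∀ a b, C a b ∈ formSpan R 2) :
    (fun p => mqExp 0 (fun a => B a p) (fun a b => C a b p)) ∈ formSpan R n := by
  let E : ∀ p : GrPoint R, Gr (Option p.κ ⊕ Fin n) := fun p =>
    mqExponent 0 (fun a => B a p) (fun a b => C a b p)
  have hE : E ∈ psiSpan R n 1 := by
    have : E = -(Complex.I • ∑ a, fun p : GrPoint R => gen (Sum.inr a) * rename Sum.inl (B a p))
        + (1 / 2 : ℂ) • ∑ a, ∑ b, fun p : GrPoint R =>
          gen (Sum.inr a) * rename Sum.inl (C a b p) * gen (Sum.inr b) := by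
      funext p
      simp [E, mqExponent]
    rw [this]
    refine Submodule.add_mem _ (Submodule.neg_mem _ (Submodule.smul_mem _ _
      (Submodule.sum_mem _ fun a _ => ?_))) (Submodule.smul_mem _ _
      (Submodule.sum_mem _ fun a _ => Submodule.sum_mem _ fun b _ => ?_))
    · exact Submodule.subset_span ⟨[a], B a, by simp, hB a, by funext p; simp⟩
    · refine Submodule.subset_span ⟨[a, b], C a b, by simp, hC a b, ?_⟩
      funext p
      rw [mul_assoc, mul_gen, parity_rename, parity_of_mem_formSpan (hC a b)]
      simp [mul_assoc]
  have hpow : ∀ k, E ^ (k + 1) ∈ psiSpan R n (k + 1) := by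
    intro k
    induction k with
    | zero => simpa using hE
    | succ k ih => rw [pow_succ]; exact mul_mem_psiSpan ih hE
  have hone : (1 : ∀ p : GrPoint R, Gr (Option p.κ ⊕ Fin n)) ∈ psiSpan R n 0 := by
    refine Submodule.subset_span ⟨[], 1, by simp, ?_, ?_⟩
    · have := hom_mem_formSpan (1 : R)
      simp only [map_one] at this
      exact this
    · funext p; simp
  have hpow0 : ∀ k, E ^ k ∈ psiSpan R n 0 := by
    intro k
    cases k with
    | zero => simpa using hone
    | succ k => exact psiSpan_antitone (Nat.zero_le _) (hpow k)
  -- The bound `n + 1` holds at all points at once, because more than `n` factors `ψ` multiply to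
  -- zero. A bound through the number of generators of the point would not give one formula for all
  -- points.
  have hexp : (fun p => grExp (E p)) = ∑ k ∈ Finset.range (n + 1), ((k.factorial : ℂ)⁻¹) • E ^ k := by
    funext p
    have h0 : E p ^ (n + 1) = 0 := by
      have := hpow n
      rw [psiSpan_eq_bot (Nat.lt_succ_self n), Submodule.mem_bot] at this
      exact congrFun this p
    rw [grExp_of_body (by simp [E, body_mqExponent]), IsNilpotent.exp_eq_sum h0, Finset.sum_apply]
    refine Finset.sum_congr rfl fun k _ => ?_
    rw [← Rat.cast_smul_eq_qsmul ℂ]; simp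
  have : (fun p => grExp (E p)) ∈ psiSpan R n 0 := by
    rw [hexp]
    exact Submodule.sum_mem _ fun k _ => Submodule.smul_mem _ _ (hpow0 k)
  exact fibreInt_mem_formSpan this

end FormalForms

/-! ### Smooth Taylor expansions -/

section Taylor

universe u

theorem hasFDerivAt_integral_smul_comp {E F : Type*} [NormedAddCommGroup E] [NormedSpace ℝ E]
    [ProperSpace E] [NormedAddCommGroup F] [NormedSpace ℝ F] [CompleteSpace F] {w : E → F}
    (hw : ContDiff ℝ ∞ w) {p : ℝ → ℝ} (hp : Continuous p) (x : E) :
    HasFDerivAt (fun x => ∫ t in (0 : ℝ)..1, p t • w (t • x))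
      (∫ t in (0 : ℝ)..1, (p t * t) • fderiv ℝ w (t • x)) x := by
  have hw' : Continuous (fderiv ℝ w) := hw.continuous_fderiv (by simp)
  have hc : Continuous fun q : E × ℝ => (p q.2 * q.2) • fderiv ℝ w (q.2 • q.1) := by fun_prop
  have hK : IsCompact (Metric.closedBall x 1 ×ˢ Set.Icc (0 : ℝ) 1) :=
    (isCompact_closedBall x 1).prod isCompact_Icc
  obtain ⟨C, hC⟩ := (hK.image hc.norm).bddAbove
  refine intervalIntegral.hasFDerivAt_integral_of_dominated_of_fderiv_le (bound := fun _ => C)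
    (s := Metric.closedBall x 1) (F' := fun x t => (p t * t) • fderiv ℝ w (t • x))
    (Metric.closedBall_mem_nhds x one_pos) ?_ ?_ ?_ ?_ ?_ ?_
  · refine Filter.Eventually.of_forall fun y => ?_
    have : Continuous fun t => p t • w (t • y) := by have := hw.continuous; fun_prop
    exact this.aestronglyMeasurable
  · have : Continuous fun t => p t • w (t • x) := by have := hw.continuous; fun_prop
    exact this.intervalIntegrable _ _
  · have : Continuous fun t => (p t * t) • fderiv ℝ w (t • x) := by fun_prop
    exact this.aestronglyMeasurable
  · refine Filter.Eventually.of_forall fun t ht y hy => hC ⟨(y, t), ⟨hy, ?_⟩, rfl⟩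
    rw [Set.uIoc_of_le zero_le_one] at ht
    exact ⟨ht.1.le, ht.2⟩
  · exact intervalIntegrable_const
  · refine Filter.Eventually.of_forall fun t _ y _ => ?_
    have h1 : HasFDerivAt w (fderiv ℝ w (t • y)) (t • y) :=
      (hw.differentiable (by simp) _).hasFDerivAt
    have h2 : HasFDerivAt (fun y : E => t • y) (t • ContinuousLinearMap.id ℝ E) y :=
      (hasFDerivAt_id y).const_smul t
    convert (h1.comp y h2).const_smul (p t) using 1
    · rfl
    · rw [ContinuousLinearMap.comp_smul, ContinuousLinearMap.comp_id, mul_smul]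

/-- The derivative is an integral of the same kind, with the weight `p t * t` and with `fderiv ℝ w`
in place of `w`. The induction therefore varies both the weight and the target, and the target must
stay in the universe of `E`. -/
theorem contDiff_integral_smul_comp {E F : Type u} [NormedAddCommGroup E] [NormedSpace ℝ E]
    [ProperSpace E] [NormedAddCommGroup F] [NormedSpace ℝ F] [CompleteSpace F] {w : E → F}
    (hw : ContDiff ℝ ∞ w) {p : ℝ → ℝ} (hp : Continuous p) :
    ContDiff ℝ ∞ (fun x => ∫ t in (0 : ℝ)..1, p t • w (t • x)) := by
  refine contDiff_infty.2 fun m => ?_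
  induction m generalizing F p with
  | zero =>
    refine contDiff_zero.2 ?_
    exact continuous_iff_continuousAt.2 fun x =>
      (hasFDerivAt_integral_smul_comp hw hp x).continuousAt
  | succ m ih =>
    rw [Nat.cast_succ, contDiff_succ_iff_fderiv]
    refine ⟨fun x => (hasFDerivAt_integral_smul_comp hw hp x).differentiableAt, by simp, ?_⟩
    have : fderiv ℝ (fun x => ∫ t in (0 : ℝ)..1, p t • w (t • x))
        = fun x => ∫ t in (0 : ℝ)..1, (p t * t) • fderiv ℝ w (t • x) := by
      funext x
      exact (hasFDerivAt_integral_smul_comp hw hp x).fderiv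
    rw [this]
    exact ih (hw.fderiv_right (by simp)) (hp.mul continuous_id)

/-- The witness is the mean of the derivative over the segment from `a` to `x`. -/
theorem exists_hadamard {E : Type u} [NormedAddCommGroup E] [NormedSpace ℝ E]
    [ProperSpace E] {f : E → ℝ} (hf : ContDiff ℝ ∞ f) (a : E) :
    ∃ g : E → E →L[ℝ] ℝ, ContDiff ℝ ∞ g ∧ ∀ x, f x = f a + g x (x - a) := by
  have hw : ContDiff ℝ ∞ fun y => fderiv ℝ f (a + y) :=
    (hf.fderiv_right (m := ∞) (by simp)).comp (contDiff_const.add contDiff_id)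
  refine ⟨fun x => ∫ t in (0 : ℝ)..1, (1 : ℝ) • fderiv ℝ f (a + t • (x - a)),
    (contDiff_integral_smul_comp hw (p := fun _ => 1) continuous_const).comp
      (contDiff_id.sub contDiff_const), fun x => ?_⟩
  have h := map_add_eq_sum_add_integral_iteratedFDeriv (f := f) (x := a) (y := x - a) (n := 0)
    fun t _ => (hf.of_le (by simp)).contDiffAt
  have hi : IntervalIntegrable (fun t : ℝ => (1 : ℝ) • fderiv ℝ f (a + t • (x - a))) volume 0 1 := by
    have : Continuous fun t : ℝ => (1 : ℝ) • fderiv ℝ f (a + t • (x - a)) := by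
      have := hf.continuous_fderiv (by simp); fun_prop
    exact this.intervalIntegrable _ _
  rw [ContinuousLinearMap.intervalIntegral_apply hi]
  simpa using h

/-- The integral form of the remainder is used since it exhibits `r` as smooth. An estimate would
not suffice: a homomorphism out of the smooth functions is going to be applied to `r`. -/
theorem exists_taylor {f : ℝ → ℝ} (hf : ContDiff ℝ ∞ f) (a : ℝ) (N : ℕ) :
    ∃ r : ℝ → ℝ, ContDiff ℝ ∞ r ∧ ∀ y, f y =
      (∑ k ∈ Finset.range (N + 1), (iteratedDeriv k f a / k.factorial) * (y - a) ^ k)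
        + (y - a) ^ (N + 1) * r y := by
  have hd : ContDiff ℝ ∞ (iteratedDeriv (N + 1) f) := by
    rw [iteratedDeriv_eq_iterate]
    exact ContDiff.iterate_deriv _ hf
  have hw : ContDiff ℝ ∞ fun y => iteratedDeriv (N + 1) f (a + y) :=
    hd.comp (contDiff_const.add contDiff_id)
  refine ⟨fun y => ∫ t in (0 : ℝ)..1, ((N.factorial : ℝ)⁻¹ * (1 - t) ^ N) •
    iteratedDeriv (N + 1) f (a + t • (y - a)),
    (contDiff_integral_smul_comp hw (p := fun t => (N.factorial : ℝ)⁻¹ * (1 - t) ^ N)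
      (by fun_prop)).comp (contDiff_id.sub contDiff_const), fun y => ?_⟩
  have h := map_add_eq_sum_add_integral_iteratedFDeriv (f := f) (x := a) (y := y - a) (n := N)
    fun t _ => (hf.of_le (by exact_mod_cast le_top)).contDiffAt
  simp only [iteratedFDeriv_apply_eq_iteratedDeriv_mul_prod, Finset.prod_const, Finset.card_univ,
    Fintype.card_fin, smul_eq_mul] at h
  rw [add_sub_cancel] at h
  rw [h]
  congr 1
  · refine Finset.sum_congr rfl fun k _ => ?_
    ring
  · rw [← intervalIntegral.integral_const_mul, ← intervalIntegral.integral_const_mul]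
    refine intervalIntegral.integral_congr fun t _ => ?_
    simp only [smul_eq_mul]
    ring

end Taylor

/-! ### Homomorphisms from smooth functions to Grassmann algebras -/

section SmoothHom

set_option linter.unusedSectionVars false

open Filter Topology

universe u

variable {E : Type u} [NormedAddCommGroup E] [NormedSpace ℝ E] [FiniteDimensional ℝ E]
  {H : Type*} [TopologicalSpace H] {I : ModelWithCorners ℝ E H}
  {X : Type*} [TopologicalSpace X] [ChartedSpace H X] [IsManifold I ∞ X] [T2Space X]
  {κ : Type} [Finite κ]


theorem exists_bump {x : X} {U : Set X} (hU : U ∈ 𝓝 x) :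
    ∃ χ : C^∞⟮I, X; 𝓘(ℝ, ℝ), ℝ⟯, χ =ᶠ[𝓝 x] 1 ∧ tsupport χ ⊆ U := by
  obtain ⟨χ, -, hχ⟩ := (SmoothBumpFunction.nhds_basis_tsupport (I := I) x).mem_iff.1 hU
  exact ⟨⟨χ, χ.contMDiff⟩, χ.eventuallyEq_one, hχ⟩

theorem exists_smooth_germ_eq {x : X} {U : Set X} (hU : IsOpen U) (hx : x ∈ U) {f : X → ℝ}
    (hf : ContMDiffOn I 𝓘(ℝ, ℝ) ∞ f U) :
    ∃ g : C^∞⟮I, X; 𝓘(ℝ, ℝ), ℝ⟯, g =ᶠ[𝓝 x] f := by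
  obtain ⟨χ, h1, hχ⟩ := exists_bump (I := I) (hU.mem_nhds hx)
  refine ⟨⟨fun y => χ y * f y, contMDiff_of_tsupport fun y hy => ?_⟩, ?_⟩
  · have : y ∈ U := hχ (tsupport_mul_subset_left hy)
    exact χ.contMDiff.contMDiffAt.mul (hf.contMDiffAt (hU.mem_nhds this))
  · filter_upwards [h1] with y hy
    simp [hy]

variable (I) in
/-- Evaluation at a point. -/
def evalAt (x : X) : C^∞⟮I, X; 𝓘(ℝ, ℝ), ℝ⟯ →ₐ[ℝ] ℝ :=
  (Pi.evalAlgHom ℝ (fun _ : X => ℝ) x).comp ContMDiffMap.coeFnAlgHom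

theorem evalAt_apply (x : X) (f : C^∞⟮I, X; 𝓘(ℝ, ℝ), ℝ⟯) : evalAt I x f = f x := rfl

/-- The homomorphism `h` lies over the point `x`. -/
def LiesOver (h : C^∞⟮I, X; 𝓘(ℝ, ℝ), ℝ⟯ →ₐ[ℝ] Gr κ) (x : X) : Prop :=
  ∀ f, body (h f) = (f x : ℂ)

variable {h : C^∞⟮I, X; 𝓘(ℝ, ℝ), ℝ⟯ →ₐ[ℝ] Gr κ} {x : X}

/-- A bump function `χ` supported where `f` vanishes gives `f = (1 - χ)ᵏ f` for all `k`. As `χ` is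
`1` at `x`, the element `h (1 - χ)` has body zero and is nilpotent. So `h` depends on germs only. -/
theorem LiesOver.map_eq_zero (hx : LiesOver h x) {f : C^∞⟮I, X; 𝓘(ℝ, ℝ), ℝ⟯}
    (hf : f =ᶠ[𝓝 x] 0) : h f = 0 := by
  obtain ⟨U, hU, hUo, hxU⟩ := eventually_nhds_iff.1 hf
  obtain ⟨χ, h1, hχ⟩ := exists_bump (I := I) (hUo.mem_nhds hxU)
  have e : (1 - χ) * f = f := by
    ext y
    by_cases hy : y ∈ U
    · simp [show f y = 0 from hU y hy]
    · have : χ y = 0 := by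
        by_contra hne
        exact hy (hχ (subset_closure hne))
      simp [this]
  have e' : ∀ k : ℕ, h f = h (1 - χ) ^ k * h f := by
    intro k
    induction k with
    | zero => simp
    | succ k ih => rw [pow_succ, mul_assoc, ← map_mul, e, ← ih]
  have hb : body (h (1 - χ)) = 0 := by
    rw [hx]
    have : χ x = 1 := h1.self_of_nhds
    simp [this]
  rw [e' (Nat.card κ + 1), pow_eq_zero_of_body hb (Nat.lt_succ_self _), zero_mul]

theorem LiesOver.map_congr (hx : LiesOver h x) {f g : C^∞⟮I, X; 𝓘(ℝ, ℝ), ℝ⟯}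
    (hf : f =ᶠ[𝓝 x] g) : h f = h g := by
  rw [← sub_eq_zero, ← map_sub]
  refine hx.map_eq_zero ?_
  filter_upwards [hf] with y hy
  simp [hy]

/-- Composition of a smooth function with a smooth function on the line. -/
def smoothComp (F : ℝ → ℝ) (hF : ContDiff ℝ ∞ F) (f : C^∞⟮I, X; 𝓘(ℝ, ℝ), ℝ⟯) :
    C^∞⟮I, X; 𝓘(ℝ, ℝ), ℝ⟯ :=
  ⟨fun y => F (f y), hF.contMDiff.comp f.contMDiff⟩

/-- Taylor's formula around the body: `h f - f x` is nilpotent, so a high enough power kills the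
remainder. -/
theorem LiesOver.map_smoothComp (hx : LiesOver h x) {F : ℝ → ℝ} (hF : ContDiff ℝ ∞ F)
    (f : C^∞⟮I, X; 𝓘(ℝ, ℝ), ℝ⟯) {N : ℕ} (hN : Nat.card κ < N) :
    h (smoothComp F hF f) = ∑ k ∈ Finset.range N,
      ((iteratedDeriv k F (f x) / k.factorial : ℝ) : ℂ) •
        (h f - algebraMap ℂ _ (f x : ℂ)) ^ k := by
  obtain ⟨N, rfl⟩ : ∃ M, N = M + 1 := ⟨N - 1, by omega⟩
  obtain ⟨r, hr, he⟩ := exists_taylor hF (f x) N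
  have hc : ∀ c : ℝ, h (algebraMap ℝ _ c) = algebraMap ℂ _ (c : ℂ) := by
    intro c
    rw [AlgHom.commutes]; rfl
  have hs : ∀ (c : ℝ) (g : C^∞⟮I, X; 𝓘(ℝ, ℝ), ℝ⟯), h (c • g) = (c : ℂ) • h g := by
    intro c g
    rw [map_smul]; rfl
  have e : smoothComp F hF f = (∑ k ∈ Finset.range (N + 1),
      (iteratedDeriv k F (f x) / k.factorial) • (f - algebraMap ℝ _ (f x)) ^ k)
        + (f - algebraMap ℝ _ (f x)) ^ (N + 1) * smoothComp r hr f := by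
    ext y
    refine (he (f y)).trans ?_
    refine Eq.trans ?_ (evalAt_apply y _)
    simp only [map_add, map_sum, map_smul, map_mul, map_pow, map_sub, AlgHom.commutes]
    rfl
  rw [e, map_add, map_sum, map_mul, map_pow]
  have hb : (h (f - algebraMap ℝ _ (f x))) ^ (N + 1) = 0 := by
    refine pow_eq_zero_of_body ?_ hN
    rw [hx]
    change ((evalAt I x (f - algebraMap ℝ _ (f x)) : ℝ) : ℂ) = 0
    simp only [map_sub, AlgHom.commutes]
    exact_mod_cast sub_self (f x)
  rw [hb, zero_mul, add_zero]
  refine Finset.sum_congr rfl fun k _ => ?_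
  rw [hs, map_pow, map_sub, hc]

theorem LiesOver.map_exp (hx : LiesOver h x) (f : C^∞⟮I, X; 𝓘(ℝ, ℝ), ℝ⟯) :
    h (smoothComp Real.exp Real.contDiff_exp f) = grExp (h f) := by
  rw [hx.map_smoothComp _ f (Nat.lt_succ_self _)]
  unfold grExp
  rw [hx, nilpotent_exp_eq (by rw [← hx f, body_sub_body]) (Nat.lt_succ_self _), Finset.smul_sum]
  refine Finset.sum_congr rfl fun k _ => ?_
  rw [smul_smul, iteratedDeriv_eq_iterate, Real.iter_deriv_exp]
  push_cast
  rw [div_eq_mul_inv]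

/-! #### Coordinates -/

variable [I.Boundaryless]

theorem contDiffOn_comp_extChartAt_symm {f : X → ℝ} (hf : ContMDiff I 𝓘(ℝ, ℝ) ∞ f) (x : X) :
    ContDiffOn ℝ ∞ (f ∘ (extChartAt I x).symm) (extChartAt I x).target :=
  contMDiffOn_iff_contDiffOn.1 (hf.comp_contMDiffOn (contMDiffOn_extChartAt_symm x))

theorem mfderiv_mfderiv_extChartAt_symm {f : X → ℝ} (hf : ContMDiff I 𝓘(ℝ, ℝ) ∞ f) (x : X) {z : E}
    (hz : z ∈ (extChartAt I x).target) (e : E) :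
    (mfderiv I 𝓘(ℝ, ℝ) f ((extChartAt I x).symm z)
      (mfderiv 𝓘(ℝ, E) I (extChartAt I x).symm z e) : ℝ)
      = fderiv ℝ (f ∘ (extChartAt I x).symm) z e := by
  have h1 : MDifferentiableAt 𝓘(ℝ, E) I (extChartAt I x).symm z :=
    ((contMDiffOn_extChartAt_symm (n := ∞) x).contMDiffAt
      ((isOpen_extChartAt_target x).mem_nhds hz)).mdifferentiableAt (by simp)
  have h2 := mfderiv_comp z (hf.mdifferentiable (by simp) _) h1
  rw [← mfderiv_eq_fderiv, h2]
  rfl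

/-- Coordinates `ξ`, coordinate fields `v` and partial derivatives `p` come from the preferred
chart, the functions being cut off to global ones. The relations hold near `x` only, which is enough
for a homomorphism over `x`. The last clause is Hadamard's lemma in the chart. -/
theorem exists_coordinates (x : X) :
    ∃ (d : ℕ) (ξ : Fin d → C^∞⟮I, X; 𝓘(ℝ, ℝ), ℝ⟯) (v : Fin d → ∀ y : X, TangentSpace I y)
      (p : Fin d → C^∞⟮I, X; 𝓘(ℝ, ℝ), ℝ⟯ → C^∞⟮I, X; 𝓘(ℝ, ℝ), ℝ⟯),
      (∀ i f, ∀ᶠ y in 𝓝 x, p i f y = mvfderiv I f y (v i y)) ∧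
      (∀ i j, ∀ᶠ y in 𝓝 x, mvfderiv I (ξ j) y (v i y) = if i = j then 1 else 0) ∧
      ∀ f : C^∞⟮I, X; 𝓘(ℝ, ℝ), ℝ⟯, ∃ g : Fin d → C^∞⟮I, X; 𝓘(ℝ, ℝ), ℝ⟯,
        ∀ᶠ y in 𝓝 x, f y = f x + ∑ i, (ξ i y - ξ i x) * g i y := by
  let φ := extChartAt I x
  let b := Module.finBasis ℝ E
  have hS : IsOpen φ.source := isOpen_extChartAt_source x
  have hxS : x ∈ φ.source := mem_extChartAt_source x
  have hT : IsOpen φ.target := isOpen_extChartAt_target x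
  have hφ : ContMDiffOn I 𝓘(ℝ, E) ∞ φ φ.source := by
    rw [extChartAt_source]; exact contMDiffOn_extChartAt
  have hglob : ∀ G : E → ℝ, ContDiffOn ℝ ∞ G φ.target →
      ∃ g : C^∞⟮I, X; 𝓘(ℝ, ℝ), ℝ⟯, g =ᶠ[𝓝 x] fun y => G (φ y) := fun G hG =>
    exists_smooth_germ_eq hS hxS
      (hG.contMDiffOn.comp hφ fun y hy => φ.map_source hy)
  have hD : ∀ (i) (f : C^∞⟮I, X; 𝓘(ℝ, ℝ), ℝ⟯),
      ContDiffOn ℝ ∞ (fun z => fderiv ℝ (f ∘ φ.symm) z (b i)) φ.target := fun i f =>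
    ((contDiffOn_comp_extChartAt_symm f.contMDiff x).fderiv_of_isOpen hT (by simp)).clm_apply
      contDiffOn_const
  choose p hp using fun i f => hglob _ (hD i f)
  choose ξ hξ using fun i => hglob (fun z => b.coord i z)
    (LinearMap.toContinuousLinearMap (b.coord i)).contDiff.contDiffOn
  refine ⟨_, ξ, fun i y => mfderiv 𝓘(ℝ, E) I φ.symm (φ y) (b i), p, fun i f => ?_, fun i j => ?_,
    fun f => ?_⟩
  · filter_upwards [hp i f, hS.mem_nhds hxS] with y hy hyS
    have := mfderiv_mfderiv_extChartAt_symm f.contMDiff x (φ.map_source hyS) (b i)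
    rw [φ.left_inv hyS] at this
    exact hy.trans this.symm
  · filter_upwards [(hξ j).eventually_nhds, hS.mem_nhds hxS] with y hy hyS
    have := mfderiv_mfderiv_extChartAt_symm (ξ j).contMDiff x (φ.map_source hyS) (b i)
    rw [φ.left_inv hyS] at this
    refine this.trans ?_
    have hc : ContinuousAt φ.symm (φ y) := continuousAt_extChartAt_symm'' (φ.map_source hyS)
    have he : (ξ j) ∘ φ.symm =ᶠ[𝓝 (φ y)] LinearMap.toContinuousLinearMap (b.coord j) := by
      rw [← φ.left_inv hyS] at hy
      filter_upwards [hc.eventually hy, hT.mem_nhds (φ.map_source hyS)] with z hz hzT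
      change ξ j (φ.symm z) = _
      rw [hz, φ.right_inv hzT]; rfl
    rw [show (ξ j) ∘ (extChartAt I x).symm = ξ j ∘ φ.symm from rfl, he.fderiv_eq,
      ContinuousLinearMap.fderiv]
    change b.coord j (b i) = _
    rw [Module.Basis.coord_apply, Module.Basis.repr_self, Finsupp.single_apply]
  · obtain ⟨F, hF⟩ := exists_smooth_germ_eq (I := 𝓘(ℝ, E)) hT (φ.map_source hxS)
      (contDiffOn_comp_extChartAt_symm f.contMDiff x).contMDiffOn
    obtain ⟨g, hg, hFg⟩ := exists_hadamard (contMDiff_iff_contDiff.1 F.contMDiff) (φ x)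
    choose g' hg' using fun i => hglob (fun z => g z (b i))
      (hg.clm_apply contDiff_const).contDiffOn
    refine ⟨g', ?_⟩
    have hc : ContinuousAt φ x := continuousAt_extChartAt x
    filter_upwards [hc.eventually hF, hS.mem_nhds hxS, eventually_all.2 hg', eventually_all.2 hξ]
      with y hy hyS hg' hξ'
    have e1 : F (φ y) = f y := by rw [hy]; exact congrArg f (φ.left_inv hyS)
    have e2 : F (φ x) = f x := by rw [hF.self_of_nhds]; exact congrArg f (φ.left_inv hxS)
    rw [← e1, ← e2, hFg (φ y)]
    congr 1
    conv_lhs => rw [← b.sum_repr (φ y - φ x)]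
    rw [map_sum]
    refine Finset.sum_congr rfl fun i _ => ?_
    rw [map_smul, hg' i, hξ' i, (hξ i).self_of_nhds, ← map_sub]
    rfl

/-! #### The chain rule -/

/-- The difference `T` of the two sides is a derivation along `h` that kills constants and the
coordinates `ξ`. Hadamard's lemma then gives `T f = ∑ h(ξ i - ξ i x) T(g i)` with nilpotent first
factors. Each iteration gains one step in `filt`, so `T f` lies in all of them and is zero. -/
theorem LiesOver.chain_rule {h : C^∞⟮I, X; 𝓘(ℝ, ℝ), ℝ⟯ →ₐ[ℝ] Gr κ} {x : X} (hx : LiesOver h x)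
    (he : ∀ f, IsEven (h f)) {d : ℕ} {ξ : Fin d → C^∞⟮I, X; 𝓘(ℝ, ℝ), ℝ⟯}
    {v : Fin d → ∀ y : X, TangentSpace I y}
    {p : Fin d → C^∞⟮I, X; 𝓘(ℝ, ℝ), ℝ⟯ → C^∞⟮I, X; 𝓘(ℝ, ℝ), ℝ⟯}
    (hp : ∀ i f, ∀ᶠ y in 𝓝 x, p i f y = mvfderiv I f y (v i y))
    (hξ : ∀ i j, ∀ᶠ y in 𝓝 x,
      mvfderiv I (ξ j) y (v i y) = if i = j then 1 else 0)
    (hH : ∀ f : C^∞⟮I, X; 𝓘(ℝ, ℝ), ℝ⟯, ∃ g : Fin d → C^∞⟮I, X; 𝓘(ℝ, ℝ), ℝ⟯,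
        ∀ᶠ y in 𝓝 x, f y = f x + ∑ i, (ξ i y - ξ i x) * g i y)
    (k : κ) (f : C^∞⟮I, X; 𝓘(ℝ, ℝ), ℝ⟯) :
    der k (h f) = ∑ i, h (p i f) * der k (h (ξ i)) := by
  have hmd : ∀ (f : C^∞⟮I, X; 𝓘(ℝ, ℝ), ℝ⟯) y, MDifferentiableAt I 𝓘(ℝ, ℝ) f y := fun f y =>
    f.contMDiff.mdifferentiable (by simp) y
  let T : C^∞⟮I, X; 𝓘(ℝ, ℝ), ℝ⟯ → Gr κ := fun f =>
    der k (h f) - ∑ i, h (p i f) * der k (h (ξ i))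
  have hT0 : ∀ {f g : C^∞⟮I, X; 𝓘(ℝ, ℝ), ℝ⟯}, f =ᶠ[𝓝 x] g → T f = T g := by
    intro f g hfg
    have : ∀ i, h (p i f) = h (p i g) := by
      intro i
      refine hx.map_congr ?_
      filter_upwards [hp i f, hp i g, hfg.eventually_nhds] with y h1 h2 h3
      rw [h1, h2]
      exact congrArg (fun L : TangentSpace I y →L[ℝ] ℝ => L (v i y))
        (Filter.EventuallyEq.mfderiv_eq h3)
    simp only [T, this, hx.map_congr hfg]
  have hTmul : ∀ f g, T (f * g) = T f * h g + h f * T g := by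
    intro f g
    have : ∀ i, h (p i (f * g)) = h f * h (p i g) + h g * h (p i f) := by
      intro i
      rw [← map_mul, ← map_mul, ← map_add]
      refine hx.map_congr ?_
      filter_upwards [hp i f, hp i g, hp i (f * g)] with y h1 h2 h3
      rw [h3]
      change mvfderiv I (⇑f * ⇑g) y (v i y) = f y * p i g y + g y * p i f y
      rw [mvfderiv_mul (hmd f y) (hmd g y), h1, h2]
      rfl
    simp only [T, map_mul, (he f).der_mul, this, add_mul, Finset.sum_add_distrib, mul_sub, sub_mul,
      Finset.mul_sum, Finset.sum_mul]
    have e : ∀ i, h g * h (p i f) * der k (h (ξ i)) = h (p i f) * der k (h (ξ i)) * h g := by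
      intro i
      rw [mul_assoc, (he g).commute]
    simp only [e, mul_assoc]
    abel
  have hTadd : ∀ f g, T (f + g) = T f + T g := by
    intro f g
    have : ∀ i, h (p i (f + g)) = h (p i f) + h (p i g) := by
      intro i
      rw [← map_add]
      refine hx.map_congr ?_
      filter_upwards [hp i f, hp i g, hp i (f + g)] with y h1 h2 h3
      rw [h3]
      change mvfderiv I (⇑f + ⇑g) y (v i y) = p i f y + p i g y
      rw [mvfderiv_add (hmd f y) (hmd g y), h1, h2]
      rfl
    simp only [T, map_add, this, add_mul, Finset.sum_add_distrib]
    abel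
  have hTc : ∀ c : ℝ, T (algebraMap ℝ _ c) = 0 := by
    intro c
    have : ∀ i, h (p i (algebraMap ℝ _ c)) = 0 := by
      intro i
      refine hx.map_eq_zero ?_
      filter_upwards [hp i (algebraMap ℝ _ c)] with y h1
      rw [h1]
      exact congrArg (fun L : TangentSpace I y →L[ℝ] ℝ => L (v i y)) (mvfderiv_const c)
    simp only [T, this, zero_mul, Finset.sum_const_zero, sub_zero, AlgHom.commutes]
    exact der_algebraMap k (c : ℂ)
  have hTξ : ∀ j, T (ξ j) = 0 := by
    intro j
    have : ∀ i, h (p i (ξ j)) = if i = j then 1 else 0 := by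
      intro i
      have : h (p i (ξ j)) = h (if i = j then 1 else 0) := by
        refine hx.map_congr ?_
        filter_upwards [hp i (ξ j), hξ i j] with y h1 h2
        rw [h1, h2]
        split_ifs <;> rfl
      rw [this]; split_ifs <;> simp
    simp [T, this]
  have hT : ∀ (N : ℕ) f, T f ∈ filt κ N := by
    intro N
    induction N with
    | zero => intro f; simp [filt_zero]
    | succ N ih =>
      intro f
      obtain ⟨g, hg⟩ := hH f
      have e : T f = T (algebraMap ℝ _ (f x) + ∑ i, (ξ i - algebraMap ℝ _ (ξ i x)) * g i) := by
        refine hT0 ?_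
        filter_upwards [hg] with y hy
        rw [hy, ← evalAt_apply (I := I) y (_ + _)]
        simp only [map_add, map_sum, map_mul, map_sub, AlgHom.commutes]
        rfl
      let T' : C^∞⟮I, X; 𝓘(ℝ, ℝ), ℝ⟯ →+ Gr κ := AddMonoidHom.mk' T hTadd
      have e2 : ∀ i, T ((ξ i - algebraMap ℝ _ (ξ i x)) * g i)
          = h (ξ i - algebraMap ℝ _ (ξ i x)) * T (g i) := by
        intro i
        have : T (ξ i - algebraMap ℝ _ (ξ i x)) = 0 := by
          change T' _ = 0
          rw [map_sub]
          change T _ - T _ = 0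
          rw [hTξ, hTc, sub_zero]
        rw [hTmul, this, zero_mul, zero_add]
      rw [e]
      change T' _ ∈ _
      rw [map_add, map_sum]
      change T _ + ∑ i, T _ ∈ _
      rw [hTc, zero_add]
      refine Submodule.sum_mem _ fun i _ => ?_
      rw [e2, add_comm N 1]
      refine filt_mul (mem_filt_one ?_) (ih _)
      rw [hx, ← evalAt_apply (I := I)]
      simp only [map_sub, AlgHom.commutes]
      exact_mod_cast sub_self (ξ i x)
  have := hT (Nat.card κ + 1) f
  rw [filt_eq_bot (Nat.lt_succ_self _), Submodule.mem_bot] at this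
  exact sub_eq_zero.1 this

end SmoothHom

/-! ### Formal forms on a manifold -/

section FormalFormManifold

set_option linter.unusedSectionVars false

open Filter Topology

/-- A finite formal sum `∑ⱼ cⱼ fⱼ dgⱼ₁ ∧ ⋯ ∧ dgⱼₖ` over a commutative ring. -/
structure FormalForm (R : Type*) (k : ℕ) where
  N : ℕ
  c : Fin N → ℂ
  f : Fin N → R
  g : Fin N → Fin k → R

/-- The function `∑ⱼ cⱼ h(fⱼ) D(h(gⱼ₁)) ⋯ D(h(gⱼₖ))`. -/
def FormalForm.contract {R : Type*} {k : ℕ} (P : FormalForm R k) {κ : Type}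
    (h : R → Gr (Option κ)) : Gr (Option κ) :=
  ∑ j, P.c j • (h (P.f j) * (List.ofFn fun a => D (h (P.g j a))).prod)

/-- The image of a formal form under a map of rings. -/
def FormalForm.map {R R' : Type*} {k : ℕ} (P : FormalForm R k) (r : R → R') : FormalForm R' k :=
  ⟨P.N, P.c, fun j => r (P.f j), fun j a => r (P.g j a)⟩

/-- The differential. -/
def FormalForm.d {R : Type*} [One R] {k : ℕ} (P : FormalForm R k) : FormalForm R (k + 1) :=
  ⟨P.N, P.c, fun _ => 1, fun j => Fin.cons (P.f j) (P.g j)⟩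

/-- The difference of two forms. -/
def FormalForm.sub {R : Type*} {k : ℕ} (P Q : FormalForm R k) : FormalForm R k :=
  ⟨P.N + Q.N, Fin.append P.c (-Q.c), Fin.append P.f Q.f, Fin.append P.g Q.g⟩

theorem FormalForm.contract_sub {R : Type*} {k : ℕ} (P Q : FormalForm R k) {κ : Type}
    (h : R → Gr (Option κ)) : (P.sub Q).contract h = P.contract h - Q.contract h := by
  refine (Fin.sum_univ_add (a := P.N) (b := Q.N) _).trans ?_
  simp [FormalForm.contract, FormalForm.sub, sub_eq_add_neg]

theorem D_prod_ofFn_D {κ : Type} {k : ℕ} (z : Fin k → Gr (Option κ)) :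
    D (List.ofFn fun a => D (z a)).prod = 0 := by
  induction k with
  | zero => rw [List.ofFn_zero, List.prod_nil]; exact der_one none
  | succ k ih =>
    rw [List.ofFn_succ, List.prod_cons]
    refine (der_mul none _ _).trans ?_
    rw [show der none (D (z 0)) = 0 from der_der _ _,
      show der none (List.ofFn fun a : Fin k => D (z a.succ)).prod = 0 from ih _]
    simp

theorem FormalForm.contract_d {R : Type*} [CommRing R] [Algebra ℝ R] {k : ℕ} (P : FormalForm R k)
    {κ : Type} (h : R →ₐ[ℝ] Gr (Option κ)) : P.d.contract h = D (P.contract h) := by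
  simp only [FormalForm.contract, map_sum, map_smul, FormalForm.d]
  refine Finset.sum_congr rfl fun j _ => ?_
  congr 1
  rw [List.ofFn_succ, map_one, one_mul, List.prod_cons]
  simp only [Fin.cons_zero, Fin.cons_succ]
  symm
  refine (der_mul none _ _).trans ?_
  rw [show der none (List.ofFn fun a : Fin k => D (h (P.g j a))).prod = 0 from D_prod_ofFn_D _]
  simp [D]

universe u

variable {E : Type u} [NormedAddCommGroup E] [NormedSpace ℝ E] [FiniteDimensional ℝ E]
  {H : Type*} [TopologicalSpace H] {I : ModelWithCorners ℝ E H}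
  {X : Type*} [TopologicalSpace X] [ChartedSpace H X] {k : ℕ}

/-- The value of a formal form on tangent vectors. -/
def FormalForm.eval (P : FormalForm C^∞⟮I, X; 𝓘(ℝ, ℝ), ℝ⟯ k) (x : X)
    (u : Fin k → TangentSpace I x) : ℂ :=
  ∑ j, P.c j * (P.f j x : ℂ) *
    ((Matrix.of fun a b : Fin k => mvfderiv I (P.g j a) x (u b)).det : ℂ)

theorem FormalForm.eval_sub (P Q : FormalForm C^∞⟮I, X; 𝓘(ℝ, ℝ), ℝ⟯ k) (x : X)
    (u : Fin k → TangentSpace I x) : (P.sub Q).eval x u = P.eval x u - Q.eval x u := by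
  refine (Fin.sum_univ_add (a := P.N) (b := Q.N) _).trans ?_
  simp [FormalForm.eval, FormalForm.sub, sub_eq_add_neg]

/-! #### The point given by tangent vectors -/

/-- The homomorphism `f ↦ f(x) + θ ∑ⱼ ηⱼ df(uⱼ)`. -/
def tangentPoint (x : X) (u : Fin k → TangentSpace I x) :
    C^∞⟮I, X; 𝓘(ℝ, ℝ), ℝ⟯ →ₐ[ℝ] Gr (Option (Fin k)) :=
  AlgHom.ofLinearMap
    { toFun := fun f => algebraMap ℂ _ (f x : ℂ)
        + gen none * ∑ j, (mvfderiv I f x (u j) : ℂ) • gen (some j)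
      map_add' := fun f g => by
        have hf := f.contMDiff.mdifferentiable (by simp) x
        have hg := g.contMDiff.mdifferentiable (by simp) x
        have : mvfderiv I (⇑(f + g)) x = mvfderiv I f x + mvfderiv I g x := mvfderiv_add hf hg
        rw [this]
        simp only [ContMDiffMap.coe_add, Pi.add_apply, Complex.ofReal_add, map_add,
          add_apply, add_smul, Finset.sum_add_distrib, mul_add]
        abel
      map_smul' := fun c f => by
        have hf := f.contMDiff.mdifferentiable (by simp) x
        have : mvfderiv I (⇑(c • f)) x = c • mvfderiv I f x := by
          have := mvfderiv_smul (I := I) (a := fun _ : X => c) mdifferentiableAt_const hf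
          rw [mvfderiv_const] at this
          ext v
          exact (congrArg (fun L : TangentSpace I x →L[ℝ] ℝ => L v) this).trans (by simp)
        rw [this]
        change _ = (c : ℂ) • (algebraMap ℂ (Gr (Option (Fin k))) (f x : ℂ)
          + gen none * ∑ j, (mvfderiv I f x (u j) : ℂ) • gen (some j))
        rw [smul_add, ← mul_smul_comm, Finset.smul_sum,
          show (c • f) x = c * f x from rfl, Complex.ofReal_mul, map_mul, ← Algebra.smul_def]
        congr 2
        refine Finset.sum_congr rfl fun j _ => ?_
        rw [smul_smul, ← Complex.ofReal_mul]
        rfl }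
    (by
      have : mvfderiv I (1 : X → ℝ) x = 0 := mvfderiv_const (1 : ℝ)
      simp [this])
    (fun f g => by
      have hf := f.contMDiff.mdifferentiable (by simp) x
      have hg := g.contMDiff.mdifferentiable (by simp) x
      have : mvfderiv I (⇑(f * g)) x = f x • mvfderiv I g x + g x • mvfderiv I f x :=
        mvfderiv_mul hf hg
      simp only [LinearMap.coe_mk, AddHom.coe_mk, this]
      have e : ∀ (a b : ℂ) (y z : Gr (Option (Fin k))), IsOdd y → IsOdd z →
          (algebraMap ℂ _ a + gen none * y) * (algebraMap ℂ _ b + gen none * z)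
            = algebraMap ℂ _ (a * b) + gen none * (a • z + b • y) := by
        intro a b y z hy hz
        have h0 : gen none * y * (gen none * z) = 0 := by
          rw [← mul_assoc, mul_assoc (gen none) y, hy.mul_odd (isOdd_gen none), mul_neg, ← mul_assoc,
            gen_mul_gen_self]
          simp
        rw [add_mul, mul_add, mul_add, h0, add_zero, map_mul, mul_add, mul_smul_comm, mul_smul_comm,
          Algebra.smul_def, Algebra.smul_def, ← Algebra.commutes b (gen none * y)]
        abel
      rw [e _ _ _ _ (IsOdd.sum fun j _ => (isOdd_gen _).smul _)
        (IsOdd.sum fun j _ => (isOdd_gen _).smul _)]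
      simp only [ContMDiffMap.coe_mul, Pi.mul_apply, Complex.ofReal_mul, Finset.smul_sum, smul_smul,
        add_apply, smul_apply, smul_eq_mul,
        Complex.ofReal_add, add_smul, Finset.sum_add_distrib])

theorem tangentPoint_apply (x : X) (u : Fin k → TangentSpace I x) (f : C^∞⟮I, X; 𝓘(ℝ, ℝ), ℝ⟯) :
    tangentPoint x u f = algebraMap ℂ _ (f x : ℂ)
        + gen none * ∑ j, (mvfderiv I f x (u j) : ℂ) • gen (some j) := rfl

theorem isEven_tangentPoint (x : X) (u : Fin k → TangentSpace I x)
    (f : C^∞⟮I, X; 𝓘(ℝ, ℝ), ℝ⟯) : IsEven (tangentPoint x u f) :=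
  (isEven_algebraMap _).add ((isOdd_gen _).mul
    (IsOdd.sum fun _ _ => (isOdd_gen _).smul _))

theorem liesOver_tangentPoint (x : X) (u : Fin k → TangentSpace I x) :
    LiesOver (tangentPoint x u) x := by
  intro f
  rw [tangentPoint_apply, map_add, map_mul, body_gen, zero_mul, add_zero, AlgHom.commutes]
  rfl

theorem D_tangentPoint (x : X) (u : Fin k → TangentSpace I x) (f : C^∞⟮I, X; 𝓘(ℝ, ℝ), ℝ⟯) :
    D (tangentPoint x u f) = ∑ j, (mvfderiv I f x (u j) : ℂ) • gen (some j) := by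
  have h0 : der none (∑ j, (mvfderiv I f x (u j) : ℂ) • gen (some j) : Gr (Option (Fin k))) = 0 := by
    rw [map_sum]
    refine Finset.sum_eq_zero fun j _ => ?_
    rw [map_smul, der_gen_of_ne (by simp), smul_zero]
  unfold D
  rw [tangentPoint_apply, map_add, der_algebraMap, zero_add, der_mul, der_gen_self, h0]
  simp

theorem atZero_tangentPoint (x : X) (u : Fin k → TangentSpace I x)
    (f : C^∞⟮I, X; 𝓘(ℝ, ℝ), ℝ⟯) : atZero (tangentPoint x u f) = algebraMap ℂ _ (f x : ℂ) := by
  rw [tangentPoint_apply, map_add, map_mul, AlgHom.commutes]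
  have : atZero (gen none : Gr (Option (Fin k))) = 0 := keep_gen_of_notMem _ _ (by simp)
  rw [this, zero_mul, add_zero]

/-- The product of the linear expressions `∑ⱼ dg(uⱼ) ηⱼ` is the determinant of their coefficients
times `η₁ ⋯ ηₖ`. -/
theorem FormalForm.atZero_contract_tangentPoint (P : FormalForm C^∞⟮I, X; 𝓘(ℝ, ℝ), ℝ⟯ k) (x : X)
    (u : Fin k → TangentSpace I x) : atZero (P.contract (tangentPoint x u))
      = P.eval x u • (List.ofFn fun a : Fin k => gen a).prod := by
  simp only [FormalForm.contract, map_sum, map_smul, map_mul, atZero_tangentPoint,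
    FormalForm.eval, Finset.sum_smul, D_tangentPoint]
  refine Finset.sum_congr rfl fun j _ => ?_
  have := prod_linearCombination_gen (κ := Option (Fin k)) (fun b => some b)
    (Matrix.of fun a b : Fin k => (mvfderiv I (P.g j a) x (u b) : ℂ))
  simp only [Matrix.of_apply] at this
  rw [this, map_smul, map_list_prod, List.map_ofFn, ← Algebra.smul_def, smul_smul, smul_smul]
  have e : (⇑(atZero : Gr (Option (Fin k)) →ₐ[ℂ] Gr (Fin k)) ∘ fun a => gen (some a)) = gen := by
    funext a
    exact keep_gen _ _ a
  rw [e]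
  congr 2
  have := RingHom.map_det Complex.ofRealHom
    (Matrix.of fun a b : Fin k => mvfderiv I (P.g j a) x (u b))
  exact this.symm

/-- The value on `u₁, …, uₖ` is the top coefficient of a contraction at one particular point.
Identities between contractions thereby become identities between differential forms. -/
theorem FormalForm.eval_eq_body_berezin (P : FormalForm C^∞⟮I, X; 𝓘(ℝ, ℝ), ℝ⟯ k) (x : X)
    (u : Fin k → TangentSpace I x) :
    P.eval x u = body (berezin (List.finRange k) (atZero (P.contract (tangentPoint x u)))) := by
  rw [P.atZero_contract_tangentPoint, map_smul, List.ofFn_eq_map,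
    berezin_prod_gen (List.nodup_finRange k)]
  simp

/-! #### Dependence on the values only -/

theorem prod_ofFn_sum {A : Type*} [Ring A] [Algebra ℂ A] {d : ℕ} (m : Fin k → Fin d → A) :
    (List.ofFn fun a => ∑ i, m a i).prod = ∑ e : Fin k → Fin d, (List.ofFn fun a => m a (e a)).prod := by
  have := (MultilinearMap.mkPiAlgebraFin ℂ k A).map_sum m
  simpa [MultilinearMap.mkPiAlgebraFin_apply] using this

theorem prod_ofFn_mul_of_commute {A : Type*} [Ring A] (s t : Fin k → A)
    (hs : ∀ a y, s a * y = y * s a) :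
    (List.ofFn fun a => s a * t a).prod = (List.ofFn s).prod * (List.ofFn t).prod := by
  induction k with
  | zero => simp
  | succ k ih =>
    rw [List.ofFn_succ, List.ofFn_succ, List.ofFn_succ, List.prod_cons, List.prod_cons,
      List.prod_cons, ih _ _ fun a y => hs a.succ y]
    have : t 0 * (List.ofFn fun i : Fin k => s i.succ).prod
        = (List.ofFn fun i : Fin k => s i.succ).prod * t 0 := by
      refine (Commute.list_prod_right _ _ ?_).eq
      intro y hy
      obtain ⟨i, rfl⟩ := (List.mem_ofFn' _ _).1 hy
      exact (hs i.succ (t 0)).symm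
    simp only [mul_assoc]
    rw [← mul_assoc (t 0), this, mul_assoc]

theorem prod_ofFn_odd_perm {κ : Type} {d : ℕ} {δ : Fin d → Gr κ} (hδ : ∀ i, IsOdd (δ i))
    (e : Fin k → Fin d) (σ : Equiv.Perm (Fin k)) :
    (List.ofFn fun a => δ (e (σ a))).prod
      = ((Equiv.Perm.sign σ : ℤ) : ℂ) • (List.ofFn fun a => δ (e a)).prod := by
  classical
  let L : (Fin d → ℂ) →ₗ[ℂ] Gr κ := ∑ i, (LinearMap.proj i : (Fin d → ℂ) →ₗ[ℂ] ℂ).smulRight (δ i)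
  have hL : ∀ w, L w = ∑ i, w i • δ i := fun w => by simp [L]
  let Λ := ExteriorAlgebra.lift ℂ ⟨L, fun w => by
    rw [hL]; exact (IsOdd.sum fun i _ => (hδ i).smul _).mul_self⟩
  have hΛ : ∀ e : Fin k → Fin d,
      Λ.toLinearMap.compAlternatingMap (ExteriorAlgebra.ιMulti ℂ k) (fun a => Pi.single (e a) 1)
        = (List.ofFn fun a => δ (e a)).prod := by
    intro e
    rw [LinearMap.compAlternatingMap_apply, ExteriorAlgebra.ιMulti_apply, AlgHom.toLinearMap_apply,
      map_list_prod, List.map_ofFn]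
    congr 2
    funext a
    simp only [Function.comp_apply, Λ, ExteriorAlgebra.lift_ι_apply, hL]
    rw [Finset.sum_eq_single (e a)] <;> simp +contextual
  have := (Λ.toLinearMap.compAlternatingMap (ExteriorAlgebra.ιMulti ℂ k)).map_perm
    (fun a => Pi.single (e a) (1 : ℂ)) σ
  rw [← hΛ e, ← hΛ fun a => e (σ a)]
  refine this.trans ?_
  rw [Units.smul_def, ← Int.cast_smul_eq_zsmul ℂ]

variable [I.Boundaryless] [IsManifold I ∞ X] [T2Space X] {κ : Type} [Finite κ]

/-- By the chain rule the contraction is `∑ K e * Pr e`, where `Pr e` is a product of the odd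
elements `∂(h ξ_i)` and `K e` is `h` applied to a coefficient function. Vanishing of the form near
`x` says that the antisymmetrised coefficient functions vanish near `x`, hence so do the
antisymmetrised `K e`; and the products `Pr e` are antisymmetric. -/
theorem FormalForm.contract_eq_zero {h : C^∞⟮I, X; 𝓘(ℝ, ℝ), ℝ⟯ →ₐ[ℝ] Gr (Option κ)} {x : X}
    (hx : LiesOver h x) (he : ∀ f, IsEven (h f)) (P : FormalForm C^∞⟮I, X; 𝓘(ℝ, ℝ), ℝ⟯ k)
    (hP : ∀ᶠ y in 𝓝 x, ∀ u, P.eval y u = 0) : P.contract h = 0 := by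
  obtain ⟨d, ξ, v, p, hp, hξ, hH⟩ := exists_coordinates (I := I) x
  have hchain := fun f => hx.chain_rule he hp hξ hH none f
  let Pr : (Fin k → Fin d) → Gr (Option κ) := fun e => (List.ofFn fun a => der none (h (ξ (e a)))).prod
  let m : Fin P.N → (Fin k → Fin d) → C^∞⟮I, X; 𝓘(ℝ, ℝ), ℝ⟯ := fun j e =>
    P.f j * ∏ a, p (e a) (P.g j a)
  -- `h` acts on real functions only, so the complex coefficients are split into real and imaginary
  -- parts.
  let Gre : (Fin k → Fin d) → C^∞⟮I, X; 𝓘(ℝ, ℝ), ℝ⟯ := fun e => ∑ j, (P.c j).re • m j e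
  let Gim : (Fin k → Fin d) → C^∞⟮I, X; 𝓘(ℝ, ℝ), ℝ⟯ := fun e => ∑ j, (P.c j).im • m j e
  let K : (Fin k → Fin d) → Gr (Option κ) := fun e => h (Gre e) + Complex.I • h (Gim e)
  have hs : ∀ (c : ℝ) (g : C^∞⟮I, X; 𝓘(ℝ, ℝ), ℝ⟯), h (c • g) = (c : ℂ) • h g := by
    intro c g
    rw [map_smul]; rfl
  have hK : ∀ e, K e = ∑ j, P.c j • h (m j e) := by
    intro e
    simp only [K, Gre, Gim, map_sum, hs, Finset.smul_sum, smul_smul, ← Finset.sum_add_distrib,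
      ← add_smul]
    refine Finset.sum_congr rfl fun j _ => ?_
    congr 1
    rw [mul_comm Complex.I]
    exact Complex.re_add_im _
  have hc : P.contract h = ∑ e, K e * Pr e := by
    simp only [FormalForm.contract, hK, Finset.sum_mul]
    rw [Finset.sum_comm]
    refine Finset.sum_congr rfl fun j _ => ?_
    have hDg : (fun a => D (h (P.g j a)))
        = fun a => ∑ i, h (p i (P.g j a)) * der none (h (ξ i)) := funext fun a => hchain _
    rw [hDg, prod_ofFn_sum, Finset.mul_sum, Finset.smul_sum]
    refine Finset.sum_congr rfl fun e _ => ?_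
    rw [prod_ofFn_mul_of_commute _ _ fun a y => (he _).commute y, ← mul_assoc, smul_mul_assoc]
    congr 3
    simp only [m, map_mul]
    congr 1
    have := map_list_prod h (List.ofFn fun a => p (e a) (P.g j a))
    rw [List.prod_ofFn, List.map_ofFn] at this
    exact this.symm
  have hpe : ∀ᶠ y in 𝓝 x, ∀ i j a, p i (P.g j a) y = mvfderiv I (P.g j a) y (v i y) :=
    eventually_all.2 fun i => eventually_all.2 fun j => eventually_all.2 fun a => hp i _
  -- The hypothesis is evaluated on the coordinate fields `v (e b)`, and the determinant is expanded
  -- over permutations.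
  have hm : ∀ (e : Fin k → Fin d), ∀ᶠ y in 𝓝 x, ∑ σ : Equiv.Perm (Fin k),
      ((Equiv.Perm.sign σ : ℤ) : ℂ) * ∑ j, P.c j * (m j (e ∘ σ) y : ℂ) = 0 := by
    intro e
    filter_upwards [hP, hpe] with y hy hpy
    rw [← hy fun b => v (e b) y, FormalForm.eval]
    simp only [Finset.mul_sum]
    rw [Finset.sum_comm]
    refine Finset.sum_congr rfl fun j _ => ?_
    rw [← Matrix.det_transpose, Matrix.det_apply']
    push_cast
    rw [Finset.mul_sum]
    refine Finset.sum_congr rfl fun σ _ => ?_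
    have : m j (e ∘ σ) y = P.f j y * ∏ a, mvfderiv I (P.g j a) y (v (e (σ a)) y) := by
      rw [← evalAt_apply (I := I) y (m j (e ∘ σ))]
      simp only [m, map_mul, map_prod, evalAt_apply, hpy, Function.comp_apply]
    rw [this]
    simp only [Matrix.transpose_apply, Matrix.of_apply]
    push_cast
    ring
  have hGre : ∀ (e : Fin k → Fin d) (y : X),
      (∑ σ : Equiv.Perm (Fin k), ((Equiv.Perm.sign σ : ℤ) : ℝ) • Gre (e ∘ σ)) y
        = (∑ σ : Equiv.Perm (Fin k),
          ((Equiv.Perm.sign σ : ℤ) : ℂ) * ∑ j, P.c j * (m j (e ∘ σ) y : ℂ)).re := by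
    intro e y
    refine (evalAt_apply (I := I) y _).symm.trans ?_
    simp only [map_sum, map_smul, Gre, evalAt_apply, Complex.re_sum, smul_eq_mul]
    refine Finset.sum_congr rfl fun σ _ => ?_
    rw [← Complex.ofReal_intCast, Complex.re_ofReal_mul, Complex.re_sum]
    simp
  have hGim : ∀ (e : Fin k → Fin d) (y : X),
      (∑ σ : Equiv.Perm (Fin k), ((Equiv.Perm.sign σ : ℤ) : ℝ) • Gim (e ∘ σ)) y
        = (∑ σ : Equiv.Perm (Fin k),
          ((Equiv.Perm.sign σ : ℤ) : ℂ) * ∑ j, P.c j * (m j (e ∘ σ) y : ℂ)).im := by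
    intro e y
    refine (evalAt_apply (I := I) y _).symm.trans ?_
    simp only [map_sum, map_smul, Gim, evalAt_apply, Complex.im_sum, smul_eq_mul]
    refine Finset.sum_congr rfl fun σ _ => ?_
    rw [← Complex.ofReal_intCast, Complex.im_ofReal_mul, Complex.im_sum]
    simp
  have hKsum : ∀ e, ∑ σ : Equiv.Perm (Fin k), ((Equiv.Perm.sign σ : ℤ) : ℂ) • K (e ∘ σ) = 0 := by
    intro e
    have h1 := hx.map_eq_zero
      (f := ∑ σ : Equiv.Perm (Fin k), ((Equiv.Perm.sign σ : ℤ) : ℝ) • Gre (e ∘ σ))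
      (by filter_upwards [hm e] with y hy; rw [hGre, hy]; rfl)
    have h2 := hx.map_eq_zero
      (f := ∑ σ : Equiv.Perm (Fin k), ((Equiv.Perm.sign σ : ℤ) : ℝ) • Gim (e ∘ σ))
      (by filter_upwards [hm e] with y hy; rw [hGim, hy]; rfl)
    simp only [map_sum, hs] at h1 h2
    simp only [K, smul_add, Finset.sum_add_distrib]
    simp only [smul_comm _ Complex.I, ← Finset.smul_sum]
    push_cast at h1 h2
    rw [h1, h2]; simp
  -- Summing over all reindexings by permutations counts the contraction `k!` times and moves the
  -- antisymmetrisation from the products to the coefficients, where it gives zero.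
  have hfact : ((Fintype.card (Equiv.Perm (Fin k)) : ℂ)) • P.contract h = 0 := by
    have e1 : ∀ σ : Equiv.Perm (Fin k), P.contract h
        = ∑ e, (((Equiv.Perm.sign σ : ℤ) : ℂ) • K (e ∘ σ)) * Pr e := by
      intro σ
      rw [hc, ← Equiv.sum_comp (σ.arrowCongr (Equiv.refl (Fin d))).symm]
      refine Finset.sum_congr rfl fun e _ => ?_
      have := prod_ofFn_odd_perm (fun i => (he (ξ i)).der none) e σ
      change K (e ∘ σ) * Pr (e ∘ σ) = _
      rw [show Pr (e ∘ σ) = _ from this, mul_smul_comm, smul_mul_assoc]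
    have e2 : ((Fintype.card (Equiv.Perm (Fin k)) : ℂ)) • P.contract h
        = ∑ _σ : Equiv.Perm (Fin k), P.contract h := by
      rw [Finset.sum_const, Finset.card_univ, ← Nat.cast_smul_eq_nsmul ℂ]
    rw [e2, Finset.sum_congr rfl fun σ _ => e1 σ, Finset.sum_comm]
    refine Finset.sum_eq_zero fun e _ => ?_
    rw [← Finset.sum_mul, hKsum, zero_mul]
  rcases smul_eq_zero.1 hfact with h0 | h0
  · exact absurd h0 (by exact_mod_cast Fintype.card_ne_zero)
  · exact h0

end FormalFormManifold

/-! ### Gaussian integrals -/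

section Gaussian

set_option linter.unusedSectionVars false

open Filter Topology ProbabilityTheory

theorem iteratedDeriv_ofReal_comp {f : ℝ → ℝ} (hf : ContDiff ℝ ∞ f) (k : ℕ) :
    iteratedDeriv k (fun s => (f s : ℂ)) = fun s => ((iteratedDeriv k f s : ℝ) : ℂ) := by
  induction k with
  | zero => simp
  | succ k ih =>
    rw [iteratedDeriv_succ, ih]
    funext s
    have h1 : DifferentiableAt ℝ (iteratedDeriv k f) s :=
      hf.differentiable_iteratedDeriv k (by exact_mod_cast WithTop.coe_lt_top _) s
    rw [h1.hasDerivAt.ofReal_comp.deriv, iteratedDeriv_succ]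

/-- The Gaussian function. -/
def gaussFun (s : ℝ) : ℝ := Real.exp (-(1 / 2) * (s * s))

theorem contDiff_gaussFun : ContDiff ℝ ∞ gaussFun := by
  unfold gaussFun; fun_prop

/-- The integrand of the moments of the oscillating Gaussian. -/
def momentFun (β : ℝ) (k : ℕ) (t : ℝ) : ℂ :=
  (Complex.I * t) ^ k * Complex.exp (-(1 / 2) * t ^ 2 + Complex.I * t * β)

theorem integrable_momentFun (β : ℝ) (k : ℕ) : Integrable (momentFun β k) := by
  have h1 : Integrable fun t : ℝ => t ^ k * Real.exp (-(1 / 2) * t ^ 2) := by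
    have := integrable_rpow_mul_exp_neg_mul_sq (b := 1 / 2) (by norm_num) (s := k)
      (by have : (0 : ℝ) ≤ k := Nat.cast_nonneg k
          linarith)
    simpa [Real.rpow_natCast] using this
  refine h1.norm.mono' ?_ ?_
  · have : Continuous (momentFun β k) := by unfold momentFun; fun_prop
    exact this.aestronglyMeasurable
  · refine Eventually.of_forall fun t => ?_
    simp only [momentFun, norm_mul, norm_pow, Complex.norm_I, one_mul, Complex.norm_real,
      Complex.norm_exp, Real.norm_eq_abs, Real.abs_exp]
    simp [← Complex.ofReal_pow]

/-- The Gaussian is the characteristic function of the standard normal distribution; its `k`-th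
derivative at `β` carries the factor `(it)ᵏ` under the integral. -/
theorem integral_momentFun (β : ℝ) (k : ℕ) :
    ∫ t, momentFun β k t = (Real.sqrt (2 * Real.pi) : ℂ) * ((iteratedDeriv k gaussFun β : ℝ) : ℂ) := by
  have h0 : charFun (gaussianReal 0 1) = fun s => (gaussFun s : ℂ) := by
    funext s
    rw [charFun_gaussianReal, gaussFun]
    push_cast
    congr 1
    simp
    ring
  have h1 := iteratedDeriv_charFun (μ := gaussianReal 0 1) (n := k) (t := β)
    (by exact_mod_cast memLp_id_gaussianReal (μ := 0) (v := 1) k)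
  rw [h0, iteratedDeriv_ofReal_comp contDiff_gaussFun] at h1
  beta_reduce at h1
  rw [h1, integral_gaussianReal_eq_integral_smul one_ne_zero, ← mul_assoc, ← integral_const_mul]
  refine integral_congr_ae (Eventually.of_forall fun t => ?_)
  simp only [momentFun, gaussianPDFReal, mul_pow, Complex.exp_add]
  have h2 : (Real.sqrt (2 * Real.pi) : ℂ) ≠ 0 := by
    exact_mod_cast (Real.sqrt_pos.2 (by positivity)).ne'
  simp only [NNReal.coe_one, mul_one, sub_zero, Complex.real_smul]
  push_cast
  have e1 : Complex.exp (-(t : ℂ) ^ 2 / 2) = Complex.exp (-(1 / 2) * t ^ 2) := by ring_nf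
  have e2 : Complex.exp (Complex.I * t * β) = Complex.exp (β * t * Complex.I) := by ring_nf
  rw [e1, e2]
  field_simp

universe u

variable {E : Type u} [NormedAddCommGroup E] [NormedSpace ℝ E] [FiniteDimensional ℝ E]
  {H : Type*} [TopologicalSpace H] {I : ModelWithCorners ℝ E H}
  {X : Type*} [TopologicalSpace X] [ChartedSpace H X] [IsManifold I ∞ X] [T2Space X]
  {κ : Type} [Finite κ] {n : ℕ}

theorem grExp_sum_eq_prod (z : Fin n → Gr κ) (hz : ∀ a, IsEven (z a)) :
    grExp (∑ a, z a) = (List.ofFn fun a => grExp (z a)).prod := by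
  induction n with
  | zero => simpa using grExp_algebraMap (κ := κ) 0
  | succ n ih =>
    rw [Fin.sum_univ_succ, List.ofFn_succ, List.prod_cons, grExp_add ((hz 0).commute _),
      ih _ fun a => hz a.succ]

/-- Expansion in the nilpotent part of `x` around the body `β`: the dependence on `t` is confined to
finitely many scalar functions, which can be integrated. -/
theorem grExp_gauss_eq_sum {x : Gr κ} {β : ℝ} (hβ : body x = (β : ℂ)) {N : ℕ}
    (hN : Nat.card κ < N) (t : ℝ) :
    grExp (algebraMap ℂ _ (-(1 / 2) * (t : ℂ) ^ 2) + (Complex.I * t) • x)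
      = ∑ k ∈ Finset.range N, momentFun β k t •
        (((k.factorial : ℂ)⁻¹) • (x - algebraMap ℂ _ (β : ℂ)) ^ k) := by
  have hb : body (algebraMap ℂ (Gr κ) (-(1 / 2) * (t : ℂ) ^ 2) + (Complex.I * t) • x)
      = -(1 / 2) * (t : ℂ) ^ 2 + Complex.I * t * β := by
    rw [map_add, map_smul, hβ, AlgHom.commutes]; rfl
  unfold grExp
  rw [hb]
  have e : algebraMap ℂ (Gr κ) (-(1 / 2) * (t : ℂ) ^ 2) + (Complex.I * t) • x
      - algebraMap ℂ (Gr κ) (-(1 / 2) * (t : ℂ) ^ 2 + Complex.I * t * β)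
      = (Complex.I * t) • (x - algebraMap ℂ _ (β : ℂ)) := by
    rw [map_add, map_mul _ (Complex.I * t), smul_sub, Algebra.smul_def, Algebra.smul_def]
    abel
  rw [e, nilpotent_exp_eq (by rw [map_smul, ← hβ, body_sub_body, smul_zero]) hN, Finset.smul_sum]
  refine Finset.sum_congr rfl fun k _ => ?_
  rw [smul_pow, smul_smul, smul_smul, smul_smul, momentFun]
  congr 1
  ring

/-- The integrand is a finite sum of products of scalar moment functions with fixed Grassmann
elements, so Fubini and `integral_momentFun` apply. Moments turn into derivatives of the Gaussian at
the body, and the result is its Taylor expansion at `h (ξ a)`. The factor `b` does not depend on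
`t`; it will be the integral over `ψ`. -/
theorem isGrIntegral_gauss {h : C^∞⟮I, X; 𝓘(ℝ, ℝ), ℝ⟯ →ₐ[ℝ] Gr κ} {p : X} (hp : LiesOver h p)
    (he : ∀ f, IsEven (h f)) (ξ : Fin n → C^∞⟮I, X; 𝓘(ℝ, ℝ), ℝ⟯) (b : Gr κ) :
    IsGrIntegral (fun t : EuclideanSpace ℝ (Fin n) =>
      grExp (algebraMap ℂ _ (-(1 / 2) * ∑ a, (t a : ℂ) ^ 2)
        + Complex.I • ∑ a, (t a : ℂ) • h (ξ a)) * b)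
      ((Real.sqrt (2 * Real.pi) : ℂ) ^ n •
        (grExp (-(1 / 2 : ℂ) • ∑ a, h (ξ a) * h (ξ a)) * b)) := by
  set N := Nat.card κ + 1 with hN
  have hN' : Nat.card κ < N := Nat.lt_succ_self _
  let z : Fin n → ℕ → Gr κ := fun a k =>
    ((k.factorial : ℂ)⁻¹) • (h (ξ a) - algebraMap ℂ _ (ξ a p : ℂ)) ^ k
  have hg : ∀ t : EuclideanSpace ℝ (Fin n), grExp (algebraMap ℂ _ (-(1 / 2) * ∑ a, (t a : ℂ) ^ 2)
        + Complex.I • ∑ a, (t a : ℂ) • h (ξ a)) = ∑ e : Fin n → Fin N,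
          (∏ a, momentFun (ξ a p) (e a) (t a)) • (List.ofFn fun a => z a (e a)).prod := by
    intro t
    have e1 : algebraMap ℂ (Gr κ) (-(1 / 2) * ∑ a, (t a : ℂ) ^ 2)
        + Complex.I • ∑ a, (t a : ℂ) • h (ξ a)
        = ∑ a, (algebraMap ℂ _ (-(1 / 2) * (t a : ℂ) ^ 2) + (Complex.I * t a) • h (ξ a)) := by
      rw [Finset.sum_add_distrib, ← map_sum, ← Finset.mul_sum, Finset.smul_sum]
      simp only [smul_smul]
    rw [e1, grExp_sum_eq_prod _ fun a => (isEven_algebraMap _).add ((he _).smul _)]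
    have e2 : (fun a => grExp (algebraMap ℂ (Gr κ) (-(1 / 2) * (t a : ℂ) ^ 2)
        + (Complex.I * t a) • h (ξ a))) = fun a => ∑ k : Fin N, momentFun (ξ a p) k (t a) • z a k := by
      funext a
      rw [grExp_gauss_eq_sum (hp (ξ a)) hN', Finset.sum_range]
    rw [e2, prod_ofFn_sum]
    refine Finset.sum_congr rfl fun e _ => ?_
    have := (MultilinearMap.mkPiAlgebraFin ℂ n (Gr κ)).map_smul_univ
      (fun a => momentFun (ξ a p) (e a) (t a)) fun a => z a (e a)
    simpa [MultilinearMap.mkPiAlgebraFin_apply] using this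
  -- The function `exp(-½ ξ²)` is read in two ways: as a function of `ξ`, expanded by Taylor's
  -- formula, and as the exponential of `-½ ξ²`.
  have hF : ∀ a, ∑ k : Fin N, ((iteratedDeriv k gaussFun (ξ a p) : ℝ) : ℂ) • z a k
      = grExp (-(1 / 2 : ℂ) • (h (ξ a) * h (ξ a))) := by
    intro a
    have h1 := hp.map_smoothComp contDiff_gaussFun (ξ a) hN'
    have h2 := hp.map_exp ((-(1 / 2) : ℝ) • (ξ a * ξ a))
    have h3 : smoothComp Real.exp Real.contDiff_exp ((-(1 / 2) : ℝ) • (ξ a * ξ a))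
        = smoothComp gaussFun contDiff_gaussFun (ξ a) := rfl
    rw [h3, h1] at h2
    rw [Finset.sum_range] at h2
    have h4 : h ((-(1 / 2) : ℝ) • (ξ a * ξ a)) = -(1 / 2 : ℂ) • (h (ξ a) * h (ξ a)) := by
      rw [map_smul, map_mul]
      change (((-(1 / 2) : ℝ) : ℂ)) • (h (ξ a) * h (ξ a)) = _
      push_cast
      rfl
    rw [← h4, ← h2]
    refine Finset.sum_congr rfl fun k _ => ?_
    rw [smul_smul]
    congr 1
    push_cast
    rw [div_eq_mul_inv]
  have hi : ∀ e : Fin n → Fin N, Integrable (fun t : EuclideanSpace ℝ (Fin n) =>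
      ∏ a, momentFun (ξ a p) (e a) (t a)) ∧ ∫ t : EuclideanSpace ℝ (Fin n),
        ∏ a, momentFun (ξ a p) (e a) (t a)
        = ∏ a, ((Real.sqrt (2 * Real.pi) : ℂ) * ((iteratedDeriv (e a) gaussFun (ξ a p) : ℝ) : ℂ)) := by
    intro e
    have hv := PiLp.volume_preserving_ofLp (Fin n)
    have h1 : Integrable (fun t : Fin n → ℝ => ∏ a, momentFun (ξ a p) (e a) (t a)) :=
      Integrable.fintype_prod fun a => integrable_momentFun _ _
    refine ⟨(hv.integrable_comp_emb
      (MeasurableEquiv.toLp 2 (Fin n → ℝ)).symm.measurableEmbedding).2 h1, ?_⟩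
    have h2 := hv.integral_comp (MeasurableEquiv.toLp 2 (Fin n → ℝ)).symm.measurableEmbedding
      fun t : Fin n → ℝ => ∏ a, momentFun (ξ a p) (e a) (t a)
    refine h2.trans ?_
    rw [integral_fintype_prod_volume_eq_prod]
    exact Finset.prod_congr rfl fun a _ => integral_momentFun _ _
  intro l
  have hl : ∀ t : EuclideanSpace ℝ (Fin n), l (grExp (algebraMap ℂ _ (-(1 / 2) * ∑ a, (t a : ℂ) ^ 2)
        + Complex.I • ∑ a, (t a : ℂ) • h (ξ a)) * b) = ∑ e : Fin n → Fin N,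
          (∏ a, momentFun (ξ a p) (e a) (t a)) * l ((List.ofFn fun a => z a (e a)).prod * b) := by
    intro t
    rw [hg, Finset.sum_mul, map_sum]
    simp only [smul_mul_assoc, map_smul, smul_eq_mul]
  simp only [hl]
  refine ⟨integrable_finsetSum _ fun e _ => (hi e).1.mul_const _, ?_⟩
  rw [integral_finsetSum _ fun e _ => (hi e).1.mul_const _]
  simp only [integral_mul_const, (hi _).2, Finset.prod_mul_distrib, Finset.prod_const,
    Finset.card_univ, Fintype.card_fin]
  rw [Finset.smul_sum, grExp_sum_eq_prod _ fun a => ((he _).mul (he _)).smul _]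
  simp only [← hF]
  rw [prod_ofFn_sum, Finset.sum_mul, map_smul, map_sum, smul_eq_mul, Finset.mul_sum]
  refine Finset.sum_congr rfl fun e _ => ?_
  have := (MultilinearMap.mkPiAlgebraFin ℂ n (Gr κ)).map_smul_univ
    (fun a => ((iteratedDeriv (e a) gaussFun (ξ a p) : ℝ) : ℂ)) fun a => z a (e a)
  simp only [MultilinearMap.mkPiAlgebraFin_apply] at this
  rw [this, smul_mul_assoc, map_smul, smul_eq_mul]
  ring

end Gaussian

/-! ### The action functional in components -/

section Action

variable {ι : Type} {n : ℕ}

theorem intTheta_odd_mul {u : Gr (Option ι)} (hu : IsOdd u) (v : Gr (Option ι)) :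
    intTheta (u * v) = intTheta u * atZero v - atZero u * intTheta v := by
  change atZero (der none (u * v)) = atZero (der none u) * _ - _ * atZero (der none v)
  rw [hu.der_mul, map_sub, map_mul, map_mul]

theorem intTheta_D (u : Gr (Option ι)) : intTheta (D u) = 0 := by
  change atZero (der none (der none u)) = 0
  rw [der_der, map_zero]

theorem intTheta_gen_some (i : ι) : intTheta (gen (some i)) = 0 := by
  change atZero (der none (gen (some i))) = 0
  rw [der_gen_of_ne (by simp), map_zero]

theorem atZero_gen_some (i : ι) : atZero (gen (some i)) = gen i := keep_gen _ _ i

theorem intTheta_gen_none_mul (w : Gr (Option ι)) : intTheta (gen none * w) = atZero w := by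
  rw [intTheta_odd_mul (isOdd_gen none), show atZero (gen (none : Option ι)) = 0 from
    keep_gen_of_notMem _ _ (by simp)]
  change atZero (der none (gen none)) * _ - _ = _
  rw [der_gen_self]; simp

theorem atZero_gen_none_mul (w : Gr (Option ι)) : atZero (gen none * w) = 0 := by
  rw [map_mul, show atZero (gen (none : Option ι)) = 0 from
    keep_gen_of_notMem _ _ (by simp), zero_mul]

theorem atZero_rename_map {κ' : Type} (j : ι → κ') (z : Gr (Option ι)) :
    atZero (rename (Option.map j) z) = rename j (atZero z) := by
  induction z using gr_induction with
  | one => simp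
  | smul c x h => simp [h]
  | add x y hx hy => simp [hx, hy]
  | gen_mul i x h =>
    rw [map_mul, map_mul, map_mul, map_mul, h, rename_gen]
    congr 1
    cases i with
    | none =>
      rw [Option.map_none, show atZero (gen (none : Option ι)) = 0 from
        keep_gen_of_notMem _ _ (by simp), show atZero (gen (none : Option κ')) = 0 from
        keep_gen_of_notMem _ _ (by simp), map_zero]
    | some i => rw [Option.map_some, atZero_gen_some, atZero_gen_some, rename_gen]

theorem D_rename_map {κ' : Type} {j : ι → κ'} (hj : Function.Injective j) (z : Gr (Option ι)) :
    D (rename (Option.map j) z) = rename (Option.map j) (D z) :=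
  der_rename (Option.map j) (Option.map_injective hj) none z

/-- The components of `Ψ` are chosen such that its covariant derivative at `θ = 0` is `t`. Two terms
are linear both in `t` and in `ψ`; they cancel by `hBw`, that is, by antisymmetry of the connection.
The terms quadratic in `ψ` combine to `dA + A ∧ A`, and those with `x` to `∇x`. -/
theorem neg_action_eq_mqExponent {A : Fin n → Fin n → Gr (Option ι)} {x : Fin n → Gr (Option ι)}
    (hA : ∀ a b, IsOdd (A a b)) (hA' : ∀ a b, A a b = -A b a)
    (t : Fin n → ℂ) {Ψ : Fin n → Gr (Option (ι ⊕ Fin n))}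
    (hΨ : ∀ a, Ψ a = gen (some (Sum.inr a)) + gen none * (algebraMap ℂ _ (t a)
      - ∑ b, rename (Option.map Sum.inl) (A a b) * gen (some (Sum.inr b)))) :
    -intTheta ((1 / 2 : ℂ) • ∑ a, Ψ a * (D (Ψ a) + ∑ b, rename (Option.map Sum.inl) (A a b) * Ψ b)
      - Complex.I • ∑ a, Ψ a * rename (Option.map Sum.inl) (x a))
      = mqExponent (algebraMap ℂ _ (-(1 / 2) * ∑ a, t a ^ 2) + Complex.I • ∑ a, t a • atZero (x a))
        (fun a => atZero (D (x a)) + ∑ b, atZero (A a b) * atZero (x b))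
        (fun a b => atZero (D (A a b)) + ∑ c, atZero (A a c) * atZero (A c b)) := by
  let ρ : Gr ι →ₐ[ℂ] Gr (ι ⊕ Fin n) := rename Sum.inl
  let ψ : Fin n → Gr (ι ⊕ Fin n) := fun a => gen (Sum.inr a)
  let a0 : Fin n → Fin n → Gr (ι ⊕ Fin n) := fun a b => ρ (atZero (A a b))
  let a1 : Fin n → Fin n → Gr (ι ⊕ Fin n) := fun a b => ρ (atZero (D (A a b)))
  let T : Fin n → Gr (ι ⊕ Fin n) := fun a => algebraMap ℂ _ (t a)
  let B : Fin n → Gr (ι ⊕ Fin n) := fun a => ∑ b, a0 a b * ψ b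
  have ha0 : ∀ a b, IsOdd (a0 a b) := fun a b => ((hA a b).keep _ _).rename _
  have ha0' : ∀ a b, a0 a b = -a0 b a := fun a b => by simp only [a0]; rw [hA' a b, map_neg, map_neg]
  have hBw : ∀ w : Fin n → Gr (ι ⊕ Fin n), ∑ a, B a * w a = ∑ a, ψ a * ∑ b, a0 a b * w b :=
    fun w => mulVec_dotProduct_odd (A := Matrix.of a0) (fun a => isOdd_gen _) ha0 ha0' w
  have hΨodd : ∀ a, IsOdd (Ψ a) := by
    intro a
    rw [hΨ]
    exact (isOdd_gen _).add ((isOdd_gen _).mul_even ((isEven_algebraMap _).sub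
      (IsEven.sum fun b _ => ((hA a b).rename _).mul (isOdd_gen _))))
  have z0 : ∀ a, atZero (Ψ a) = ψ a := by
    intro a
    rw [hΨ, map_add, atZero_gen_none_mul, atZero_gen_some, add_zero]
  have z1 : ∀ a, intTheta (Ψ a) = T a - B a := by
    intro a
    rw [hΨ, map_add, intTheta_gen_none_mul, intTheta_gen_some, zero_add, map_sub, AlgHom.commutes,
      map_sum]
    simp only [map_mul, atZero_rename_map, atZero_gen_some]
    rfl
  have n0 : ∀ a, atZero (D (Ψ a) + ∑ b, rename (Option.map Sum.inl) (A a b) * Ψ b) = T a := by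
    intro a
    rw [map_add, show atZero (D (Ψ a)) = intTheta (Ψ a) from rfl, z1, map_sum]
    simp only [map_mul, atZero_rename_map, z0]
    exact sub_add_cancel _ _
  have n1 : ∀ a, intTheta (D (Ψ a) + ∑ b, rename (Option.map Sum.inl) (A a b) * Ψ b)
      = ∑ b, a1 a b * ψ b - ∑ b, a0 a b * (T b - B b) := by
    intro a
    rw [map_add, intTheta_D, zero_add, map_sum, ← Finset.sum_sub_distrib]
    refine Finset.sum_congr rfl fun b _ => ?_
    rw [intTheta_odd_mul ((hA a b).rename _), z0, z1, atZero_rename_map]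
    change atZero (D _) * _ - _ = _
    rw [D_rename_map Sum.inl_injective, atZero_rename_map]
  have hl : intTheta ((1 / 2 : ℂ) • ∑ a, Ψ a * (D (Ψ a)
      + ∑ b, rename (Option.map Sum.inl) (A a b) * Ψ b)
      - Complex.I • ∑ a, Ψ a * rename (Option.map Sum.inl) (x a))
      = (1 / 2 : ℂ) • ∑ a, ((T a - B a) * T a - ψ a * (∑ b, a1 a b * ψ b
          - ∑ b, a0 a b * (T b - B b)))
        - Complex.I • ∑ a, ((T a - B a) * ρ (atZero (x a)) - ψ a * ρ (atZero (D (x a)))) := by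
    refine (map_sub intTheta _ _).trans (congrArg₂ _ ((map_smul intTheta _ _).trans ?_)
      ((map_smul intTheta _ _).trans ?_))
    · rw [map_sum]
      congr 1
      refine Finset.sum_congr rfl fun a _ => ?_
      rw [intTheta_odd_mul (hΨodd a), z1, z0, n0, n1]
    · rw [map_sum]
      congr 1
      refine Finset.sum_congr rfl fun a _ => ?_
      rw [intTheta_odd_mul (hΨodd a), z1, z0, atZero_rename_map]
      change _ - ψ a * atZero (D (rename (Option.map Sum.inl) (x a))) = _
      rw [D_rename_map Sum.inl_injective, atZero_rename_map]
  have hr : mqExponent (algebraMap ℂ _ (-(1 / 2) * ∑ a, t a ^ 2)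
        + Complex.I • ∑ a, t a • atZero (x a))
        (fun a => atZero (D (x a)) + ∑ b, atZero (A a b) * atZero (x b))
        (fun a b => atZero (D (A a b)) + ∑ c, atZero (A a c) * atZero (A c b))
      = -(1 / 2 : ℂ) • ∑ a, T a * T a + Complex.I • ∑ a, T a * ρ (atZero (x a))
        - Complex.I • ∑ a, ψ a * (ρ (atZero (D (x a))) + ∑ b, a0 a b * ρ (atZero (x b)))
        + (1 / 2 : ℂ) • (∑ a, ψ a * (∑ b, a1 a b * ψ b) + ∑ a, ψ a * ∑ b, a0 a b * B b) := by
    unfold mqExponent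
    congr 1
    · congr 1
      · rw [map_add, AlgHom.commutes, map_smul, map_sum]
        congr 1
        · simp only [T, ← map_mul, ← map_sum, Algebra.smul_def]
          congr 2
          exact Finset.sum_congr rfl fun a _ => sq _
        · simp only [T, Algebra.smul_def, map_mul, AlgHom.commutes]
          rfl
      · simp only [map_add, map_sum, map_mul]
        rfl
    · congr 1
      rw [← Finset.sum_add_distrib]
      refine Finset.sum_congr rfl fun a _ => ?_
      simp only [map_add, map_sum, map_mul, mul_add, add_mul, Finset.sum_add_distrib,
        Finset.mul_sum, Finset.sum_mul, B, mul_assoc]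
      congr 1
      exact Finset.sum_comm
  rw [hl, hr]
  simp only [mul_sub, sub_mul, mul_add, Finset.sum_sub_distrib, Finset.sum_add_distrib, hBw,
    smul_sub, smul_add]
  simp only [neg_smul]
  abel

end Action

/-! ### The action on the universal section over an object of the stack. -/

section FibreIntegral

variable {EB : Type*} [NormedAddCommGroup EB] [NormedSpace ℝ EB]
  {M : Type*} [TopologicalSpace M] [ChartedSpace EB M]
  {F : Type*} [NormedAddCommGroup F] [NormedSpace ℝ F]
  {V : M → Type*} [TopologicalSpace (TotalSpace F V)]
  [∀ m, NormedAddCommGroup (V m)] [∀ m, InnerProductSpace ℝ (V m)]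
  [FiberBundle F V] [VectorBundle ℝ F V]
  {n : ℕ} {o : ∀ m, Orientation ℝ (V m) (Fin n)}
  {fr : OrthoFrame EB F o} {cov : CovariantDerivative 𝓘(ℝ, EB) F V}

theorem contract_pullTotal {S : SuperDomain} (pull : fr.Fun → S.U → Gr (Option (Fin S.q))) {k : ℕ}
    (P : FormSum (𝓘(ℝ, EB).prod 𝓘(ℝ, F)) fr.over k) (z : S.U × EuclideanSpace ℝ (Fin n)) :
    P.contract (pullTotal pull) z = rename (Option.map Sum.inl) (P.contract pull z.1) := by
  simp only [FormSum.contract, map_sum, map_smul, map_mul, map_list_prod, List.map_ofFn]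
  refine Finset.sum_congr rfl fun j _ => ?_
  congr 4
  funext a
  exact D_rename_map Sum.inl_injective _

theorem LocalData.neg_action_universal (L : LocalData fr cov) {S : SuperDomain}
    {pull : fr.Fun → S.U → Gr (Option (Fin S.q))} {y : S.U}
    (hA : ∀ a b, IsOdd ((L.A a b).contract pull y))
    (hA' : ∀ a b, (L.A a b).contract pull y = -(L.A b a).contract pull y)
    (t : EuclideanSpace ℝ (Fin n)) :
    -(L.action (pullTotal pull) (L.universal pull) (y, t))
      = mqExponent (algebraMap ℂ _ (-(1 / 2) * ∑ a, (t a : ℂ) ^ 2)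
          + Complex.I • ∑ a, (t a : ℂ) • atZero (pull (L.x a) y))
        (fun a => atZero (D (pull (L.x a) y))
          + ∑ b, atZero ((L.A a b).contract pull y) * atZero (pull (L.x b) y))
        (fun a b => atZero (D ((L.A a b).contract pull y))
          + ∑ c, atZero ((L.A a c).contract pull y) * atZero ((L.A c b).contract pull y)) := by
  rw [← neg_action_eq_mqExponent hA hA' (fun a => (t a : ℂ))
    (Ψ := fun a => L.universal pull a (y, t)) fun a => by
      simp only [LocalData.universal, contract_pullTotal]]
  simp only [LocalData.action, LocalData.nablaD, contract_pullTotal]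
  rfl

end FibreIntegral

/-! ### Coordinate vector fields on the base -/

section BaseFields

set_option linter.unusedSectionVars false

open Filter Topology

variable {EB : Type*} [NormedAddCommGroup EB] [NormedSpace ℝ EB]
  {M : Type*} [TopologicalSpace M] [ChartedSpace EB M] [IsManifold 𝓘(ℝ, EB) ∞ M]

/-- The vector field near `m₀` with constant coefficients `w` in the preferred chart at `m₀`. -/
def constField (m₀ : M) (w : EB) (m : M) : TangentSpace 𝓘(ℝ, EB) m :=
  (trivializationAt EB (TangentSpace 𝓘(ℝ, EB) : M → Type _) m₀).symmL ℝ m w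

/-- `FiberBundle.extend` transports a vector through the trivialization at `m₀`, and that
trivialization is the identity on the fibre over `m₀`. The extensions in `curvature` may thus be
replaced by coordinate fields. -/
theorem extend_eq_constField (m₀ : M) (w : TangentSpace 𝓘(ℝ, EB) m₀) {m : M}
    (hm : m ∈ (chartAt EB m₀).source) :
    FiberBundle.extend EB (E := (TangentSpace 𝓘(ℝ, EB) : M → Type _)) w m
      = constField (EB := EB) m₀ w m := by
  have h : ((trivializationAt EB (TangentSpace 𝓘(ℝ, EB) : M → Type _) m₀) ⟨m₀, w⟩).2 = (w : EB) :=
    (tangentBundleCore 𝓘(ℝ, EB) M).coordChange_self (achart EB m₀) m₀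
      (mem_chart_source EB m₀) w
  simp only [FiberBundle.extend]
  rw [h]
  exact (Trivialization.symmL_apply (R := ℝ)
    (trivializationAt EB (TangentSpace 𝓘(ℝ, EB) : M → Type _) m₀) hm (w : EB)).symm

theorem constField_self (m₀ : M) (w : EB) : constField m₀ w m₀ = w := by
  rw [← extend_eq_constField m₀ (w : TangentSpace 𝓘(ℝ, EB) m₀) (mem_chart_source EB m₀)]
  exact FiberBundle.extend_apply_self EB (E := (TangentSpace 𝓘(ℝ, EB) : M → Type _))
    (w : TangentSpace 𝓘(ℝ, EB) m₀)

theorem constField_eq (m₀ : M) (w : EB) {m : M} (hm : m ∈ (chartAt EB m₀).source) :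
    constField m₀ w m = mfderiv 𝓘(ℝ, EB) 𝓘(ℝ, EB) (extChartAt 𝓘(ℝ, EB) m₀).symm
      (extChartAt 𝓘(ℝ, EB) m₀ m) w := by
  have h := TangentBundle.symmL_trivializationAt (I := 𝓘(ℝ, EB)) hm
  rw [modelWithCornersSelf_coe, Set.range_id, mfderivWithin_univ] at h
  exact DFunLike.congr_fun h w

theorem contMDiffAt_constField (m₀ : M) (w : EB) {m : M} (hm : m ∈ (chartAt EB m₀).source) :
    ContMDiffAt 𝓘(ℝ, EB) (𝓘(ℝ, EB).prod 𝓘(ℝ, EB)) ∞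
      (fun m => (⟨m, constField m₀ w m⟩ : TangentBundle 𝓘(ℝ, EB) M)) m := by
  have h := (trivializationAt EB (TangentSpace 𝓘(ℝ, EB) : M → Type _) m₀).contMDiffAt_symmL
    (n := ∞) (IB := 𝓘(ℝ, EB)) (x := m) hm
  exact h.clm_bundle_apply (F₁ := EB) (F₂ := EB) (v := fun _ => w) (E₁ := Bundle.Trivial M EB)
    ((Bundle.contMDiffAt_section (F := EB) (E := Bundle.Trivial M EB) (s := fun _ => w) m).2
      contMDiffAt_const)

theorem mvfderiv_constField {f : M → ℝ} (m₀ : M) (w : EB) {m : M}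
    (hm : m ∈ (chartAt EB m₀).source) (hf : MDifferentiableAt 𝓘(ℝ, EB) 𝓘(ℝ, ℝ) f m) :
    mvfderiv 𝓘(ℝ, EB) f m (constField m₀ w m)
      = fderiv ℝ (f ∘ (extChartAt 𝓘(ℝ, EB) m₀).symm) (extChartAt 𝓘(ℝ, EB) m₀ m) w := by
  rw [constField_eq m₀ w hm]
  have hms : m ∈ (extChartAt 𝓘(ℝ, EB) m₀).source := by rwa [extChartAt_source]
  have h1 : MDifferentiableAt 𝓘(ℝ, EB) 𝓘(ℝ, EB) (extChartAt 𝓘(ℝ, EB) m₀).symm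
      (extChartAt 𝓘(ℝ, EB) m₀ m) :=
    ((contMDiffOn_extChartAt_symm (n := ∞) m₀).contMDiffAt
      ((isOpen_extChartAt_target m₀).mem_nhds
        ((extChartAt 𝓘(ℝ, EB) m₀).map_source hms))).mdifferentiableAt (by simp)
  have h2 := mfderiv_comp_of_eq (I := 𝓘(ℝ, EB)) (I' := 𝓘(ℝ, EB)) (I'' := 𝓘(ℝ, ℝ))
    (x := extChartAt 𝓘(ℝ, EB) m₀ m) (y := m) hf h1 ((extChartAt 𝓘(ℝ, EB) m₀).left_inv hms)
  rw [mfderiv_eq_fderiv] at h2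
  -- The chain rule yields a derivative at `(extChartAt 𝓘(ℝ, EB) m₀).symm` of the image of `m`. Its
  -- equality with `m` is only propositional, so it is eliminated for a variable base point.
  have h3 : ∀ m', m' = m → ∀ e : EB, (mvfderiv 𝓘(ℝ, EB) f m e : ℝ)
      = (mfderiv 𝓘(ℝ, EB) 𝓘(ℝ, ℝ) f m' : EB →L[ℝ] ℝ) e := by
    rintro _ rfl e
    rfl
  exact (h3 _ ((extChartAt 𝓘(ℝ, EB) m₀).left_inv hms) _).trans (DFunLike.congr_fun h2 w).symm

theorem mvfderiv_comp_extChartAt {G : EB → ℝ} (m₀ : M)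
    (hG : DifferentiableAt ℝ G (extChartAt 𝓘(ℝ, EB) m₀ m₀)) (u : EB) :
    mvfderiv 𝓘(ℝ, EB) (G ∘ extChartAt 𝓘(ℝ, EB) m₀) m₀ (u : TangentSpace 𝓘(ℝ, EB) m₀)
      = fderiv ℝ G (extChartAt 𝓘(ℝ, EB) m₀ m₀) u := by
  have hd : MDifferentiableAt 𝓘(ℝ, EB) 𝓘(ℝ, ℝ) (G ∘ extChartAt 𝓘(ℝ, EB) m₀) m₀ :=
    hG.mdifferentiableAt.comp m₀ (mdifferentiableAt_extChartAt (mem_chart_source EB m₀))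
  have h := mvfderiv_constField m₀ u (mem_chart_source EB m₀) hd
  rw [constField_self] at h
  refine h.trans ?_
  congr 1
  refine Filter.EventuallyEq.fderiv_eq ?_
  filter_upwards [(isOpen_extChartAt_target (I := 𝓘(ℝ, EB)) m₀).mem_nhds
    (mem_extChartAt_target m₀)] with z hz
  exact congrArg G ((extChartAt 𝓘(ℝ, EB) m₀).right_inv hz)

theorem contDiffAt_comp_extChartAt_symm {f : M → ℝ} {m₀ m : M}
    (hf : ContMDiffAt 𝓘(ℝ, EB) 𝓘(ℝ, ℝ) ∞ f m) (hm : m ∈ (chartAt EB m₀).source) :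
    ContDiffAt ℝ ∞ (f ∘ (extChartAt 𝓘(ℝ, EB) m₀).symm) (extChartAt 𝓘(ℝ, EB) m₀ m) := by
  have hms : m ∈ (extChartAt 𝓘(ℝ, EB) m₀).source := by rwa [extChartAt_source]
  rw [← contMDiffAt_iff_contDiffAt]
  refine ContMDiffAt.comp_of_eq (y := m) hf ?_ ((extChartAt 𝓘(ℝ, EB) m₀).left_inv hms)
  exact (contMDiffOn_extChartAt_symm m₀).contMDiffAt ((isOpen_extChartAt_target m₀).mem_nhds
    ((extChartAt 𝓘(ℝ, EB) m₀).map_source hms))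

theorem eventually_mdifferentiableAt {f : M → ℝ} {m₀ : M}
    (hf : ContMDiffAt 𝓘(ℝ, EB) 𝓘(ℝ, ℝ) ∞ f m₀) :
    ∀ᶠ m in 𝓝 m₀, MDifferentiableAt 𝓘(ℝ, EB) 𝓘(ℝ, ℝ) f m := by
  have h1 : ContMDiffAt 𝓘(ℝ, EB) 𝓘(ℝ, ℝ) 1 f m₀ := hf.of_le (by simp)
  filter_upwards [contMDiffAt_iff_contMDiffAt_nhds (by simp) |>.1 h1] with m hm using hm.mdifferentiableAt (by simp)

/-- Derivatives along coordinate vector fields commute. -/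
theorem mvfderiv_constField_comm {f : M → ℝ} {m₀ : M}
    (hf : ContMDiffAt 𝓘(ℝ, EB) 𝓘(ℝ, ℝ) ∞ f m₀) (u w : EB) :
    mvfderiv 𝓘(ℝ, EB) (fun m => mvfderiv 𝓘(ℝ, EB) f m (constField m₀ w m)) m₀
        (u : TangentSpace 𝓘(ℝ, EB) m₀)
      = mvfderiv 𝓘(ℝ, EB) (fun m => mvfderiv 𝓘(ℝ, EB) f m (constField m₀ u m)) m₀
        (w : TangentSpace 𝓘(ℝ, EB) m₀) := by
  have hc := contDiffAt_comp_extChartAt_symm hf (mem_chart_source EB m₀)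
  set F := f ∘ (extChartAt 𝓘(ℝ, EB) m₀).symm with hF
  have hd : DifferentiableAt ℝ (fderiv ℝ F) (extChartAt 𝓘(ℝ, EB) m₀ m₀) :=
    (hc.fderiv_right (m := 1) (by norm_cast)).differentiableAt (by simp)
  have key : ∀ u w : EB, mvfderiv 𝓘(ℝ, EB) (fun m => mvfderiv 𝓘(ℝ, EB) f m (constField m₀ w m)) m₀
        (u : TangentSpace 𝓘(ℝ, EB) m₀)
      = fderiv ℝ (fderiv ℝ F) (extChartAt 𝓘(ℝ, EB) m₀ m₀) u w := by
    intro u w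
    have he : (fun m => mvfderiv 𝓘(ℝ, EB) f m (constField m₀ w m)) =ᶠ[𝓝 m₀]
        (fun z => fderiv ℝ F z w) ∘ extChartAt 𝓘(ℝ, EB) m₀ := by
      filter_upwards [eventually_mdifferentiableAt hf,
        (chartAt EB m₀).open_source.mem_nhds (mem_chart_source EB m₀)] with m h1 h2
      exact mvfderiv_constField m₀ w h2 h1
    have h1 : mvfderiv 𝓘(ℝ, EB) (fun m => mvfderiv 𝓘(ℝ, EB) f m (constField m₀ w m)) m₀
        (u : TangentSpace 𝓘(ℝ, EB) m₀) = mvfderiv 𝓘(ℝ, EB)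
          ((fun z => fderiv ℝ F z w) ∘ extChartAt 𝓘(ℝ, EB) m₀) m₀
        (u : TangentSpace 𝓘(ℝ, EB) m₀) :=
      DFunLike.congr_fun (he.mfderiv_eq) (u : TangentSpace 𝓘(ℝ, EB) m₀)
    rw [h1]
    have h2 : DifferentiableAt ℝ (fun z => fderiv ℝ F z w) (extChartAt 𝓘(ℝ, EB) m₀ m₀) :=
      hd.clm_apply (differentiableAt_const _)
    rw [mvfderiv_comp_extChartAt m₀ h2 u, fderiv_clm_apply hd (differentiableAt_const _)]
    simp
  rw [key, key]
  exact (hc.isSymmSndFDerivAt (by simp; norm_cast)).eq _ _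

/-- Both fields pull back to constant fields on the target of the chart. This removes the bracket
term from the curvature. -/
theorem mlieBracket_constField (m₀ : M) (u w : EB) :
    VectorField.mlieBracket 𝓘(ℝ, EB) (constField m₀ u) (constField m₀ w) m₀ = 0 := by
  have key : ∀ w : EB, VectorField.mpullbackWithin 𝓘(ℝ, EB) 𝓘(ℝ, EB) (extChartAt 𝓘(ℝ, EB) m₀).symm
      (constField m₀ w) (Set.range 𝓘(ℝ, EB)) =ᶠ[𝓝 (extChartAt 𝓘(ℝ, EB) m₀ m₀)] fun _ => w := by
    intro w
    filter_upwards [(isOpen_extChartAt_target (I := 𝓘(ℝ, EB)) m₀).mem_nhds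
      (mem_extChartAt_target m₀)] with z hz
    rw [VectorField.mpullbackWithin_apply, constField_eq m₀ w (by
      rw [← extChartAt_source 𝓘(ℝ, EB)]; exact (extChartAt 𝓘(ℝ, EB) m₀).map_target hz),
      (extChartAt 𝓘(ℝ, EB) m₀).right_inv hz, ← mfderivWithin_univ]
    have hi := isInvertible_mfderivWithin_extChartAt_symm (I := 𝓘(ℝ, EB)) hz
    have hr : Set.range 𝓘(ℝ, EB) = Set.univ := by simp
    rw [hr] at hi ⊢
    obtain ⟨e, he⟩ := hi
    rw [← he, ContinuousLinearMap.inverse_equiv]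
    exact e.symm_apply_apply w
  rw [← VectorField.mlieBracketWithin_univ, VectorField.mlieBracketWithin_apply,
    Filter.EventuallyEq.lieBracketWithin_vectorField_eq_nhds (key u) (key w)]
  have h0 : VectorField.lieBracketWithin ℝ (fun _ : EB => u) (fun _ : EB => w)
      ((extChartAt 𝓘(ℝ, EB) m₀).symm ⁻¹' Set.univ ∩ Set.range 𝓘(ℝ, EB))
      (extChartAt 𝓘(ℝ, EB) m₀ m₀) = 0 := by
    simp [VectorField.lieBracketWithin]
  refine (congrArg _ h0).trans ?_
  exact map_zero _

end BaseFields

/-! ### The connection and its curvature in an orthonormal frame -/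

section Frames

set_option linter.unusedSectionVars false

open Filter Topology

variable {EB : Type*} [NormedAddCommGroup EB] [NormedSpace ℝ EB] [FiniteDimensional ℝ EB]
  {M : Type*} [TopologicalSpace M] [ChartedSpace EB M] [IsManifold 𝓘(ℝ, EB) ∞ M] [T2Space M]
  {F : Type*} [NormedAddCommGroup F] [NormedSpace ℝ F] [FiniteDimensional ℝ F]
  {V : M → Type*} [TopologicalSpace (TotalSpace F V)]
  [∀ m, NormedAddCommGroup (V m)] [∀ m, InnerProductSpace ℝ (V m)]
  [FiberBundle F V] [VectorBundle ℝ F V] [ContMDiffVectorBundle ∞ F V 𝓘(ℝ, EB)]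
  [IsContMDiffRiemannianBundle 𝓘(ℝ, EB) ∞ F V]
  {n : ℕ} {o : ∀ m, Orientation ℝ (V m) (Fin n)}

theorem OrthoFrame.contMDiffAt (fr : OrthoFrame EB F o) {m : M} (hm : m ∈ fr.W) (a : Fin n) :
    CMDiffAt ∞ (T% (fr.e a)) m :=
  fr.isFrame.contMDiffAt fr.W.isOpen hm a

theorem OrthoFrame.mdifferentiableAt (fr : OrthoFrame EB F o) {m : M} (hm : m ∈ fr.W)
    (a : Fin n) : MDiffAt (T% (fr.e a)) m :=
  (fr.contMDiffAt hm a).mdifferentiableAt (by simp)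

/-- The frame as an orthonormal basis of the fibre. -/
def OrthoFrame.basis (fr : OrthoFrame EB F o) {m : M} (hm : m ∈ fr.W) :
    OrthonormalBasis (Fin n) ℝ (V m) :=
  OrthonormalBasis.mk (fr.orthonormal m hm) (fr.isFrame.generating hm)

@[simp]
theorem OrthoFrame.basis_apply (fr : OrthoFrame EB F o) {m : M} (hm : m ∈ fr.W) (a : Fin n) :
    fr.basis hm a = fr.e a m := by
  simp [OrthoFrame.basis]

theorem OrthoFrame.inner_eq (fr : OrthoFrame EB F o) {m : M} (hm : m ∈ fr.W) (a b : Fin n) :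
    inner ℝ (fr.e a m) (fr.e b m) = if a = b then (1 : ℝ) else 0 :=
  (orthonormal_iff_ite.1 (fr.orthonormal m hm)) a b

theorem OrthoFrame.sum_inner_mul (fr : OrthoFrame EB F o) {m : M} (hm : m ∈ fr.W) (v w : V m) :
    ∑ c, inner ℝ v (fr.e c m) * inner ℝ (fr.e c m) w = (inner ℝ v w : ℝ) := by
  have h := (fr.basis hm).sum_inner_mul_inner v w
  simpa using h

variable {cov : CovariantDerivative 𝓘(ℝ, EB) F V}

/-- Metric compatibility applied to the locally constant functions `⟨e_a, e_b⟩`: the connection form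
of an orthonormal frame is antisymmetric. -/
theorem inner_cov_frame (hcov : cov.IsMetricCompatible) (fr : OrthoFrame EB F o) {m : M}
    (hm : m ∈ fr.W) (a b : Fin n) (u : TangentSpace 𝓘(ℝ, EB) m) :
    inner ℝ (fr.e a m) (cov (fr.e b) m u) = -(inner ℝ (fr.e b m) (cov (fr.e a) m u) : ℝ) := by
  have h := hcov.mvfderiv_inner_eq
    (FiberBundle.extend EB (E := (TangentSpace 𝓘(ℝ, EB) : M → Type _)) u)
    (fr.mdifferentiableAt hm a) (fr.mdifferentiableAt hm b)
  simp only [FiberBundle.extend_apply_self] at h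
  have h0 : mvfderiv 𝓘(ℝ, EB) (fun m' => (inner ℝ (fr.e a m') (fr.e b m') : ℝ)) m u = 0 := by
    have he : (fun m' => (inner ℝ (fr.e a m') (fr.e b m') : ℝ)) =ᶠ[𝓝 m]
        fun _ => if a = b then (1 : ℝ) else 0 := by
      filter_upwards [fr.W.isOpen.mem_nhds hm] with m' hm' using fr.inner_eq hm' a b
    have h1 : mvfderiv 𝓘(ℝ, EB) (fun m' => (inner ℝ (fr.e a m') (fr.e b m') : ℝ)) m u
        = mvfderiv 𝓘(ℝ, EB) (fun _ : M => if a = b then (1 : ℝ) else 0) m u :=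
      DFunLike.congr_fun he.mfderiv_eq u
    rw [h1, mvfderiv_const]; rfl
  rw [h0] at h
  linarith [real_inner_comm (fr.e b m) (cov (fr.e a) m u)]

/-- The components of `∇ s` in the frame. -/
theorem inner_cov (hcov : cov.IsMetricCompatible) (fr : OrthoFrame EB F o) {m : M} (hm : m ∈ fr.W)
    {s : ∀ m, V m} (hs : MDiffAt (T% s) m) (a : Fin n) (u : TangentSpace 𝓘(ℝ, EB) m) :
    inner ℝ (fr.e a m) (cov s m u)
      = mvfderiv 𝓘(ℝ, EB) (fun m' => (inner ℝ (fr.e a m') (s m') : ℝ)) m u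
        + ∑ c, inner ℝ (fr.e c m) (s m) * inner ℝ (fr.e a m) (cov (fr.e c) m u) := by
  have h := hcov.mvfderiv_inner_eq
    (FiberBundle.extend EB (E := (TangentSpace 𝓘(ℝ, EB) : M → Type _)) u)
    (fr.mdifferentiableAt hm a) hs
  simp only [FiberBundle.extend_apply_self] at h
  have h2 : (inner ℝ (cov (fr.e a) m u) (s m) : ℝ)
      = -∑ c, inner ℝ (fr.e c m) (s m) * inner ℝ (fr.e a m) (cov (fr.e c) m u) := by
    rw [← fr.sum_inner_mul hm, ← Finset.sum_neg_distrib]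
    refine Finset.sum_congr rfl fun c _ => ?_
    rw [inner_cov_frame hcov fr hm a c u, real_inner_comm (fr.e c m)]
    ring
  rw [h, h2]
  ring

variable [CovariantDerivative.ContMDiffCovariantDerivative cov ∞]

theorem exists_contMDiff_section_eq {s : ∀ m, V m} {U : Set M} (hU : IsOpen U) {m₀ : M}
    (hm : m₀ ∈ U) (hs : CMDiff[U] ∞ (T% s)) :
    ∃ s' : ∀ m, V m, CMDiff ∞ (T% s') ∧ ∀ᶠ m in 𝓝 m₀, s' m = s m := by
  obtain ⟨χ, hχ, hχU⟩ := exists_bump (I := 𝓘(ℝ, EB)) (hU.mem_nhds hm)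
  refine ⟨fun m => χ m • s m, ?_, ?_⟩
  · exact ContMDiffOn.smul_section_of_tsupport χ.contMDiff.contMDiffOn hU hχU hs
  · filter_upwards [hχ] with m h
    rw [h]
    exact one_smul ℝ (s m)

/-- Smoothness of `cov` is available for sections smooth on all of `M`. The section is cut off to
such a one, and locality of the connection shows that nothing changes near `m₀`. -/
theorem contMDiffAt_cov {s : ∀ m, V m} {U : Set M} (hU : IsOpen U) {m₀ : M}
    (hm : m₀ ∈ U) (hs : CMDiff[U] ∞ (T% s)) {Y : ∀ m, TangentSpace 𝓘(ℝ, EB) m}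
    (hY : CMDiffAt ∞ (T% Y) m₀) :
    CMDiffAt ∞ (T% fun m => cov s m (Y m)) m₀ := by
  obtain ⟨s', hs', he⟩ := exists_contMDiff_section_eq hU hm hs
  have h1 := (CovariantDerivative.ContMDiffCovariantDerivative.contMDiff
    (cov := cov) (k := ∞)).contMDiff (σ := s') (by simpa using hs'.contMDiffOn)
  have h2 := ContMDiffAt.clm_bundle_apply (F₁ := EB) (F₂ := F)
    (E₁ := (TangentSpace 𝓘(ℝ, EB) : M → Type _)) (E₂ := V) (h1.contMDiffAt Filter.univ_mem) hY
  refine h2.congr_of_eventuallyEq ?_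
  filter_upwards [he.eventually_nhds, hU.mem_nhds hm] with m h hmU
  have h3 : cov s' m = cov s m := cov.isCovariantDerivativeOn.congr_of_eventuallyEq
    (s := Set.univ) ((hs' m).mdifferentiableAt (by simp))
    ((hs.contMDiffAt (hU.mem_nhds hmU)).mdifferentiableAt (by simp)) Filter.univ_mem h
  rw [h3]

theorem contMDiffOn_extend {m : M} (v : V m) :
    CMDiff[(trivializationAt F V m).baseSet] ∞ (T% (FiberBundle.extend F v)) := by
  rw [Trivialization.contMDiffOn_section_baseSet_iff]
  refine contMDiffOn_const (c := (trivializationAt F V m ⟨m, v⟩).2) |>.congr fun m' hm' => ?_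
  have h := congrArg Prod.snd (Trivialization.apply_mk_symm (trivializationAt F V m) hm'
    (trivializationAt F V m ⟨m, v⟩).2)
  exact h

theorem mvfderiv_add_sum_mul {EX HX X : Type*} [NormedAddCommGroup EX] [NormedSpace ℝ EX]
    [TopologicalSpace HX] {I : ModelWithCorners ℝ EX HX} [TopologicalSpace X] [ChartedSpace HX X]
    {ι : Type*} (t : Finset ι) {h : X → ℝ} {f g : ι → X → ℝ} {m : X}
    (hh : MDifferentiableAt I 𝓘(ℝ, ℝ) h m)
    (hf : ∀ c, MDifferentiableAt I 𝓘(ℝ, ℝ) (f c) m)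
    (hg : ∀ c, MDifferentiableAt I 𝓘(ℝ, ℝ) (g c) m) (u : TangentSpace I m) :
    MDifferentiableAt I 𝓘(ℝ, ℝ) (fun m' => h m' + ∑ c ∈ t, f c m' * g c m') m ∧
    mvfderiv I (fun m' => h m' + ∑ c ∈ t, f c m' * g c m') m u
      = mvfderiv I h m u + ∑ c ∈ t, (mvfderiv I (f c) m u * g c m
        + f c m * mvfderiv I (g c) m u) := by
  classical
  induction t using Finset.induction_on with
  | empty => simpa using hh
  | insert c t hc ih =>
    have he : (fun m' => h m' + ∑ c ∈ insert c t, f c m' * g c m')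
        = fun m' => (h m' + ∑ c ∈ t, f c m' * g c m') + f c m' * g c m' := by
      funext m'
      rw [Finset.sum_insert hc]
      ring
    have hfg : MDifferentiableAt I 𝓘(ℝ, ℝ) (fun m' => f c m' * g c m') m :=
      (hf c).mul (hg c)
    rw [he]
    refine ⟨ih.1.add hfg, ?_⟩
    rw [mvfderiv_fun_add ih.1 hfg, add_apply, ih.2,
      mvfderiv_fun_mul (hf c) (hg c), Finset.sum_insert hc, add_apply, smul_apply, smul_apply,
      smul_eq_mul, smul_eq_mul]
    ring

theorem mdifferentiableAt_mvfderiv_constField {f : M → ℝ} {m : M}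
    (hf : ContMDiffAt 𝓘(ℝ, EB) 𝓘(ℝ, ℝ) ∞ f m) (w : EB) : MDifferentiableAt 𝓘(ℝ, EB) 𝓘(ℝ, ℝ)
      (fun m' => mvfderiv 𝓘(ℝ, EB) f m' (constField (EB := EB) m w m')) m := by
  have hc := contDiffAt_comp_extChartAt_symm hf (mem_chart_source EB m)
  have hd : DifferentiableAt ℝ (fun z => fderiv ℝ (f ∘ (extChartAt 𝓘(ℝ, EB) m).symm) z w)
      (extChartAt 𝓘(ℝ, EB) m m) :=
    ((hc.fderiv_right (m := 1) (by norm_cast)).differentiableAt (by simp)).clm_apply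
      (differentiableAt_const _)
  refine (hd.mdifferentiableAt.comp m
    (mdifferentiableAt_extChartAt (mem_chart_source EB m))).congr_of_eventuallyEq ?_
  filter_upwards [eventually_mdifferentiableAt hf,
    (chartAt EB m).open_source.mem_nhds (mem_chart_source EB m)] with m' h1 h2
  exact mvfderiv_constField m w h2 h1

/-- The curvature in an orthonormal frame. -/
theorem inner_curvature (hcov : cov.IsMetricCompatible) (fr : OrthoFrame EB F o) {m : M}
    (hm : m ∈ fr.W) (a b : Fin n) (u w : TangentSpace 𝓘(ℝ, EB) m) :
    inner ℝ (fr.e a m) (curvature cov m u w (fr.e b m))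
      = mvfderiv 𝓘(ℝ, EB) (fun m' =>
          (inner ℝ (fr.e a m') (cov (fr.e b) m' (constField (EB := EB) m w m')) : ℝ)) m u
        - mvfderiv 𝓘(ℝ, EB) (fun m' =>
          (inner ℝ (fr.e a m') (cov (fr.e b) m' (constField (EB := EB) m u m')) : ℝ)) m w
        + ∑ c, ((inner ℝ (fr.e a m) (cov (fr.e c) m u) : ℝ) * inner ℝ (fr.e c m) (cov (fr.e b) m w)
          - (inner ℝ (fr.e a m) (cov (fr.e c) m w) : ℝ)
            * inner ℝ (fr.e c m) (cov (fr.e b) m u)) := by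
  have hchart := (chartAt EB m).open_source.mem_nhds (mem_chart_source EB m)
  set s' : ∀ m, V m := FiberBundle.extend F (fr.e b m) with hs'
  set U := (trivializationAt F V m).baseSet
  have hU : IsOpen U := (trivializationAt F V m).open_baseSet
  have hmU : m ∈ U := FiberBundle.mem_baseSet_trivializationAt' m
  have hsU : CMDiff[U] ∞ (T% s') := contMDiffOn_extend _
  have hsm : s' m = fr.e b m := FiberBundle.extend_apply_self F _
  -- The frame coordinates of the extension `s'`, which agrees with `e_b` at `m` but not necessarily
  -- nearby. Their derivatives have to drop out in the end.
  let f : Fin n → M → ℝ := fun c m' => inner ℝ (fr.e c m') (s' m')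
  let G : Fin n → Fin n → EB → M → ℝ := fun a c w m' =>
    inner ℝ (fr.e a m') (cov (fr.e c) m' (constField (EB := EB) m w m'))
  have hf : ∀ c, ContMDiffAt 𝓘(ℝ, EB) 𝓘(ℝ, ℝ) ∞ (f c) m := fun c =>
    (fr.contMDiffAt hm c).inner_bundle (hsU.contMDiffAt (hU.mem_nhds hmU))
  have hfm : ∀ c, f c m = if c = b then 1 else 0 := fun c => by
    change inner ℝ (fr.e c m) (s' m) = _
    rw [hsm, fr.inner_eq hm]
  have hG : ∀ a c w, ContMDiffAt 𝓘(ℝ, EB) 𝓘(ℝ, ℝ) ∞ (G a c w) m := fun a c w =>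
    (fr.contMDiffAt hm a).inner_bundle (contMDiffAt_cov fr.W.isOpen hm (fr.isFrame.contMDiffOn c)
      (contMDiffAt_constField m w (mem_chart_source EB m)))
  have hGm : ∀ a c w, G a c w m = inner ℝ (fr.e a m) (cov (fr.e c) m w) := fun a c w => by
    simp only [G, constField_self]
  let σ : EB → ∀ m', V m' := fun w m' => cov s' m' (FiberBundle.extend EB
    (E := (TangentSpace 𝓘(ℝ, EB) : M → Type _)) (x := m) w m')
  have hσ : ∀ w, MDiffAt (T% (σ w)) m := by
    intro w
    have h := contMDiffAt_cov (cov := cov) hU hmU hsU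
      (contMDiffAt_constField m w (mem_chart_source EB m))
    refine (h.congr_of_eventuallyEq ?_).mdifferentiableAt (by simp)
    filter_upwards [hchart] with m' hm'
    exact congrArg (fun z => (⟨m', cov s' m' z⟩ : TotalSpace F V)) (extend_eq_constField m w hm')
  have hcoef : ∀ (a : Fin n) (w : EB), (fun m' => (inner ℝ (fr.e a m') (σ w m') : ℝ)) =ᶠ[𝓝 m]
      fun m' => mvfderiv 𝓘(ℝ, EB) (f a) m' (constField (EB := EB) m w m')
        + ∑ c, f c m' * G a c w m' := by
    intro a w
    filter_upwards [hchart, fr.W.isOpen.mem_nhds hm, hU.mem_nhds hmU] with m' h1 h2 h3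
    refine (congrArg (fun z => inner ℝ (fr.e a m') (cov s' m' z))
      (extend_eq_constField m w h1)).trans ?_
    exact inner_cov hcov fr h2 ((hsU.contMDiffAt (hU.mem_nhds h3)).mdifferentiableAt (by simp)) a _
  have hdf : ∀ (a : Fin n) (w : EB), MDifferentiableAt 𝓘(ℝ, EB) 𝓘(ℝ, ℝ)
      (fun m' => mvfderiv 𝓘(ℝ, EB) (f a) m' (constField (EB := EB) m w m')) m :=
    fun a w => mdifferentiableAt_mvfderiv_constField (hf a) w
  have hterm : ∀ u w : EB, inner ℝ (fr.e a m) (cov (σ w) m u)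
      = mvfderiv 𝓘(ℝ, EB) (fun m' => mvfderiv 𝓘(ℝ, EB) (f a) m' (constField (EB := EB) m w m')) m u
        + ∑ c, (mvfderiv 𝓘(ℝ, EB) (f c) m u * G a c w m)
        + mvfderiv 𝓘(ℝ, EB) (G a b w) m u
        + ∑ c, (mvfderiv 𝓘(ℝ, EB) (f c) m w * G a c u m + G a c u m * G c b w m) := by
    intro u w
    have h1 := inner_cov hcov fr hm (hσ w) a u
    have h2 : mvfderiv 𝓘(ℝ, EB) (fun m' => (inner ℝ (fr.e a m') (σ w m') : ℝ)) m u
      = mvfderiv 𝓘(ℝ, EB) (fun m' => mvfderiv 𝓘(ℝ, EB) (f a) m' (constField (EB := EB) m w m')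
        + ∑ c, f c m' * G a c w m') m u := DFunLike.congr_fun (hcoef a w).mfderiv_eq u
    rw [h1, h2, (mvfderiv_add_sum_mul Finset.univ (hdf a w)
      (fun c => (hf c).mdifferentiableAt (by simp))
      (fun c => (hG a c w).mdifferentiableAt (by simp)) u).2, Finset.sum_add_distrib]
    have h3 : ∑ c, f c m * mvfderiv 𝓘(ℝ, EB) (G a c w) m u = mvfderiv 𝓘(ℝ, EB) (G a b w) m u := by
      simp [hfm]
    rw [h3, ← add_assoc]
    congr 1
    refine Finset.sum_congr rfl fun c _ => ?_
    have h4 : (inner ℝ (fr.e c m) (σ w m) : ℝ)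
        = mvfderiv 𝓘(ℝ, EB) (f c) m (w : TangentSpace 𝓘(ℝ, EB) m) + G c b w m := by
      refine (hcoef c w).self_of_nhds.trans ?_
      simp only [constField_self, hfm, ite_mul, one_mul, zero_mul, Finset.sum_ite_eq',
        Finset.mem_univ, if_true]
    refine (congrArg₂ (· * ·) h4 (hGm a c u).symm).trans ?_
    ring
  have hbr : VectorField.mlieBracket 𝓘(ℝ, EB)
      (FiberBundle.extend EB (E := (TangentSpace 𝓘(ℝ, EB) : M → Type _)) u)
      (FiberBundle.extend EB (E := (TangentSpace 𝓘(ℝ, EB) : M → Type _)) w) m = 0 := by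
    rw [← mlieBracket_constField (EB := EB) m u w]
    refine Filter.EventuallyEq.mlieBracket_vectorField_eq ?_ ?_
    · filter_upwards [hchart] with m' hm' using extend_eq_constField m _ hm'
    · filter_upwards [hchart] with m' hm' using extend_eq_constField m _ hm'
  have hcurv : curvature cov m u w (fr.e b m) = cov (σ w) m u - cov (σ u) m w := by
    unfold curvature
    simp only []
    rw [hbr, map_zero, sub_zero]
  -- Under exchange of `u` and `w` the second derivatives of `f a` agree, and the products of a
  -- first derivative of `f` with a connection coefficient are symmetric in total. Only `dA + A ∧ A`
  -- survives.
  have hc := mvfderiv_constField_comm (EB := EB) (hf a) u w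
  rw [hcurv, inner_sub_right]
  refine (congrArg₂ (· - ·) (hterm u w) (hterm w u)).trans ?_
  refine Eq.trans ?_ (congrArg₂ (· + ·) rfl (Finset.sum_congr rfl fun c _ =>
    congrArg₂ (· - ·) (congrArg₂ (· * ·) (hGm a c u) (hGm c b w))
      (congrArg₂ (· * ·) (hGm a c w) (hGm c b u))))
  simp only [Finset.sum_add_distrib, Finset.sum_sub_distrib]
  linear_combination hc

end Frames

/-! ### Local models of the connection by globally defined functions -/

section LocalModel

set_option linter.unusedSectionVars false

open Filter Topology

variable {EB : Type*} [NormedAddCommGroup EB] [NormedSpace ℝ EB] [FiniteDimensional ℝ EB]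
  {M : Type*} [TopologicalSpace M] [ChartedSpace EB M] [IsManifold 𝓘(ℝ, EB) ∞ M] [T2Space M]

/-- Smooth functions that restrict to linear coordinates near a point, and the expression of
tangent vectors through them. -/
theorem exists_base_coordinates (m₀ : M) :
    ∃ (d : ℕ) (β : Fin d → EB) (y : Fin d → C^∞⟮𝓘(ℝ, EB), M; 𝓘(ℝ, ℝ), ℝ⟯), ∀ᶠ m in 𝓝 m₀,
      (∀ i u, mvfderiv 𝓘(ℝ, EB) (y i) m (constField m₀ u m)
        = mvfderiv 𝓘(ℝ, EB) (y i) m₀ (u : TangentSpace 𝓘(ℝ, EB) m₀)) ∧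
      ∀ u : TangentSpace 𝓘(ℝ, EB) m,
        u = ∑ i, mvfderiv 𝓘(ℝ, EB) (y i) m u • constField m₀ (β i) m := by
  set d := Module.finrank ℝ EB
  let b : Module.Basis (Fin d) ℝ EB := Module.finBasis ℝ EB
  let ℓ : Fin d → EB →L[ℝ] ℝ := fun i => (b.coord i).toContinuousLinearMap
  have hy : ∀ i, ∃ g : C^∞⟮𝓘(ℝ, EB), M; 𝓘(ℝ, ℝ), ℝ⟯,
      g =ᶠ[𝓝 m₀] fun m => ℓ i (extChartAt 𝓘(ℝ, EB) m₀ m) := fun i =>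
    exists_smooth_germ_eq (chartAt EB m₀).open_source (mem_chart_source EB m₀)
      ((ℓ i).contDiff.contMDiff.comp_contMDiffOn (contMDiffOn_extChartAt))
  choose y hy using hy
  have hd : ∀ᶠ m in 𝓝 m₀, ∀ i (u : EB), mvfderiv 𝓘(ℝ, EB) (y i) m (constField m₀ u m) = ℓ i u := by
    have h1 : ∀ᶠ m in 𝓝 m₀, ∀ i, y i =ᶠ[𝓝 m] fun m => ℓ i (extChartAt 𝓘(ℝ, EB) m₀ m) :=
      eventually_all.2 fun i => (hy i).eventually_nhds
    filter_upwards [h1, (chartAt EB m₀).open_source.mem_nhds (mem_chart_source EB m₀)]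
      with m hm hs i u
    rw [mvfderiv_constField m₀ u hs ((y i).contMDiff.mdifferentiableAt (by simp))]
    have hms : m ∈ (extChartAt 𝓘(ℝ, EB) m₀).source := by rwa [extChartAt_source]
    have h2 : (y i ∘ (extChartAt 𝓘(ℝ, EB) m₀).symm) =ᶠ[𝓝 (extChartAt 𝓘(ℝ, EB) m₀ m)] ℓ i := by
      have hc : Tendsto (extChartAt 𝓘(ℝ, EB) m₀).symm (𝓝 (extChartAt 𝓘(ℝ, EB) m₀ m)) (𝓝 m) := by
        have := (continuousAt_extChartAt_symm' (I := 𝓘(ℝ, EB)) hms).tendsto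
        rwa [(extChartAt 𝓘(ℝ, EB) m₀).left_inv hms] at this
      filter_upwards [hc.eventually (hm i), (isOpen_extChartAt_target (I := 𝓘(ℝ, EB)) m₀).mem_nhds
        ((extChartAt 𝓘(ℝ, EB) m₀).map_source hms)] with z h3 h4
      exact h3.trans (congrArg (ℓ i) ((extChartAt 𝓘(ℝ, EB) m₀).right_inv h4))
    rw [h2.fderiv_eq, ContinuousLinearMap.fderiv]
  refine ⟨d, b, y, ?_⟩
  filter_upwards [hd, (chartAt EB m₀).open_source.mem_nhds (mem_chart_source EB m₀)] with m hm hs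
  refine ⟨fun i u => ?_, fun u => ?_⟩
  · have h0 := hd.self_of_nhds i u
    rw [constField_self] at h0
    rw [hm, h0]
  · let e := trivializationAt EB (TangentSpace 𝓘(ℝ, EB) : M → Type _) m₀
    let w : EB := e.continuousLinearMapAt ℝ m u
    have hu : constField m₀ w m = u := e.symmL_continuousLinearMapAt (R := ℝ) (b := m) hs u
    have hw : w = ∑ i, b.repr w i • b i := (b.sum_repr w).symm
    have h1 : ∀ i, mvfderiv 𝓘(ℝ, EB) (y i) m u = b.repr w i := fun i => by
      rw [← hu]
      exact hm i w
    simp only [h1]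
    conv_lhs => rw [← hu, hw]
    simp only [constField, map_sum, map_smul]

variable {F : Type*} [NormedAddCommGroup F] [NormedSpace ℝ F] [FiniteDimensional ℝ F]
  {V : M → Type*} [TopologicalSpace (TotalSpace F V)]
  [∀ m, NormedAddCommGroup (V m)] [∀ m, InnerProductSpace ℝ (V m)]
  [FiberBundle F V] [VectorBundle ℝ F V] [ContMDiffVectorBundle ∞ F V 𝓘(ℝ, EB)]
  [IsContMDiffRiemannianBundle 𝓘(ℝ, EB) ∞ F V]
  {n : ℕ} {o : ∀ m, Orientation ℝ (V m) (Fin n)}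

/-- Global sections and functions that describe the frame and its connection form over `O`. -/
structure LocalModel (fr : OrthoFrame EB F o) (cov : CovariantDerivative 𝓘(ℝ, EB) F V) where
  O : TopologicalSpace.Opens M
  le : O ≤ fr.W
  s : Fin n → ∀ m, V m
  smooth : ∀ a, CMDiff ∞ (T% (s a))
  s_eq : ∀ m ∈ O, ∀ a, s a m = fr.e a m
  d : ℕ
  y : Fin d → C^∞⟮𝓘(ℝ, EB), M; 𝓘(ℝ, ℝ), ℝ⟯
  A : Fin n → Fin n → Fin d → C^∞⟮𝓘(ℝ, EB), M; 𝓘(ℝ, ℝ), ℝ⟯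
  antisymm : ∀ a b i, A a b i = -A b a i
  A_eq : ∀ m ∈ O, ∀ a b (u : TangentSpace 𝓘(ℝ, EB) m),
    inner ℝ (fr.e a m) (cov (fr.e b) m u) = ∑ i, A a b i m * mvfderiv 𝓘(ℝ, EB) (y i) m u

variable {cov : CovariantDerivative 𝓘(ℝ, EB) F V}
  [CovariantDerivative.ContMDiffCovariantDerivative cov ∞]

/-- The connection coefficients along coordinate fields are cut off to global functions `c a b i`
and replaced by `½ (c a b i - c b a i)`. This changes nothing near `m₀`, where they are
antisymmetric already, and makes antisymmetry hold globally as an identity of functions. -/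
theorem exists_localModel (hcov : cov.IsMetricCompatible) (fr : OrthoFrame EB F o) {m₀ : M}
    (hm : m₀ ∈ fr.W) : ∃ L : LocalModel fr cov, m₀ ∈ L.O := by
  obtain ⟨d, β, y, hy⟩ := exists_base_coordinates (EB := EB) m₀
  have hs : ∀ a, ∃ s' : ∀ m, V m, CMDiff ∞ (T% s') ∧ ∀ᶠ m in 𝓝 m₀, s' m = fr.e a m := fun a =>
    exists_contMDiff_section_eq fr.W.isOpen hm (fr.isFrame.contMDiffOn a)
  choose s hs hse using hs
  have hc : ∀ a b i, ∃ g : C^∞⟮𝓘(ℝ, EB), M; 𝓘(ℝ, ℝ), ℝ⟯, g =ᶠ[𝓝 m₀] fun m =>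
      (inner ℝ (fr.e a m) (cov (fr.e b) m (constField m₀ (β i) m)) : ℝ) := by
    intro a b i
    refine exists_smooth_germ_eq (fr.W.isOpen.inter (chartAt EB m₀).open_source)
      ⟨hm, mem_chart_source EB m₀⟩ fun m hm' => ContMDiffAt.contMDiffWithinAt ?_
    exact (fr.contMDiffAt hm'.1 a).inner_bundle (contMDiffAt_cov fr.W.isOpen hm'.1
      (fr.isFrame.contMDiffOn b) (contMDiffAt_constField m₀ (β i) hm'.2))
  choose c hc using hc
  have hev : ∀ᶠ m in 𝓝 m₀, m ∈ fr.W ∧ (∀ a, s a m = fr.e a m) ∧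
      ∀ a b (u : TangentSpace 𝓘(ℝ, EB) m), inner ℝ (fr.e a m) (cov (fr.e b) m u)
        = ∑ i, ((1 / 2 : ℝ) • (c a b i - c b a i)) m * mvfderiv 𝓘(ℝ, EB) (y i) m u := by
    have h1 : ∀ᶠ m in 𝓝 m₀, ∀ a, s a m = fr.e a m := eventually_all.2 hse
    have h2 : ∀ᶠ m in 𝓝 m₀, ∀ a b i, c a b i m =
        (inner ℝ (fr.e a m) (cov (fr.e b) m (constField m₀ (β i) m)) : ℝ) :=
      eventually_all.2 fun a => eventually_all.2 fun b => eventually_all.2 fun i => hc a b i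
    filter_upwards [fr.W.isOpen.mem_nhds hm, h1, h2, hy] with m hW h1 h2 hy
    refine ⟨hW, h1, fun a b u => ?_⟩
    have h3 : ∀ i, ((1 / 2 : ℝ) • (c a b i - c b a i)) m
        = inner ℝ (fr.e a m) (cov (fr.e b) m (constField m₀ (β i) m)) := by
      intro i
      have h4 : ((1 / 2 : ℝ) • (c a b i - c b a i)) m = (1 / 2) * (c a b i m - c b a i m) := rfl
      rw [h4, h2, h2, inner_cov_frame hcov fr hW b a]
      ring
    simp only [h3]
    conv_lhs => rw [hy.2 u]
    simp only [map_sum, map_smul, inner_sum, inner_smul_right]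
    exact Finset.sum_congr rfl fun i _ => mul_comm _ _
  obtain ⟨U, hU, hUo, hmU⟩ := eventually_nhds_iff.1 hev
  exact ⟨⟨⟨U, hUo⟩, fun m h => (hU m h).1, s, hs, fun m h => (hU m h).2.1, d, y,
    fun a b i => (1 / 2 : ℝ) • (c a b i - c b a i), fun a b i => by
      rw [← smul_neg, neg_sub], fun m h => (hU m h).2.2⟩, hmU⟩

/-- The curvature through the coefficient functions of a local model. -/
theorem LocalModel.inner_curvature (hcov : cov.IsMetricCompatible) {fr : OrthoFrame EB F o}
    (L : LocalModel fr cov) {m : M} (hm : m ∈ L.O) (a b : Fin n) (u w : TangentSpace 𝓘(ℝ, EB) m) :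
    inner ℝ (fr.e a m) (curvature cov m u w (fr.e b m))
      = ∑ i, (mvfderiv 𝓘(ℝ, EB) (L.A a b i) m u * mvfderiv 𝓘(ℝ, EB) (L.y i) m w
          - mvfderiv 𝓘(ℝ, EB) (L.A a b i) m w * mvfderiv 𝓘(ℝ, EB) (L.y i) m u)
        + ∑ c, ((inner ℝ (fr.e a m) (cov (fr.e c) m u) : ℝ) * inner ℝ (fr.e c m) (cov (fr.e b) m w)
          - (inner ℝ (fr.e a m) (cov (fr.e c) m w) : ℝ)
            * inner ℝ (fr.e c m) (cov (fr.e b) m u)) := by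
  rw [MathaiQuillen.inner_curvature hcov fr (L.le hm)]
  congr 1
  have key : ∀ u w : EB, mvfderiv 𝓘(ℝ, EB) (fun m' =>
      (inner ℝ (fr.e a m') (cov (fr.e b) m' (constField (EB := EB) m w m')) : ℝ)) m u
      = ∑ i, (mvfderiv 𝓘(ℝ, EB) (L.A a b i) m u * mvfderiv 𝓘(ℝ, EB) (L.y i) m w
        + L.A a b i m * mvfderiv 𝓘(ℝ, EB) (fun m' =>
          mvfderiv 𝓘(ℝ, EB) (L.y i) m' (constField (EB := EB) m w m')) m u) := by
    intro u w
    have h1 : (fun m' =>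
      (inner ℝ (fr.e a m') (cov (fr.e b) m' (constField (EB := EB) m w m')) : ℝ)) =ᶠ[𝓝 m]
        fun m' => 0 + ∑ i, L.A a b i m' *
          mvfderiv 𝓘(ℝ, EB) (L.y i) m' (constField (EB := EB) m w m') := by
      filter_upwards [L.O.isOpen.mem_nhds hm] with m' hm'
      rw [zero_add]
      exact L.A_eq m' hm' a b _
    refine (DFunLike.congr_fun h1.mfderiv_eq u).trans ?_
    refine (mvfderiv_add_sum_mul Finset.univ mdifferentiableAt_const
      (fun i => (L.A a b i).contMDiff.mdifferentiableAt (by simp))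
      (fun i => mdifferentiableAt_mvfderiv_constField (L.y i).contMDiff.contMDiffAt w) u).2.trans ?_
    rw [mvfderiv_const]
    simp only [constField_self]
    exact zero_add _
  refine (congrArg₂ (· - ·) (key u w) (key w u)).trans ?_
  rw [← Finset.sum_sub_distrib]
  refine Finset.sum_congr rfl fun i _ => ?_
  -- The second derivatives of the functions `y i` cancel, which leaves `∑ dA ∧ dy`.
  have h := mvfderiv_constField_comm (EB := EB) (L.y i).contMDiff.contMDiffAt (m₀ := m) u w
  linear_combination (L.A a b i m) * h

end LocalModel

/-! ### The Mathai–Quillen form of a local model -/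

section LocalForm

set_option linter.unusedSectionVars false

open Filter Topology

variable {EB : Type*} [NormedAddCommGroup EB] [NormedSpace ℝ EB] [FiniteDimensional ℝ EB]
  {M : Type*} [TopologicalSpace M] [ChartedSpace EB M] [IsManifold 𝓘(ℝ, EB) ∞ M] [T2Space M]
  {F : Type*} [NormedAddCommGroup F] [NormedSpace ℝ F] [FiniteDimensional ℝ F]
  {V : M → Type*} [TopologicalSpace (TotalSpace F V)]
  [∀ m, NormedAddCommGroup (V m)] [∀ m, InnerProductSpace ℝ (V m)]
  [FiberBundle F V] [VectorBundle ℝ F V] [ContMDiffVectorBundle ∞ F V 𝓘(ℝ, EB)]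
  [IsContMDiffRiemannianBundle 𝓘(ℝ, EB) ∞ F V]
  {n : ℕ} {o : ∀ m, Orientation ℝ (V m) (Fin n)}

-- Bump functions on the total space require this. Points of one fibre are separated inside a
-- trivialization, other points through the projection.
variable (F V) in
theorem t2Space_totalSpace : T2Space (TotalSpace F V) := by
  refine ⟨fun v w hvw => ?_⟩
  by_cases h : v.proj = w.proj
  · let e := trivializationAt F V v.proj
    have hv : v ∈ e.source := (e.mem_source).2 (FiberBundle.mem_baseSet_trivializationAt' v.proj)
    have hw : w ∈ e.source := (e.mem_source).2 (h ▸ FiberBundle.mem_baseSet_trivializationAt' v.proj)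
    have hne : e v ≠ e w := fun h' => hvw (e.injOn hv hw h')
    obtain ⟨U, U', h1, h2, h3, h4, h5⟩ := t2_separation hne
    exact ⟨_, _, e.toOpenPartialHomeomorph.isOpen_inter_preimage h1,
      e.toOpenPartialHomeomorph.isOpen_inter_preimage h2, ⟨hv, h3⟩, ⟨hw, h4⟩,
      (h5.preimage _).mono Set.inter_subset_right Set.inter_subset_right⟩
  · obtain ⟨U, U', h1, h2, h3, h4, h5⟩ := t2_separation h
    have hc := FiberBundle.continuous_proj F V
    exact ⟨_, _, h1.preimage hc, h2.preimage hc, h3, h4, h5.preimage _⟩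

variable (EB F V) in
/-- Smooth functions on the total space. -/
abbrev TotalFun : Type _ := C^∞⟮𝓘(ℝ, EB).prod 𝓘(ℝ, F), TotalSpace F V; 𝓘(ℝ, ℝ), ℝ⟯

variable (EB F V) in
/-- Pullback of functions along the bundle projection. -/
def pullProj : C^∞⟮𝓘(ℝ, EB), M; 𝓘(ℝ, ℝ), ℝ⟯ →ₐ[ℝ] TotalFun EB F V where
  toFun f := f.comp ⟨TotalSpace.proj, contMDiff_proj V⟩
  map_one' := rfl
  map_mul' _ _ := rfl
  map_zero' := rfl
  map_add' _ _ := rfl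
  commutes' _ := rfl

/-- The fibrewise linear function given by a section. -/
def fibreLinear (s : ∀ m, V m) (hs : CMDiff ∞ (T% s)) : TotalFun EB F V :=
  ⟨fun v => inner ℝ (s v.proj) v.snd, by
    have h1 : ContMDiff (𝓘(ℝ, EB).prod 𝓘(ℝ, F)) (𝓘(ℝ, EB).prod 𝓘(ℝ, F)) ∞
        (fun v : TotalSpace F V => (⟨v.proj, s v.proj⟩ : TotalSpace F V)) :=
      hs.comp (contMDiff_proj V)
    have h2 : ContMDiff (𝓘(ℝ, EB).prod 𝓘(ℝ, F)) (𝓘(ℝ, EB).prod 𝓘(ℝ, F)) ∞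
        (fun v : TotalSpace F V => (⟨v.proj, v.snd⟩ : TotalSpace F V)) := contMDiff_id
    exact h1.inner_bundle h2⟩

variable (EB F V) in
/-- The functions on the total space that are polynomial along the fibres. -/
def fibrePolynomials : Subalgebra ℝ (TotalFun EB F V) :=
  Algebra.adjoin ℝ (Set.range (pullProj EB F V) ∪ {f | ∃ s hs, f = fibreLinear s hs})

theorem pullProj_mem (f : C^∞⟮𝓘(ℝ, EB), M; 𝓘(ℝ, ℝ), ℝ⟯) :
    pullProj EB F V f ∈ fibrePolynomials EB F V :=
  Algebra.subset_adjoin (Or.inl ⟨f, rfl⟩)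

theorem fibreLinear_mem (s : ∀ m, V m) (hs : CMDiff ∞ (T% s)) :
    fibreLinear s hs ∈ fibrePolynomials EB F V :=
  Algebra.subset_adjoin (Or.inr ⟨s, hs, rfl⟩)

theorem OrthoFrame.mqValue_eq_mqExp (fr : OrthoFrame EB F o)
    (cov : CovariantDerivative 𝓘(ℝ, EB) F V) (v : TotalSpace F V)
    (u : Fin n → TangentSpace (𝓘(ℝ, EB).prod 𝓘(ℝ, F)) v) : fr.mqValue cov v u
      = (((2 * Real.pi) ^ (-(n : ℝ) / 2) : ℝ) : ℂ) * body (berezin (List.finRange n)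
        (mqExp (algebraMap ℂ _ (-(1 / 2 : ℂ) * ((‖v.snd‖ ^ 2 : ℝ) : ℂ)))
          (fun a => ∑ j, (fr.nablaX cov a v (u j) : ℂ) • gen j)
          (fun a b => ∑ j, ∑ k, if j < k then
            ((inner ℝ (fr.e a v.proj) (curvature cov v.proj (dproj EB v (u j))
              (dproj EB v (u k)) (fr.e b v.proj)) : ℝ) : ℂ) • (gen j * gen k) else 0))) := by
  rw [mqExp, fibreInt_apply, berezin_keep, body_keep]
  unfold OrthoFrame.mqValue
  simp only [mqExponent, AlgHom.commutes, map_sum, map_smul, rename_gen]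
  refine congrArg (fun z => _ * body (berezin _ (berezin _ (grExp (_ - _ + (1 / 2 : ℂ) • z)))))
    (Finset.sum_congr rfl fun a _ => Finset.sum_congr rfl fun b _ =>
      congrArg (fun z => gen (Sum.inr a) * z * gen (Sum.inr b)) ?_)
  refine Finset.sum_congr rfl fun j _ => Finset.sum_congr rfl fun k _ => ?_
  split_ifs
  · rw [map_smul, map_mul, rename_gen, rename_gen]
  · rw [map_zero]

variable {cov : CovariantDerivative 𝓘(ℝ, EB) F V} {fr : OrthoFrame EB F o}

namespace LocalModel

variable (L : LocalModel fr cov) {κ : Type}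

/-- The coordinates of the tautological section. -/
def x (a : Fin n) : TotalFun EB F V := fibreLinear (L.s a) (L.smooth a)

theorem x_apply {v : TotalSpace F V} (hv : v.proj ∈ L.O) (a : Fin n) :
    L.x a v = fr.coord a v := by
  change inner ℝ (L.s a v.proj) v.snd = _
  rw [L.s_eq _ hv]
  rfl

/-- The connection form at a point of the odd tangent bundle. -/
def conn (h : TotalFun EB F V → Gr (Option κ)) (a b : Fin n) : Gr (Option κ) :=
  ∑ i, h (pullProj EB F V (L.A a b i)) * D (h (pullProj EB F V (L.y i)))

/-- The covariant derivative of the tautological section at a point of the odd tangent bundle. -/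
def nabla (h : TotalFun EB F V → Gr (Option κ)) (a : Fin n) : Gr (Option κ) :=
  D (h (L.x a)) + ∑ b, L.conn h a b * h (L.x b)

/-- The curvature at a point of the odd tangent bundle. -/
def curv (h : TotalFun EB F V → Gr (Option κ)) (a b : Fin n) : Gr (Option κ) :=
  D (L.conn h a b) + ∑ c, L.conn h a c * L.conn h c b

theorem isOdd_conn {h : TotalFun EB F V → Gr (Option κ)} (he : ∀ f, IsEven (h f)) (a b : Fin n) :
    IsOdd (L.conn h a b) :=
  IsOdd.sum fun _ _ => (he _).mul_odd ((he _).der none)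

theorem conn_antisymm (h : TotalFun EB F V →ₐ[ℝ] Gr (Option κ)) (a b : Fin n) :
    L.conn h a b = -L.conn h b a := by
  simp only [conn, ← Finset.sum_neg_distrib]
  refine Finset.sum_congr rfl fun i _ => ?_
  rw [L.antisymm a b i, map_neg, map_neg, neg_mul]

/-- The computation takes place over the ring of fibrewise polynomial functions. The resulting
coefficients are thus known to be polynomial along the fibres, which rapid decrease relies on; for
this reason the Gaussian factor is left out. -/
theorem exists_formalForm : ∃ P : FormalForm (TotalFun EB F V) n,
    (∀ j, P.f j ∈ fibrePolynomials EB F V) ∧ (∀ j a, P.g j a ∈ fibrePolynomials EB F V) ∧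
    ∀ {κ : Type} [Finite κ] (h : TotalFun EB F V →ₐ[ℝ] Gr (Option κ)) (_ : ∀ f, IsEven (h f)),
      P.contract h = mqExp 0 (L.nabla h) (L.curv h) := by
  let R := fibrePolynomials EB F V
  let xR : Fin n → R := fun a => ⟨L.x a, fibreLinear_mem _ _⟩
  let AR : Fin n → Fin n → Fin L.d → R := fun a b i => ⟨_, pullProj_mem (L.A a b i)⟩
  let yR : Fin L.d → R := fun i => ⟨_, pullProj_mem (L.y i)⟩
  let A : Fin n → Fin n → ∀ p : GrPoint R, Gr (Option p.κ) := fun a b p =>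
    ∑ i, p.hom (AR a b i) * D (p.hom (yR i))
  have hA : ∀ a b, A a b ∈ formSpan R 1 := fun a b => by
    have : A a b = ∑ i, (fun p : GrPoint R => p.hom (AR a b i)) * (fun p => D (p.hom (yR i))) := by
      funext p
      simp [A]
    rw [this]
    exact Submodule.sum_mem _ fun i _ =>
      mul_mem_formSpan (j := 0) (k := 1) (hom_mem_formSpan _) (D_hom_mem_formSpan _)
  let B : Fin n → ∀ p : GrPoint R, Gr (Option p.κ) := fun a p =>
    D (p.hom (xR a)) + ∑ b, A a b p * p.hom (xR b)
  have hB : ∀ a, B a ∈ formSpan R 1 := fun a => by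
    have : B a = (fun p : GrPoint R => D (p.hom (xR a)))
        + ∑ b, A a b * (fun p : GrPoint R => p.hom (xR b)) := by
      funext p
      simp [B]
    rw [this]
    exact Submodule.add_mem _ (D_hom_mem_formSpan _) (Submodule.sum_mem _ fun b _ =>
      mul_mem_formSpan (j := 1) (k := 0) (hA a b) (hom_mem_formSpan _))
  let C : Fin n → Fin n → ∀ p : GrPoint R, Gr (Option p.κ) := fun a b p =>
    D (A a b p) + ∑ c, A a c p * A c b p
  have hC : ∀ a b, C a b ∈ formSpan R 2 := fun a b => by
    have : C a b = (fun p : GrPoint R => D (A a b p)) + ∑ c, A a c * A c b := by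
      funext p
      simp [C]
    rw [this]
    exact Submodule.add_mem _ (D_mem_formSpan (hA a b)) (Submodule.sum_mem _ fun c _ =>
      mul_mem_formSpan (j := 1) (k := 1) (hA a c) (hA c b))
  obtain ⟨N, c, f, g, hP⟩ := exists_sum_of_mem_formSpan (mqExp_mem_formSpan hB hC)
  refine ⟨⟨N, c, fun j => (f j).1, fun j a => (g j a).1⟩, fun j => (f j).2, fun j a => (g j a).2,
    fun {κ} _ h he => ?_⟩
  exact (hP ⟨κ, inferInstance, h.comp R.val, fun f => he _⟩).symm

/-- The form `exp(½ |𝐱|²)` times the Mathai–Quillen form, up to a constant. -/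
def preForm : FormalForm (TotalFun EB F V) n := L.exists_formalForm.choose

theorem preForm_f_mem (j) : L.preForm.f j ∈ fibrePolynomials EB F V :=
  L.exists_formalForm.choose_spec.1 j

theorem preForm_g_mem (j a) : L.preForm.g j a ∈ fibrePolynomials EB F V :=
  L.exists_formalForm.choose_spec.2.1 j a

theorem preForm_contract [Finite κ] (h : TotalFun EB F V →ₐ[ℝ] Gr (Option κ))
    (he : ∀ f, IsEven (h f)) : L.preForm.contract h = mqExp 0 (L.nabla h) (L.curv h) :=
  L.exists_formalForm.choose_spec.2.2 h he

/-- The function `exp(-½ |𝐱|²)`. -/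
def gauss : TotalFun EB F V :=
  smoothComp Real.exp Real.contDiff_exp ((-(1 / 2) : ℝ) • ∑ a, L.x a * L.x a)

/-- The Mathai–Quillen form up to a constant. -/
def form : FormalForm (TotalFun EB F V) n :=
  ⟨L.preForm.N, L.preForm.c, fun j => L.gauss * L.preForm.f j, L.preForm.g⟩

/-- The hypothesis that `h` lies over a point enters through the Gaussian: `h` commutes with the
exponential because of its Taylor expansion at `v`. -/
theorem form_contract [Finite κ] {h : TotalFun EB F V →ₐ[ℝ] Gr (Option κ)} {v : TotalSpace F V}
    (hv : LiesOver h v) (he : ∀ f, IsEven (h f)) :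
    L.form.contract h = mqExp (-(1 / 2 : ℂ) • ∑ a, h (L.x a) * h (L.x a)) (L.nabla h)
      (L.curv h) := by
  have := t2Space_totalSpace F V
  have hs : IsEven (-(1 / 2 : ℂ) • ∑ a, h (L.x a) * h (L.x a)) :=
    IsEven.smul _ (IsEven.sum fun a _ => (he _).mul (he _))
  have hg : h L.gauss = grExp (-(1 / 2 : ℂ) • ∑ a, h (L.x a) * h (L.x a)) := by
    rw [gauss, hv.map_exp]
    congr 1
    rw [map_smul, map_sum]
    simp only [map_mul]
    refine Eq.trans (b := ((-(1 / 2) : ℝ) : ℂ) • ∑ a, h (L.x a) * h (L.x a)) rfl ?_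
    congr 1
    push_cast
    ring
  rw [mqExp_eq_mul hs, ← hg, ← L.preForm_contract h he]
  simp only [FormalForm.contract, form, map_mul, Finset.mul_sum, mul_smul_comm, mul_assoc]
  rfl

theorem D_form_contract [Finite κ] {h : TotalFun EB F V →ₐ[ℝ] Gr (Option κ)} {v : TotalSpace F V}
    (hv : LiesOver h v) (he : ∀ f, IsEven (h f)) : D (L.form.contract h) = 0 := by
  rw [L.form_contract hv he]
  exact der_mqExp none (fun a => h (L.x a)) (L.conn h) (fun a => he _)
    (L.isOdd_conn he) (L.conn_antisymm h)

/-! #### Evaluation on tangent vectors -/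

/-- Odd elements anticommute and square to zero, so only antisymmetrised coefficients count. This
yields the sum over `j < k` by which `OrthoFrame.mqValue` represents a two-form. -/
theorem sum_smul_odd_mul {κ : Type} {m : ℕ} {η : Fin m → Gr κ} (hη : ∀ j, IsOdd (η j))
    (T : Fin m → Fin m → ℂ) : ∑ j, ∑ k, T j k • (η j * η k)
      = ∑ j, ∑ k, if j < k then (T j k - T k j) • (η j * η k) else 0 := by
  have h1 : ∀ j k, T j k • (η j * η k) = (if j < k then T j k • (η j * η k) else 0)
      + (if k < j then T j k • (η j * η k) else 0) := by
    intro j k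
    rcases lt_trichotomy j k with h | h | h
    · simp [h, h.not_gt]
    · subst h
      simp [(hη j).mul_self]
    · simp [h, h.not_gt]
  rw [Finset.sum_congr rfl fun j _ => Finset.sum_congr rfl fun k _ => h1 j k]
  simp only [Finset.sum_add_distrib]
  rw [add_comm, Finset.sum_comm, add_comm, ← Finset.sum_add_distrib]
  refine Finset.sum_congr rfl fun j _ => ?_
  rw [← Finset.sum_add_distrib]
  refine Finset.sum_congr rfl fun k _ => ?_
  split_ifs with h
  · rw [(hη k).mul_odd (hη j), sub_smul, smul_neg, ← sub_eq_add_neg]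
  · rw [add_zero]

theorem mvfderiv_pullProj (f : C^∞⟮𝓘(ℝ, EB), M; 𝓘(ℝ, ℝ), ℝ⟯) (v : TotalSpace F V)
    (u : TangentSpace (𝓘(ℝ, EB).prod 𝓘(ℝ, F)) v) :
    mvfderiv (𝓘(ℝ, EB).prod 𝓘(ℝ, F)) (pullProj EB F V f) v u
      = mvfderiv 𝓘(ℝ, EB) f v.proj (dproj EB v u) := by
  have h := mfderiv_comp v (I := 𝓘(ℝ, EB).prod 𝓘(ℝ, F)) (I' := 𝓘(ℝ, EB)) (I'' := 𝓘(ℝ, ℝ))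
    (f := (TotalSpace.proj : TotalSpace F V → M)) (g := f)
    (f.contMDiff.mdifferentiableAt (by simp))
    ((contMDiff_proj V (n := ∞)).mdifferentiableAt (by simp))
  exact DFunLike.congr_fun h u

section Eval

variable {v : TotalSpace F V} (hv : v.proj ∈ L.O)
  {m : ℕ} (u : Fin m → TangentSpace (𝓘(ℝ, EB).prod 𝓘(ℝ, F)) v)
include hv

theorem mvfderiv_x (a : Fin n) (w : TangentSpace (𝓘(ℝ, EB).prod 𝓘(ℝ, F)) v) :
    mvfderiv (𝓘(ℝ, EB).prod 𝓘(ℝ, F)) (L.x a) v w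
      = (show ℝ from mfderiv (𝓘(ℝ, EB).prod 𝓘(ℝ, F)) 𝓘(ℝ, ℝ) (fr.coord a) v w) := by
  have h : (L.x a : TotalSpace F V → ℝ) =ᶠ[𝓝 v] fr.coord a := by
    filter_upwards [(L.O.isOpen.preimage (FiberBundle.continuous_proj F V)).mem_nhds hv] with w hw
      using L.x_apply hw a
  exact DFunLike.congr_fun h.mfderiv_eq w

theorem connForm_eq (a b : Fin n) (w : TangentSpace (𝓘(ℝ, EB).prod 𝓘(ℝ, F)) v) :
    fr.connForm cov a b v w = ∑ i, L.A a b i v.proj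
      * mvfderiv (𝓘(ℝ, EB).prod 𝓘(ℝ, F)) (pullProj EB F V (L.y i)) v w := by
  simp only [mvfderiv_pullProj]
  exact L.A_eq _ hv a b _

theorem atZero_conn_tangentPoint (a b : Fin n) : atZero (L.conn (tangentPoint v u) a b)
    = ∑ j, (fr.connForm cov a b v (u j) : ℂ) • gen j := by
  simp only [conn, map_sum, map_mul, atZero_tangentPoint, D_tangentPoint, map_smul,
    atZero_gen_some, L.connForm_eq hv, Complex.ofReal_sum, Complex.ofReal_mul, Finset.sum_smul,
    ← Algebra.smul_def, Finset.smul_sum, smul_smul]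
  exact Finset.sum_comm

theorem nablaX_eq (a : Fin n) (w : TangentSpace (𝓘(ℝ, EB).prod 𝓘(ℝ, F)) v) :
    fr.nablaX cov a v w = mvfderiv (𝓘(ℝ, EB).prod 𝓘(ℝ, F)) (L.x a) v w
      + ∑ b, fr.coord b v * fr.connForm cov a b v w := by
  rw [L.mvfderiv_x hv]
  rfl

theorem atZero_nabla_tangentPoint (a : Fin n) : atZero (L.nabla (tangentPoint v u) a)
    = ∑ j, (fr.nablaX cov a v (u j) : ℂ) • gen j := by
  rw [nabla, map_add, D_tangentPoint, map_sum, map_sum]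
  simp only [map_mul, L.atZero_conn_tangentPoint hv, atZero_tangentPoint, map_smul,
    atZero_gen_some, L.x_apply hv]
  simp only [L.nablaX_eq hv, Complex.ofReal_add, Complex.ofReal_sum, Complex.ofReal_mul, add_smul,
    Finset.sum_smul, Finset.sum_add_distrib]
  congr 1
  rw [Finset.sum_comm]
  refine Finset.sum_congr rfl fun b _ => ?_
  rw [← (isEven_algebraMap _).commute, ← Algebra.smul_def, Finset.smul_sum]
  simp only [smul_smul]

variable [CovariantDerivative.ContMDiffCovariantDerivative cov ∞]

/-- At a tangent point the odd variables antisymmetrise `dA + A A` in `u j` and `u k`, and the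
outcome is the frame formula of `LocalModel.inner_curvature`. -/
theorem atZero_curv_tangentPoint (hcov : cov.IsMetricCompatible) (a b : Fin n) :
    atZero (L.curv (tangentPoint v u) a b) = ∑ j, ∑ k, if j < k then
      ((inner ℝ (fr.e a v.proj)
        (curvature cov v.proj (dproj EB v (u j)) (dproj EB v (u k)) (fr.e b v.proj)) : ℝ) : ℂ)
          • (gen j * gen k) else 0 := by
  have h1 : atZero (D (L.conn (tangentPoint v u) a b)) = ∑ j, ∑ k, (∑ i,
      ((mvfderiv 𝓘(ℝ, EB) (L.A a b i) v.proj (dproj EB v (u j))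
        * mvfderiv 𝓘(ℝ, EB) (L.y i) v.proj (dproj EB v (u k)) : ℝ) : ℂ)) • (gen j * gen k) := by
    have h2 : ∀ i, atZero (D (tangentPoint v u (pullProj EB F V (L.A a b i))
        * D (tangentPoint v u (pullProj EB F V (L.y i)))))
        = ∑ j, ∑ k, ((mvfderiv 𝓘(ℝ, EB) (L.A a b i) v.proj (dproj EB v (u j))
          * mvfderiv 𝓘(ℝ, EB) (L.y i) v.proj (dproj EB v (u k)) : ℝ) : ℂ) • (gen j * gen k) := by
      intro i
      refine (congrArg atZero ((isEven_tangentPoint v u _).der_mul none _)).trans ?_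
      rw [show der none (D (tangentPoint v u (pullProj EB F V (L.y i)))) = 0 from der_der _ _,
        mul_zero, add_zero]
      change atZero (D _ * D _) = _
      simp only [D_tangentPoint, map_mul, map_sum, map_smul, atZero_gen_some, mvfderiv_pullProj,
        Finset.sum_mul_sum, smul_mul_smul_comm, Complex.ofReal_mul]
    simp only [conn, map_sum, h2, Finset.sum_smul]
    rw [Finset.sum_comm]
    exact Finset.sum_congr rfl fun j _ => Finset.sum_comm
  have h3 : atZero (∑ c, L.conn (tangentPoint v u) a c * L.conn (tangentPoint v u) c b)
      = ∑ j, ∑ k, (∑ c, ((fr.connForm cov a c v (u j) * fr.connForm cov c b v (u k) : ℝ) : ℂ))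
        • (gen j * gen k) := by
    simp only [map_sum, map_mul, L.atZero_conn_tangentPoint hv, Finset.sum_mul_sum,
      smul_mul_smul_comm, Complex.ofReal_mul, Finset.sum_smul]
    rw [Finset.sum_comm]
    exact Finset.sum_congr rfl fun j _ => Finset.sum_comm
  rw [curv, map_add, h1, h3]
  simp only [← Finset.sum_add_distrib, ← add_smul]
  rw [sum_smul_odd_mul (fun j => isOdd_gen j)]
  refine Finset.sum_congr rfl fun j _ => Finset.sum_congr rfl fun k _ => ?_
  split_ifs
  · congr 1
    rw [L.inner_curvature hcov hv]
    simp only [Finset.sum_sub_distrib, Complex.ofReal_add, Complex.ofReal_sub, Complex.ofReal_sum]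
    simp only [OrthoFrame.connForm]
    ring
  · rfl

/-- The form of a local model is the Mathai–Quillen form. -/
theorem mqValue_eq (hcov : cov.IsMetricCompatible)
    (u : Fin n → TangentSpace (𝓘(ℝ, EB).prod 𝓘(ℝ, F)) v) : fr.mqValue cov v u
      = (((2 * Real.pi) ^ (-(n : ℝ) / 2) : ℝ) : ℂ) * L.form.eval v u := by
  have hnorm : ‖v.snd‖ ^ 2 = ∑ a, fr.coord a v * fr.coord a v := by
    rw [← real_inner_self_eq_norm_sq, ← fr.sum_inner_mul (L.le hv)]
    refine Finset.sum_congr rfl fun a _ => ?_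
    rw [real_inner_comm]
    rfl
  rw [FormalForm.eval_eq_body_berezin, L.form_contract (liesOver_tangentPoint v u)
    (isEven_tangentPoint v u)]
  unfold atZero
  rw [← mqExp_keep, fr.mqValue_eq_mqExp]
  change _ = _ * body (berezin _ (mqExp (atZero _) (fun a => atZero _) (fun a b => atZero _)))
  simp only [L.atZero_nabla_tangentPoint hv, L.atZero_curv_tangentPoint hv u hcov]
  have hs : (atZero (-(1 / 2 : ℂ) • ∑ a, tangentPoint v u (L.x a) * tangentPoint v u (L.x a)) :
      Gr (Fin n)) = algebraMap ℂ _ (-(1 / 2 : ℂ) * ((‖v.snd‖ ^ 2 : ℝ) : ℂ)) := by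
    rw [hnorm]
    rw [map_smul, Algebra.smul_def]
    simp only [map_sum, map_mul, atZero_tangentPoint, L.x_apply hv, Complex.ofReal_sum,
      Complex.ofReal_mul]
  rw [hs]

end Eval

end LocalModel

end LocalForm

/-! ### Independence of the frame -/

section FrameChange

set_option linter.unusedSectionVars false

open Filter Topology

variable {EB : Type*} [NormedAddCommGroup EB] [NormedSpace ℝ EB] [FiniteDimensional ℝ EB]
  {M : Type*} [TopologicalSpace M] [ChartedSpace EB M] [IsManifold 𝓘(ℝ, EB) ∞ M] [T2Space M]
  {F : Type*} [NormedAddCommGroup F] [NormedSpace ℝ F] [FiniteDimensional ℝ F]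
  {V : M → Type*} [TopologicalSpace (TotalSpace F V)]
  [∀ m, NormedAddCommGroup (V m)] [∀ m, InnerProductSpace ℝ (V m)]
  [FiberBundle F V] [VectorBundle ℝ F V] [ContMDiffVectorBundle ∞ F V 𝓘(ℝ, EB)]
  [IsContMDiffRiemannianBundle 𝓘(ℝ, EB) ∞ F V]
  {n : ℕ} {o : ∀ m, Orientation ℝ (V m) (Fin n)}
  {cov : CovariantDerivative 𝓘(ℝ, EB) F V}

theorem extend_add_smul {m m' : M} (hm' : m' ∈ (trivializationAt F V m).baseSet) (c : ℝ)
    (s t : V m) : FiberBundle.extend F (c • s + t) m'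
      = (c • FiberBundle.extend F s + FiberBundle.extend F t) m' := by
  have hm := FiberBundle.mem_baseSet_trivializationAt' (F := F) (E := V) m
  have h1 := (trivializationAt F V m).linear ℝ hm
  have h2 : (trivializationAt F V m ⟨m, c • s + t⟩).2
      = c • (trivializationAt F V m ⟨m, s⟩).2 + (trivializationAt F V m ⟨m, t⟩).2 := by
    rw [← h1.map_smul, ← h1.map_add]
  have h3 : ∀ y : F, (trivializationAt F V m).symm m' y
      = (trivializationAt F V m).symmₗ ℝ m' y := fun y => by
    rw [Trivialization.symmₗ_apply _ hm']
  unfold FiberBundle.extend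
  simp only [Pi.add_apply, Pi.smul_apply]
  rw [h2, h3, h3, h3, map_add, map_smul]

theorem mdifferentiableAt_const_smul {m : M} {s : ∀ m, V m} (hs : MDiffAt (T% s) m) (c : ℝ) :
    MDiffAt (T% (c • s)) m := by
  exact MDifferentiableAt.smul_const_section hs

theorem cov_add_smul {m : M} (c : ℝ) {s t : ∀ m, V m} (hs : MDiffAt (T% s) m)
    (ht : MDiffAt (T% t) m) : cov (c • s + t) m = c • cov s m + cov t m := by
  have h := cov.isCovariantDerivativeOnUniv
  have hcs : MDiffAt (T% (c • s)) m := mdifferentiableAt_const_smul hs c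
  rw [h.add hcs ht, h.smul_const c hs]

variable [CovariantDerivative.ContMDiffCovariantDerivative cov ∞]

/-- The definition uses a chosen extension of the vector, so linearity has to be proved. Extensions
are linear in the vector over the whole base set of the trivialization, with constant coefficients;
linearity of the connection over constants is then enough, and tensoriality is not needed. -/
theorem curvature_add_smul (m : M) (u w : TangentSpace 𝓘(ℝ, EB) m) (c : ℝ) (s t : V m) :
    curvature cov m u w (c • s + t) = c • curvature cov m u w s + curvature cov m u w t := by
  have hU : IsOpen (trivializationAt F V m).baseSet := (trivializationAt F V m).open_baseSet
  have hmU : m ∈ (trivializationAt F V m).baseSet := FiberBundle.mem_baseSet_trivializationAt' m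
  have hext : ∀ (s : V m), ∀ m' ∈ (trivializationAt F V m).baseSet,
      MDiffAt (T% (FiberBundle.extend F s)) m' := fun s m' hm' =>
    ((contMDiffOn_extend s).contMDiffAt (hU.mem_nhds hm')).mdifferentiableAt (by simp)
  let σ : V m → EB → ∀ m', V m' := fun s w m' =>
    cov (FiberBundle.extend F s) m'
      (FiberBundle.extend EB (E := (TangentSpace 𝓘(ℝ, EB) : M → Type _)) (x := m) w m')
  have hσ : ∀ s w, MDiffAt (T% (σ s w)) m := by
    intro s w
    have h := contMDiffAt_cov (cov := cov) hU hmU (contMDiffOn_extend s)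
      (contMDiffAt_constField m w (mem_chart_source EB m))
    refine (h.congr_of_eventuallyEq ?_).mdifferentiableAt (by simp)
    filter_upwards [(chartAt EB m).open_source.mem_nhds (mem_chart_source EB m)] with m' hm'
    exact congrArg (fun z => (⟨m', cov (FiberBundle.extend F s) m' z⟩ : TotalSpace F V))
      (extend_eq_constField m w hm')
  have hext' : ∀ m' ∈ (trivializationAt F V m).baseSet, cov (FiberBundle.extend F (c • s + t)) m'
      = c • cov (FiberBundle.extend F s) m' + cov (FiberBundle.extend F t) m' := by
    intro m' hm'
    have he : ∀ᶠ m'' in 𝓝 m', FiberBundle.extend F (c • s + t) m''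
        = (c • FiberBundle.extend F s + FiberBundle.extend F t) m'' := by
      filter_upwards [hU.mem_nhds hm'] with m'' hm'' using extend_add_smul hm'' c s t
    rw [cov.isCovariantDerivativeOnUniv.congr_of_eventuallyEq (hext _ m' hm')
      (mdifferentiableAt_add_section (mdifferentiableAt_const_smul (hext s m' hm') c)
        (hext t m' hm')) Filter.univ_mem he, cov_add_smul c (hext s m' hm') (hext t m' hm')]
  have hcov : ∀ u w : EB, cov (σ (c • s + t) w) m u = c • cov (σ s w) m u + cov (σ t w) m u := by
    intro u w
    have he : ∀ᶠ m' in 𝓝 m, σ (c • s + t) w m' = (c • σ s w + σ t w) m' := by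
      filter_upwards [hU.mem_nhds hmU] with m' hm'
      simp only [σ]
      rw [hext' m' hm']
      rfl
    have h1 := cov.isCovariantDerivativeOnUniv.congr_of_eventuallyEq (hσ (c • s + t) w)
      (mdifferentiableAt_add_section (mdifferentiableAt_const_smul (hσ s w) c) (hσ t w)) Filter.univ_mem he
    rw [h1, cov_add_smul c (hσ s w) (hσ t w)]
    rfl
  unfold curvature
  simp only []
  refine (congrArg₂ (· - ·) (congrArg₂ (· - ·) (hcov u w) (hcov w u))
    (DFunLike.congr_fun (hext' m hmU) _)).trans ?_
  rw [add_apply, smul_apply, smul_sub, smul_sub]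
  abel

theorem curvature_sum (m : M) (u w : TangentSpace 𝓘(ℝ, EB) m) {ι : Type*} (t : Finset ι)
    (c : ι → ℝ) (s : ι → V m) :
    curvature cov m u w (∑ i ∈ t, c i • s i) = ∑ i ∈ t, c i • curvature cov m u w (s i) := by
  classical
  have h0 : curvature cov m u w (0 : V m) = 0 := by
    have h := curvature_add_smul (cov := cov) m u w (-1) (0 : V m) 0
    rw [smul_zero, add_zero, neg_smul, one_smul, neg_add_cancel] at h
    exact h
  induction t using Finset.induction_on with
  | empty => simpa using h0
  | insert i t hi ih => rw [Finset.sum_insert hi, Finset.sum_insert hi, curvature_add_smul, ih]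

/-- The transition matrix between two frames. -/
def OrthoFrame.transition (fr fr' : OrthoFrame EB F o) (m : M) : Matrix (Fin n) (Fin n) ℝ :=
  Matrix.of fun a b => inner ℝ (fr.e a m) (fr'.e b m)

theorem OrthoFrame.sum_transition (fr fr' : OrthoFrame EB F o) {m : M} (hm : m ∈ fr.W)
    (b : Fin n) : fr'.e b m = ∑ a, fr.transition fr' m a b • fr.e a m := by
  have h := (fr.basis hm).sum_repr' (fr'.e b m)
  simp only [OrthoFrame.basis_apply] at h
  exact h.symm

theorem OrthoFrame.det_transition (fr fr' : OrthoFrame EB F o) {m : M} (hm : m ∈ fr.W)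
    (hm' : m ∈ fr'.W) : (fr.transition fr' m).det = 1 := by
  have ho : ∀ (fr : OrthoFrame EB F o) (hm : m ∈ fr.W), (fr.basis hm).toBasis.orientation = o m := by
    intro fr hm
    rw [← fr.oriented m hm]
    congr 1
    ext a
    simp
  have h := (OrthonormalBasis.same_orientation_iff_det_eq_det (e := fr.basis hm) (f := fr'.basis hm')).2
    ((ho fr hm).trans (ho fr' hm').symm)
  have h2 := (fr'.basis hm').toBasis.det_self
  rw [← h, Module.Basis.det_apply] at h2
  rw [← h2]
  congr 1
  ext a b
  simp [OrthoFrame.transition, Module.Basis.toMatrix_apply, OrthonormalBasis.repr_apply_apply]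

theorem OrthoFrame.mdifferentiableAt_coord (fr : OrthoFrame EB F o) {v : TotalSpace F V}
    (hv : v.proj ∈ fr.W) (a : Fin n) :
    MDifferentiableAt (𝓘(ℝ, EB).prod 𝓘(ℝ, F)) 𝓘(ℝ, ℝ) (fr.coord a) v := by
  have h1 : ContMDiffAt (𝓘(ℝ, EB).prod 𝓘(ℝ, F)) (𝓘(ℝ, EB).prod 𝓘(ℝ, F)) ∞
      (fun v : TotalSpace F V => (⟨v.proj, fr.e a v.proj⟩ : TotalSpace F V)) v :=
    (fr.contMDiffAt hv a).comp v (contMDiff_proj V).contMDiffAt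
  have h2 : ContMDiffAt (𝓘(ℝ, EB).prod 𝓘(ℝ, F)) (𝓘(ℝ, EB).prod 𝓘(ℝ, F)) ∞
      (fun v : TotalSpace F V => (⟨v.proj, v.snd⟩ : TotalSpace F V)) v := contMDiffAt_id
  exact (h1.inner_bundle h2).mdifferentiableAt (by simp)

theorem mvfderiv_comp_proj {f : M → ℝ} {v : TotalSpace F V}
    (hf : MDifferentiableAt 𝓘(ℝ, EB) 𝓘(ℝ, ℝ) f v.proj)
    (u : TangentSpace (𝓘(ℝ, EB).prod 𝓘(ℝ, F)) v) :
    mvfderiv (𝓘(ℝ, EB).prod 𝓘(ℝ, F)) (fun v : TotalSpace F V => f v.proj) v u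
      = mvfderiv 𝓘(ℝ, EB) f v.proj (dproj EB v u) := by
  have h := mfderiv_comp v (I := 𝓘(ℝ, EB).prod 𝓘(ℝ, F)) (I' := 𝓘(ℝ, EB)) (I'' := 𝓘(ℝ, ℝ))
    (f := (TotalSpace.proj : TotalSpace F V → M)) (g := f)
    hf ((contMDiff_proj V (n := ∞)).mdifferentiableAt (by simp))
  exact DFunLike.congr_fun h u

/-- Differentiating the new coordinates produces the derivative of the transition matrix, and the
inhomogeneous term in the transformation of the connection form cancels it. What remains is
tensorial. -/
theorem OrthoFrame.nablaX_transition (hcov : cov.IsMetricCompatible) (fr fr' : OrthoFrame EB F o)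
    {v : TotalSpace F V} (hv : v.proj ∈ fr.W) (hv' : v.proj ∈ fr'.W) (b : Fin n)
    (u : TangentSpace (𝓘(ℝ, EB).prod 𝓘(ℝ, F)) v) :
    fr'.nablaX cov b v u = ∑ a, fr.transition fr' v.proj a b * fr.nablaX cov a v u := by
  have hG : ∀ a, MDifferentiableAt 𝓘(ℝ, EB) 𝓘(ℝ, ℝ)
      (fun m => (inner ℝ (fr.e a m) (fr'.e b m) : ℝ)) v.proj := fun a =>
    ((fr.contMDiffAt hv a).inner_bundle (fr'.contMDiffAt hv' b)).mdifferentiableAt (by simp)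
  have hd : mvfderiv (𝓘(ℝ, EB).prod 𝓘(ℝ, F)) (fr'.coord b) v u
      = ∑ a, (mvfderiv 𝓘(ℝ, EB) (fun m => (inner ℝ (fr.e a m) (fr'.e b m) : ℝ)) v.proj
          (dproj EB v u) * fr.coord a v
        + fr.transition fr' v.proj a b * mvfderiv (𝓘(ℝ, EB).prod 𝓘(ℝ, F)) (fr.coord a) v u) := by
    have he : fr'.coord b =ᶠ[𝓝 v] fun v => (0 : ℝ) + ∑ a,
        (inner ℝ (fr.e a v.proj) (fr'.e b v.proj) : ℝ) * fr.coord a v := by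
      filter_upwards [((fr.W.isOpen.preimage (FiberBundle.continuous_proj F V))).mem_nhds hv]
        with w hw
      have h := fr.sum_inner_mul hw (fr'.e b w.proj) w.snd
      rw [zero_add]
      refine h.symm.trans (Finset.sum_congr rfl fun a _ => ?_)
      rw [real_inner_comm]
      rfl
    have h1 : mvfderiv (𝓘(ℝ, EB).prod 𝓘(ℝ, F)) (fr'.coord b) v u
      = mvfderiv (𝓘(ℝ, EB).prod 𝓘(ℝ, F)) (fun v : TotalSpace F V => (0 : ℝ) + ∑ a,
        (inner ℝ (fr.e a v.proj) (fr'.e b v.proj) : ℝ) * fr.coord a v) v u :=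
      DFunLike.congr_fun he.mfderiv_eq u
    have hGc : ∀ a, MDifferentiableAt (𝓘(ℝ, EB).prod 𝓘(ℝ, F)) 𝓘(ℝ, ℝ)
        (fun v : TotalSpace F V => (inner ℝ (fr.e a v.proj) (fr'.e b v.proj) : ℝ)) v := fun a =>
      (hG a).comp v ((contMDiff_proj V (n := ∞)).mdifferentiableAt (by simp))
    rw [h1, (mvfderiv_add_sum_mul Finset.univ (mdifferentiableAt_const (c := (0 : ℝ))) hGc
      (fun a => fr.mdifferentiableAt_coord hv a) u).2, mvfderiv_const]
    refine (zero_add _).trans (Finset.sum_congr rfl fun a _ => ?_)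
    rw [mvfderiv_comp_proj (hG a)]
    rfl
  -- Antisymmetry turns the connection term into `-⟨∇e'_b, 𝐱⟩`, which can then be expanded in the
  -- old frame.
  have hc : ∑ d, fr'.coord d v * fr'.connForm cov b d v u
      = -∑ a, fr.coord a v * (mvfderiv 𝓘(ℝ, EB) (fun m => (inner ℝ (fr.e a m) (fr'.e b m) : ℝ))
          v.proj (dproj EB v u)
        + ∑ c, fr.transition fr' v.proj c b * fr.connForm cov a c v u) := by
    have h1 := fr'.sum_inner_mul hv' (cov (fr'.e b) v.proj (dproj EB v u)) v.snd
    have h2 := fr.sum_inner_mul hv (cov (fr'.e b) v.proj (dproj EB v u)) v.snd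
    rw [← h2] at h1
    have h3 : ∑ d, fr'.coord d v * fr'.connForm cov b d v u
        = -∑ d, inner ℝ (cov (fr'.e b) v.proj (dproj EB v u)) (fr'.e d v.proj)
          * inner ℝ (fr'.e d v.proj) v.snd := by
      rw [← Finset.sum_neg_distrib]
      refine Finset.sum_congr rfl fun d _ => ?_
      rw [OrthoFrame.connForm, inner_cov_frame hcov fr' hv' b d, real_inner_comm (fr'.e d v.proj)]
      simp only [OrthoFrame.coord]
      ring
    rw [h3, h1]
    congr 1
    refine Finset.sum_congr rfl fun a _ => ?_
    rw [mul_comm, real_inner_comm (fr.e a v.proj), inner_cov hcov fr hv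
      (fr'.mdifferentiableAt hv' b) a]
    rfl
  have h0 : fr'.nablaX cov b v u = mvfderiv (𝓘(ℝ, EB).prod 𝓘(ℝ, F)) (fr'.coord b) v u
    + ∑ d, fr'.coord d v * fr'.connForm cov b d v u := rfl
  have h1 : ∀ a, fr.nablaX cov a v u = mvfderiv (𝓘(ℝ, EB).prod 𝓘(ℝ, F)) (fr.coord a) v u
    + ∑ d, fr.coord d v * fr.connForm cov a d v u := fun _ => rfl
  rw [h0, hd, hc]
  simp only [h1, mul_add, Finset.sum_add_distrib, Finset.mul_sum, neg_add]
  have h2 : ∑ a, ∑ c, fr.coord a v * (fr.transition fr' v.proj c b * fr.connForm cov a c v u)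
      = -∑ c, ∑ a, fr.transition fr' v.proj c b * (fr.coord a v * fr.connForm cov c a v u) := by
    rw [Finset.sum_comm, ← Finset.sum_neg_distrib]
    refine Finset.sum_congr rfl fun c _ => ?_
    rw [← Finset.sum_neg_distrib]
    refine Finset.sum_congr rfl fun a _ => ?_
    rw [OrthoFrame.connForm, inner_cov_frame hcov fr hv a c]
    simp only [OrthoFrame.connForm]
    ring
  rw [h2, neg_neg]
  have h3 : ∀ a, fr.coord a v * mvfderiv 𝓘(ℝ, EB)
      (fun m => (inner ℝ (fr.e a m) (fr'.e b m) : ℝ)) v.proj (dproj EB v u)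
      = mvfderiv 𝓘(ℝ, EB)
      (fun m => (inner ℝ (fr.e a m) (fr'.e b m) : ℝ)) v.proj (dproj EB v u) * fr.coord a v :=
    fun a => mul_comm _ _
  simp only [h3]
  ring

theorem OrthoFrame.inner_curvature_transition (fr fr' : OrthoFrame EB F o) {m : M}
    (hm : m ∈ fr.W) (u w : TangentSpace 𝓘(ℝ, EB) m) (b d : Fin n) :
    inner ℝ (fr'.e b m) (curvature cov m u w (fr'.e d m))
      = ∑ a, ∑ c, fr.transition fr' m a b * fr.transition fr' m c d
        * inner ℝ (fr.e a m) (curvature cov m u w (fr.e c m)) := by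
  rw [fr.sum_transition fr' hm b, fr.sum_transition fr' hm d, curvature_sum, sum_inner]
  refine Finset.sum_congr rfl fun a _ => ?_
  rw [inner_sum]
  refine Finset.sum_congr rfl fun c _ => ?_
  rw [real_inner_smul_left, real_inner_smul_right, mul_assoc]

theorem sum_comm₄ {A : Type*} [AddCommMonoid A] (f : Fin n → Fin n → Fin n → Fin n → A) :
    ∑ a, ∑ b, ∑ c, ∑ d, f a b c d = ∑ c, ∑ d, ∑ a, ∑ b, f a b c d := by
  have h := Finset.sum_comm (s := Finset.univ) (t := Finset.univ)
    (f := fun (p : Fin n × Fin n) (q : Fin n × Fin n) => f p.1 p.2 q.1 q.2)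
  simpa only [Fintype.sum_prod_type] using h

/-- Both `∇𝐱` and the curvature transform by the transition matrix. It relates orthonormal bases of
the same orientation and so has determinant one, which is the factor in `mqExp_rotate`. -/
theorem OrthoFrame.mqValue_eq_mqValue (hcov : cov.IsMetricCompatible) (fr fr' : OrthoFrame EB F o)
    {v : TotalSpace F V} (hv : v.proj ∈ fr.W) (hv' : v.proj ∈ fr'.W)
    (u : Fin n → TangentSpace (𝓘(ℝ, EB).prod 𝓘(ℝ, F)) v) :
    fr'.mqValue cov v u = fr.mqValue cov v u := by
  let g : Matrix (Fin n) (Fin n) ℂ := (fr.transition fr' v.proj).map (algebraMap ℝ ℂ)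
  have hg : g.det = 1 := by
    have h := (algebraMap ℝ ℂ).map_det (fr.transition fr' v.proj)
    rw [fr.det_transition fr' hv hv', map_one] at h
    exact h.symm
  have hrot := mqExp_rotate g (algebraMap ℂ (Gr (Fin n)) (-(1 / 2 : ℂ) * ((‖v.snd‖ ^ 2 : ℝ) : ℂ)))
    (fun a => ∑ j, (fr.nablaX cov a v (u j) : ℂ) • gen j)
    (fun a b => ∑ j, ∑ k, if j < k then
      ((inner ℝ (fr.e a v.proj) (curvature cov v.proj (dproj EB v (u j))
        (dproj EB v (u k)) (fr.e b v.proj)) : ℝ) : ℂ) • (gen j * gen k) else 0)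
  rw [hg, one_smul] at hrot
  rw [fr.mqValue_eq_mqExp, fr'.mqValue_eq_mqExp, ← hrot]
  congr 5
  · funext b
    simp only [fr.nablaX_transition hcov fr' hv hv' b, Complex.ofReal_sum, Complex.ofReal_mul,
      Finset.smul_sum, Finset.sum_smul, smul_smul]
    rw [Finset.sum_comm]
    rfl
  · funext b d
    simp only [fr.inner_curvature_transition fr' hv, Finset.smul_sum]
    have h1 : ∀ (a c : Fin n), ∑ j, ∑ k, (g a b * g c d) • (if j < k then
        ((inner ℝ (fr.e a v.proj) (curvature cov v.proj (dproj EB v (u j))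
          (dproj EB v (u k)) (fr.e c v.proj)) : ℝ) : ℂ) • (gen j * gen k : Gr (Fin n)) else 0)
        = ∑ j, ∑ k, if j < k then (g a b * g c d *
        ((inner ℝ (fr.e a v.proj) (curvature cov v.proj (dproj EB v (u j))
          (dproj EB v (u k)) (fr.e c v.proj)) : ℝ) : ℂ)) • (gen j * gen k : Gr (Fin n)) else 0 := by
      intro a c
      refine Finset.sum_congr rfl fun j _ => Finset.sum_congr rfl fun k _ => ?_
      split_ifs
      · rw [smul_smul]
      · rw [smul_zero]
    refine Eq.trans ?_ (Finset.sum_congr rfl fun a _ => Finset.sum_congr rfl fun c _ =>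
      (h1 a c).symm)
    rw [sum_comm₄]
    refine Finset.sum_congr rfl fun j _ => Finset.sum_congr rfl fun k _ => ?_
    split_ifs
    · simp only [Complex.ofReal_sum, Complex.ofReal_mul, Finset.sum_smul]
      rfl
    · simp

end FrameChange

/-! ### Existence of orthonormal frames -/

section GramSchmidt

set_option linter.unusedSectionVars false

open Filter Topology InnerProductSpace

/-- The change of basis is triangular, and its diagonal entries are the lengths of the unnormalised
Gram–Schmidt vectors, which are positive. -/
theorem orientation_eq_of_gramSchmidtNormed {E : Type*} [NormedAddCommGroup E]
    [InnerProductSpace ℝ E] {n : ℕ} (b c : Module.Basis (Fin n) ℝ E)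
    (hc : ∀ i, c i = gramSchmidtNormed ℝ b i) : c.orientation = b.orientation := by
  have : FiniteDimensional ℝ E := b.finiteDimensional_of_finite
  have hcard : Module.finrank ℝ E = Fintype.card (Fin n) := Module.finrank_eq_card_basis b
  have hne : ∀ i, gramSchmidtNormed ℝ b i ≠ 0 := fun i => by
    rw [← hc]
    exact c.ne_zero i
  have hq : (gramSchmidtOrthonormalBasis hcard b).toBasis = c := by
    ext i
    rw [OrthonormalBasis.coe_toBasis, gramSchmidtOrthonormalBasis_apply hcard (hne i), hc]
  rw [Module.Basis.orientation_eq_iff_det_pos, ← hq, gramSchmidtOrthonormalBasis_det]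
  refine Finset.prod_pos fun i _ => ?_
  have hG : gramSchmidt ℝ b i ≠ 0 := gramSchmidt_ne_zero i b.linearIndependent
  rw [gramSchmidtOrthonormalBasis_apply hcard (hne i), gramSchmidtNormed, real_inner_smul_left,
    gramSchmidt_def' ℝ b i, inner_add_right, inner_sum]
  have h0 : ∑ j ∈ Finset.Iio i, inner ℝ (gramSchmidt ℝ b i)
      ((ℝ ∙ gramSchmidt ℝ b j).starProjection (b i)) = 0 := by
    refine Finset.sum_eq_zero fun j hj => ?_
    rw [Submodule.starProjection_singleton, inner_smul_right,
      gramSchmidt_orthogonal ℝ b (Finset.mem_Iio.1 hj).ne', mul_zero]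
  rw [h0, add_zero, real_inner_self_eq_norm_sq]
  have hpos := norm_pos_iff.2 hG
  simp only [RCLike.ofReal_real_eq_id, id]
  positivity

variable {EB : Type*} [NormedAddCommGroup EB] [NormedSpace ℝ EB] [FiniteDimensional ℝ EB]
  {M : Type*} [TopologicalSpace M] [ChartedSpace EB M] [IsManifold 𝓘(ℝ, EB) ∞ M] [T2Space M]
  {F : Type*} [NormedAddCommGroup F] [NormedSpace ℝ F] [FiniteDimensional ℝ F]
  {V : M → Type*} [TopologicalSpace (TotalSpace F V)]
  [∀ m, NormedAddCommGroup (V m)] [∀ m, InnerProductSpace ℝ (V m)]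
  [FiberBundle F V] [VectorBundle ℝ F V] [ContMDiffVectorBundle ∞ F V 𝓘(ℝ, EB)]
  [IsContMDiffRiemannianBundle 𝓘(ℝ, EB) ∞ F V]
  {n : ℕ} {o : ∀ m, Orientation ℝ (V m) (Fin n)}

/-- Each vector is a rational expression in inner products with the earlier ones, and the
denominators are nonzero by linear independence at `m`. -/
theorem contMDiffAt_gramSchmidt {e : Fin n → ∀ m, V m} {m : M}
    (he : ∀ a, CMDiffAt ∞ (T% (e a)) m) (hli : LinearIndependent ℝ fun a => e a m) (a : Fin n) :
    CMDiffAt ∞ (T% fun m => gramSchmidt ℝ (fun b => e b m) a) m := by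
  induction a using WellFoundedLT.induction with
  | ind a ih =>
    have h1 : (fun m => gramSchmidt ℝ (fun b => e b m) a) = fun m => e a m
        - ∑ i ∈ Finset.Iio a, ((inner ℝ (gramSchmidt ℝ (fun b => e b m) i) (e a m) : ℝ)
          * (inner ℝ (gramSchmidt ℝ (fun b => e b m) i) (gramSchmidt ℝ (fun b => e b m) i))⁻¹)
          • gramSchmidt ℝ (fun b => e b m) i := by
      funext m
      rw [gramSchmidt_def]
      congr 1
      refine Finset.sum_congr rfl fun i _ => ?_
      rw [Submodule.starProjection_singleton, real_inner_self_eq_norm_sq, div_eq_mul_inv]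
      rfl
    suffices h : CMDiffAt ∞ (T% fun m => e a m
        - ∑ i ∈ Finset.Iio a, ((inner ℝ (gramSchmidt ℝ (fun b => e b m) i) (e a m) : ℝ)
          * (inner ℝ (gramSchmidt ℝ (fun b => e b m) i) (gramSchmidt ℝ (fun b => e b m) i))⁻¹)
          • gramSchmidt ℝ (fun b => e b m) i) m from
      h.congr_of_eventuallyEq (Eventually.of_forall fun m' =>
        congrArg (fun z => (⟨m', z⟩ : TotalSpace F V)) (congrFun h1 m'))
    refine (he a).sub_section (ContMDiffAt.sum_section fun i hi => ?_)
    have hi' := ih i (Finset.mem_Iio.1 hi)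
    refine ContMDiffAt.smul_section ((hi'.inner_bundle (he a)).mul ?_) hi'
    refine ContDiffAt.contMDiffAt (contDiffAt_inv ℝ ?_) |>.comp m (hi'.inner_bundle hi')
    exact inner_self_eq_zero.not.2 (gramSchmidt_ne_zero i hli)

theorem contMDiffAt_gramSchmidtNormed {e : Fin n → ∀ m, V m} {m : M}
    (he : ∀ a, CMDiffAt ∞ (T% (e a)) m) (hli : LinearIndependent ℝ fun a => e a m) (a : Fin n) :
    CMDiffAt ∞ (T% fun m => gramSchmidtNormed ℝ (fun b => e b m) a) m := by
  have h := contMDiffAt_gramSchmidt he hli a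
  have h0 : (inner ℝ (gramSchmidt ℝ (fun b => e b m) a) (gramSchmidt ℝ (fun b => e b m) a) : ℝ)
      ≠ 0 := inner_self_eq_zero.not.2 (gramSchmidt_ne_zero a hli)
  have h2 : ContDiffAt ℝ ∞ (fun x : ℝ => (√x)⁻¹)
      (inner ℝ (gramSchmidt ℝ (fun b => e b m) a) (gramSchmidt ℝ (fun b => e b m) a)) :=
    (Real.contDiffAt_sqrt h0).inv (by
      rw [Ne, Real.sqrt_eq_zero']
      exact not_le.2 (lt_of_le_of_ne real_inner_self_nonneg h0.symm))
  have h3 := h2.contMDiffAt.comp m (h.inner_bundle h)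
  refine (ContMDiffAt.smul_section h3 h).congr_of_eventuallyEq (Eventually.of_forall fun m' => ?_)
  simp only [gramSchmidtNormed, Function.comp, Pi.smul_apply']
  rw [norm_eq_sqrt_real_inner]
  rfl

theorem exists_orthoFrame (ho : IsBundleOrientation EB F o) (m₀ : M) :
    ∃ fr : OrthoFrame EB F o, m₀ ∈ fr.W := by
  obtain ⟨W, e, he, hm, hor⟩ := ho m₀
  have hli : ∀ m ∈ W, LinearIndependent ℝ fun a => gramSchmidtNormed ℝ (fun b => e b m) a :=
    fun m hm => gramSchmidtNormed_linearIndependent (he.linearIndependent hm)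
  have hfr : IsLocalFrameOn 𝓘(ℝ, EB) F ∞ (fun a m => gramSchmidtNormed ℝ (fun b => e b m) a)
      (W : Set M) :=
    { linearIndependent := fun hm => hli _ hm
      generating := fun {m} hm => by
        rw [span_gramSchmidtNormed_range]
        exact (he.generating hm).trans (span_gramSchmidt ℝ _).ge
      contMDiffOn := fun a m hm => (contMDiffAt_gramSchmidtNormed
        (fun b => he.contMDiffAt W.isOpen hm b) (he.linearIndependent hm) a).contMDiffWithinAt }
  refine ⟨⟨W, _, hfr, fun m hm => gramSchmidtNormed_orthonormal (he.linearIndependent hm),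
    fun m hm => ?_⟩, hm⟩
  rw [← hor m hm]
  refine orientation_eq_of_gramSchmidtNormed _ _ fun i => ?_
  rw [IsLocalFrameOn.toBasisAt_coe]
  congr 1
  funext b
  rw [IsLocalFrameOn.toBasisAt_coe]

end GramSchmidt

/-! ### Formal forms as differential forms -/

section Alternating

variable {k : ℕ} {E : Type*} [NormedAddCommGroup E] [NormedSpace ℝ E]

/-- The determinant as an alternating form. -/
def detForm (k : ℕ) : (Fin k → ℝ) [⋀^Fin k]→L[ℝ] ℝ :=
  { (Matrix.detRowAlternating : (Fin k → ℝ) [⋀^Fin k]→ₗ[ℝ] ℝ) with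
    cont := by
      change Continuous fun A : Matrix (Fin k) (Fin k) ℝ => A.det
      exact continuous_id.matrix_det }

/-- The form `c ℓ₁ ∧ ⋯ ∧ ℓₖ`. -/
def wedgeForm (c : ℂ) (ℓ : Fin k → E →L[ℝ] ℝ) : E [⋀^Fin k]→L[ℝ] ℂ :=
  (ContinuousLinearMap.toSpanSingleton ℝ c).compContinuousAlternatingMap
    ((detForm k).compContinuousLinearMap (ContinuousLinearMap.pi ℓ))

theorem wedgeForm_apply (c : ℂ) (ℓ : Fin k → E →L[ℝ] ℝ) (u : Fin k → E) :
    wedgeForm c ℓ u = c * ((Matrix.of fun a b => ℓ a (u b)).det : ℂ) := by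
  have h : (Matrix.of fun a b => ℓ a (u b)).det = (Matrix.of fun b a => ℓ a (u b)).det := by
    rw [← Matrix.det_transpose]
    rfl
  rw [h, mul_comm]
  exact Complex.real_smul

/-- Alternating maps are determined by their values on tuples of basis vectors, and a linear left
inverse of this evaluation supplies the `η i`. Smoothness and growth of forms reduce in this way to
finitely many scalar coefficients. -/
theorem exists_coframe (k : ℕ) (E : Type*) [NormedAddCommGroup E] [NormedSpace ℝ E]
    [FiniteDimensional ℝ E] : ∃ (N : ℕ) (u : Fin N → Fin k → E) (η : Fin N → E [⋀^Fin k]→L[ℝ] ℂ),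
      ∀ α : E [⋀^Fin k]→L[ℝ] ℂ, α = ∑ i, α (u i) • η i := by
  classical
  let b := Module.finBasis ℝ E
  let I := Fin k → Fin (Module.finrank ℝ E)
  let Φ : (E [⋀^Fin k]→L[ℝ] ℂ) →ₗ[ℂ] (I → ℂ) :=
    { toFun := fun α s => α fun a => b (s a)
      map_add' := fun α β => rfl
      map_smul' := fun c α => rfl }
  have hΦ : Function.Injective Φ := by
    intro α β h
    apply ContinuousAlternatingMap.toAlternatingMap_injective
    refine Module.Basis.ext_alternating b fun s _ => ?_
    exact congrFun h s
  obtain ⟨r, hr⟩ := Φ.exists_leftInverse_of_injective (LinearMap.ker_eq_bot.2 hΦ)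
  let e := Fintype.equivFin I
  refine ⟨Fintype.card I, fun i a => b (e.symm i a), fun i => r (Pi.single (e.symm i) 1),
    fun α => ?_⟩
  have h1 : r (Φ α) = α := DFunLike.congr_fun hr α
  conv_lhs => rw [← h1, ← Finset.univ_sum_single (Φ α), map_sum]
  rw [← e.symm.sum_comp]
  refine Finset.sum_congr rfl fun i _ => ?_
  have h2 : (Pi.single (e.symm i) (Φ α (e.symm i)) : I → ℂ)
      = Φ α (e.symm i) • Pi.single (e.symm i) 1 := by
    rw [← Pi.single_smul, smul_eq_mul, mul_one]
  rw [h2, map_smul]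
  rfl

theorem contDiffOn_alternating [FiniteDimensional ℝ E] {E' : Type*} [NormedAddCommGroup E']
    [NormedSpace ℝ E'] {η : E' → E [⋀^Fin k]→L[ℝ] ℂ} {s : Set E'}
    (h : ∀ u, ContDiffOn ℝ ∞ (fun z => η z u) s) : ContDiffOn ℝ ∞ η s := by
  obtain ⟨N, u, ζ, hζ⟩ := exists_coframe k E
  have he : η = fun z => ∑ i, η z (u i) • ζ i := funext fun z => hζ (η z)
  rw [he]
  exact ContDiffOn.sum fun i _ => (h (u i)).smul contDiffOn_const

/-- The alternating sum in the exterior derivative is the Laplace expansion of the determinant along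
the row of the new differential. -/
theorem extDeriv_coordinate (c : ℂ) (w : Fin (k + 1) → ℝ) :
    extDeriv (fun w : Fin (k + 1) → ℝ =>
      w 0 • wedgeForm c fun a : Fin k => ContinuousLinearMap.proj (R := ℝ) (φ := fun _ => ℝ) a.succ) w
      = wedgeForm c fun a => ContinuousLinearMap.proj a := by
  set η := wedgeForm c fun a : Fin k =>
    ContinuousLinearMap.proj (R := ℝ) (φ := fun _ : Fin (k + 1) => ℝ) a.succ with hη
  have hd : DifferentiableAt ℝ (fun w : Fin (k + 1) → ℝ => w 0 • η) w :=
    (differentiableAt_apply 0 w).smul_const η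
  ext u
  rw [extDeriv_apply hd, wedgeForm_apply, ← Matrix.det_transpose, Matrix.det_succ_column_zero]
  push_cast
  rw [Finset.mul_sum]
  refine Finset.sum_congr rfl fun i _ => ?_
  have h1 : fderiv ℝ (fun w : Fin (k + 1) → ℝ => (w 0 • η) (i.removeNth u)) w (u i)
      = u i 0 • η (i.removeNth u) := by
    have h2 : HasFDerivAt (fun w : Fin (k + 1) → ℝ => w 0 • η (i.removeNth u))
      ((ContinuousLinearMap.proj (R := ℝ) (φ := fun _ : Fin (k + 1) => ℝ) 0).smulRight
        (η (i.removeNth u))) w := (hasFDerivAt_apply 0 w).smul_const _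
    exact DFunLike.congr_fun h2.fderiv (u i)
  rw [h1, hη, wedgeForm_apply, Complex.real_smul]
  have h3 : (Matrix.of fun a b : Fin k =>
      (ContinuousLinearMap.proj (R := ℝ) (φ := fun _ : Fin (k + 1) => ℝ) a.succ)
        (i.removeNth u b)).det
      = ((Matrix.of fun a b : Fin (k + 1) =>
      (ContinuousLinearMap.proj (R := ℝ) (φ := fun _ : Fin (k + 1) => ℝ) a)
        (u b)).transpose.submatrix i.succAbove Fin.succ).det := by
    rw [← Matrix.det_transpose]
    rfl
  rw [h3]
  simp only [Matrix.transpose_apply, Matrix.of_apply, ContinuousLinearMap.proj_apply,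
    zsmul_eq_mul]
  push_cast
  ring

/-- The form is the pullback along `G = (f, g₁, …, gₖ)` of `w₀ dw₁ ∧ ⋯ ∧ dwₖ` on `ℝ^(k+1)`, and the
exterior derivative commutes with pullback. -/
theorem extDeriv_smul_wedgeForm (c : ℂ) {f : E → ℝ} {g : Fin k → E → ℝ} {z : E}
    (hf : ContDiffAt ℝ ∞ f z) (hg : ∀ a, ContDiffAt ℝ ∞ (g a) z) :
    extDeriv (fun z => f z • wedgeForm c fun a => fderiv ℝ (g a) z) z
      = wedgeForm c (Fin.cons (fderiv ℝ f z) fun a => fderiv ℝ (g a) z) := by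
  let G : E → Fin (k + 1) → ℝ := fun z => Fin.cons (f z) fun a => g a z
  have hGi : ∀ i z, G z i = (Fin.cons f g : Fin (k + 1) → E → ℝ) i z := fun i z => by
    refine Fin.cases ?_ (fun a => ?_) i <;> rfl
  have hcG : ∀ i, ContDiffAt ℝ ∞ ((Fin.cons f g : Fin (k + 1) → E → ℝ) i) z := fun i => by
    refine Fin.cases ?_ (fun a => ?_) i
    · simpa using hf
    · simpa using hg a
  have hG : ContDiffAt ℝ ∞ G z := contDiffAt_pi.2 fun i => by
    simp only [hGi]
    exact hcG i
  have hdG : ∀ᶠ z' in nhds z, ∀ i, ContinuousLinearMap.proj i ∘L fderiv ℝ G z'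
      = fderiv ℝ ((Fin.cons f g : Fin (k + 1) → E → ℝ) i) z' := by
    have h1 : ∀ i, ∀ᶠ z' in nhds z,
        DifferentiableAt ℝ ((Fin.cons f g : Fin (k + 1) → E → ℝ) i) z' := fun i =>
      (((hcG i).of_le (m := 1) (by simp)).eventually (by simp)).mono fun z' h => h.differentiableAt (by simp)
    filter_upwards [Filter.eventually_all.2 h1] with z' h i
    have h2 : HasFDerivAt G (ContinuousLinearMap.pi fun i =>
        fderiv ℝ ((Fin.cons f g : Fin (k + 1) → E → ℝ) i) z') z' := by
      refine hasFDerivAt_pi.2 fun i => ?_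
      exact (h i).hasFDerivAt.congr_of_eventuallyEq (Filter.Eventually.of_forall fun z => hGi i z)
    rw [h2.fderiv]
    rfl
  let η : (Fin (k + 1) → ℝ) → (Fin (k + 1) → ℝ) [⋀^Fin k]→L[ℝ] ℂ := fun w =>
      w 0 • wedgeForm c fun a : Fin k => ContinuousLinearMap.proj (R := ℝ) (φ := fun _ => ℝ) a.succ
  have hη : DifferentiableAt ℝ η (G z) := (differentiableAt_apply 0 _).smul_const _
  have hpull : extDeriv (fun z => (η (G z)).compContinuousLinearMap (fderiv ℝ G z)) z
      = (extDeriv η (G z)).compContinuousLinearMap (fderiv ℝ G z) :=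
    extDeriv_pullback (r := ∞) hη hG (by
      simp only [minSmoothness_of_isRCLikeNormedField]
      exact WithTop.coe_le_coe.2 le_top)
  rw [extDeriv_coordinate] at hpull
  refine Eq.trans ?_ (hpull.trans ?_)
  · refine Filter.EventuallyEq.extDeriv_eq ?_
    filter_upwards [hdG] with z' h
    ext u
    have h0 : ∀ a : Fin k, ∀ v, fderiv ℝ G z' v a.succ = fderiv ℝ (g a) z' v := fun a v => by
      have := DFunLike.congr_fun (h a.succ) v
      simpa using this
    change f z' • wedgeForm c _ u = G z' 0 • wedgeForm c _ (fun b => fderiv ℝ G z' (u b))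
    rw [wedgeForm_apply, wedgeForm_apply]
    simp only [ContinuousLinearMap.proj_apply, h0]
    rfl
  · ext u
    change wedgeForm c _ (fun b => fderiv ℝ G z (u b)) = _
    rw [wedgeForm_apply, wedgeForm_apply]
    congr 3
    ext a b
    have := DFunLike.congr_fun (hdG.self_of_nhds a) (u b)
    refine this.trans ?_
    refine Fin.cases ?_ (fun a => ?_) a <;> simp

end Alternating

/-! ### Formal forms in charts: smoothness and closedness. -/

section Alt

set_option linter.unusedSectionVars false

open Filter Topology

variable {E : Type*} [NormedAddCommGroup E] [NormedSpace ℝ E] [FiniteDimensional ℝ E]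
  {H : Type*} [TopologicalSpace H] {I : ModelWithCorners ℝ E H} [I.Boundaryless]
  {X : Type*} [TopologicalSpace X] [ChartedSpace H X] [IsManifold I ∞ X] {k : ℕ}

/-- The differential form given by a formal form. -/
def FormalForm.alt (P : FormalForm C^∞⟮I, X; 𝓘(ℝ, ℝ), ℝ⟯ k) : DiffForm I X k := fun x =>
  ∑ j, (P.f j x : ℝ) • wedgeForm (E := E) (P.c j) fun a => mvfderiv I (P.g j a) x

theorem FormalForm.alt_apply (P : FormalForm C^∞⟮I, X; 𝓘(ℝ, ℝ), ℝ⟯ k) (x : X)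
    (u : Fin k → TangentSpace I x) : P.alt x u = P.eval x u := by
  have h : P.alt x u = ∑ j, ((P.f j x : ℝ) • wedgeForm (E := E) (P.c j)
      (fun a => mvfderiv I (P.g j a) x)) (u : Fin k → E) := by
    exact ContinuousAlternatingMap.sum_apply _ _
  rw [h]
  refine Finset.sum_congr rfl fun j _ => ?_
  refine (congrArg (fun z => P.f j x • z) (wedgeForm_apply (E := E) _ _ u)).trans ?_
  rw [Complex.real_smul, ← mul_assoc, mul_comm (P.c j)]
  rfl

/-- A multiple of a formal form. -/
def FormalForm.smul {R : Type*} (c : ℂ) (P : FormalForm R k) : FormalForm R k :=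
  ⟨P.N, fun j => c * P.c j, P.f, P.g⟩

theorem FormalForm.contract_smul {R : Type*} (c : ℂ) (P : FormalForm R k) {κ : Type}
    (h : R → Gr (Option κ)) : (P.smul c).contract h = c • P.contract h := by
  simp only [FormalForm.contract, FormalForm.smul, Finset.smul_sum, smul_smul]
  rfl

theorem FormalForm.eval_smul (c : ℂ) (P : FormalForm C^∞⟮I, X; 𝓘(ℝ, ℝ), ℝ⟯ k) (x : X)
    (u : Fin k → TangentSpace I x) : (P.smul c).eval x u = c * P.eval x u := by
  simp only [FormalForm.eval, FormalForm.smul, Finset.mul_sum, mul_assoc]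
  rfl

variable [T2Space X]

theorem FormalForm.alt_inChart (P : FormalForm C^∞⟮I, X; 𝓘(ℝ, ℝ), ℝ⟯ k) (x : X) {z : E}
    (hz : z ∈ (extChartAt I x).target) : P.alt.inChart x z
      = ∑ j, P.f j ((extChartAt I x).symm z) • wedgeForm (P.c j) fun a =>
        fderiv ℝ (P.g j a ∘ (extChartAt I x).symm) z := by
  ext u
  change P.alt _ (fun b => mfderiv 𝓘(ℝ, E) I (extChartAt I x).symm z (u b)) = _
  rw [P.alt_apply, ContinuousAlternatingMap.sum_apply]
  refine Finset.sum_congr rfl fun j _ => ?_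
  rw [ContinuousAlternatingMap.smul_apply, wedgeForm_apply, Complex.real_smul, ← mul_assoc,
    mul_comm (P.c j)]
  congr 3
  ext a b
  exact mfderiv_mfderiv_extChartAt_symm (P.g j a).contMDiff x hz (u b)

theorem FormalForm.contDiffOn_alt_inChart (P : FormalForm C^∞⟮I, X; 𝓘(ℝ, ℝ), ℝ⟯ k) (x : X) :
    ContDiffOn ℝ ∞ (P.alt.inChart x) (extChartAt I x).target := by
  have ho := isOpen_extChartAt_target (I := I) x
  refine contDiffOn_alternating fun u => ?_
  have h : ContDiffOn ℝ ∞ (fun z => ∑ j, (P.f j ((extChartAt I x).symm z) : ℝ) •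
      (P.c j * ((Matrix.of fun a b => fderiv ℝ (P.g j a ∘ (extChartAt I x).symm) z (u b)).det : ℂ)))
      (extChartAt I x).target := by
    refine ContDiffOn.sum fun j _ => ?_
    suffices h : ContDiffOn ℝ ∞ (fun z => (Matrix.of fun a b =>
        fderiv ℝ (P.g j a ∘ (extChartAt I x).symm) z (u b)).det) (extChartAt I x).target from
      (contDiffOn_comp_extChartAt_symm (P.f j).contMDiff x).smul
        (contDiffOn_const.mul (Complex.ofRealCLM.contDiff.comp_contDiffOn h))
    simp only [Matrix.det_apply']
    refine ContDiffOn.sum fun σ _ => contDiffOn_const.mul (contDiffOn_prod fun a _ => ?_)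
    exact ((contDiffOn_comp_extChartAt_symm (P.g j _).contMDiff x).fderiv_of_isOpen ho
      (by simp)).clm_apply contDiffOn_const
  refine h.congr fun z hz => ?_
  rw [P.alt_inChart x hz, ContinuousAlternatingMap.sum_apply]
  refine Finset.sum_congr rfl fun j _ => ?_
  rw [ContinuousAlternatingMap.smul_apply, wedgeForm_apply]

theorem FormalForm.extDeriv_alt_inChart (P : FormalForm C^∞⟮I, X; 𝓘(ℝ, ℝ), ℝ⟯ k) (x : X) {z : E}
    (hz : z ∈ (extChartAt I x).target) :
    extDeriv (P.alt.inChart x) z = P.d.alt.inChart x z := by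
  have ho := isOpen_extChartAt_target (I := I) x
  have hc : ∀ f : C^∞⟮I, X; 𝓘(ℝ, ℝ), ℝ⟯, ContDiffAt ℝ ∞ (f ∘ (extChartAt I x).symm) z := fun f =>
    (contDiffOn_comp_extChartAt_symm f.contMDiff x).contDiffAt (ho.mem_nhds hz)
  have he : P.alt.inChart x =ᶠ[𝓝 z] fun z => ∑ j, P.f j ((extChartAt I x).symm z) •
      wedgeForm (P.c j) fun a => fderiv ℝ (P.g j a ∘ (extChartAt I x).symm) z := by
    filter_upwards [ho.mem_nhds hz] with z' h using P.alt_inChart x h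
  rw [he.extDeriv_eq, P.d.alt_inChart x hz]
  have hd : ∀ j, DifferentiableAt ℝ (fun z => (P.f j ∘ (extChartAt I x).symm) z •
      wedgeForm (P.c j) fun a => fderiv ℝ (P.g j a ∘ (extChartAt I x).symm) z) z := fun j => by
    refine ((hc (P.f j)).differentiableAt (by simp)).smul ?_
    have h : ContDiffOn ℝ ∞ (fun z => wedgeForm (P.c j) fun a =>
        fderiv ℝ (P.g j a ∘ (extChartAt I x).symm) z) (extChartAt I x).target := by
      have h1 := (⟨1, fun _ => P.c j, fun _ => 1, fun _ => P.g j⟩ :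
        FormalForm C^∞⟮I, X; 𝓘(ℝ, ℝ), ℝ⟯ k).contDiffOn_alt_inChart x
      refine h1.congr fun z hz => ?_
      rw [FormalForm.alt_inChart _ x hz, Fin.sum_univ_one]
      exact (one_smul ℝ _).symm
    exact (h.contDiffAt (ho.mem_nhds hz)).differentiableAt (by simp)
  -- Differentiability of the partial sums is carried along in the induction because additivity of
  -- `extDeriv` requires it.
  have hs : ∀ s : Finset (Fin P.N), DifferentiableAt ℝ (fun z => ∑ j ∈ s,
      (P.f j ∘ (extChartAt I x).symm) z • wedgeForm (P.c j) fun a =>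
        fderiv ℝ (P.g j a ∘ (extChartAt I x).symm) z) z ∧
      extDeriv (fun z => ∑ j ∈ s, (P.f j ∘ (extChartAt I x).symm) z •
      wedgeForm (P.c j) fun a => fderiv ℝ (P.g j a ∘ (extChartAt I x).symm) z) z
      = ∑ j ∈ s, wedgeForm (P.c j) (Fin.cons (fderiv ℝ (P.f j ∘ (extChartAt I x).symm) z)
        fun a => fderiv ℝ (P.g j a ∘ (extChartAt I x).symm) z) := by
    classical
    intro s
    induction s using Finset.induction_on with
    | empty =>
      simp only [Finset.sum_empty]
      refine ⟨differentiableAt_const _, ?_⟩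
      have h := extDeriv_smul (x := z) (0 : ℝ) (0 : E → E [⋀^Fin k]→L[ℝ] ℂ)
      rw [zero_smul, zero_smul] at h
      exact h
    | insert j s hj ih =>
      simp only [Finset.sum_insert hj]
      refine ⟨(hd j).add ih.1, ?_⟩
      rw [extDeriv_fun_add (hd j) ih.1, ih.2, extDeriv_smul_wedgeForm _ (hc _) fun a => hc _]
  refine (hs Finset.univ).2.trans (Finset.sum_congr rfl fun j _ => ?_)
  refine Eq.trans ?_ (one_smul ℝ _).symm
  congr 1
  funext a
  refine Fin.cases ?_ (fun a => ?_) a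
  · rfl
  · rfl

theorem DiffForm.inChart_eventuallyEq {α β : DiffForm I X k} {x : X} {z : E}
    (hz : z ∈ (extChartAt I x).target)
    (h : ∀ᶠ y in 𝓝 ((extChartAt I x).symm z), α y = β y) :
    α.inChart x =ᶠ[𝓝 z] β.inChart x := by
  filter_upwards [(continuousAt_extChartAt_symm'' hz).eventually h] with z' h'
  rw [DiffForm.inChart, h']
  rfl

/-- A form that is locally given by formal forms is smooth. -/
theorem DiffForm.isSmooth_of_local {α : DiffForm I X k}
    (h : ∀ x, ∃ P : FormalForm C^∞⟮I, X; 𝓘(ℝ, ℝ), ℝ⟯ k, ∀ᶠ y in 𝓝 x, α y = P.alt y) :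
    α.IsSmooth := by
  intro x z hz
  obtain ⟨P, hP⟩ := h ((extChartAt I x).symm z)
  exact (((P.contDiffOn_alt_inChart x).contDiffAt ((isOpen_extChartAt_target x).mem_nhds hz)
    ).congr_of_eventuallyEq (DiffForm.inChart_eventuallyEq hz hP)).contDiffWithinAt

/-- A form that is locally given by closed formal forms is closed. -/
theorem DiffForm.isClosed_of_local {α : DiffForm I X k}
    (h : ∀ x, ∃ P : FormalForm C^∞⟮I, X; 𝓘(ℝ, ℝ), ℝ⟯ k, (∀ᶠ y in 𝓝 x, α y = P.alt y) ∧
      ∀ u, P.d.eval x u = 0) : α.IsClosed := by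
  intro x z hz
  obtain ⟨P, hP, hd⟩ := h ((extChartAt I x).symm z)
  rw [(DiffForm.inChart_eventuallyEq hz hP).extDeriv_eq, P.extDeriv_alt_inChart x hz]
  ext u
  change P.d.alt _ _ = 0
  rw [P.d.alt_apply, hd]

end Alt

/-! ### The Mathai–Quillen form -/

section MQForm

set_option linter.unusedSectionVars false

open Filter Topology

variable {EB : Type*} [NormedAddCommGroup EB] [NormedSpace ℝ EB] [FiniteDimensional ℝ EB]
  {M : Type*} [TopologicalSpace M] [ChartedSpace EB M] [IsManifold 𝓘(ℝ, EB) ∞ M] [T2Space M]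
  {F : Type*} [NormedAddCommGroup F] [NormedSpace ℝ F] [FiniteDimensional ℝ F]
  {V : M → Type*} [TopologicalSpace (TotalSpace F V)]
  [∀ m, NormedAddCommGroup (V m)] [∀ m, InnerProductSpace ℝ (V m)]
  [FiberBundle F V] [VectorBundle ℝ F V] [ContMDiffVectorBundle ∞ F V 𝓘(ℝ, EB)]
  [IsContMDiffRiemannianBundle 𝓘(ℝ, EB) ∞ F V]
  {n : ℕ} {o : ∀ m, Orientation ℝ (V m) (Fin n)}
  {cov : CovariantDerivative 𝓘(ℝ, EB) F V}

section Thom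

variable {fr : OrthoFrame EB F o} (L : LocalModel fr cov)

/-- The Mathai–Quillen form of a local model. -/
def LocalModel.thom : FormalForm (TotalFun EB F V) n :=
  L.form.smul (((2 * Real.pi) ^ (-(n : ℝ) / 2) : ℝ) : ℂ)

theorem LocalModel.D_thom_contract {κ : Type} [Finite κ]
    {h : TotalFun EB F V →ₐ[ℝ] Gr (Option κ)} {v : TotalSpace F V}
    (hv : LiesOver h v) (he : ∀ f, IsEven (h f)) : D (L.thom.contract h) = 0 := by
  rw [LocalModel.thom, FormalForm.contract_smul, map_smul, L.D_form_contract hv he, smul_zero]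

/-- At the tangent point of `n + 1` vectors the contraction of the differential is `D` of the
contraction, which vanishes by `der_mqExp`. -/
theorem LocalModel.eval_thom_d (v : TotalSpace F V)
    (u : Fin (n + 1) → TangentSpace (𝓘(ℝ, EB).prod 𝓘(ℝ, F)) v) : L.thom.d.eval v u = 0 := by
  rw [FormalForm.eval_eq_body_berezin, FormalForm.contract_d,
    L.D_thom_contract (liesOver_tangentPoint v u) (isEven_tangentPoint v u)]
  simp

variable [CovariantDerivative.ContMDiffCovariantDerivative cov ∞]

theorem LocalModel.eval_thom (hcov : cov.IsMetricCompatible) {v : TotalSpace F V}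
    (hv : v.proj ∈ L.O) (u : Fin n → TangentSpace (𝓘(ℝ, EB).prod 𝓘(ℝ, F)) v) :
    L.thom.eval v u = fr.mqValue cov v u := by
  rw [LocalModel.thom, FormalForm.eval_smul, L.mqValue_eq hv hcov]

end Thom

theorem FormalForm.alt_smul (c : ℂ) {k : ℕ} (P : FormalForm (TotalFun EB F V) k)
    (v : TotalSpace F V) : (P.smul c).alt v = c • P.alt v := by
  ext u
  exact ((P.smul c).alt_apply v u).trans ((P.eval_smul c v u).trans
    (congrArg (c * ·) (P.alt_apply v u).symm))

variable [CovariantDerivative.ContMDiffCovariantDerivative cov ∞]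

/-- A frame near `m`. -/
def frameAt (ho : IsBundleOrientation EB F o) (m : M) : OrthoFrame EB F o :=
  (exists_orthoFrame ho m).choose

/-- A local model near `m`. -/
def modelAt (ho : IsBundleOrientation EB F o) (hcov : cov.IsMetricCompatible) (m : M) :
    LocalModel (frameAt ho m) cov :=
  (exists_localModel hcov (frameAt ho m) (exists_orthoFrame ho m).choose_spec).choose

theorem mem_modelAt (ho : IsBundleOrientation EB F o) (hcov : cov.IsMetricCompatible) (m : M) :
    m ∈ (modelAt ho hcov m).O :=
  (exists_localModel hcov (frameAt ho m) (exists_orthoFrame ho m).choose_spec).choose_spec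

variable (ho : IsBundleOrientation EB F o) (hcov : cov.IsMetricCompatible)

/-- The Mathai–Quillen form. -/
def mqForm : DiffForm (𝓘(ℝ, EB).prod 𝓘(ℝ, F)) (TotalSpace F V) n := fun v =>
  (modelAt ho hcov v.proj).thom.alt v

/-- `mqForm` takes an unrelated model at each base point; independence of the frame makes the choice
invisible. -/
theorem mqForm_apply (fr : OrthoFrame EB F o) {v : TotalSpace F V} (hv : v.proj ∈ fr.W)
    (u : Fin n → TangentSpace (𝓘(ℝ, EB).prod 𝓘(ℝ, F)) v) :
    mqForm ho hcov v u = fr.mqValue cov v u := by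
  have hm := mem_modelAt ho hcov v.proj
  rw [mqForm, FormalForm.alt_apply, LocalModel.eval_thom _ hcov hm]
  exact OrthoFrame.mqValue_eq_mqValue hcov _ _ hv ((modelAt ho hcov v.proj).le hm) u

theorem mqForm_eq {fr : OrthoFrame EB F o} (L : LocalModel fr cov) {v : TotalSpace F V}
    (hv : v.proj ∈ L.O) : mqForm ho hcov v = L.thom.alt v := by
  ext u
  exact (mqForm_apply ho hcov fr (L.le hv) u).trans
    ((L.eval_thom hcov hv u).symm.trans (L.thom.alt_apply v u).symm)

theorem LocalModel.eventually_mem {fr : OrthoFrame EB F o} (L : LocalModel fr cov)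
    {v : TotalSpace F V} (hv : v.proj ∈ L.O) : ∀ᶠ w in 𝓝 v, w.proj ∈ L.O :=
  (L.O.isOpen.preimage (FiberBundle.continuous_proj F V)).mem_nhds hv

theorem isSmooth_mqForm (c : ℂ) : (show DiffForm (𝓘(ℝ, EB).prod 𝓘(ℝ, F)) (TotalSpace F V) n from
    fun v => c • mqForm ho hcov v).IsSmooth := by
  have := t2Space_totalSpace F V
  refine DiffForm.isSmooth_of_local fun v => ?_
  have hm := mem_modelAt ho hcov v.proj
  refine ⟨(modelAt ho hcov v.proj).thom.smul c, ?_⟩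
  filter_upwards [(modelAt ho hcov v.proj).eventually_mem hm] with w hw
  rw [FormalForm.alt_smul, mqForm_eq ho hcov _ hw]

theorem isClosed_mqForm (c : ℂ) : (show DiffForm (𝓘(ℝ, EB).prod 𝓘(ℝ, F)) (TotalSpace F V) n from
    fun v => c • mqForm ho hcov v).IsClosed := by
  have := t2Space_totalSpace F V
  refine DiffForm.isClosed_of_local fun v => ?_
  have hm := mem_modelAt ho hcov v.proj
  refine ⟨(modelAt ho hcov v.proj).thom.smul c, ?_, fun u => ?_⟩
  · filter_upwards [(modelAt ho hcov v.proj).eventually_mem hm] with w hw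
    rw [FormalForm.alt_smul, mqForm_eq ho hcov _ hw]
  · have h : ((modelAt ho hcov v.proj).thom.smul c).d = (modelAt ho hcov v.proj).thom.d.smul c :=
      rfl
    rw [h, FormalForm.eval_smul, LocalModel.eval_thom_d, mul_zero]

/-! #### Integrals over the fibres -/

section Fibre

variable (fr : OrthoFrame EB F o)

theorem OrthoFrame.contMDiff_fibre (m : M) : ContMDiff 𝓘(ℝ, EuclideanSpace ℝ (Fin n))
    (𝓘(ℝ, EB).prod 𝓘(ℝ, F)) ∞ (fr.fibre m) := by
  intro t
  rw [contMDiffAt_totalSpace]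
  refine ⟨contMDiffAt_const, ?_⟩
  have hlin := (trivializationAt F V m).linear ℝ
    (FiberBundle.mem_baseSet_trivializationAt' (F := F) (E := V) m)
  have he : (fun t => (trivializationAt F V m (fr.fibre m t)).2)
      = fun t => ∑ a, t a • (trivializationAt F V m ⟨m, fr.e a m⟩).2 := by
    funext t
    have h := map_sum hlin.mk' (fun a => t a • fr.e a m) Finset.univ
    simp only [map_smul] at h
    exact h
  change ContMDiffAt _ _ _ (fun t => (trivializationAt F V m (fr.fibre m t)).2) t
  rw [he]
  refine ContDiffAt.contMDiffAt ?_
  fun_prop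

theorem OrthoFrame.coord_fibre {m : M} (hm : m ∈ fr.W) (t : EuclideanSpace ℝ (Fin n)) (a : Fin n) :
    fr.coord a (fr.fibre m t) = t a := by
  change inner ℝ (fr.e a m) (∑ b, t b • fr.e b m) = _
  simp [inner_sum, inner_smul_right, fr.inner_eq hm]

theorem OrthoFrame.norm_fibre_sq {m : M} (hm : m ∈ fr.W) (t : EuclideanSpace ℝ (Fin n)) :
    ‖(fr.fibre m t).snd‖ ^ 2 = ‖t‖ ^ 2 := by
  have h := fr.sum_inner_mul hm (fr.fibre m t).snd (fr.fibre m t).snd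
  rw [EuclideanSpace.norm_sq_eq]
  refine (real_inner_self_eq_norm_sq _).symm.trans (h.symm.trans ?_)
  refine Finset.sum_congr rfl fun a _ => ?_
  have h1 := fr.coord_fibre hm t a
  have h2 : inner ℝ (fr.e a m) (fr.fibre m t).snd = t a := h1
  have h3 : inner ℝ (fr.fibre m t).snd (fr.e a m) = t a := (real_inner_comm _ _).trans h2
  rw [Real.norm_eq_abs, sq_abs, sq]
  exact congrArg₂ (· * ·) h3 h2

/-- The tangent vector of the fibre in the direction of the `a`-th coordinate. -/
def OrthoFrame.vertical (m : M) (t : EuclideanSpace ℝ (Fin n)) (a : Fin n) :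
    TangentSpace (𝓘(ℝ, EB).prod 𝓘(ℝ, F)) (fr.fibre m t) :=
  mfderiv 𝓘(ℝ, EuclideanSpace ℝ (Fin n)) (𝓘(ℝ, EB).prod 𝓘(ℝ, F)) (fr.fibre m) t
    (EuclideanSpace.single a (1 : ℝ))

theorem OrthoFrame.dproj_vertical (m : M) (t : EuclideanSpace ℝ (Fin n)) (a : Fin n) :
    dproj EB (fr.fibre m t) (fr.vertical m t a) = 0 := by
  have h := mfderiv_comp t (I := 𝓘(ℝ, EuclideanSpace ℝ (Fin n)))
    (I' := 𝓘(ℝ, EB).prod 𝓘(ℝ, F)) (I'' := 𝓘(ℝ, EB))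
    (f := fr.fibre m) (g := (TotalSpace.proj : TotalSpace F V → M))
    ((contMDiff_proj V (n := ∞)).mdifferentiableAt (by simp))
    ((fr.contMDiff_fibre m).mdifferentiableAt (by simp))
  have h2 : mfderiv 𝓘(ℝ, EuclideanSpace ℝ (Fin n)) 𝓘(ℝ, EB)
      ((TotalSpace.proj : TotalSpace F V → M) ∘ fr.fibre m) t = 0 := mfderiv_const
  rw [h2] at h
  exact (DFunLike.congr_fun h (EuclideanSpace.single a (1 : ℝ))).symm

theorem OrthoFrame.nablaX_vertical {m : M} (hm : m ∈ fr.W) (t : EuclideanSpace ℝ (Fin n)) (a b : Fin n) :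
    fr.nablaX cov a (fr.fibre m t) (fr.vertical m t b) = if a = b then 1 else 0 := by
  have hc : ∀ c, fr.connForm cov a c (fr.fibre m t) (fr.vertical m t b) = 0 := fun c => by
    rw [OrthoFrame.connForm, fr.dproj_vertical, map_zero, inner_zero_right]
  have h := mfderiv_comp t (I := 𝓘(ℝ, EuclideanSpace ℝ (Fin n)))
    (I' := 𝓘(ℝ, EB).prod 𝓘(ℝ, F)) (I'' := 𝓘(ℝ, ℝ)) (f := fr.fibre m) (g := fr.coord a)
    (fr.mdifferentiableAt_coord hm a) ((fr.contMDiff_fibre m).mdifferentiableAt (by simp))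
  have h1 : fr.coord a ∘ fr.fibre m = fun t => t a := funext fun t => fr.coord_fibre hm t a
  have h2 : HasFDerivAt (fun t : EuclideanSpace ℝ (Fin n) => t a)
      (EuclideanSpace.proj a : EuclideanSpace ℝ (Fin n) →L[ℝ] ℝ) t :=
    (EuclideanSpace.proj a : EuclideanSpace ℝ (Fin n) →L[ℝ] ℝ).hasFDerivAt
  rw [h1, mfderiv_eq_fderiv, h2.fderiv] at h
  have h3 : (mfderiv (𝓘(ℝ, EB).prod 𝓘(ℝ, F)) 𝓘(ℝ, ℝ) (fr.coord a) (fr.fibre m t)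
      (fr.vertical m t b) : ℝ) = EuclideanSpace.single b (1 : ℝ) a :=
    (DFunLike.congr_fun h (EuclideanSpace.single b (1 : ℝ))).symm
  have h4 : ∑ c, fr.coord c (fr.fibre m t) * fr.connForm cov a c (fr.fibre m t)
      (fr.vertical m t b) = 0 := Finset.sum_eq_zero fun c _ => by rw [hc, mul_zero]
  unfold OrthoFrame.nablaX
  rw [h4, add_zero]
  refine h3.trans ?_
  rw [PiLp.single_apply]

/-- Vertical vectors project to zero, so the connection and the curvature drop out and `∇𝐱` becomes
`dt`. The integral over `ψ` is that of `mqExp_zero_curvature`, and the scalar part gives the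
Gaussian. -/
theorem OrthoFrame.mqValue_vertical (hcov : cov.IsMetricCompatible) {m : M} (hm : m ∈ fr.W) (t : EuclideanSpace ℝ (Fin n)) :
    fr.mqValue cov (fr.fibre m t) (fr.vertical m t)
      = topSign n * ((((2 * Real.pi) ^ (-(n : ℝ) / 2) * Real.exp (-(1 / 2) * ‖t‖ ^ 2) : ℝ)) : ℂ) := by
  obtain ⟨L, hL⟩ := exists_localModel hcov fr hm
  have hcurv : ∀ a b, inner ℝ (fr.e a (fr.fibre m t).proj) (curvature cov (fr.fibre m t).proj 0 0
      (fr.e b (fr.fibre m t).proj)) = (0 : ℝ) := fun a b => by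
    refine (L.inner_curvature hcov hL a b 0 0).trans ?_
    simp only [map_zero, mul_zero, inner_zero_right, sub_zero, Finset.sum_const_zero, add_zero]
  have hs : IsEven (algebraMap ℂ (Gr (Fin n)) (-(1 / 2 : ℂ) * ((‖t‖ ^ 2 : ℝ) : ℂ))) :=
    isEven_algebraMap _
  rw [fr.mqValue_eq_mqExp, fr.norm_fibre_sq hm]
  simp only [fr.dproj_vertical, hcurv, fr.nablaX_vertical hm, Complex.ofReal_zero, zero_smul,
    ite_self, Finset.sum_const_zero]
  have h1 : (fun a : Fin n => ∑ j, (((if a = j then 1 else 0 : ℝ)) : ℂ) • (gen j : Gr (Fin n)))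
      = gen := by
    funext a
    rw [Finset.sum_eq_single a (fun j _ hj => by simp [hj.symm]) (by simp)]
    simp
  rw [h1, mqExp_eq_mul hs, grExp_algebraMap]
  have h2 := mqExp_zero_curvature (gen : Fin n → Gr (Fin n)) isOdd_gen
  have h3 : mqExp 0 (gen : Fin n → Gr (Fin n)) (fun _ _ => 0)
      = topSign n • (List.ofFn gen).prod := h2
  rw [h3, ← Algebra.smul_def, map_smul, map_smul, map_smul (berezin _),
    List.ofFn_eq_map, berezin_prod_gen (List.nodup_finRange n)]
  simp only [map_smul, map_one, smul_eq_mul]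
  push_cast
  ring

theorem integral_one_mqForm {m : M} (hm : m ∈ fr.W) :
    Integrable (fun t : EuclideanSpace ℝ (Fin n) =>
      (epsilon n • mqForm ho hcov (fr.fibre m t)) (fr.vertical m t)) ∧
    ∫ t : EuclideanSpace ℝ (Fin n),
      ((epsilon n • mqForm ho hcov (fr.fibre m t)) (fr.vertical m t)) = 1 := by
  have he : (fun t : EuclideanSpace ℝ (Fin n) =>
      (epsilon n • mqForm ho hcov (fr.fibre m t)) (fr.vertical m t))
      = fun t => ((((2 * Real.pi) ^ (-(n : ℝ) / 2) * Real.exp (-(1 / 2) * ‖t‖ ^ 2) : ℝ)) : ℂ) := by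
    funext t
    change epsilon n * mqForm ho hcov (fr.fibre m t) (fr.vertical m t) = _
    rw [mqForm_apply ho hcov fr (v := fr.fibre m t) hm, fr.mqValue_vertical hcov hm, ← mul_assoc,
      epsilon_mul_topSign, one_mul]
  have hI := GaussianFourier.integral_rexp_neg_mul_sq_norm (V := EuclideanSpace ℝ (Fin n))
    (b := 1 / 2) (by norm_num)
  rw [finrank_euclideanSpace_fin] at hI
  have hpos : (0 : ℝ) < (Real.pi / (1 / 2)) ^ ((n : ℝ) / 2) := by positivity
  -- The integral of a non-integrable function is `0` by convention, whereas `hI` gives a positive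
  -- value; so integrability comes for free.
  have hint : Integrable fun t : EuclideanSpace ℝ (Fin n) => Real.exp (-(1 / 2) * ‖t‖ ^ 2) := by
    by_contra h
    rw [integral_undef h] at hI
    exact hpos.ne hI
  rw [he]
  refine ⟨(hint.const_mul _).ofReal, ?_⟩
  refine (integral_ofReal (𝕜 := ℂ) (f := fun t : EuclideanSpace ℝ (Fin n) =>
    (2 * Real.pi) ^ (-(n : ℝ) / 2) * Real.exp (-(1 / 2) * ‖t‖ ^ 2))).trans ?_
  rw [integral_const_mul, hI, neg_div, Real.rpow_neg (by positivity),
    show Real.pi / (1 / 2) = 2 * Real.pi by ring, inv_mul_cancel₀ (by positivity)]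
  simp

end Fibre

end MQForm

/-! ### Tempered and rapidly decreasing functions -/

section Tempered

open Filter Topology

set_option linter.unusedSectionVars false

variable {E F G G' : Type*} [NormedAddCommGroup E] [NormedSpace ℝ E] [NormedAddCommGroup F]
  [NormedSpace ℝ F] [NormedAddCommGroup G] [NormedSpace ℝ G] [NormedAddCommGroup G']
  [NormedSpace ℝ G'] {U B : Set E}

/-- Polynomial bounds in the second variable, uniformly in the first variable in `B`. -/
def PolyBdd (B : Set E) (φ : E × F → ℝ) : Prop :=
  ∃ (C : ℝ) (N : ℕ), 0 ≤ C ∧ ∀ b ∈ B, ∀ x, φ (b, x) ≤ C * (1 + ‖x‖) ^ N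

/-- Rapid decrease in the second variable, uniformly in the first variable in `B`. -/
def RapidBdd (B : Set E) (φ : E × F → ℝ) : Prop :=
  ∀ N : ℕ, ∃ C : ℝ, ∀ b ∈ B, ∀ x, (1 + ‖x‖) ^ N * φ (b, x) ≤ C

theorem PolyBdd.mono {φ ψ : E × F → ℝ} (h : PolyBdd B φ) (hψ : ∀ b ∈ B, ∀ x, ψ (b, x) ≤ φ (b, x)) :
    PolyBdd B ψ := by
  obtain ⟨C, N, hC, h⟩ := h
  exact ⟨C, N, hC, fun b hb x => (hψ b hb x).trans (h b hb x)⟩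

theorem polyBdd_const (c : ℝ) : PolyBdd B fun _ : E × F => c :=
  ⟨|c|, 0, abs_nonneg c, fun _ _ _ => by simpa using le_abs_self c⟩

theorem PolyBdd.add {φ ψ : E × F → ℝ} (hφ : PolyBdd B φ) (hψ : PolyBdd B ψ) :
    PolyBdd B fun z => φ z + ψ z := by
  obtain ⟨C, N, hC, h⟩ := hφ
  obtain ⟨C', N', hC', h'⟩ := hψ
  refine ⟨C + C', N + N', by positivity, fun b hb x => ?_⟩
  have h1 : (1 : ℝ) ≤ 1 + ‖x‖ := by linarith [norm_nonneg x]
  have h2 := mul_le_mul_of_nonneg_left (pow_le_pow_right₀ h1 (Nat.le_add_right N N')) hC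
  have h3 := mul_le_mul_of_nonneg_left (pow_le_pow_right₀ h1 (Nat.le_add_left N' N)) hC'
  have := h b hb x
  have := h' b hb x
  rw [add_mul]
  linarith

theorem PolyBdd.mul {φ ψ : E × F → ℝ} (hφ : PolyBdd B φ) (hψ : PolyBdd B ψ) (h0 : ∀ z, 0 ≤ ψ z) :
    PolyBdd B fun z => φ z * ψ z := by
  obtain ⟨C, N, hC, h⟩ := hφ
  obtain ⟨C', N', hC', h'⟩ := hψ
  refine ⟨C * C', N + N', by positivity, fun b hb x => ?_⟩
  have h1 := mul_le_mul (h b hb x) (h' b hb x) (h0 _) (by positivity)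
  rw [pow_add]
  linarith

theorem PolyBdd.sum {ι : Type*} {s : Finset ι} {φ : ι → E × F → ℝ} (h : ∀ i ∈ s, PolyBdd B (φ i)) :
    PolyBdd B fun z => ∑ i ∈ s, φ i z := by
  classical
  induction s using Finset.induction_on with
  | empty => simpa using polyBdd_const 0
  | insert i s hi ih =>
    simp only [Finset.sum_insert hi]
    exact (h i (Finset.mem_insert_self i s)).add
      (ih fun j hj => h j (Finset.mem_insert_of_mem hj))

theorem RapidBdd.mono {φ ψ : E × F → ℝ} (h : RapidBdd B φ)
    (hψ : ∀ b ∈ B, ∀ x, ψ (b, x) ≤ φ (b, x)) : RapidBdd B ψ := by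
  intro N
  obtain ⟨C, h⟩ := h N
  exact ⟨C, fun b hb x => (mul_le_mul_of_nonneg_left (hψ b hb x) (by positivity)).trans (h b hb x)⟩

theorem RapidBdd.mul {φ ψ : E × F → ℝ} (hφ : RapidBdd B φ) (hψ : PolyBdd B ψ) (h0 : ∀ z, 0 ≤ φ z) :
    RapidBdd B fun z => φ z * ψ z := by
  intro N
  obtain ⟨C', N', hC', h'⟩ := hψ
  obtain ⟨C, h⟩ := hφ (N + N')
  refine ⟨C * C', fun b hb x => ?_⟩
  have h1 := mul_le_mul_of_nonneg_right (h b hb x) hC'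
  have h2 := mul_le_mul_of_nonneg_left (h' b hb x)
    (show 0 ≤ (1 + ‖x‖) ^ N * φ (b, x) from mul_nonneg (by positivity) (h0 _))
  rw [pow_add] at h1
  calc _ = (1 + ‖x‖) ^ N * φ (b, x) * ψ (b, x) := by ring
    _ ≤ _ := h2
    _ = (1 + ‖x‖) ^ N * (1 + ‖x‖) ^ N' * φ (b, x) * C' := by ring
    _ ≤ _ := h1

theorem RapidBdd.sum {ι : Type*} {s : Finset ι} {φ : ι → E × F → ℝ}
    (h : ∀ i ∈ s, RapidBdd B (φ i)) : RapidBdd B fun z => ∑ i ∈ s, φ i z := by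
  intro N
  have h' : ∀ i, ∃ C : ℝ, i ∈ s → ∀ b ∈ B, ∀ x, (1 + ‖x‖) ^ N * φ i (b, x) ≤ C := fun i => by
    by_cases hi : i ∈ s
    · obtain ⟨C, hC⟩ := h i hi N
      exact ⟨C, fun _ => hC⟩
    · exact ⟨0, fun hi' => absurd hi' hi⟩
  choose C hC using h'
  refine ⟨∑ i ∈ s, C i, fun b hb x => ?_⟩
  rw [Finset.mul_sum]
  exact Finset.sum_le_sum fun i hi => hC i hi b hb x

/-- A smooth function on `U × F` is tempered over `B` if all derivatives have polynomial bounds. -/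
def Tempered (U B : Set E) (f : E × F → G) : Prop :=
  ContDiffOn ℝ ∞ f (U ×ˢ Set.univ) ∧
    ∀ j : ℕ, PolyBdd B fun z => ‖iteratedFDerivWithin ℝ j f (U ×ˢ Set.univ) z‖

theorem Tempered.congr {f g : E × F → G} (hf : Tempered U B f) (hB : B ⊆ U)
    (h : Set.EqOn g f (U ×ˢ Set.univ)) : Tempered U B g :=
  ⟨hf.1.congr h, fun j => (hf.2 j).mono fun b hb x => by
    rw [iteratedFDerivWithin_congr h ⟨hB hb, Set.mem_univ x⟩]⟩

theorem isOpen_prod_univ (hU : IsOpen U) : IsOpen (U ×ˢ (Set.univ : Set F)) := hU.prod isOpen_univ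

theorem Tempered.smul (hU : IsOpen U) (hB : B ⊆ U) {f : E × F → ℝ} {g : E × F → G} (hf : Tempered U B f) (hg : Tempered U B g) :
    Tempered U B fun z => f z • g z := by
  refine ⟨hf.1.smul hg.1, fun j => ?_⟩
  refine PolyBdd.mono (PolyBdd.sum (s := Finset.range (j + 1)) fun i _ =>
    ((polyBdd_const (j.choose i : ℝ)).mul (hf.2 i) fun z => norm_nonneg _).mul (hg.2 (j - i))
      fun z => norm_nonneg _) fun b hb x => ?_
  exact norm_iteratedFDerivWithin_smul_le hf.1 hg.1 (isOpen_prod_univ hU).uniqueDiffOn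
    ⟨hB hb, Set.mem_univ x⟩ (by exact_mod_cast le_top)

theorem Tempered.add (hU : IsOpen U) (hB : B ⊆ U) {f g : E × F → G} (hf : Tempered U B f) (hg : Tempered U B g) :
    Tempered U B fun z => f z + g z := by
  refine ⟨hf.1.add hg.1, fun j => ((hf.2 j).add (hg.2 j)).mono fun b hb x => ?_⟩
  have hz : (b, x) ∈ U ×ˢ (Set.univ : Set F) := ⟨hB hb, Set.mem_univ x⟩
  have h := iteratedFDerivWithin_add_apply ((hf.1.of_le (by exact_mod_cast le_top) :
    ContDiffOn ℝ j f _) _ hz) ((hg.1.of_le (by exact_mod_cast le_top) : ContDiffOn ℝ j g _) _ hz)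
    (isOpen_prod_univ hU).uniqueDiffOn hz
  change ‖iteratedFDerivWithin ℝ j (f + g) _ _‖ ≤ _
  rw [h]
  exact norm_add_le _ _

theorem tempered_const (c : G) : Tempered U B fun _ : E × F => c := by
  refine ⟨contDiffOn_const, fun j => ?_⟩
  cases j with
  | zero => exact (polyBdd_const ‖c‖).mono fun b _ x => by rw [norm_iteratedFDerivWithin_zero]
  | succ j =>
    exact (polyBdd_const 0).mono fun b _ x => by rw [iteratedFDerivWithin_succ_const]; simp

theorem Tempered.sum (hU : IsOpen U) (hB : B ⊆ U) {ι : Type*} {s : Finset ι} {f : ι → E × F → G}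
    (h : ∀ i ∈ s, Tempered U B (f i)) : Tempered U B fun z => ∑ i ∈ s, f i z := by
  classical
  induction s using Finset.induction_on with
  | empty => simpa using tempered_const (0 : G)
  | insert i s hi ih =>
    simp only [Finset.sum_insert hi]
    exact (h i (Finset.mem_insert_self i s)).add hU hB
      (ih fun j hj => h j (Finset.mem_insert_of_mem hj))

theorem Tempered.prod (hU : IsOpen U) (hB : B ⊆ U) {ι : Type*} {s : Finset ι} {f : ι → E × F → ℝ}
    (h : ∀ i ∈ s, Tempered U B (f i)) : Tempered U B fun z => ∏ i ∈ s, f i z := by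
  classical
  induction s using Finset.induction_on with
  | empty => simpa using tempered_const (1 : ℝ)
  | insert i s hi ih =>
    simp only [Finset.prod_insert hi]
    exact (h i (Finset.mem_insert_self i s)).smul hU hB
      (ih fun j hj => h j (Finset.mem_insert_of_mem hj))

theorem Tempered.clm_comp (hU : IsOpen U) (hB : B ⊆ U) {f : E × F → G} (hf : Tempered U B f) (ℓ : G →L[ℝ] G') :
    Tempered U B fun z => ℓ (f z) := by
  refine ⟨ℓ.contDiff.comp_contDiffOn hf.1, fun j =>
    ((polyBdd_const ‖ℓ‖).mul (hf.2 j) fun _ => norm_nonneg _).mono fun b hb x => ?_⟩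
  have hz : (b, x) ∈ U ×ˢ (Set.univ : Set F) := ⟨hB hb, Set.mem_univ x⟩
  change ‖iteratedFDerivWithin ℝ j (ℓ ∘ f) _ _‖ ≤ _
  rw [ℓ.iteratedFDerivWithin_comp_left (hf.1 _ hz) (isOpen_prod_univ hU).uniqueDiffOn hz
    (by exact_mod_cast le_top)]
  exact ContinuousLinearMap.norm_compContinuousMultilinearMap_le _ _

theorem Tempered.fderiv (hU : IsOpen U) (hB : B ⊆ U) {f : E × F → G} (hf : Tempered U B f) :
    Tempered U B (fderiv ℝ f) := by
  have ho := isOpen_prod_univ (F := F) hU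
  have h1 : Tempered U B (fderivWithin ℝ f (U ×ˢ Set.univ)) := by
    refine ⟨hf.1.fderivWithin ho.uniqueDiffOn (by simp), fun j => (hf.2 (j + 1)).mono fun b hb x => ?_⟩
    rw [norm_iteratedFDerivWithin_fderivWithin ho.uniqueDiffOn ⟨hB hb, Set.mem_univ x⟩]
  exact h1.congr hB fun z hz => (fderivWithin_of_isOpen ho hz).symm

theorem tempered_comp_fst (hU : IsOpen U) (hB : B ⊆ U) (hBc : IsCompact B) {c : E → G} (hc : ContDiffOn ℝ ∞ c U) :
    Tempered U B fun z : E × F => c z.1 := by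
  have hpre : (ContinuousLinearMap.fst ℝ E F) ⁻¹' U = U ×ˢ Set.univ := by ext; simp
  refine ⟨hc.comp contDiff_fst.contDiffOn fun z hz => hz.1, fun j => ?_⟩
  have hcont : ContinuousOn (iteratedFDerivWithin ℝ j c U) U :=
    hc.continuousOn_iteratedFDerivWithin (by exact_mod_cast le_top) hU.uniqueDiffOn
  obtain ⟨C, hC⟩ := hBc.exists_bound_of_continuousOn (hcont.mono hB)
  refine (polyBdd_const (C * 1)).mono fun b hb x => ?_
  have h := (ContinuousLinearMap.fst ℝ E F).iteratedFDerivWithin_comp_right hc hU.uniqueDiffOn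
    (by rw [hpre]; exact (isOpen_prod_univ hU).uniqueDiffOn) (x := (b, x)) (hB hb) (i := j)
    (by exact_mod_cast le_top)
  rw [hpre] at h
  change ‖iteratedFDerivWithin ℝ j (c ∘ ContinuousLinearMap.fst ℝ E F) _ _‖ ≤ _
  rw [h]
  refine (ContinuousMultilinearMap.norm_compContinuousLinearMap_le _ _).trans ?_
  refine mul_le_mul (hC b hb) (Finset.prod_le_one (fun _ _ => norm_nonneg _) fun _ _ =>
    ContinuousLinearMap.norm_fst_le ℝ E F) (Finset.prod_nonneg fun _ _ => norm_nonneg _)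
    ((norm_nonneg _).trans (hC b hb))

theorem tempered_snd (hU : IsOpen U) (hB : B ⊆ U) : Tempered U B (Prod.snd : E × F → F) := by
  have ho := isOpen_prod_univ (F := F) hU
  refine ⟨contDiff_snd.contDiffOn, fun j => ?_⟩
  cases j with
  | zero =>
    refine ⟨1, 1, by norm_num, fun b hb x => ?_⟩
    change ‖iteratedFDerivWithin ℝ 0 _ _ _‖ ≤ _
    rw [norm_iteratedFDerivWithin_zero]
    simp
  | succ j =>
    refine ((tempered_const (U := U) (B := B) (F := F)
      (ContinuousLinearMap.snd ℝ E F)).2 j).mono fun b hb x => ?_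
    have hz : (b, x) ∈ U ×ˢ (Set.univ : Set F) := ⟨hB hb, Set.mem_univ x⟩
    rw [← norm_iteratedFDerivWithin_fderivWithin ho.uniqueDiffOn hz]
    refine le_of_eq (congrArg norm (iteratedFDerivWithin_congr (fun z hz => ?_) hz j))
    exact (ContinuousLinearMap.snd ℝ E F).fderivWithin (ho.uniqueDiffOn z hz)

/-- The constant combines `(1 + r)ᴺ ≤ N! exp(1 + r)` with `r - c r² ≤ 1/(4c)`, the latter by
completing the square. -/
theorem rapidBdd_gaussian {c : ℝ} (hc : 0 < c) {φ : E × F → ℝ}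
    (h : ∀ b ∈ B, ∀ x, φ (b, x) ≤ Real.exp (-c * ‖x‖ ^ 2)) : RapidBdd B φ := by
  intro N
  refine ⟨N.factorial * Real.exp (1 + 1 / (4 * c)), fun b hb x => ?_⟩
  have h1 := Real.pow_div_factorial_le_exp (1 + ‖x‖) (by positivity) N
  rw [div_le_iff₀ (by positivity)] at h1
  have h2 : ‖x‖ - c * ‖x‖ ^ 2 ≤ 1 / (4 * c) := by
    have h3 : 1 / (4 * c) - (‖x‖ - c * ‖x‖ ^ 2) = c * (‖x‖ - 1 / (2 * c)) ^ 2 := by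
      field_simp
      ring
    have h4 : 0 ≤ c * (‖x‖ - 1 / (2 * c)) ^ 2 := by positivity
    linarith
  calc (1 + ‖x‖) ^ N * φ (b, x)
      ≤ (Real.exp (1 + ‖x‖) * N.factorial) * Real.exp (-c * ‖x‖ ^ 2) :=
        (mul_le_mul_of_nonneg_left (h b hb x) (by positivity)).trans
          (mul_le_mul_of_nonneg_right h1 (by positivity))
    _ = N.factorial * Real.exp (1 + (‖x‖ - c * ‖x‖ ^ 2)) := by
        rw [mul_comm (Real.exp _), mul_assoc, ← Real.exp_add]
        ring_nf
    _ ≤ _ := by gcongr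

/-- Since `D(exp g) = exp g • Dg`, the Leibniz rule bounds each derivative by lower derivatives of
`exp g` times tempered factors, and strong induction applies. -/
theorem rapidBdd_exp (hU : IsOpen U) (hB : B ⊆ U) {g : E × F → ℝ} (hg : Tempered U B g) {c : ℝ} (hc : 0 < c)
    (h : ∀ b ∈ B, ∀ x, g (b, x) ≤ -c * ‖x‖ ^ 2) (j : ℕ) : RapidBdd B fun z =>
      ‖iteratedFDerivWithin ℝ j (fun z => Real.exp (g z)) (U ×ˢ Set.univ) z‖ := by
  have ho := isOpen_prod_univ (F := F) hU
  have hexp : ContDiffOn ℝ ∞ (fun z => Real.exp (g z)) (U ×ˢ Set.univ) :=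
    Real.contDiff_exp.comp_contDiffOn hg.1
  induction j using Nat.strong_induction_on with
  | _ j ih =>
    cases j with
    | zero =>
      refine rapidBdd_gaussian hc fun b hb x => ?_
      rw [norm_iteratedFDerivWithin_zero, Real.norm_eq_abs, Real.abs_exp]
      exact Real.exp_le_exp.2 (h b hb x)
    | succ j =>
      have hd := hg.fderiv hU hB
      refine RapidBdd.mono (RapidBdd.sum (s := Finset.range (j + 1)) fun i hi =>
        ((ih i (Finset.mem_range.1 hi)).mul ((polyBdd_const (j.choose i : ℝ)).mul (hd.2 (j - i))
          fun _ => norm_nonneg _) fun _ => norm_nonneg _)) fun b hb x => ?_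
      have hz : (b, x) ∈ U ×ˢ (Set.univ : Set F) := ⟨hB hb, Set.mem_univ x⟩
      rw [← norm_iteratedFDerivWithin_fderivWithin ho.uniqueDiffOn hz]
      have he : Set.EqOn (fderivWithin ℝ (fun z => Real.exp (g z)) (U ×ˢ Set.univ))
          (fun z => Real.exp (g z) • fderiv ℝ g z) (U ×ˢ Set.univ) := fun z hz => by
        rw [fderivWithin_of_isOpen ho hz]
        exact fderiv_exp ((hg.1.contDiffAt (ho.mem_nhds hz)).differentiableAt (by simp))
      rw [iteratedFDerivWithin_congr he hz]
      refine (norm_iteratedFDerivWithin_smul_le hexp hd.1 ho.uniqueDiffOn hz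
        (n := j) (by exact_mod_cast le_top)).trans (le_of_eq (Finset.sum_congr rfl fun i _ => ?_))
      ring

/-- The product of a Gaussian and a tempered function is rapidly decreasing. -/
theorem rapidBdd_exp_smul (hU : IsOpen U) (hB : B ⊆ U) {g : E × F → ℝ} (hg : Tempered U B g) {c : ℝ} (hc : 0 < c)
    (h : ∀ b ∈ B, ∀ x, g (b, x) ≤ -c * ‖x‖ ^ 2) {f : E × F → G} (hf : Tempered U B f) (j : ℕ) :
    RapidBdd B fun z =>
      ‖iteratedFDerivWithin ℝ j (fun z => Real.exp (g z) • f z) (U ×ˢ Set.univ) z‖ := by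
  have ho := isOpen_prod_univ (F := F) hU
  refine RapidBdd.mono (RapidBdd.sum (s := Finset.range (j + 1)) fun i hi =>
    ((rapidBdd_exp hU hB hg hc h i).mul ((polyBdd_const (j.choose i : ℝ)).mul (hf.2 (j - i))
      fun _ => norm_nonneg _) fun _ => norm_nonneg _)) fun b hb x => ?_
  have hexp : ContDiffOn ℝ ∞ (fun z => Real.exp (g z)) (U ×ˢ Set.univ) :=
    Real.contDiff_exp.comp_contDiffOn hg.1
  refine (norm_iteratedFDerivWithin_smul_le hexp hf.1
    ho.uniqueDiffOn ⟨hB hb, Set.mem_univ x⟩ (n := j) (by exact_mod_cast le_top)).trans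
    (le_of_eq (Finset.sum_congr rfl fun i _ => ?_))
  ring

end Tempered

/-! ### Rapid decrease of the Mathai–Quillen form -/

section Rapid

set_option linter.unusedSectionVars false

open Filter Topology

/-! ### Functions that are linear or quadratic along the fibres. -/

section Linear

variable {E F : Type*} [NormedAddCommGroup E] [NormedSpace ℝ E] [NormedAddCommGroup F]
  [NormedSpace ℝ F] [FiniteDimensional ℝ F] {U B : Set E}

/-- In a basis `β` of the fibre, `f (b, x)` is a sum of coordinates of `x` times `f (b, β i)`. The
latter depend on the base alone, where compactness of `B` bounds all derivatives. -/
theorem tempered_of_linear (hU : IsOpen U) (hB : B ⊆ U) (hBc : IsCompact B) {f : E × F → ℝ}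
    (hf : ContDiffOn ℝ ∞ f (U ×ˢ Set.univ)) {ℓ : E → F →ₗ[ℝ] ℝ}
    (h : ∀ b ∈ U, ∀ x, f (b, x) = ℓ b x) : Tempered U B f := by
  let β := Module.finBasis ℝ F
  have hc : ∀ i, ContDiffOn ℝ ∞ (fun b => f (b, β i)) U := fun i =>
    hf.comp (contDiff_prodMk_left (β i)).contDiffOn fun b hb => ⟨hb, Set.mem_univ _⟩
  have ht : Tempered U B fun z : E × F =>
      ∑ i, LinearMap.toContinuousLinearMap (β.coord i) z.2 • f (z.1, β i) :=
    Tempered.sum hU hB fun i _ => ((tempered_snd hU hB).clm_comp hU hB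
      (LinearMap.toContinuousLinearMap (β.coord i))).smul hU hB
      (tempered_comp_fst hU hB hBc (hc i))
  refine ht.congr hB fun z hz => ?_
  have h1 : z.2 = ∑ i, β.coord i z.2 • β i := (β.sum_repr z.2).symm
  change f (z.1, z.2) = _
  rw [h _ hz.1]
  conv_lhs => rw [h1, map_sum]
  refine Finset.sum_congr rfl fun i _ => ?_
  rw [map_smul, h _ hz.1]
  rfl

/-- The constant is the minimum on the compact set `B × sphere`, extended to all vectors by
homogeneity. -/
theorem exists_quadratic_lower_bound (hBc : IsCompact B) {q : E × F → ℝ}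
    (hq : ContinuousOn q (B ×ˢ Set.univ)) (hpos : ∀ b ∈ B, ∀ x, x ≠ 0 → 0 < q (b, x))
    (hom : ∀ b ∈ B, ∀ (r : ℝ) x, q (b, r • x) = r ^ 2 * q (b, x)) :
    ∃ c > 0, ∀ b ∈ B, ∀ x, c * ‖x‖ ^ 2 ≤ q (b, x) := by
  have hc : IsCompact (B ×ˢ Metric.sphere (0 : F) 1) := hBc.prod (isCompact_sphere 0 1)
  have hb : ∃ c > 0, ∀ z ∈ B ×ˢ Metric.sphere (0 : F) 1, c ≤ q z := by
    by_cases hne : (B ×ˢ Metric.sphere (0 : F) 1).Nonempty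
    · obtain ⟨z, hz, hmin⟩ := hc.exists_isMinOn hne
        (hq.mono (Set.prod_mono_right (Set.subset_univ _)))
      refine ⟨q z, hpos z.1 hz.1 z.2 ?_, fun w hw => hmin hw⟩
      intro h0
      have := hz.2
      rw [h0] at this
      simp at this
    -- If `B` or the unit sphere is empty, the last case being a fibre of dimension zero, any
    -- positive constant serves.
    · exact ⟨1, one_pos, fun z hz => (hne ⟨z, hz⟩).elim⟩
  obtain ⟨c, hc0, hc⟩ := hb
  refine ⟨c, hc0, fun b hb x => ?_⟩
  by_cases hx : x = 0
  · have h0 := hom b hb 0 x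
    rw [zero_smul] at h0
    rw [hx, h0]
    simp
  · have hn : ‖x‖ ≠ 0 := norm_ne_zero_iff.2 hx
    have h1 := hc (b, ‖x‖⁻¹ • x) ⟨hb, by simp [norm_smul, hn]⟩
    have h2 := hom b hb ‖x‖ (‖x‖⁻¹ • x)
    rw [smul_smul, mul_inv_cancel₀ hn, one_smul] at h2
    rw [h2, mul_comm]
    exact mul_le_mul_of_nonneg_left h1 (by positivity)

theorem tempered_wedgeForm [FiniteDimensional ℝ E] (hU : IsOpen U) (hB : B ⊆ U) {k : ℕ} (c : ℂ)
    {g : Fin k → E × F → ℝ} (hg : ∀ a, Tempered U B (g a)) :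
    Tempered U B fun z => wedgeForm c fun a => fderiv ℝ (g a) z := by
  obtain ⟨N, u, η, hη⟩ := exists_coframe k (E × F)
  have h : Tempered U B fun z => ∑ i,
      ((Matrix.of fun a b => fderiv ℝ (g a) z (u i b)).det : ℝ) • (c • η i) := by
    refine Tempered.sum hU hB fun i _ => Tempered.smul hU hB ?_ (tempered_const _)
    simp only [Matrix.det_apply']
    refine Tempered.sum hU hB fun σ _ => Tempered.smul hU hB (tempered_const _)
      (Tempered.prod hU hB fun a _ => ?_)
    exact ((hg _).fderiv hU hB).clm_comp hU hB
      (ContinuousLinearMap.apply ℝ ℝ (u i a))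
  refine h.congr hB fun z _ => (hη _).trans (Finset.sum_congr rfl fun i _ => ?_)
  rw [wedgeForm_apply]
  ext w
  change _ * η i w = ((Matrix.of fun a b => _root_.fderiv ℝ (g a) z (u i b)).det : ℝ) • (c * η i w)
  rw [Complex.real_smul]
  ring

end Linear

variable {EB : Type*} [NormedAddCommGroup EB] [NormedSpace ℝ EB] [FiniteDimensional ℝ EB]
  {M : Type*} [TopologicalSpace M] [ChartedSpace EB M] [IsManifold 𝓘(ℝ, EB) ∞ M] [T2Space M]
  {F : Type*} [NormedAddCommGroup F] [NormedSpace ℝ F] [FiniteDimensional ℝ F]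
  {V : M → Type*} [TopologicalSpace (TotalSpace F V)]
  [∀ m, NormedAddCommGroup (V m)] [∀ m, InnerProductSpace ℝ (V m)]
  [FiberBundle F V] [VectorBundle ℝ F V] [ContMDiffVectorBundle ∞ F V 𝓘(ℝ, EB)]
  [IsContMDiffRiemannianBundle 𝓘(ℝ, EB) ∞ F V]
  {n : ℕ} {o : ∀ m, Orientation ℝ (V m) (Fin n)}
  {cov : CovariantDerivative 𝓘(ℝ, EB) F V}

theorem extChartAt_totalSpace_symm (v : TotalSpace F V) {b : EB}
    (hb : (extChartAt 𝓘(ℝ, EB) v.proj).symm b ∈ (trivializationAt F V v.proj).baseSet) (x : F) :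
    (extChartAt (𝓘(ℝ, EB).prod 𝓘(ℝ, F)) v).symm (b, x)
      = ⟨(extChartAt 𝓘(ℝ, EB) v.proj).symm b, (trivializationAt F V v.proj).symmₗ ℝ
        ((extChartAt 𝓘(ℝ, EB) v.proj).symm b) x⟩ := by
  rw [FiberBundle.extChartAt, Trivialization.symmₗ_apply _ hb]
  exact ((trivializationAt F V v.proj).mk_symm hb x).symm

/-! ### Fibrewise polynomial functions and forms in a bundle chart. -/

section Chart

variable {v : TotalSpace F V} {U B : Set EB}

theorem prod_subset_target (hUv : U ⊆ (extChartAt 𝓘(ℝ, EB) v.proj).target ∩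
    (extChartAt 𝓘(ℝ, EB) v.proj).symm ⁻¹' (trivializationAt F V v.proj).baseSet) :
    U ×ˢ Set.univ ⊆ (extChartAt (𝓘(ℝ, EB).prod 𝓘(ℝ, F)) v).target := by
  rw [FiberBundle.extChartAt_target]
  exact Set.prod_mono_left hUv

/-- Tempered functions are closed under sums and products, so only generators matter. Functions from
the base are bounded with all derivatives over compact sets, and the others are linear along the
fibres in a bundle chart. -/
theorem tempered_fibrePolynomial (hU : IsOpen U) (hB : B ⊆ U) (hBc : IsCompact B)
    (hUv : U ⊆ (extChartAt 𝓘(ℝ, EB) v.proj).target ∩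
    (extChartAt 𝓘(ℝ, EB) v.proj).symm ⁻¹' (trivializationAt F V v.proj).baseSet)
    {f : TotalFun EB F V} (hf : f ∈ fibrePolynomials EB F V) :
    Tempered U B (f ∘ (extChartAt (𝓘(ℝ, EB).prod 𝓘(ℝ, F)) v).symm) := by
  have := t2Space_totalSpace F V
  induction hf using Algebra.adjoin_induction with
  | mem f hf =>
    rcases hf with ⟨g, rfl⟩ | ⟨s, hs, rfl⟩
    · have hg : ContDiffOn ℝ ∞ (g ∘ (extChartAt 𝓘(ℝ, EB) v.proj).symm) U :=
        (contDiffOn_comp_extChartAt_symm g.contMDiff v.proj).mono fun b hb => (hUv hb).1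
      refine (tempered_comp_fst hU hB hBc hg).congr hB fun z hz => ?_
      change pullProj EB F V g ((extChartAt _ v).symm (z.1, z.2)) = _
      rw [extChartAt_totalSpace_symm v (hUv hz.1).2]
      rfl
    · refine tempered_of_linear hU hB hBc ((contDiffOn_comp_extChartAt_symm
        (fibreLinear s hs).contMDiff v).mono (prod_subset_target hUv))
        (ℓ := fun b => (innerₗ _ (s ((extChartAt 𝓘(ℝ, EB) v.proj).symm b))).comp
          ((trivializationAt F V v.proj).symmₗ ℝ ((extChartAt 𝓘(ℝ, EB) v.proj).symm b)))
        fun b hb x => ?_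
      change fibreLinear s hs ((extChartAt _ v).symm (b, x)) = _
      rw [extChartAt_totalSpace_symm v (hUv hb).2]
      rfl
  | algebraMap r => exact tempered_const r
  | add f g _ _ hf hg => exact hf.add hU hB hg
  | mul f g _ _ hf hg => exact hf.smul hU hB hg

theorem FormalForm.tempered_alt (hU : IsOpen U) (hB : B ⊆ U) (hBc : IsCompact B)
    (hUv : U ⊆ (extChartAt 𝓘(ℝ, EB) v.proj).target ∩
    (extChartAt 𝓘(ℝ, EB) v.proj).symm ⁻¹' (trivializationAt F V v.proj).baseSet)
    {k : ℕ} {P : FormalForm (TotalFun EB F V) k} (hf : ∀ j, P.f j ∈ fibrePolynomials EB F V)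
    (hg : ∀ j a, P.g j a ∈ fibrePolynomials EB F V) : Tempered U B (P.alt.inChart v) := by
  have := t2Space_totalSpace F V
  refine Tempered.congr (Tempered.sum hU hB fun j _ =>
    (tempered_fibrePolynomial hU hB hBc hUv (hf j)).smul hU hB
      (tempered_wedgeForm hU hB (P.c j) fun a => tempered_fibrePolynomial hU hB hBc hUv (hg j a)))
    hB fun z hz => P.alt_inChart v (prod_subset_target hUv hz)

variable {fr : OrthoFrame EB F o} (L : LocalModel fr cov)

theorem LocalModel.sum_x_mul_x {w : TotalSpace F V} (hw : w.proj ∈ L.O) :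
    ∑ a, L.x a w * L.x a w = ‖w.snd‖ ^ 2 := by
  rw [← real_inner_self_eq_norm_sq, ← fr.sum_inner_mul (L.le hw)]
  refine Finset.sum_congr rfl fun a _ => ?_
  rw [L.x_apply hw, real_inner_comm (fr.e a w.proj) w.snd]
  rfl

/-- The form splits as `exp(-½ q)` times a form with fibrewise polynomial coefficients. In the chart
`q` is the square of the fibre norm, bounded below by `C ‖x‖²` uniformly over `B`, so the Gaussian
beats the polynomial growth. -/
theorem LocalModel.exists_bound_thom (hU : IsOpen U) (hB : B ⊆ U) (hBc : IsCompact B)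
    (hUv : U ⊆ (extChartAt 𝓘(ℝ, EB) v.proj).target ∩
    (extChartAt 𝓘(ℝ, EB) v.proj).symm ⁻¹' (trivializationAt F V v.proj).baseSet)
    (hUL : ∀ b ∈ U, (extChartAt 𝓘(ℝ, EB) v.proj).symm b ∈ L.O) (c : ℂ) (j : ℕ) :
    RapidBdd B fun z => ‖iteratedFDerivWithin ℝ j ((L.thom.smul c).alt.inChart v)
      (U ×ˢ Set.univ) z‖ := by
  have := t2Space_totalSpace F V
  set Φ := (extChartAt (𝓘(ℝ, EB).prod 𝓘(ℝ, F)) v).symm with hΦ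
  let q : TotalFun EB F V := ∑ a, L.x a * L.x a
  have hqm : q ∈ fibrePolynomials EB F V :=
    Subalgebra.sum_mem _ fun a _ => Subalgebra.mul_mem _ (fibreLinear_mem _ _) (fibreLinear_mem _ _)
  have hq : ∀ b ∈ U, ∀ x, q (Φ (b, x)) = ‖(trivializationAt F V v.proj).symmₗ ℝ
      ((extChartAt 𝓘(ℝ, EB) v.proj).symm b) x‖ ^ 2 := fun b hb x => by
    rw [hΦ, extChartAt_totalSpace_symm v (hUv hb).2]
    refine Eq.trans ?_ (L.sum_x_mul_x (w := ⟨_, _⟩) (hUL b hb))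
    exact (map_sum (evalAt (𝓘(ℝ, EB).prod 𝓘(ℝ, F)) _) (fun a => L.x a * L.x a) Finset.univ).trans
      (Finset.sum_congr rfl fun a _ => map_mul _ _ _)
  have hqt := tempered_fibrePolynomial hU hB hBc hUv hqm
  obtain ⟨C, hC, hbound⟩ := exists_quadratic_lower_bound hBc (q := q ∘ Φ)
    (hqt.1.continuousOn.mono (Set.prod_mono_left hB)) (fun b hb x hx => by
      rw [Function.comp_apply, hq b (hB hb)]
      have h0 : (trivializationAt F V v.proj).symmₗ ℝ
          ((extChartAt 𝓘(ℝ, EB) v.proj).symm b) x ≠ 0 := fun h => hx (by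
        have h1 := (trivializationAt F V v.proj).linearMapAt_symmₗ (R := ℝ) (hUv (hB hb)).2 x
        rw [h, map_zero] at h1
        exact h1.symm)
      positivity) fun b hb r x => by
      rw [Function.comp_apply, Function.comp_apply, hq b (hB hb), hq b (hB hb), map_smul,
        norm_smul, mul_pow, Real.norm_eq_abs, sq_abs]
  have hg : Tempered U B fun z => (-(1 / 2) : ℝ) • q (Φ z) :=
    Tempered.smul hU hB (tempered_const _) hqt
  let Q := (L.preForm.smul (((2 * Real.pi) ^ (-(n : ℝ) / 2) : ℝ) : ℂ)).smul c
  have hQ : Tempered U B (Q.alt.inChart v) :=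
    FormalForm.tempered_alt hU hB hBc hUv L.preForm_f_mem L.preForm_g_mem
  have hr := rapidBdd_exp_smul hU hB hg (c := C / 2) (by positivity) (fun b hb x => by
    have := hbound b hb x
    rw [Function.comp_apply] at this
    rw [smul_eq_mul]
    linarith) hQ j
  have he : Set.EqOn ((L.thom.smul c).alt.inChart v)
      (fun z => Real.exp ((-(1 / 2) : ℝ) • q (Φ z)) • Q.alt.inChart v z) (U ×ˢ Set.univ) := by
    intro z hz
    rw [FormalForm.alt_inChart _ v (prod_subset_target hUv hz)]
    refine Eq.trans ?_ (congrArg (fun y => Real.exp ((-(1 / 2) : ℝ) • q (Φ z)) • y)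
      (FormalForm.alt_inChart Q v (prod_subset_target hUv hz)).symm)
    refine Eq.trans (Finset.sum_congr rfl fun i _ => ?_) Finset.smul_sum.symm
    exact mul_smul _ _ _
  refine hr.mono fun b hb x => le_of_eq ?_
  have hz : (b, x) ∈ U ×ˢ (Set.univ : Set F) := ⟨hB hb, Set.mem_univ x⟩
  exact congrArg norm (iteratedFDerivWithin_congr he hz j)

end Chart

variable [CovariantDerivative.ContMDiffCovariantDerivative cov ∞]
  (ho : IsBundleOrientation EB F o) (hcov : cov.IsMetricCompatible)

/-- A local model is available only near a given base point. Compactness of `K` reduces the bound to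
small compact neighbourhoods, each contained in the domain of one model. -/
theorem isRapidlyDecreasing_mqForm (c : ℂ) :
    IsRapidlyDecreasing (show DiffForm (𝓘(ℝ, EB).prod 𝓘(ℝ, F)) (TotalSpace F V) n from
      fun v => c • mqForm ho hcov v) := by
  intro v K hK hKv N j
  rw [FiberBundle.extChartAt_target] at hKv
  have hKv' : K ⊆ (extChartAt 𝓘(ℝ, EB) v.proj).target ∩
      (extChartAt 𝓘(ℝ, EB) v.proj).symm ⁻¹' (trivializationAt F V v.proj).baseSet := fun b hb =>
    (hKv (⟨hb, Set.mem_univ (0 : F)⟩ : (b, (0 : F)) ∈ K ×ˢ Set.univ)).1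
  set α : DiffForm (𝓘(ℝ, EB).prod 𝓘(ℝ, F)) (TotalSpace F V) n := fun v => c • mqForm ho hcov v
    with hα
  change ∃ C : ℝ, ∀ b ∈ K, ∀ x : F, ‖x‖ ^ N * ‖iteratedFDeriv ℝ j (α.inChart v) (b, x)‖ ≤ C
  refine hK.induction_on (p := fun K => ∃ C : ℝ, ∀ b ∈ K, ∀ x : F,
    ‖x‖ ^ N * ‖iteratedFDeriv ℝ j (α.inChart v) (b, x)‖ ≤ C) ⟨0, by simp⟩
    (fun s t hst ⟨C, hC⟩ => ⟨C, fun b hb => hC b (hst hb)⟩)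
    (fun s t ⟨C, hC⟩ ⟨C', hC'⟩ => ⟨max C C', fun b hb x => hb.elim
      (fun h => (hC b h x).trans (le_max_left _ _))
      (fun h => (hC' b h x).trans (le_max_right _ _))⟩) fun b₀ hb₀ => ?_
  set m₀ := (extChartAt 𝓘(ℝ, EB) v.proj).symm b₀ with hm₀
  let L := modelAt ho hcov m₀
  let U : Set EB := (extChartAt 𝓘(ℝ, EB) v.proj).target ∩ (extChartAt 𝓘(ℝ, EB) v.proj).symm ⁻¹'
    ((trivializationAt F V v.proj).baseSet ∩ L.O)
  have hU : IsOpen U := (continuousOn_extChartAt_symm v.proj).isOpen_inter_preimage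
    (isOpen_extChartAt_target v.proj) ((trivializationAt F V v.proj).open_baseSet.inter L.O.isOpen)
  have hUv : U ⊆ (extChartAt 𝓘(ℝ, EB) v.proj).target ∩
      (extChartAt 𝓘(ℝ, EB) v.proj).symm ⁻¹' (trivializationAt F V v.proj).baseSet :=
    fun b hb => ⟨hb.1, hb.2.1⟩
  have hbU : b₀ ∈ U := ⟨(hKv' hb₀).1, (hKv' hb₀).2, mem_modelAt ho hcov m₀⟩
  obtain ⟨B, hBn, hBU, hBc⟩ := local_compact_nhds (hU.mem_nhds hbU)
  refine ⟨B, mem_nhdsWithin_of_mem_nhds hBn, ?_⟩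
  obtain ⟨C, hC⟩ := L.exists_bound_thom hU hBU hBc hUv (fun b hb => hb.2.2) c j N
  refine ⟨C, fun b hb x => le_trans ?_ (hC b hb x)⟩
  have ho' := isOpen_prod_univ (F := F) hU
  have hz : (b, x) ∈ U ×ˢ (Set.univ : Set F) := ⟨hBU hb, Set.mem_univ x⟩
  change _ ≤ (1 + ‖x‖) ^ N * ‖iteratedFDerivWithin ℝ j _ (U ×ˢ Set.univ) (b, x)‖
  rw [iteratedFDerivWithin_of_isOpen j ho' hz]
  refine mul_le_mul (pow_le_pow_left₀ (norm_nonneg x) (by linarith) N) (le_of_eq ?_)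
    (norm_nonneg _) (by positivity)
  have he : α.inChart v =ᶠ[𝓝 (b, x)] (L.thom.smul c).alt.inChart v := by
    have := t2Space_totalSpace F V
    have hp : ((extChartAt (𝓘(ℝ, EB).prod 𝓘(ℝ, F)) v).symm (b, x)).proj ∈ L.O := by
      rw [extChartAt_totalSpace_symm v (hUv hz.1).2]
      exact hz.1.2.2
    refine DiffForm.inChart_eventuallyEq (prod_subset_target hUv hz) ?_
    filter_upwards [L.eventually_mem hp] with w hw
    rw [FormalForm.alt_smul, ← mqForm_eq ho hcov L hw]
  rw [(he.iteratedFDeriv ℝ j).eq_of_nhds]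

end Rapid

/-! ### Formal forms as functions on points of the odd tangent bundle -/

section Points

set_option linter.unusedSectionVars false

open Filter Topology

universe u

variable {E : Type u} [NormedAddCommGroup E] [NormedSpace ℝ E] [FiniteDimensional ℝ E]
  {H : Type*} [TopologicalSpace H] {I : ModelWithCorners ℝ E H}
  {X : Type*} [TopologicalSpace X] [ChartedSpace H X] {k : ℕ} {S : SuperDomain}

/-- The homomorphism given by an object of `L^{0|1}(X)` at a point of the base. -/
def SPoint.homAt (φ : SPoint I X S) (y : S.U) :
    C^∞⟮I, X; 𝓘(ℝ, ℝ), ℝ⟯ →ₐ[ℝ] Gr (Option (Fin S.q)) :=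
  (Pi.evalAlgHom ℝ (fun _ : S.U => Gr (Option (Fin S.q))) y).comp φ.pull

theorem SPoint.liesOver_homAt (φ : SPoint I X S) (y : S.U) : LiesOver (φ.homAt y) (φ.red y) :=
  fun f => φ.body_eq f y

theorem SPoint.isEven_homAt (φ : SPoint I X S) (y : S.U) (f : C^∞⟮I, X; 𝓘(ℝ, ℝ), ℝ⟯) :
    IsEven (φ.homAt y f) := φ.even f y

/-- The function on the base given by a formal form. -/
def FormalForm.sec (P : FormalForm C^∞⟮I, X; 𝓘(ℝ, ℝ), ℝ⟯ k) (φ : SPoint I X S) : S.O :=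
  ∑ j, P.c j • (φ.comp₀ (P.f j) * (List.ofFn fun a => φ.comp₁ (P.g j a)).prod)

theorem FormalForm.atZero_contract {R : Type*} (P : FormalForm R k) {ι : Type}
    (h : R → Gr (Option ι)) : atZero (P.contract h)
      = ∑ j, P.c j • (atZero (h (P.f j)) * (List.ofFn fun a => intTheta (h (P.g j a))).prod) := by
  simp only [FormalForm.contract, map_sum, map_smul, map_mul, map_list_prod, List.map_ofFn]
  rfl

theorem FormalForm.sec_apply (P : FormalForm C^∞⟮I, X; 𝓘(ℝ, ℝ), ℝ⟯ k) (φ : SPoint I X S)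
    (y : S.U) : (P.sec φ).1 y = atZero (P.contract (φ.homAt y)) := by
  let e : S.O →ₐ[ℂ] Gr (Fin S.q) :=
    (Pi.evalAlgHom ℂ (fun _ : S.U => Gr (Fin S.q)) y).comp S.O.val
  rw [FormalForm.atZero_contract]
  change e (P.sec φ) = _
  simp only [FormalForm.sec, map_sum, map_smul, map_mul, map_list_prod, List.map_ofFn]
  rfl

theorem FormalForm.pull_sec (P : FormalForm C^∞⟮I, X; 𝓘(ℝ, ℝ), ℝ⟯ k) {S' : SuperDomain}
    {h : SuperMap S' S} {φ : SPoint I X S} {φ' : SPoint I X S'} (hφ : IsBaseChange h φ φ') :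
    h.pull (P.sec φ) = P.sec φ' := by
  simp only [FormalForm.sec, map_sum, map_smul, map_mul, map_list_prod, List.map_ofFn,
    (hφ _).1, Function.comp_def, (hφ _).2]

theorem prod_ofFn_mul_of_even {κ : Type} {μ : Gr κ} (hμ : IsEven μ) (z : Fin k → Gr κ) :
    (List.ofFn fun a => μ * z a).prod = μ ^ k * (List.ofFn z).prod := by
  induction k with
  | zero => simp
  | succ k ih =>
    rw [List.ofFn_succ, List.prod_cons, ih, List.ofFn_succ, List.prod_cons, pow_succ', mul_assoc,
      mul_assoc, ← mul_assoc (z 0), ← (IsEven.pow hμ k).commute (z 0), mul_assoc]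

/-- Each of the `k` differentials contributes a factor `μ`. The translation by `η` affects only the
leading functions and adds `η` times the differential of the form, which is zero for closed forms.
-/
theorem FormalForm.atZero_contract_precomp {R : Type*} [CommRing R] [Algebra ℝ R]
    (P : FormalForm R k) {ι : Type} (h h' : R →ₐ[ℝ] Gr (Option ι)) {η μ : Gr ι} (hμ : IsEven μ)
    (h0 : ∀ f, atZero (h' f) = atZero (h f) + η * intTheta (h f))
    (h1 : ∀ f, intTheta (h' f) = μ * intTheta (h f)) :
    atZero (P.contract h') = μ ^ k * (atZero (P.contract h) + η * atZero (D (P.contract h))) := by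
  have hd : atZero (D (P.contract h)) = ∑ j, P.c j •
      (intTheta (h (P.f j)) * (List.ofFn fun a => intTheta (h (P.g j a))).prod) := by
    rw [← P.contract_d, FormalForm.atZero_contract]
    refine Finset.sum_congr rfl fun j _ => ?_
    simp only [FormalForm.d, map_one, one_mul, List.ofFn_succ, List.prod_cons, Fin.cons_zero,
      Fin.cons_succ]
  rw [hd, FormalForm.atZero_contract, FormalForm.atZero_contract]
  simp only [Finset.mul_sum, mul_add, ← Finset.sum_add_distrib]
  refine Finset.sum_congr rfl fun j _ => ?_
  simp only [h0, h1, prod_ofFn_mul_of_even hμ, mul_smul_comm, ← smul_add]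
  rw [← mul_assoc, ← (IsEven.pow hμ k).commute, mul_assoc, add_mul, mul_add, mul_assoc η]

variable [I.Boundaryless] [IsManifold I ∞ X] [T2Space X]

/-- The odd element `η` has body zero, so it cannot move the underlying point; a bump function would
detect a difference. -/
theorem red_eq_of_isPrecomp {g : ConfIsometry S} {φ φ' : SPoint I X S} (h : IsPrecomp g φ φ')
    (y : S.U) : φ'.red y = φ.red y := by
  by_contra hne
  obtain ⟨χ, h1, hχ⟩ := exists_bump (I := I) (x := φ.red y) (isOpen_ne.mem_nhds (Ne.symm hne))
  have h2 : χ (φ.red y) = 1 := h1.eq_of_nhds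
  have h3 : χ (φ'.red y) = 0 := image_eq_zero_of_notMem_tsupport fun hm => hχ hm rfl
  have h4 : body (atZero (φ'.pull χ y)) = body (atZero (φ.pull χ y))
      + body ((g.η).1 y) * body (intTheta (φ.pull χ y)) := by
    rw [← map_mul, ← map_add]
    exact congrArg (fun z : S.O => body (z.1 y)) (h χ).1
  rw [(g.η_odd y).body_eq, zero_mul, add_zero, atZero, body_keep, body_keep, φ.body_eq, φ'.body_eq,
    h2, h3] at h4
  simp at h4

end Points

/-! ### The Thom section -/

section ThomSection

set_option linter.unusedSectionVars false

open Filter Topology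

variable {EB : Type*} [NormedAddCommGroup EB] [NormedSpace ℝ EB] [FiniteDimensional ℝ EB]
  {M : Type*} [TopologicalSpace M] [ChartedSpace EB M] [IsManifold 𝓘(ℝ, EB) ∞ M] [T2Space M]
  {F : Type*} [NormedAddCommGroup F] [NormedSpace ℝ F] [FiniteDimensional ℝ F]
  {V : M → Type*} [TopologicalSpace (TotalSpace F V)]
  [∀ m, NormedAddCommGroup (V m)] [∀ m, InnerProductSpace ℝ (V m)]
  [FiberBundle F V] [VectorBundle ℝ F V] [ContMDiffVectorBundle ∞ F V 𝓘(ℝ, EB)]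
  [IsContMDiffRiemannianBundle 𝓘(ℝ, EB) ∞ F V]
  {n : ℕ} {o : ∀ m, Orientation ℝ (V m) (Fin n)}
  {cov : CovariantDerivative 𝓘(ℝ, EB) F V}
  [CovariantDerivative.ContMDiffCovariantDerivative cov ∞]

/-- Both forms have the frame-independent Mathai–Quillen values near the point, and contractions
depend on values only. -/
theorem LocalModel.thom_contract_eq (hcov : cov.IsMetricCompatible) {fr fr' : OrthoFrame EB F o}
    (L : LocalModel fr cov) (L' : LocalModel fr' cov) {κ : Type} [Finite κ]
    {h : TotalFun EB F V →ₐ[ℝ] Gr (Option κ)} {v : TotalSpace F V} (hv : LiesOver h v)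
    (he : ∀ f, IsEven (h f)) (hL : v.proj ∈ L.O) (hL' : v.proj ∈ L'.O) :
    L.thom.contract h = L'.thom.contract h := by
  have := t2Space_totalSpace F V
  rw [← sub_eq_zero, ← FormalForm.contract_sub]
  refine FormalForm.contract_eq_zero hv he _ ?_
  filter_upwards [L.eventually_mem hL, L'.eventually_mem hL'] with w hw hw' u
  rw [FormalForm.eval_sub, L.eval_thom hcov hw, L'.eval_thom hcov hw',
    OrthoFrame.mqValue_eq_mqValue hcov fr fr' (L.le hw) (L'.le hw'), sub_self]

variable (ho : IsBundleOrientation EB F o) (hcov : cov.IsMetricCompatible) {S : SuperDomain}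

/-- The values of the Thom section. -/
def thomVal (φ : SPoint (𝓘(ℝ, EB).prod 𝓘(ℝ, F)) (TotalSpace F V) S) (y : S.U) : Gr (Fin S.q) :=
  atZero ((modelAt ho hcov (φ.red y).proj).thom.contract (φ.homAt y))

theorem thomVal_eq (φ : SPoint (𝓘(ℝ, EB).prod 𝓘(ℝ, F)) (TotalSpace F V) S)
    {fr : OrthoFrame EB F o} (L : LocalModel fr cov) {y : S.U} (hy : (φ.red y).proj ∈ L.O) :
    thomVal ho hcov φ y = (L.thom.sec φ).1 y := by
  rw [FormalForm.sec_apply, thomVal, LocalModel.thom_contract_eq hcov _ L (φ.liesOver_homAt y)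
    (φ.isEven_homAt y) (mem_modelAt ho hcov _) hy]

theorem smoothGr_thomVal (φ : SPoint (𝓘(ℝ, EB).prod 𝓘(ℝ, F)) (TotalSpace F V) S) :
    SmoothGr (thomVal ho hcov φ) := by
  intro l y
  let L := modelAt ho hcov (φ.red y).proj
  refine ((L.thom.sec φ).2 l y).congr_of_eventuallyEq ?_
  filter_upwards [φ.continuous_red.continuousAt.eventually
    (L.eventually_mem (mem_modelAt ho hcov _))] with z hz
  rw [thomVal_eq ho hcov φ L hz]

/-- A `SuperMap` is given on algebras of functions and not on points, so a formula valid near one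
point of `S'` has to be carried over by a cut-off function: `χ` equals `1` near the point in
question and is supported where a single model applies. -/
theorem thomVal_pull {S' : SuperDomain} (h : SuperMap S' S)
    (φ : SPoint (𝓘(ℝ, EB).prod 𝓘(ℝ, F)) (TotalSpace F V) S)
    (φ' : SPoint (𝓘(ℝ, EB).prod 𝓘(ℝ, F)) (TotalSpace F V) S') (hφ : IsBaseChange h φ φ') :
    (⟨thomVal ho hcov φ', smoothGr_thomVal ho hcov φ'⟩ : S'.O)
      = h.pull ⟨thomVal ho hcov φ, smoothGr_thomVal ho hcov φ⟩ := by
  have := t2Space_totalSpace F V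
  refine Subtype.ext (funext fun y => ?_)
  let L := modelAt ho hcov (φ'.red y).proj
  have hL := mem_modelAt ho hcov (φ'.red y).proj
  obtain ⟨χ, h1, hχ⟩ := exists_bump (I := 𝓘(ℝ, EB).prod 𝓘(ℝ, F)) (x := φ'.red y)
    (L.eventually_mem hL)
  -- Where the model applies the two factors agree; elsewhere the pullback of `χ` vanishes since `χ`
  -- is zero near the underlying point. After applying `h.pull`, the factor `χ` becomes `1` at `y`.
  have hmul : φ.comp₀ χ * ⟨thomVal ho hcov φ, smoothGr_thomVal ho hcov φ⟩
      = φ.comp₀ χ * L.thom.sec φ := by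
    refine Subtype.ext (funext fun z => ?_)
    change atZero (φ.homAt z χ) * thomVal ho hcov φ z = atZero (φ.homAt z χ) * (L.thom.sec φ).1 z
    by_cases hz : (φ.red z).proj ∈ L.O
    · rw [thomVal_eq ho hcov φ L hz]
    · have h0 : φ.homAt z χ = 0 := (φ.liesOver_homAt z).map_eq_zero
        (notMem_tsupport_iff_eventuallyEq.1 fun hm => hz (hχ hm))
      rw [h0, map_zero, zero_mul, zero_mul]
  have hp := congrArg (fun w : S'.O => w.1 y) (congrArg h.pull hmul)
  simp only [map_mul, ← (hφ χ).1, L.thom.pull_sec hφ] at hp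
  change atZero (φ'.homAt y χ) * _ = atZero (φ'.homAt y χ) * _ at hp
  rw [(φ'.liesOver_homAt y).map_congr (g := 1) h1, map_one, map_one, one_mul, one_mul] at hp
  exact (thomVal_eq ho hcov φ' L hL).trans hp.symm

theorem thomVal_precomp {g : ConfIsometry S}
    {φ φ' : SPoint (𝓘(ℝ, EB).prod 𝓘(ℝ, F)) (TotalSpace F V) S} (hg : IsPrecomp g φ φ') (y : S.U) :
    thomVal ho hcov φ' y = g.μ.1 y ^ n * thomVal ho hcov φ y := by
  have := t2Space_totalSpace F V
  have hr := red_eq_of_isPrecomp hg y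
  let L := modelAt ho hcov (φ.red y).proj
  have hL := mem_modelAt ho hcov (φ.red y).proj
  rw [thomVal_eq ho hcov φ L hL, thomVal_eq ho hcov φ' L (by rw [hr]; exact hL),
    FormalForm.sec_apply, FormalForm.sec_apply,
    L.thom.atZero_contract_precomp (φ.homAt y) (φ'.homAt y) (g.μ_even y)
      (fun f => congrArg (fun z : S.O => z.1 y) (hg f).1)
      (fun f => congrArg (fun z : S.O => z.1 y) (hg f).2),
    L.D_thom_contract (φ.liesOver_homAt y) (φ.isEven_homAt y), map_zero, mul_zero, add_zero]

/-- The Berezin integral of the Mathai–Quillen action, as a section of `ω^{n/2}`. -/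
def thomSection : LSection (𝓘(ℝ, EB).prod 𝓘(ℝ, F)) (TotalSpace F V) n where
  val φ := ⟨thomVal ho hcov φ, smoothGr_thomVal ho hcov φ⟩
  natural := thomVal_pull ho hcov
  equivariant _ _ _ hg := Subtype.ext (funext fun y => thomVal_precomp ho hcov hg y)

end ThomSection

/-! ### The Thom section over open subsets -/

section Restriction

set_option linter.unusedSectionVars false

open Filter Topology

universe u

variable {E : Type u} [NormedAddCommGroup E] [NormedSpace ℝ E]
  {H : Type*} [TopologicalSpace H] {I : ModelWithCorners ℝ E H}
  {X : Type*} [TopologicalSpace X] [ChartedSpace H X] {k : ℕ}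

theorem FormalForm.eval_restrict (P : FormalForm C^∞⟮I, X; 𝓘(ℝ, ℝ), ℝ⟯ k)
    (O : TopologicalSpace.Opens X) (x : O) (u : Fin k → TangentSpace I x) :
    (P.map (restrict O)).eval x u
      = P.eval x.1 fun b => mfderiv I I (Subtype.val : O → X) x (u b) := by
  refine Finset.sum_congr rfl fun j _ => congrArg (fun z : Matrix (Fin k) (Fin k) ℝ =>
    P.c j * (P.f j x.1 : ℂ) * (z.det : ℂ)) ?_
  ext a b
  have h := mfderiv_comp x (I := I) (I' := I) (I'' := 𝓘(ℝ, ℝ)) (f := (Subtype.val : O → X))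
    (g := P.g j a) ((P.g j a).contMDiff.mdifferentiableAt (by simp))
    ((contMDiff_subtype_val (n := ∞)).mdifferentiableAt (by simp))
  exact DFunLike.congr_fun h (u b)

end Restriction

/-! ### The Thom section as the function of a differential form and as a fibre integral. -/

section Section

set_option linter.unusedSectionVars false

open Filter Topology

variable {EB : Type*} [NormedAddCommGroup EB] [NormedSpace ℝ EB] [FiniteDimensional ℝ EB]
  {M : Type*} [TopologicalSpace M] [ChartedSpace EB M] [IsManifold 𝓘(ℝ, EB) ∞ M] [T2Space M]
  {F : Type*} [NormedAddCommGroup F] [NormedSpace ℝ F] [FiniteDimensional ℝ F]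
  {V : M → Type*} [TopologicalSpace (TotalSpace F V)]
  [∀ m, NormedAddCommGroup (V m)] [∀ m, InnerProductSpace ℝ (V m)]
  [FiberBundle F V] [VectorBundle ℝ F V] [ContMDiffVectorBundle ∞ F V 𝓘(ℝ, EB)]
  [IsContMDiffRiemannianBundle 𝓘(ℝ, EB) ∞ F V]
  {n : ℕ} {o : ∀ m, Orientation ℝ (V m) (Fin n)}
  {cov : CovariantDerivative 𝓘(ℝ, EB) F V}
  [CovariantDerivative.ContMDiffCovariantDerivative cov ∞]
  (ho : IsBundleOrientation EB F o) (hcov : cov.IsMetricCompatible)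

/-- Formal forms on an open subset with the same values have the same contractions. -/
theorem contract_restrict_eq {O : TopologicalSpace.Opens (TotalSpace F V)} {k : ℕ}
    {κ : Type} [Finite κ]
    {h : C^∞⟮𝓘(ℝ, EB).prod 𝓘(ℝ, F), O; 𝓘(ℝ, ℝ), ℝ⟯ →ₐ[ℝ] Gr (Option κ)} {x : O}
    (hx : LiesOver h x) (he : ∀ f, IsEven (h f)) (P : FormalForm (TotalFun EB F V) k)
    (Q : FormalForm C^∞⟮𝓘(ℝ, EB).prod 𝓘(ℝ, F), O; 𝓘(ℝ, ℝ), ℝ⟯ k)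
    (hPQ : ∀ᶠ y in 𝓝 x, ∀ u, P.eval y.1 (fun b => mfderiv (𝓘(ℝ, EB).prod 𝓘(ℝ, F))
      (𝓘(ℝ, EB).prod 𝓘(ℝ, F)) (Subtype.val : O → TotalSpace F V) y (u b)) = Q.eval y u) :
    P.contract (h.comp (restrict O)) = Q.contract h := by
  have := t2Space_totalSpace F V
  have h1 : P.contract (h.comp (restrict O)) = (P.map (restrict O)).contract h := rfl
  rw [h1, ← sub_eq_zero, ← FormalForm.contract_sub]
  refine FormalForm.contract_eq_zero hx he _ ?_
  filter_upwards [hPQ] with y hy u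
  rw [FormalForm.eval_sub, FormalForm.eval_restrict, hy, sub_self]

/-- The given formal sum and the form of the local model represent the same differential form near
the underlying point, so their contractions agree. -/
theorem isSectionOfForm_thomSection :
    IsSectionOfForm (thomSection ho hcov) (mqForm ho hcov) := by
  intro O P hP S φ y
  let L := modelAt ho hcov (φ.red y).1.proj
  refine congrArg atZero ((contract_restrict_eq (φ.liesOver_homAt y) (φ.isEven_homAt y) L.thom
    ⟨P.N, P.c, P.f, P.g⟩ ?_).trans rfl)
  filter_upwards [continuous_subtype_val.continuousAt.eventually
    (L.eventually_mem (mem_modelAt ho hcov (φ.red y).1.proj))] with x hx u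
  refine Eq.trans ?_ (hP x u)
  rw [mqForm_eq ho hcov L hx]
  exact (L.thom.alt_apply _ _).symm

/-! ### Comparison with the Berezin integral of the action. -/

section FibreIntegral

variable {fr : OrthoFrame EB F o} (L : LocalModel fr cov) (L' : LocalData fr cov)
  {κ : Type} [Finite κ] {h : fr.Fun →ₐ[ℝ] Gr (Option κ)} {v : fr.over}

theorem LocalData.map_x (hv : LiesOver h v) (hL : v.1.proj ∈ L.O) (a : Fin n) :
    h (L'.x a) = h (restrict fr.over (L.x a)) := by
  have := t2Space_totalSpace F V
  refine hv.map_congr ?_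
  filter_upwards [continuous_subtype_val.continuousAt.eventually (L.eventually_mem hL)] with w hw
  exact (L'.x_eq a w).trans (L.x_apply hw a).symm

/-- `LocalData` and `LocalModel` may express the connection form through different functions, but
the underlying one-form is the same. -/
theorem LocalData.contract_A (hv : LiesOver h v) (he : ∀ f, IsEven (h f)) (hL : v.1.proj ∈ L.O)
    {T : Type} {pull : fr.Fun → T → Gr (Option κ)} {y : T} (hp : ∀ f, pull f y = h f) (a b : Fin n) :
    (L'.A a b).contract pull y = L.conn (h.comp (restrict fr.over)) a b := by
  have hp' : (L'.A a b).contract pull y = (⟨(L'.A a b).N, (L'.A a b).c, (L'.A a b).f,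
      (L'.A a b).g⟩ : FormalForm fr.Fun 1).contract h := by
    simp only [FormSum.contract, FormalForm.contract, hp]
  let C : FormalForm (TotalFun EB F V) 1 :=
    ⟨L.d, fun _ => 1, fun i => pullProj EB F V (L.A a b i), fun i _ => pullProj EB F V (L.y i)⟩
  have hC : C.contract (h.comp (restrict fr.over)) = L.conn (h.comp (restrict fr.over)) a b := by
    simp [FormalForm.contract, C, LocalModel.conn]
  rw [hp', ← hC]
  refine (contract_restrict_eq hv he C _ ?_).symm
  filter_upwards [continuous_subtype_val.continuousAt.eventually (L.eventually_mem hL)] with w hw u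
  refine Eq.trans ?_ (L'.A_eq a b w u).symm
  rw [L.connForm_eq hw]
  simp only [FormalForm.eval, C, Matrix.det_unique, one_mul, Complex.ofReal_sum, Complex.ofReal_mul]
  rfl

/-- The constants match because the Gaussian integral produces one factor `√(2π)` for each
coordinate. -/
theorem two_pi_pow_mul (n : ℕ) : ((2 * Real.pi : ℝ) : ℂ) ^ n
    * (((2 * Real.pi) ^ (-(n : ℝ) / 2) : ℝ) : ℂ) = (Real.sqrt (2 * Real.pi) : ℂ) ^ n := by
  have h : (2 * Real.pi) ^ n * (2 * Real.pi) ^ (-(n : ℝ) / 2) = Real.sqrt (2 * Real.pi) ^ n := by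
    rw [Real.sqrt_eq_rpow, ← Real.rpow_natCast, ← Real.rpow_natCast, ← Real.rpow_mul (by positivity),
      ← Real.rpow_add (by positivity)]
    congr 1
    ring
  exact_mod_cast congrArg (fun x : ℝ => (x : ℂ)) h

theorem LocalData.integrand_eq {S : SuperDomain} {pull : fr.Fun → S.U → Gr (Option (Fin S.q))}
    {y : S.U} (hx : ∀ a, IsEven (atZero (pull (L'.x a) y)))
    (hA : ∀ a b, IsOdd ((L'.A a b).contract pull y))
    (hA' : ∀ a b, (L'.A a b).contract pull y = -(L'.A b a).contract pull y)
    (t : EuclideanSpace ℝ (Fin n)) :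
    keep Sum.inl Sum.inl_injective (berezin ((List.finRange n).map Sum.inr)
      (grExp (-(L'.action (pullTotal pull) (L'.universal pull) (y, t)))))
      = grExp (algebraMap ℂ _ (-(1 / 2) * ∑ a, (t a : ℂ) ^ 2)
        + Complex.I • ∑ a, (t a : ℂ) • atZero (pull (L'.x a) y))
      * mqExp 0 (fun a => atZero (D (pull (L'.x a) y))
          + ∑ b, atZero ((L'.A a b).contract pull y) * atZero (pull (L'.x b) y))
        (fun a b => atZero (D ((L'.A a b).contract pull y))
          + ∑ c, atZero ((L'.A a c).contract pull y) * atZero ((L'.A c b).contract pull y)) := by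
  have hs : IsEven (algebraMap ℂ (Gr (Fin S.q)) (-(1 / 2) * ∑ a, (t a : ℂ) ^ 2)
      + Complex.I • ∑ a, (t a : ℂ) • atZero (pull (L'.x a) y)) :=
    (isEven_algebraMap _).add (IsEven.smul _ (IsEven.sum fun a _ => IsEven.smul _ (hx a)))
  rw [L'.neg_action_universal hA hA', ← mqExp_eq_mul hs, mqExp, fibreInt_apply]

theorem LocalModel.atZero_thom_contract {κ : Type} [Finite κ]
    {h : TotalFun EB F V →ₐ[ℝ] Gr (Option κ)} {v : TotalSpace F V} (hv : LiesOver h v)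
    (he : ∀ f, IsEven (h f)) : ((2 * Real.pi : ℝ) : ℂ) ^ n • atZero (L.thom.contract h)
      = (Real.sqrt (2 * Real.pi) : ℂ) ^ n •
        (grExp (-(1 / 2 : ℂ) • ∑ a, atZero (h (L.x a)) * atZero (h (L.x a)))
          * mqExp 0 (fun a => atZero (L.nabla h a)) fun a b => atZero (L.curv h a b)) := by
  have hs : IsEven (-(1 / 2 : ℂ) • ∑ a, atZero (h (L.x a)) * atZero (h (L.x a))) :=
    IsEven.smul _ (IsEven.sum fun a _ => ((he _).keep _ _).mul ((he _).keep _ _))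
  have hz : -(1 / 2 : ℂ) • ∑ a, atZero (h (L.x a)) * atZero (h (L.x a))
      = atZero (-(1 / 2 : ℂ) • ∑ a, h (L.x a) * h (L.x a)) := by
    simp only [map_smul, map_sum, map_mul]
  rw [LocalModel.thom, FormalForm.contract_smul, map_smul, smul_smul,
    two_pi_pow_mul, L.form_contract hv he, ← mqExp_eq_mul hs, hz]
  exact congrArg (_ • ·) (mqExp_keep _ _ _ _ _).symm

/-- After `LocalData.integrand_eq` the integrand is a Gaussian in `t` times the integral over `ψ`,
which does not involve `t`, so `isGrIntegral_gauss` applies to the homomorphism `h0` obtained at `θ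
= 0`. Its value is matched with the local model by `LocalModel.atZero_thom_contract`. -/
theorem isFibreIntegral_thomSection {S : SuperDomain}
    (φ : SPoint (𝓘(ℝ, EB).prod 𝓘(ℝ, F)) fr.over S) :
    L'.IsFibreIntegral φ
      (((2 * Real.pi : ℝ) : ℂ) ^ n • ((thomSection ho hcov).val φ.toAmbient).1) := by
  have := t2Space_totalSpace F V
  intro y
  obtain ⟨L, hL⟩ := exists_localModel hcov fr (φ.red y).2
  have hv := φ.liesOver_homAt y
  have he := φ.isEven_homAt y
  let h' : TotalFun EB F V →ₐ[ℝ] Gr (Option (Fin S.q)) := (φ.homAt y).comp (restrict fr.over)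
  have hv' : LiesOver h' (φ.red y).1 := fun f => hv _
  have he' : ∀ f, IsEven (h' f) := fun f => he _
  let h0 : fr.Fun →ₐ[ℝ] Gr (Fin S.q) := (atZero.restrictScalars ℝ).comp (φ.homAt y)
  have hv0 : LiesOver h0 (φ.red y) := fun f => (body_keep _ _ _).trans (hv f)
  have he0 : ∀ f, IsEven (h0 f) := fun f => (he f).keep _ _
  have hx : ∀ a, φ.pull (L'.x a) y = h' (L.x a) := fun a => L'.map_x L hv hL a
  have hA : ∀ a b, (L'.A a b).contract (fun f => φ.pull f) y = L.conn h' a b :=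
    fun a b => L'.contract_A L hv he hL (fun _ => rfl) a b
  have hval : (((2 * Real.pi : ℝ) : ℂ) ^ n • ((thomSection ho hcov).val φ.toAmbient).1) y
      = ((2 * Real.pi : ℝ) : ℂ) ^ n • atZero (L.thom.contract h') :=
    congrArg (((2 * Real.pi : ℝ) : ℂ) ^ n • ·) ((thomVal_eq ho hcov φ.toAmbient L hL).trans (L.thom.sec_apply _ _))
  rw [hval, L.atZero_thom_contract hv' he']
  have hdx : ∀ a, atZero (D (φ.pull (L'.x a) y)) + ∑ b, atZero ((L'.A a b).contract
      (fun f => φ.pull f) y) * atZero (φ.pull (L'.x b) y) = atZero (L.nabla h' a) := fun a => by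
    simp only [hA, hx, LocalModel.nabla, map_add, map_sum, map_mul]
  have hF : ∀ a b, atZero (D ((L'.A a b).contract (fun f => φ.pull f) y))
      + ∑ c, atZero ((L'.A a c).contract (fun f => φ.pull f) y)
        * atZero ((L'.A c b).contract (fun f => φ.pull f) y) = atZero (L.curv h' a b) :=
    fun a b => by simp only [hA, LocalModel.curv, map_add, map_sum, map_mul]
  have hint := fun t => L'.integrand_eq (pull := fun f => φ.pull f) (y := y)
    (fun a => he0 (L'.x a)) (fun a b => by rw [hA]; exact L.isOdd_conn he' a b)
    (fun a b => by rw [hA, hA]; exact L.conn_antisymm h' a b) t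
  simp only [hdx, hF] at hint
  simp only [hint]
  have h2 : ∀ a, atZero (h' (L.x a)) = h0 (L'.x a) := fun a => congrArg atZero (hx a).symm
  simp only [h2]
  exact isGrIntegral_gauss hv0 he0 L'.x _

end FibreIntegral

end Section

end MathaiQuillen

end

theorem mainTheorem8
    {EB : Type*} [NormedAddCommGroup EB] [NormedSpace ℝ EB] [FiniteDimensional ℝ EB]
    {M : Type*} [TopologicalSpace M] [ChartedSpace EB M] [IsManifold 𝓘(ℝ, EB) ∞ M]
    [T2Space M] [SigmaCompactSpace M]
    {F : Type*} [NormedAddCommGroup F] [NormedSpace ℝ F] [FiniteDimensional ℝ F]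
    {V : M → Type*} [TopologicalSpace (TotalSpace F V)]
    [∀ m, NormedAddCommGroup (V m)] [∀ m, InnerProductSpace ℝ (V m)]
    [FiberBundle F V] [VectorBundle ℝ F V] [ContMDiffVectorBundle ∞ F V 𝓘(ℝ, EB)]
    [IsContMDiffRiemannianBundle 𝓘(ℝ, EB) ∞ F V]
    (n : ℕ) (hn : Module.finrank ℝ F = n)
    (o : ∀ m, Orientation ℝ (V m) (Fin n)) (ho : IsBundleOrientation EB F o)
    (cov : CovariantDerivative 𝓘(ℝ, EB) F V) [CovariantDerivative.ContMDiffCovariantDerivative cov ∞]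
    (hcov : cov.IsMetricCompatible) :
    ∃ (Th : LSection (𝓘(ℝ, EB).prod 𝓘(ℝ, F)) (TotalSpace F V) n)
      (α : DiffForm (𝓘(ℝ, EB).prod 𝓘(ℝ, F)) (TotalSpace F V) n),
      (∀ (fr : OrthoFrame EB F o) (L : LocalData fr cov) (S : SuperDomain)
        (φ : SPoint (𝓘(ℝ, EB).prod 𝓘(ℝ, F)) fr.over S),
        L.IsFibreIntegral φ (((2 * Real.pi : ℝ) : ℂ) ^ n • (Th.val φ.toAmbient).1)) ∧
      IsSectionOfForm Th α ∧
      (∀ (fr : OrthoFrame EB F o) (v : TotalSpace F V), v ∈ fr.over →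
        ∀ u, α v u = fr.mqValue cov v u) ∧
      IsThomForm o (fun v => epsilon n • α v) := by
  exact ⟨thomSection ho hcov, mqForm ho hcov,
    fun _ L _ φ => isFibreIntegral_thomSection ho hcov L φ,
    isSectionOfForm_thomSection ho hcov,
    fun fr _ hv u => mqForm_apply ho hcov fr hv u,
    isSmooth_mqForm ho hcov _, isClosed_mqForm ho hcov _, isRapidlyDecreasing_mqForm ho hcov _,
    fun fr _ hm => integral_one_mqForm ho hcov fr hm⟩
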